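/- **Setup.** Let $N\ge 0$, let $\varsigma=(s_1,\dots,s_d)\in\mathbb Z_{>0}^d$ with $\sum_i s_i=2N$ and $\max_i s_i\le N$, and put $q_0=0$, $q_k=s_1+\dots+s_k$; the $k$-th *group* is $\{q_{k-1}+1,\dots,q_k\}$. Let $\mathsf{LP}_N$ be the set of planar pair partitions (link patterns) of $\{1,\dots,2N\}$, partially ordered by $\alpha\preceq\beta$ iff the Dyck path of $\alpha$ (up-step at each left endpoint of a link, down-step at each right endpoint) stays weakly below that of $\beta$. Valenced link patterns are identified with their unfused patterns: $\mathsf{LP}_\varsigma\subset\mathsf{LP}_N$ consists of the patterns without a link inside a group. For $\alpha\preceq\beta$ let $\#\mathcal C(\alpha/\beta)$ be the number of cover-inclusive Dyck tilings of the region between the two Dyck paths: tilings by ribbons of unit boxes whose centres form a translated Dyck path (possibly of length zero), such that if a tile $t$ has a box straight above a box of another tile $t'$, then the horizontal extent of $t$ is contained in that of $t'$. Let $\mathscr K(x,y)=\frac1\pi(x-y)^{-2}$. For $a=q_{i-1}+m_a$ and $b=q_{j-1}+m_b$ in the $i$-th and $j$-th groups put $\mathfrak K_\varsigma(a,b)=\partial_{x_i}^{m_a-1}\partial_{x_j}^{m_b-1}\mathscr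 K(x_i,x_j)$ if $i\ne j$, and $\mathfrak K_\varsigma(a,b)=0$ if $i=j$. The pure partition functions are $$\mathcal Z_\alpha(x_1,\dots,x_d)=\sum_{\beta\in\mathsf{LP}_N,\ \beta\succeq\alpha}\#\mathcal C(\alpha/\beta)\,\det\big(\mathfrak K_\varsigma(a_k,b_\ell)\big)_{k,\ell=1}^N,\qquad \alpha\in\mathsf{LP}_\varsigma,$$ where $\beta=\{\{a_1,b_1\},\dots,\{a_N,b_N\}\}$, $a_1<\dots<a_N$, $a_k<b_k$. They are rational functions, regarded as functions of pairwise distinct points of $\mathbb C$. Let $\mathcal S_\varsigma=\mathrm{span}_{\mathbb C}\{\mathcal Z_\alpha:\alpha\in\mathsf{LP}_\varsigma\}$, and let $\mathcal S_N=\mathcal S_{(1,\dots,1)}$ be the unfused space. Let $\mathsf{TL}_{2N}=\mathsf{TL}_{2N}(-2)$ be the algebra with generators $e_1,\dots,e_{2N-1}$ and relations $e_i^2=-2e_i$, $e_ie_{i\pm1}e_i=e_i$, $e_ie_j=e_je_i$ for $|i-j|>1$. For consecutive sites $i,\dots,j$ let $\mathrm{JW}_{i,j}$ be the Jones–Wenzl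 idempotent, given by $\mathrm{JW}_{i,i}=1$ and $\mathrm{JW}_{i,i+k+1}=\mathrm{JW}_{i,i+k}+\frac{k+1}{k+2}\,\mathrm{JW}_{i,i+k}\,e_{i+k}\,\mathrm{JW}_{i,i+k}$; put $\mathrm p_\varsigma=\prod_{k=1}^d\mathrm{JW}_{q_{k-1}+1,q_k}$, and let $\mathsf{TL}_\varsigma=\mathrm p_\varsigma\mathsf{TL}_{2N}\mathrm p_\varsigma$ be the valenced Temperley–Lieb algebra, with unit $\mathrm p_\varsigma$. **Theorem.** 0. An element of $\mathcal S_\varsigma$ that vanishes at all real points $x_1<\dots<x_d$ is zero; so $\mathcal S_\varsigma$ may equally be regarded as a space of functions on this chamber. 1. $\mathcal S_N$ is stable under the action $(\sigma.F)(x_1,\dots,x_{2N})=F(x_{\sigma(1)},\dots,x_{\sigma(2N)})$ of $\mathfrak S_{2N}$. Let $\pi$ be the rectangular Young diagram with $N$ rows and two columns, and let $V^\pi$ be the Specht module spanned by the polytabloids $v_A$, for numberings $A$ of $\pi$ by $1,\dots,2N$. There is an isomorphism of $\mathfrak S_{2N}$-modules $V^\pi\to\mathcal S_N$ that sends each $v_A$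 to the $N\times N$ minor of the symmetric matrix with entries $\mathscr K(x_i,x_j)$ for $i\ne j$ and $0$ on the diagonal, with rows given by the first column of $A$ and columns given by its second column (read from top to bottom). 2. There is a surjective homomorphism of algebras $\mathbb C[\mathfrak S_{2N}]\to\mathsf{TL}_{2N}$ that sends the transposition $\tau_i=(i,i+1)$ to $-(1+e_i)$ for every $i$; it sends the antisymmetrizer $\frac1{s_1!\cdots s_d!}\sum_{\sigma\in\mathfrak S_{s_1}\times\dots\times\mathfrak S_{s_d}}\mathrm{sgn}(\sigma)\,\sigma$ to $\mathrm p_\varsigma$, and the action of $\mathfrak S_{2N}$ on $\mathcal S_N$ factors through it. Thus $\mathcal S_N$ is a $\mathsf{TL}_{2N}$-module. 3. There is a linear isomorphism $\psi:\mathrm p_\varsigma(\mathcal S_N)\to\mathcal S_\varsigma$, $$\psi(\mathrm p_\varsigma.F)=\left[\frac{\mathrm p_\varsigma.F}{\prod_{k=1}^d\prod_{q_{k-1}<i<j\le q_k}(x_j-x_i)}\right]_{\mathrm{eval}},$$ where $[f]_{\mathrm{eval}}(\xi_1,\dots,\xi_d)$, for pairwise distinct $\xi_1,\dots,\xi_d\in\mathbb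 C$, denotes the limit of $f(x_1,\dots,x_{2N})$ as $x_a\to\xi_k$ for all $a$ in the $k$-th group, for all $k$ (this limit exists for the functions above). 4. There is an action of the algebra $\mathsf{TL}_\varsigma$ on $\mathcal S_\varsigma$ such that $$(\mathrm p_\varsigma a\,\mathrm p_\varsigma).\psi(\mathrm p_\varsigma.F)=\psi(\mathrm p_\varsigma a\,\mathrm p_\varsigma.F)\qquad\text{for all }a\in\mathsf{TL}_{2N},\ F\in\mathcal S_N,$$ and with this action $\mathcal S_\varsigma$ is a simple $\mathsf{TL}_\varsigma$-module. -/

import Mathlib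

open Filter Topology

noncomputable section

namespace USTAlg

/-! ## Link patterns -/

/-- A planar pair partition of the `2N` points `0, …, 2N-1` on the line: `partner` exchanges the two
endpoints of every link, and no two links cross. -/
@[ext]
structure LinkPattern (N : ℕ) where
  partner : Fin (2 * N) → Fin (2 * N)
  partner_partner : ∀ a, partner (partner a) = a
  partner_ne : ∀ a, partner a ≠ a
  noncrossing : ∀ a b, ¬ (a < b ∧ b < partner a ∧ partner a < partner b)

instance (N : ℕ) : Fintype (LinkPattern N) :=
  Fintype.ofInjective LinkPattern.partner fun _ _ h => LinkPattern.ext h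

/-- Height after `k` steps of the Dyck path of `α`: an up-step at each left endpoint of a link,
a down-step at each right endpoint. -/
def LinkPattern.height {N : ℕ} (α : LinkPattern N) (k : ℕ) : ℤ :=
  ∑ a : Fin (2 * N), if (a : ℕ) < k then (if a < α.partner a then 1 else -1) else 0

/-- The partial order `α ≼ β` on link patterns: the Dyck path of `α` stays weakly below that
of `β`. -/
def LinkPattern.Below {N : ℕ} (α β : LinkPattern N) : Prop :=
  ∀ k, α.height k ≤ β.height k

/-- The valenced link patterns, regarded as ordinary link patterns through the unfusing map: the
`ς.length` valenced points are split into consecutive groups of `ς.blocksFun i` points,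
and no link joins two points of the same group. -/
def LinkPattern.IsValenced {N : ℕ} (ς : Composition (2 * N)) (α : LinkPattern N) : Prop :=
  ∀ a, ς.index (α.partner a) ≠ ς.index a

/-! ## Cover-inclusive Dyck tilings

A box is a unit square rotated by 45 degrees; it is recorded by its centre `(x, y)`, and its corners
are `(x ± 1, y)` and `(x, y ± 1)`. -/

/-- The boxes of the skew Young diagram `α / β` enclosed between the Dyck path of `α` (below) and
the Dyck path of `β` (above). -/
def skewShape {N : ℕ} (α β : LinkPattern N) : Set (ℤ × ℤ) :=
  {b | ∃ x : ℕ, b.1 = x ∧ x ≤ 2 * N ∧ α.height x + 1 ≤ b.2 ∧ b.2 + 1 ≤ β.height x ∧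
    Odd (b.1 + b.2)}

/-- A Dyck tile: a set of boxes whose centres are the points of a translated Dyck path (possibly of
length zero, in which case the tile is a single box). -/
def IsDyckTile (t : Finset (ℤ × ℤ)) : Prop :=
  ∃ (x₀ y₀ : ℤ) (m : ℕ) (D : ℕ → ℤ), D 0 = 0 ∧ D (2 * m) = 0 ∧
    (∀ k, k ≤ 2 * m → 0 ≤ D k) ∧
    (∀ k, k < 2 * m → D (k + 1) = D k + 1 ∨ D (k + 1) = D k - 1) ∧
    t = (Finset.range (2 * m + 1)).image fun k : ℕ => (x₀ + (k : ℤ), y₀ + D k)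

/-- `t` covers `s` if some box of `t` is straight above some box of `s`. -/
def Covers (t s : Finset (ℤ × ℤ)) : Prop :=
  ∃ b ∈ t, ∃ c ∈ s, b.1 = c.1 ∧ c.2 < b.2

/-- `T` is a tiling of `α / β` by Dyck tiles which is cover-inclusive: if the tile `t` covers the
tile `s`, then the horizontal extent of `t` is contained in that of `s`. -/
structure IsCoverInclusiveDyckTiling {N : ℕ} (α β : LinkPattern N)
    (T : Finset (Finset (ℤ × ℤ))) : Prop where
  tile : ∀ t ∈ T, IsDyckTile t
  disjoint : ∀ t ∈ T, ∀ s ∈ T, t ≠ s → Disjoint t s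
  cover : ∀ b : ℤ × ℤ, b ∈ skewShape α β ↔ ∃ t ∈ T, b ∈ t
  inclusive : ∀ t ∈ T, ∀ s ∈ T, t ≠ s → Covers t s → t.image Prod.fst ⊆ s.image Prod.fst

/-- The number of cover-inclusive Dyck tilings of `α / β`. -/
def numTilings {N : ℕ} (α β : LinkPattern N) : ℕ :=
  Set.ncard {T : Finset (Finset (ℤ × ℤ)) | IsCoverInclusiveDyckTiling α β T}

/-! ## Fomin type determinants and pure partition functions -/

/-- The Fomin type determinant `det (K (a_k, b_l))` of a link pattern with links `{a_k, b_k}`,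
`a_k < b_k`. Rows and columns are indexed by the left endpoints. -/
def fominDet {N : ℕ} (K : Fin (2 * N) → Fin (2 * N) → ℂ) (β : LinkPattern N) : ℂ :=
  Matrix.det (Matrix.of fun a b : {a : Fin (2 * N) // a < β.partner a} => K a (β.partner b))

open Classical in
/-- The inverse Fomin type sum of `α` with kernel `K`. -/
def fominSum {N : ℕ} (K : Fin (2 * N) → Fin (2 * N) → ℂ) (α : LinkPattern N) : ℂ :=
  ∑ β : LinkPattern N with α.Below β, (numTilings α β : ℂ) * fominDet K β

/-- The Brownian excursion kernel of the upper half-plane, extended to complex arguments. -/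
def excKernel (x y : ℂ) : ℂ := 1 / (Real.pi : ℂ) * (1 / (x - y) ^ 2)

/-- `∂_x ^ p ∂_y ^ q` of the Brownian excursion kernel. -/
def excKernelDeriv (p q : ℕ) (x y : ℂ) : ℂ :=
  iteratedDeriv p (fun u => iteratedDeriv q (fun v => excKernel u v) y) x

/-- Configurations of `d` pairwise distinct complex points. -/
def Conf (d : ℕ) : Type := {x : Fin d → ℂ // Function.Injective x}

/-- A point of the chamber `x_1 < ⋯ < x_d` as a configuration. -/
def Conf.ofReal {d : ℕ} (x : Fin d → ℝ) (hx : StrictMono x) : Conf d :=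
  ⟨fun i => (x i : ℂ), fun _ _ h => hx.injective (Complex.ofReal_injective h)⟩

/-- Permutation of the points of a configuration. -/
def Conf.perm {d : ℕ} (σ : Equiv.Perm (Fin d)) (x : Conf d) : Conf d :=
  ⟨fun i => x.1 (σ i), x.2.comp σ.injective⟩

/-- The fused kernel at the points `x_1, …, x_d`: the index `a` which is the `m_a`-th one in the
`i`-th group stands for the point `x_i` with `m_a - 1` derivatives, and the kernel vanishes
within each group. -/
def fusedKernel {N : ℕ} (ς : Composition (2 * N)) (x : Conf ς.length) (a b : Fin (2 * N)) : ℂ :=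
  if ς.index a = ς.index b then 0
  else excKernelDeriv (ς.invEmbedding a : ℕ) (ς.invEmbedding b : ℕ)
    (x.1 (ς.index a)) (x.1 (ς.index b))

/-- The pure partition function `Z_α` with valences `ς`. -/
def pureZ {N : ℕ} (ς : Composition (2 * N)) (α : LinkPattern N) (x : Conf ς.length) : ℂ :=
  fominSum (fusedKernel ς x) α

/-- The space `S_ς` spanned by the pure partition functions with valences `ς`. -/
def solSpace {N : ℕ} (ς : Composition (2 * N)) : Submodule ℂ (Conf ς.length → ℂ) :=
  Submodule.span ℂ (pureZ ς '' {α | α.IsValenced ς})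

/-- The unfused kernel: all valences are one. -/
def unfusedKernel {n : ℕ} (x : Conf n) (a b : Fin n) : ℂ :=
  if a = b then 0 else excKernel (x.1 a) (x.1 b)

/-- The space `S_N` spanned by the unfused pure partition functions. -/
def unfusedSpace (N : ℕ) : Submodule ℂ (Conf (2 * N) → ℂ) :=
  Submodule.span ℂ (Set.range fun (α : LinkPattern N) (x : Conf (2 * N)) =>
    fominSum (unfusedKernel x) α)

/-- The symmetric group acting on functions of `n` distinct points by permuting the variables. -/
def permRep (n : ℕ) : Representation ℂ (Equiv.Perm (Fin n)) (Conf n → ℂ) where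
  toFun σ :=
    { toFun := fun F x => F (x.perm σ)
      map_add' := fun _ _ => rfl
      map_smul' := fun _ _ => rfl }
  map_one' := rfl
  map_mul' _ _ := rfl

/-- The product of the differences `x_b - x_a` over pairs `a < b` in a common group. -/
def groupVandermonde {N : ℕ} (ς : Composition (2 * N)) (x : Conf (2 * N)) : ℂ :=
  ∏ p : Fin (2 * N) × Fin (2 * N) with p.1 < p.2 ∧ ς.index p.1 = ς.index p.2, (x.1 p.2 - x.1 p.1)

/-- The point of the diagonal at which all variables in the `i`-th group equal `ξ_i`. -/
def diagPoint {N : ℕ} (ς : Composition (2 * N)) (ξ : Conf ς.length) : Fin (2 * N) → ℂ :=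
  fun a => ξ.1 (ς.index a)

/-- `g` is the evaluation on the diagonal of `f`: at every point `ξ` of `d` distinct points, `g ξ`
is the value of the continuous extension of `f` to the corresponding point of the diagonal. -/
def IsDiagEval {N : ℕ} (ς : Composition (2 * N)) (f : Conf (2 * N) → ℂ)
    (g : Conf ς.length → ℂ) : Prop :=
  ∀ ξ : Conf ς.length,
    Tendsto f (comap (Subtype.val : Conf (2 * N) → Fin (2 * N) → ℂ) (𝓝 (diagPoint ς ξ)))
      (𝓝 (g ξ))

/-! ## The Specht module of the rectangular shape with `N` rows and two columns -/

/-- Numberings of the boxes (row, column) of the `N × 2` rectangle by `2N` numbers. -/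
def Numbering (N : ℕ) : Type := Fin N × Fin 2 ≃ Fin (2 * N)

/-- The row of the box that contains a given number. -/
def Numbering.row {N : ℕ} (A : Numbering N) (a : Fin (2 * N)) : Fin N :=
  ((show Fin N × Fin 2 ≃ Fin (2 * N) from A).symm a).1

/-- The column of the box that contains a given number. -/
def Numbering.col {N : ℕ} (A : Numbering N) (a : Fin (2 * N)) : Fin 2 :=
  ((show Fin N × Fin 2 ≃ Fin (2 * N) from A).symm a).2

/-- The number in a given box. -/
def Numbering.entry {N : ℕ} (A : Numbering N) (i : Fin N) (c : Fin 2) : Fin (2 * N) :=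
  (show Fin N × Fin 2 ≃ Fin (2 * N) from A) (i, c)

/-- Letter permutations of a numbering. -/
instance (N : ℕ) : MulAction (Equiv.Perm (Fin (2 * N))) (Numbering N) where
  smul σ A := Equiv.trans (show Fin N × Fin 2 ≃ Fin (2 * N) from A) σ
  one_smul _ := rfl
  mul_smul _ _ _ := rfl

theorem Numbering.row_smul {N : ℕ} (σ : Equiv.Perm (Fin (2 * N))) (A : Numbering N)
    (a : Fin (2 * N)) : (σ • A).row a = A.row (σ⁻¹ a) := rfl

theorem Numbering.col_smul {N : ℕ} (σ : Equiv.Perm (Fin (2 * N))) (A : Numbering N)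
    (a : Fin (2 * N)) : (σ • A).col a = A.col (σ⁻¹ a) := rfl

/-- Two numberings are row equivalent if their rows have the same sets of entries. -/
def rowSetoid (N : ℕ) : Setoid (Numbering N) := Setoid.ker Numbering.row

/-- Tabloids: numberings up to permutations within the rows. -/
def Tabloid (N : ℕ) : Type := Quotient (rowSetoid N)

/-- The tabloid of a numbering. -/
def Numbering.tabloid {N : ℕ} (A : Numbering N) : Tabloid N := Quotient.mk (rowSetoid N) A

instance (N : ℕ) : MulAction (Equiv.Perm (Fin (2 * N))) (Tabloid N) where
  smul σ := Quotient.map (σ • ·) fun A B (h : A.row = B.row) => by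
    change (σ • A).row = (σ • B).row
    funext a
    rw [Numbering.row_smul, Numbering.row_smul, h]
  one_smul t := Quotient.inductionOn t fun _ => rfl
  mul_smul _ _ t := Quotient.inductionOn t fun _ => rfl

/-- The permutation module on tabloids. -/
abbrev tabloidRep (N : ℕ) :
    Representation ℂ (Equiv.Perm (Fin (2 * N))) (MonoidAlgebra ℂ (Tabloid N)) :=
  Representation.ofMulAction ℂ (Equiv.Perm (Fin (2 * N))) (Tabloid N)

/-- The polytabloid of a numbering: the column antisymmetrizer applied to its tabloid. -/
def polytabloid {N : ℕ} (A : Numbering N) : MonoidAlgebra ℂ (Tabloid N) :=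
  ∑ σ : Equiv.Perm (Fin (2 * N)) with ∀ a, A.col (σ a) = A.col a,
    ((Equiv.Perm.sign σ : ℤ) : ℂ) • MonoidAlgebra.single (σ • A).tabloid 1

theorem tabloidRep_polytabloid {N : ℕ} (τ : Equiv.Perm (Fin (2 * N))) (A : Numbering N) :
    tabloidRep N τ (polytabloid A) = polytabloid (τ • A) := by
  unfold polytabloid
  rw [map_sum]
  refine Finset.sum_bij (fun σ _ => τ * σ * τ⁻¹) ?_ ?_ ?_ ?_
  · intro σ hσ
    simp only [Finset.mem_filter, Finset.mem_univ, true_and] at hσ ⊢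
    intro a
    simp [Numbering.col_smul, hσ]
  · intro σ _ σ' _ h
    simpa using h
  · intro σ hσ
    simp only [Finset.mem_filter, Finset.mem_univ, true_and] at hσ
    refine ⟨τ⁻¹ * σ * τ, ?_, by group⟩
    simp only [Finset.mem_filter, Finset.mem_univ, true_and]
    intro a
    have := hσ (τ a)
    simpa [Numbering.col_smul] using this
  · intro σ _
    rw [map_smul, Representation.ofMulAction_single]
    have h1 : τ • (σ • A).tabloid = ((τ * σ * τ⁻¹) • τ • A).tabloid := by
      change ((τ • σ • A).tabloid) = _
      rw [smul_smul, smul_smul]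
      simp
    rw [h1]
    rcases Int.units_eq_one_or (Equiv.Perm.sign τ) with h | h <;> simp [h]

/-- The Specht module `V^π` of the `N × 2` rectangle `π`: the span of all polytabloids. -/
def specht (N : ℕ) : Subrepresentation (tabloidRep N) where
  toSubmodule := Submodule.span ℂ (Set.range polytabloid)
  apply_mem_toSubmodule τ v hv := by
    induction hv using Submodule.span_induction with
    | mem v hv =>
      obtain ⟨A, rfl⟩ := hv
      rw [tabloidRep_polytabloid]
      exact Submodule.subset_span ⟨_, rfl⟩
    | zero => rw [map_zero]; exact Submodule.zero_mem _
    | add v w _ _ hv hw => rw [map_add]; exact Submodule.add_mem _ hv hw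
    | smul c v _ hv => rw [map_smul]; exact Submodule.smul_mem _ c hv

/-- A polytabloid as an element of the Specht module. -/
def spechtVec {N : ℕ} (A : Numbering N) : (specht N).toSubmodule :=
  ⟨polytabloid A, Submodule.subset_span ⟨A, rfl⟩⟩

/-- The minor of the symmetric matrix of excursion kernels (with zero diagonal) whose rows are the
entries of the first column of `A` and whose columns are the entries of its second column. -/
def kernelMinor {N : ℕ} (A : Numbering N) (x : Conf (2 * N)) : ℂ :=
  Matrix.det (Matrix.of fun i j : Fin N => unfusedKernel x (A.entry i 0) (A.entry j 1))

/-! ## Temperley-Lieb algebras -/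

/-- The Temperley-Lieb relations with fugacity `ν`, for generators `e_0, …, e_{n-2}`. -/
inductive TLRel (n : ℕ) (ν : ℂ) :
    FreeAlgebra ℂ (Fin (n - 1)) → FreeAlgebra ℂ (Fin (n - 1)) → Prop
  | sq (i : Fin (n - 1)) :
      TLRel n ν (FreeAlgebra.ι ℂ i * FreeAlgebra.ι ℂ i) (ν • FreeAlgebra.ι ℂ i)
  | adj (i j : Fin (n - 1)) (h : (i : ℕ) + 1 = j ∨ (j : ℕ) + 1 = i) :
      TLRel n ν (FreeAlgebra.ι ℂ i * FreeAlgebra.ι ℂ j * FreeAlgebra.ι ℂ i) (FreeAlgebra.ι ℂ i)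
  | far (i j : Fin (n - 1)) (h : (i : ℕ) + 1 < j ∨ (j : ℕ) + 1 < i) :
      TLRel n ν (FreeAlgebra.ι ℂ i * FreeAlgebra.ι ℂ j) (FreeAlgebra.ι ℂ j * FreeAlgebra.ι ℂ i)

/-- The Temperley-Lieb algebra on `n` sites with fugacity `ν`. -/
abbrev TL (n : ℕ) (ν : ℂ) : Type := RingQuot (TLRel n ν)

/-- The generators of the Temperley-Lieb algebra with fugacity `-2`. -/
def TL.e {n : ℕ} (i : Fin (n - 1)) : TL n (-2) :=
  RingQuot.mkAlgHom ℂ (TLRel n (-2)) (FreeAlgebra.ι ℂ i)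

/-- The generator with a natural number as index (zero out of range). -/
def TL.gen (n k : ℕ) : TL n (-2) := if h : k < n - 1 then TL.e ⟨k, h⟩ else 0

theorem TL.gen_sq (n k : ℕ) : TL.gen n k * TL.gen n k = (-2 : ℂ) • TL.gen n k := by
  unfold TL.gen
  split_ifs with h
  · have := RingQuot.mkAlgHom_rel ℂ (TLRel.sq (ν := -2) (⟨k, h⟩ : Fin (n - 1)))
    simpa only [map_mul, map_smul, TL.e] using this
  · simp

theorem TL.gen_adj (n k : ℕ) (h : k + 1 < n - 1) :
    TL.gen n (k + 1) * TL.gen n k * TL.gen n (k + 1) = TL.gen n (k + 1) := by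
  have h' : k < n - 1 := by omega
  unfold TL.gen
  rw [dif_pos h, dif_pos h']
  have := RingQuot.mkAlgHom_rel ℂ
    (TLRel.adj (ν := -2) (⟨k + 1, h⟩ : Fin (n - 1)) ⟨k, h'⟩ (Or.inr rfl))
  simpa only [map_mul, TL.e] using this

theorem TL.gen_far (n k l : ℕ) (h : k + 1 < l) : Commute (TL.gen n k) (TL.gen n l) := by
  unfold TL.gen
  split_ifs with h1 h2
  · have := RingQuot.mkAlgHom_rel ℂ
      (TLRel.far (ν := -2) (⟨k, h1⟩ : Fin (n - 1)) ⟨l, h2⟩ (Or.inl h))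
    rw [map_mul, map_mul] at this
    exact this
  · exact Commute.zero_right _
  · exact Commute.zero_left _
  · exact Commute.zero_left _

/-- The Jones-Wenzl idempotent on the `k + 1` consecutive sites `i, …, i + k`, by Wenzl's recursion
at fugacity `-2`. -/
def TL.jw (n i : ℕ) : ℕ → TL n (-2)
  | 0 => 1
  | k + 1 => TL.jw n i k +
      (((k : ℂ) + 1) / ((k : ℂ) + 2)) • (TL.jw n i k * TL.gen n (i + k) * TL.jw n i k)

theorem TL.commute_jw (n i : ℕ) (x : TL n (-2)) :
    ∀ k, (∀ l, l < k → Commute x (TL.gen n (i + l))) → Commute x (TL.jw n i k)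
  | 0, _ => Commute.one_right _
  | k + 1, h => by
    have ih := TL.commute_jw n i x k fun l hl => h l (by omega)
    have hk := h k (by omega)
    exact ih.add_right (((ih.mul_right hk).mul_right ih).smul_right _)

/-- The defining properties of the Jones-Wenzl idempotents. -/
theorem TL.jw_spec (n i : ℕ) : ∀ k, i + k < n ∨ k = 0 →
    TL.jw n i k * TL.jw n i k = TL.jw n i k ∧
    (∀ l, l < k → TL.gen n (i + l) * TL.jw n i k = 0 ∧ TL.jw n i k * TL.gen n (i + l) = 0) ∧
    (i + k + 1 < n → TL.gen n (i + k) * TL.jw n i k * TL.gen n (i + k) =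
      (-(((k : ℂ) + 2) / ((k : ℂ) + 1))) • (TL.jw n i (k - 1) * TL.gen n (i + k))) ∧
    TL.jw n i (k - 1) * TL.jw n i k = TL.jw n i k ∧
    TL.jw n i k * TL.jw n i (k - 1) = TL.jw n i k := by
  intro k
  induction k with
  | zero =>
    intro _
    refine ⟨by simp [TL.jw], fun l hl => absurd hl (by omega), fun _ => ?_, by simp [TL.jw],
      by simp [TL.jw]⟩
    simp only [TL.jw, mul_one, add_zero, TL.gen_sq]
    norm_num [TL.jw]
  | succ k ih =>
    intro hk
    have hk' : i + (k + 1) < n := by omega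
    obtain ⟨hid, hkill, hsand, hlow, hlow'⟩ := ih (Or.inl (by omega))
    have hsand := hsand (by omega)
    have hc1 : ((k : ℂ) + 1) ≠ 0 := by exact_mod_cast Nat.succ_ne_zero k
    have hc2 : ((k : ℂ) + 2) ≠ 0 := by exact_mod_cast Nat.succ_ne_zero (k + 1)
    have hc3 : ((k : ℂ) + 1 + 1) ≠ 0 := by exact_mod_cast Nat.succ_ne_zero (k + 1)
    have hcomm : Commute (TL.gen n (i + k)) (TL.jw n i (k - 1)) :=
      TL.commute_jw n i _ _ fun l hl => (TL.gen_far n _ _ (by omega)).symm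
    have hcoef : ((k : ℂ) + 1) / ((k : ℂ) + 2) * -(((k : ℂ) + 2) / ((k : ℂ) + 1)) = -1 := by
      field_simp
    set J := TL.jw n i k with hJ
    set g := TL.gen n (i + k) with hg
    set J' := TL.jw n i (k - 1) with hJ'
    have hdef : TL.jw n i (k + 1) = J + (((k : ℂ) + 1) / ((k : ℂ) + 2)) • (J * g * J) := rfl
    have hgJ : g * TL.jw n i (k + 1) = 0 := by
      rw [hdef, mul_add, mul_smul_comm, ← mul_assoc, ← mul_assoc, hsand, smul_mul_assoc, smul_smul,
        hcoef, ← hcomm.eq, mul_assoc, hlow]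
      simp
    have hJg : TL.jw n i (k + 1) * g = 0 := by
      have : J * g * J * g = (-(((k : ℂ) + 2) / ((k : ℂ) + 1))) • (J * g) := by
        rw [mul_assoc, mul_assoc, ← mul_assoc g, hsand, mul_smul_comm, ← mul_assoc, hlow']
      rw [hdef, add_mul, smul_mul_assoc, this, smul_smul, hcoef]
      simp
    have hJJ : J * TL.jw n i (k + 1) = TL.jw n i (k + 1) := by
      rw [hdef, mul_add, mul_smul_comm, ← mul_assoc, ← mul_assoc, hid]
    have hJJ' : TL.jw n i (k + 1) * J = TL.jw n i (k + 1) := by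
      rw [hdef, add_mul, smul_mul_assoc, mul_assoc (J * g), hid]
    refine ⟨?_, ?_, ?_, hJJ, hJJ'⟩
    · nth_rw 1 [hdef]
      rw [add_mul, smul_mul_assoc, mul_assoc, hJJ, mul_assoc, hgJ]
      simp
    · intro l hl
      rcases Nat.lt_succ_iff_lt_or_eq.mp hl with hl | rfl
      · constructor
        · rw [← hJJ, ← mul_assoc, (hkill l hl).1, zero_mul]
        · rw [← hJJ', mul_assoc, (hkill l hl).2, mul_zero]
      · exact ⟨hgJ, hJg⟩
    · intro hn
      have hadj : TL.gen n (i + (k + 1)) * g * TL.gen n (i + (k + 1)) = TL.gen n (i + (k + 1)) :=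
        TL.gen_adj n (i + k) (by omega)
      have hgc : Commute (TL.gen n (i + (k + 1))) J :=
        TL.commute_jw n i _ _ fun l hl => (TL.gen_far n _ _ (by omega)).symm
      set f := TL.gen n (i + (k + 1)) with hf
      have hff : f * f = (-2 : ℂ) • f := TL.gen_sq n _
      have h1 : f * J * f = (-2 : ℂ) • (J * f) := by
        rw [hgc.eq, mul_assoc, hff, mul_smul_comm]
      have h2 : f * (J * g * J) * f = J * f := by
        calc f * (J * g * J) * f = (f * J) * g * (J * f) := by simp only [mul_assoc]
          _ = (J * f) * g * (f * J) := by rw [hgc.eq]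
          _ = J * (f * g * f) * J := by simp only [mul_assoc]
          _ = J * f * J := by rw [hadj]
          _ = J * J * f := by rw [mul_assoc, hgc.eq, mul_assoc]
          _ = J * f := by rw [hid]
      rw [hdef, mul_add, add_mul, h1, mul_smul_comm, smul_mul_assoc, h2, ← add_smul]
      congr 1
      push_cast
      field_simp
      ring

/-- The idempotent `p_ς`: the product of the Jones-Wenzl idempotents of the groups. -/
def TL.idem {N : ℕ} (ς : Composition (2 * N)) : TL (2 * N) (-2) :=
  (List.ofFn fun i : Fin ς.length => TL.jw (2 * N) (ς.sizeUpTo i) (ς.blocksFun i - 1)).prod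

theorem isIdempotentElem_list_prod {R : Type*} [Monoid R] :
    ∀ l : List R, (∀ x ∈ l, IsIdempotentElem x) → l.Pairwise Commute → IsIdempotentElem l.prod
  | [], _, _ => IsIdempotentElem.one
  | x :: l, h, hc => by
    rw [List.pairwise_cons] at hc
    rw [List.prod_cons]
    exact IsIdempotentElem.mul_of_commute (Commute.list_prod_right _ _ hc.1) (h x (by simp))
      (isIdempotentElem_list_prod l (fun y hy => h y (by simp [hy])) hc.2)

theorem TL.idem_isIdempotentElem {N : ℕ} (ς : Composition (2 * N)) :
    IsIdempotentElem (TL.idem ς) := by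
  have hsz : ∀ i : Fin ς.length, ς.sizeUpTo i + (ς.blocksFun i - 1) < 2 * N ∧
      ς.sizeUpTo i + (ς.blocksFun i - 1) + 1 = ς.sizeUpTo ((i : ℕ) + 1) := by
    intro i
    have h1 := ς.sizeUpTo_succ' i
    have h2 := ς.sizeUpTo_le ((i : ℕ) + 1)
    have h3 := ς.one_le_blocksFun i
    omega
  refine isIdempotentElem_list_prod _ ?_ ?_
  · intro x hx
    rw [List.mem_ofFn] at hx
    obtain ⟨i, rfl⟩ := hx
    exact (TL.jw_spec _ _ _ (Or.inl (hsz i).1)).1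
  · rw [List.pairwise_ofFn]
    intro i j hij
    refine TL.commute_jw _ _ _ _ fun l _ => ?_
    refine (TL.commute_jw _ _ _ _ fun m hm => ?_).symm
    refine (TL.gen_far _ _ _ ?_).symm
    have h1 := (hsz i).2
    have h2 : ς.sizeUpTo ((i : ℕ) + 1) ≤ ς.sizeUpTo j := ς.monotone_sizeUpTo hij
    omega

/-- The valenced Temperley-Lieb algebra `p_ς TL p_ς`, with unit `p_ς`. -/
abbrev ValencedTL {N : ℕ} (ς : Composition (2 * N)) : Type :=
  (TL.idem_isIdempotentElem ς).Corner

/-- The element `p_ς a p_ς` of the valenced Temperley-Lieb algebra. -/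
def ValencedTL.mk {N : ℕ} (ς : Composition (2 * N)) (a : TL (2 * N) (-2)) : ValencedTL ς :=
  ⟨TL.idem ς * a * TL.idem ς, a, rfl⟩

instance {N : ℕ} (ς : Composition (2 * N)) : SMul ℂ (ValencedTL ς) where
  smul c x := ⟨c • x.1, by
    obtain ⟨_, a, rfl⟩ := x
    exact ⟨c • a, by simp⟩⟩

/-- The valenced Temperley-Lieb algebra is a complex algebra. -/
instance {N : ℕ} (ς : Composition (2 * N)) : Module ℂ (ValencedTL ς) where
  one_smul x := Subtype.ext (one_smul ℂ x.1)
  mul_smul c d x := Subtype.ext (mul_smul c d x.1)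
  smul_zero c := Subtype.ext (smul_zero (A := TL (2 * N) (-2)) c)
  smul_add c x y := Subtype.ext (smul_add c x.1 y.1)
  add_smul c d x := Subtype.ext (add_smul c d x.1)
  zero_smul x := Subtype.ext (zero_smul ℂ x.1)

instance {N : ℕ} (ς : Composition (2 * N)) : Algebra ℂ (ValencedTL ς) :=
  Algebra.ofModule (fun c x y => Subtype.ext (smul_mul_assoc c x.1 y.1))
    (fun c x y => Subtype.ext (mul_smul_comm c x.1 y.1))

/-! ## The symmetric group algebra -/

/-- The transposition of the sites `i` and `i + 1`. -/
def simpleTransposition {n : ℕ} (i : Fin (n - 1)) : Equiv.Perm (Fin n) :=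
  Equiv.swap ⟨i, by omega⟩ ⟨i + 1, by omega⟩

/-- The antisymmetrizer of the subgroup of permutations preserving each group of sites. -/
def antisymmetrizer {N : ℕ} (ς : Composition (2 * N)) :
    MonoidAlgebra ℂ (Equiv.Perm (Fin (2 * N))) :=
  (∏ i : Fin ς.length, ((ς.blocksFun i).factorial : ℂ))⁻¹ •
    ∑ σ : Equiv.Perm (Fin (2 * N)) with ∀ a, ς.index (σ a) = ς.index a,
      ((Equiv.Perm.sign σ : ℤ) : ℂ) • MonoidAlgebra.single σ 1

end USTAlg

end

/-!
The partition functions are images of vectors of the Specht module under evaluation functionals. A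
symmetric kernel `K` on the sites defines a linear functional `kernelEval K` on formal combinations
of tabloids, the product of `K` over the rows, which takes a polytabloid to a minor of `K`. In this
way the Fomin determinant of a link pattern is the value of one polytabloid (`kernelEval_polytab`),
and a pure partition function, fused or not, is the value of one *pure vector*
(`kernelEval_pureVec`), which depends on the pattern only.

The polytabloids of the link patterns span the Specht module by Garnir relations (`span_polytab`).
Flipping a valley of the upper path to a peak is a bijection of cover-inclusive Dyck tilings unless
the lower path has a peak there (`numTilings_flip`). Hence the pure vector of `α` changes sign under
the transposition of two consecutive points which `α` does not link (`swap_pureVec`), and the pure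
vectors of the valenced patterns span the space of the vectors that are antisymmetric within the
groups (`span_pureVec_isValenced`).

Newton interpolation in each group writes the unfused kernel as a congruence transform of the kernel
of divided differences, and the transformation matrix has the Vandermonde product as its determinant.
On antisymmetric vectors this factors out (`kernelEval_congruence`), and at coinciding points the
divided differences are the derivatives in the fused kernel. So the diagonal evaluation turns the
unfused evaluation of an antisymmetric vector into the fused one (`isDiagEval_kernelEval`).

The heart of the matter is that the fused evaluation is injective on antisymmetric vectors
(`eq_zero_of_kernelEval_fused`); with groups of one site this also gives the isomorphism of the
Specht module with `S_N`. It is shown for the antisymmetrized polytabloids of the valenced patterns.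
At points `t ^ w_1, t ^ w_2, …` with rapidly decreasing weights, the binomial series expands them over
integer labels of the sites, where the two ends of a chord carry opposite labels. Two chords with the
same label over a cut between groups can exchange their ends, and such configurations cancel
(`IsCompatible.sum_sign_eq_zero`). In all others the labels of the chords over a cut are distinct, so
their sum is at least `1 + ⋯ + r`, where `r` is the height of the Dyck path there
(`IsCompatible.le_sum`). Extremal configurations, with equality at all cuts, all have the same sign
(`IsExtremal.sign_eq`), and the links of a valenced pattern labelled by their heights form one of
them (`LinkPattern.IsValenced.isExtremal`). The leading exponent thus records the heights at the
cuts, and these determine a valenced pattern.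

The algebraic part is standard. The elements `-(1 + e_i)` satisfy the Coxeter relations, and the
annihilation of the Specht module by symmetrizers of three points (`symmetrizer_eq_zero`) makes it a
module of the Temperley-Lieb algebra. The module is simple (`specht_simple`), and so is its image
under the idempotent, as a module of the corner algebra (`isSimpleModule_valencedTL`); this image is
not zero since there is a valenced pattern if no group has more than half of the sites
(`exists_isValenced`). All functions in question are rational, and a rational function that vanishes
on the real chamber is zero (`eq_zero_of_mem_rationalFunctions`).
-/

open Filter Topology

noncomputable section

namespace USTAlg

/-! ### Tabloids, kernels and determinants -/

/-- The sign of a permutation as a complex number. -/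
abbrev csign {n : ℕ} (σ : Equiv.Perm (Fin n)) : ℂ := ((Equiv.Perm.sign σ : ℤ) : ℂ)

theorem csign_mul {n : ℕ} (σ τ : Equiv.Perm (Fin n)) : csign (σ * τ) = csign σ * csign τ := by
  simp [csign]

theorem csign_inv {n : ℕ} (σ : Equiv.Perm (Fin n)) : csign σ⁻¹ = csign σ := by
  simp [csign]

theorem csign_mul_self {n : ℕ} (σ : Equiv.Perm (Fin n)) : csign σ * csign σ = 1 := by
  rcases Int.units_eq_one_or (Equiv.Perm.sign σ) with h | h <;> simp [csign, h]

theorem csign_swap {n : ℕ} {a b : Fin n} (h : a ≠ b) : csign (Equiv.swap a b) = -1 := by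
  simp [csign, Equiv.Perm.sign_swap h]

section Numbering

variable {N : ℕ}

theorem Numbering.ext' {A B : Numbering N} (h : ∀ i c, A.entry i c = B.entry i c) : A = B :=
  Equiv.ext fun p => h p.1 p.2

@[simp] theorem Numbering.entry_row_col (A : Numbering N) (a : Fin (2 * N)) :
    A.entry (A.row a) (A.col a) = a :=
  Equiv.apply_symm_apply (show Fin N × Fin 2 ≃ Fin (2 * N) from A) a

@[simp] theorem Numbering.row_entry (A : Numbering N) (i : Fin N) (c : Fin 2) :
    A.row (A.entry i c) = i :=
  congrArg Prod.fst (Equiv.symm_apply_apply (show Fin N × Fin 2 ≃ Fin (2 * N) from A) (i, c))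

@[simp] theorem Numbering.col_entry (A : Numbering N) (i : Fin N) (c : Fin 2) :
    A.col (A.entry i c) = c :=
  congrArg Prod.snd (Equiv.symm_apply_apply (show Fin N × Fin 2 ≃ Fin (2 * N) from A) (i, c))

@[simp] theorem Numbering.entry_smul (σ : Equiv.Perm (Fin (2 * N))) (A : Numbering N) (i : Fin N)
    (c : Fin 2) : (σ • A).entry i c = σ (A.entry i c) := rfl

theorem Numbering.entry_inj (A : Numbering N) {i j : Fin N} {c d : Fin 2} :
    A.entry i c = A.entry j d ↔ i = j ∧ c = d :=
  ⟨fun h => ⟨by simpa using congrArg A.row h, by simpa using congrArg A.col h⟩,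
    fun h => by rw [h.1, h.2]⟩

theorem Numbering.tabloid_eq_iff {A B : Numbering N} : A.tabloid = B.tabloid ↔ A.row = B.row :=
  Quotient.eq (r := rowSetoid N)

theorem Numbering.tabloid_smul (σ : Equiv.Perm (Fin (2 * N))) (A : Numbering N) :
    (σ • A).tabloid = σ • A.tabloid := rfl

/-- The permutation taking one numbering to another one. -/
theorem Numbering.exists_smul_eq (A B : Numbering N) :
    ∃ σ : Equiv.Perm (Fin (2 * N)), σ • A = B :=
  ⟨(show Fin N × Fin 2 ≃ Fin (2 * N) from A).symm.trans
    (show Fin N × Fin 2 ≃ Fin (2 * N) from B),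
    Numbering.ext' fun i c => by
      change (show Fin N × Fin 2 ≃ Fin (2 * N) from B)
        ((show Fin N × Fin 2 ≃ Fin (2 * N) from A).symm (A.entry i c)) = B.entry i c
      have : (show Fin N × Fin 2 ≃ Fin (2 * N) from A).symm (A.entry i c) = (i, c) :=
        Equiv.symm_apply_apply (show Fin N × Fin 2 ≃ Fin (2 * N) from A) (i, c)
      rw [this]; rfl⟩

/-- Permutation of the entries of each column of a numbering. -/
def Numbering.permCols (A : Numbering N) (π : Fin 2 → Equiv.Perm (Fin N)) : Numbering N :=
  (Equiv.prodCongrLeft π).trans (show Fin N × Fin 2 ≃ Fin (2 * N) from A)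

@[simp] theorem Numbering.entry_permCols (A : Numbering N) (π : Fin 2 → Equiv.Perm (Fin N))
    (i : Fin N) (c : Fin 2) : (A.permCols π).entry i c = A.entry (π c i) c := rfl

/-- The permutation of the letters that permutes the entries of each column. -/
def Numbering.colPerm (A : Numbering N) (π : Fin 2 → Equiv.Perm (Fin N)) :
    Equiv.Perm (Fin (2 * N)) :=
  (show Fin N × Fin 2 ≃ Fin (2 * N) from A).permCongr (Equiv.prodCongrLeft π)

theorem Numbering.colPerm_entry (A : Numbering N) (π : Fin 2 → Equiv.Perm (Fin N))
    (i : Fin N) (c : Fin 2) : A.colPerm π (A.entry i c) = A.entry (π c i) c := by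
  change (show Fin N × Fin 2 ≃ Fin (2 * N) from A) (Equiv.prodCongrLeft π
    ((show Fin N × Fin 2 ≃ Fin (2 * N) from A).symm (A.entry i c))) = _
  have : (show Fin N × Fin 2 ≃ Fin (2 * N) from A).symm (A.entry i c) = (i, c) :=
    Equiv.symm_apply_apply (show Fin N × Fin 2 ≃ Fin (2 * N) from A) (i, c)
  rw [this]; rfl

theorem Numbering.colPerm_smul (A : Numbering N) (π : Fin 2 → Equiv.Perm (Fin N)) :
    A.colPerm π • A = A.permCols π :=
  Numbering.ext' fun i c => by
    rw [Numbering.entry_smul, Numbering.colPerm_entry, Numbering.entry_permCols]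

theorem Numbering.col_colPerm (A : Numbering N) (π : Fin 2 → Equiv.Perm (Fin N))
    (a : Fin (2 * N)) : A.col (A.colPerm π a) = A.col a := by
  conv_lhs => rw [← A.entry_row_col a, A.colPerm_entry]
  simp

theorem Numbering.csign_colPerm (A : Numbering N) (π : Fin 2 → Equiv.Perm (Fin N)) :
    csign (A.colPerm π) = csign (π 0) * csign (π 1) := by
  unfold csign Numbering.colPerm
  rw [Equiv.Perm.sign_permCongr, Equiv.Perm.sign_prodCongrLeft, Fin.prod_univ_two]
  push_cast
  rfl

/-- Permutations that preserve the columns act on each column separately. -/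
theorem Numbering.exists_colPerm (A : Numbering N) {σ : Equiv.Perm (Fin (2 * N))}
    (hσ : ∀ a, A.col (σ a) = A.col a) : ∃ π, A.colPerm π = σ := by
  have key : ∀ c, Function.Injective fun i => A.row (σ (A.entry i c)) := by
    intro c i j hij
    have h1 : σ (A.entry i c) = σ (A.entry j c) := by
      rw [← A.entry_row_col (σ (A.entry i c)), ← A.entry_row_col (σ (A.entry j c)), hσ, hσ]
      simp only [Numbering.col_entry]
      rw [show A.row (σ (A.entry i c)) = A.row (σ (A.entry j c)) from hij]
    exact ((A.entry_inj).mp (σ.injective h1)).1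
  refine ⟨fun c => Equiv.ofBijective _ (Finite.injective_iff_bijective.mp (key c)), ?_⟩
  ext1 a
  conv_lhs => rw [← A.entry_row_col a, A.colPerm_entry]
  simp only [Equiv.ofBijective_apply, Numbering.entry_row_col]
  conv_lhs => rw [← hσ a]
  exact A.entry_row_col _

theorem Numbering.colPerm_injective (A : Numbering N) : Function.Injective A.colPerm := by
  intro π π' h
  funext c
  ext1 i
  have := congrArg A.row (congrArg (fun σ => σ (A.entry i c)) h)
  simpa [Numbering.colPerm_entry] using this

theorem polytabloid_eq_sum (A : Numbering N) : polytabloid A =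
    ∑ π : Fin 2 → Equiv.Perm (Fin N),
      (csign (π 0) * csign (π 1)) • MonoidAlgebra.single (A.permCols π).tabloid 1 := by
  unfold polytabloid
  symm
  refine Finset.sum_bij (fun π _ => A.colPerm π) ?_ ?_ ?_ ?_
  · intro π _
    simpa using A.col_colPerm π
  · intro π _ π' _ h
    exact A.colPerm_injective h
  · intro σ hσ
    obtain ⟨π, hπ⟩ := A.exists_colPerm (Finset.mem_filter.mp hσ).2
    exact ⟨π, Finset.mem_univ _, hπ⟩
  · intro π _
    rw [← A.csign_colPerm, A.colPerm_smul]

theorem polytabloid_smul_of_col (A : Numbering N) {σ : Equiv.Perm (Fin (2 * N))}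
    (hσ : ∀ a, A.col (σ a) = A.col a) : polytabloid (σ • A) = csign σ • polytabloid A := by
  have hσ' : ∀ a, A.col (σ⁻¹ a) = A.col a := fun a => by
    rw [← hσ (σ⁻¹ a)]; simp
  unfold polytabloid
  simp only [Numbering.col_smul, hσ', Finset.smul_sum]
  refine Finset.sum_bij (fun τ _ => τ * σ) ?_ ?_ ?_ ?_
  · intro τ hτ
    simp only [Finset.mem_filter, Finset.mem_univ, true_and] at hτ ⊢
    intro a
    rw [Equiv.Perm.mul_apply, hτ, hσ]
  · intro τ _ τ' _ h
    exact mul_right_cancel h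
  · intro τ hτ
    simp only [Finset.mem_filter, Finset.mem_univ, true_and] at hτ
    refine ⟨τ * σ⁻¹, ?_, by group⟩
    simp only [Finset.mem_filter, Finset.mem_univ, true_and]
    intro a
    rw [Equiv.Perm.mul_apply, hτ, hσ']
  · intro τ _
    have h : csign τ = csign σ * csign (τ * σ) := by
      rw [csign_mul, mul_left_comm, csign_mul_self, mul_one]
    exact (congrArg (fun c : ℂ => c • (MonoidAlgebra.single ((τ * σ) • A).tabloid 1 :
      MonoidAlgebra ℂ (Tabloid N))) h).trans (mul_smul _ _ _)

theorem polytabloid_permCols (A : Numbering N) (π : Fin 2 → Equiv.Perm (Fin N)) :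
    polytabloid (A.permCols π) = (csign (π 0) * csign (π 1)) • polytabloid A := by
  rw [← A.colPerm_smul, polytabloid_smul_of_col A (A.col_colPerm π), A.csign_colPerm]

end Numbering

section KernelEval

variable {N : ℕ}

/-- The product of the values of a kernel over the rows of a tabloid. It only depends on the
tabloid if the kernel is symmetric. -/
def rowProd (K : Fin (2 * N) → Fin (2 * N) → ℂ) (t : Tabloid N) : ℂ :=
  ∏ i : Fin N, K ((Quotient.out (s := rowSetoid N) t).entry i 0)
    ((Quotient.out (s := rowSetoid N) t).entry i 1)

theorem rowProd_tabloid {K : Fin (2 * N) → Fin (2 * N) → ℂ} (hK : ∀ a b, K a b = K b a)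
    (A : Numbering N) : rowProd K A.tabloid = ∏ i : Fin N, K (A.entry i 0) (A.entry i 1) := by
  unfold rowProd
  have hrow : (Quotient.out (s := rowSetoid N) A.tabloid).row = A.row :=
    Numbering.tabloid_eq_iff.mp (Quotient.out_eq (s := rowSetoid N) A.tabloid)
  set B : Numbering N := Quotient.out (s := rowSetoid N) A.tabloid
  refine Finset.prod_congr rfl fun i _ => ?_
  have h : ∀ c, B.entry i c = A.entry i (A.col (B.entry i c)) := fun c => by
    conv_lhs => rw [← A.entry_row_col (B.entry i c), ← hrow, B.row_entry]
  have hne : B.entry i 0 ≠ B.entry i 1 := fun h => by simpa using (B.entry_inj.mp h).2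
  rw [h 0, h 1] at hne ⊢
  generalize A.col (B.entry i 0) = c at hne ⊢
  generalize A.col (B.entry i 1) = d at hne ⊢
  fin_cases c <;> fin_cases d <;> simp_all

/-- The linear functional on formal combinations of tabloids induced by a kernel. The factor `1 /
N!` accounts for the order of the rows of a tabloid. -/
def kernelEval (K : Fin (2 * N) → Fin (2 * N) → ℂ) : MonoidAlgebra ℂ (Tabloid N) →ₗ[ℂ] ℂ :=
  (N.factorial : ℂ)⁻¹ • (Finsupp.linearCombination ℂ (rowProd K) ∘ₗ
    (MonoidAlgebra.coeffLinearEquiv ℂ).toLinearMap)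

theorem kernelEval_single (K : Fin (2 * N) → Fin (2 * N) → ℂ) (t : Tabloid N) (c : ℂ) :
    kernelEval K (MonoidAlgebra.single t c) = (N.factorial : ℂ)⁻¹ * (c * rowProd K t) := by
  simp [kernelEval]

theorem kernelEval_tabloidRep {K : Fin (2 * N) → Fin (2 * N) → ℂ} (hK : ∀ a b, K a b = K b a)
    (σ : Equiv.Perm (Fin (2 * N))) (v : MonoidAlgebra ℂ (Tabloid N)) :
    kernelEval K (tabloidRep N σ v) = kernelEval (fun a b => K (σ a) (σ b)) v := by
  suffices h : kernelEval K ∘ₗ tabloidRep N σ = kernelEval fun a b => K (σ a) (σ b) from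
    LinearMap.congr_fun h v
  refine MonoidAlgebra.lhom_ext' fun t => LinearMap.ext_ring ?_
  simp only [LinearMap.comp_apply, MonoidAlgebra.lsingle_apply]
  rw [Representation.ofMulAction_single, kernelEval_single,
    kernelEval_single]
  obtain ⟨A, rfl⟩ := Quotient.exists_rep t
  change _ * (_ * rowProd K (σ • A).tabloid) = _ * (_ * rowProd _ A.tabloid)
  rw [rowProd_tabloid hK, rowProd_tabloid fun a b => hK _ _]
  rfl

theorem kernelEval_polytabloid {K : Fin (2 * N) → Fin (2 * N) → ℂ} (hK : ∀ a b, K a b = K b a)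
    (A : Numbering N) : kernelEval K (polytabloid A) =
      Matrix.det (Matrix.of fun i j : Fin N => K (A.entry i 0) (A.entry j 1)) := by
  rw [polytabloid_eq_sum, map_sum]
  have h1 : ∀ π : Fin 2 → Equiv.Perm (Fin N),
      kernelEval K ((csign (π 0) * csign (π 1)) • MonoidAlgebra.single (A.permCols π).tabloid 1) =
      (N.factorial : ℂ)⁻¹ * (csign (π 1 * (π 0)⁻¹) *
        ∏ i, K (A.entry i 0) (A.entry ((π 1 * (π 0)⁻¹) i) 1)) := by
    intro π
    rw [map_smul, kernelEval_single, rowProd_tabloid hK, csign_mul, csign_inv, one_mul,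
      smul_eq_mul, ← mul_assoc, mul_comm (csign (π 0) * csign (π 1)), mul_assoc,
      mul_comm (csign (π 0))]
    congr 2
    rw [← Equiv.prod_comp (π 0) fun i => K (A.entry i 0) (A.entry ((π 1 * (π 0)⁻¹) i) 1)]
    simp
  rw [Finset.sum_congr rfl fun π _ => h1 π, ← Finset.mul_sum,
    ← (finTwoArrowEquiv (Equiv.Perm (Fin N))).symm.sum_comp, Fintype.sum_prod_type]
  simp only [finTwoArrowEquiv_symm_apply, Matrix.cons_val_zero, Matrix.cons_val_one]
  have h2 : ∀ π₀ : Equiv.Perm (Fin N), ∑ π₁ : Equiv.Perm (Fin N),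
      csign (π₁ * π₀⁻¹) * ∏ i, K (A.entry i 0) (A.entry ((π₁ * π₀⁻¹) i) 1) =
      Matrix.det (Matrix.of fun i j : Fin N => K (A.entry i 0) (A.entry j 1)) := by
    intro π₀
    rw [← Matrix.det_transpose, Matrix.det_apply', ← Equiv.sum_comp (Equiv.mulRight π₀)]
    simp [csign]
  rw [Finset.sum_congr rfl fun π _ => h2 π, Finset.sum_const, Finset.card_univ,
    Fintype.card_perm, Fintype.card_fin, nsmul_eq_mul, ← mul_assoc, inv_mul_cancel₀, one_mul]
  exact_mod_cast N.factorial_ne_zero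

end KernelEval

/-! ### Antisymmetrizers and simplicity of the Specht module -/

section Antisymmetrizer

variable {n : ℕ} {W : Type*} [AddCommGroup W] [Module ℂ W]

open Classical in
/-- The unnormalized antisymmetrizer of a subgroup of the symmetric group, acting in a
representation. -/
def antisym (ρ : Representation ℂ (Equiv.Perm (Fin n)) W) (H : Subgroup (Equiv.Perm (Fin n))) :
    W →ₗ[ℂ] W :=
  ∑ σ : Equiv.Perm (Fin n) with σ ∈ H, csign σ • ρ σ

variable (ρ : Representation ℂ (Equiv.Perm (Fin n)) W) (H : Subgroup (Equiv.Perm (Fin n)))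

open Classical in
theorem antisym_apply (v : W) :
    antisym ρ H v = ∑ σ : Equiv.Perm (Fin n) with σ ∈ H, csign σ • ρ σ v := by
  simp [antisym, LinearMap.sum_apply]

theorem antisym_rep {σ : Equiv.Perm (Fin n)} (hσ : σ ∈ H) (v : W) :
    antisym ρ H (ρ σ v) = csign σ • antisym ρ H v := by
  classical
  rw [antisym_apply, antisym_apply, Finset.smul_sum]
  refine Finset.sum_bij (fun τ _ => τ * σ) ?_ ?_ ?_ ?_
  · intro τ hτ
    simpa using H.mul_mem (Finset.mem_filter.mp hτ).2 hσ
  · intro τ _ τ' _ h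
    exact mul_right_cancel h
  · intro τ hτ
    exact ⟨τ * σ⁻¹, by simpa using H.mul_mem (Finset.mem_filter.mp hτ).2 (H.inv_mem hσ), by group⟩
  · intro τ _
    rw [smul_smul, csign_mul, mul_left_comm, csign_mul_self, mul_one, map_mul, Module.End.mul_apply]

theorem rep_antisym {σ : Equiv.Perm (Fin n)} (hσ : σ ∈ H) (v : W) :
    ρ σ (antisym ρ H v) = csign σ • antisym ρ H v := by
  classical
  rw [antisym_apply, map_sum, Finset.smul_sum]
  refine Finset.sum_bij (fun τ _ => σ * τ) ?_ ?_ ?_ ?_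
  · intro τ hτ
    simpa using H.mul_mem hσ (Finset.mem_filter.mp hτ).2
  · intro τ _ τ' _ h
    exact mul_left_cancel h
  · intro τ hτ
    exact ⟨σ⁻¹ * τ, by simpa using H.mul_mem (H.inv_mem hσ) (Finset.mem_filter.mp hτ).2, by group⟩
  · intro τ _
    rw [smul_smul, csign_mul, ← mul_assoc, csign_mul_self, one_mul, map_smul, map_mul,
      Module.End.mul_apply]

theorem antisym_eq_zero {a b : Fin n} (hab : a ≠ b) (hH : Equiv.swap a b ∈ H) {v : W}
    (hv : ρ (Equiv.swap a b) v = v) : antisym ρ H v = 0 := by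
  have h := antisym_rep ρ H hH v
  rw [hv, csign_swap hab, neg_one_smul] at h
  have h2 : (2 : ℂ) • antisym ρ H v = 0 := by rw [two_smul, add_eq_zero_iff_eq_neg]; exact h
  exact (smul_eq_zero.mp h2).resolve_left two_ne_zero

end Antisymmetrizer

section Specht

variable {N : ℕ}

/-- The group of the permutations that preserve the columns of a numbering. -/
def Numbering.colStab (A : Numbering N) : Subgroup (Equiv.Perm (Fin (2 * N))) where
  carrier := {σ | ∀ a, A.col (σ a) = A.col a}
  mul_mem' := fun hσ hτ a => by rw [Equiv.Perm.mul_apply, hσ, hτ]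
  one_mem' := fun _ => rfl
  inv_mem' := fun {σ} hσ a => by rw [← hσ (σ⁻¹ a)]; simp

theorem Numbering.mem_colStab {A : Numbering N} {σ : Equiv.Perm (Fin (2 * N))} :
    σ ∈ A.colStab ↔ ∀ a, A.col (σ a) = A.col a := Iff.rfl

theorem polytabloid_eq_antisym (A : Numbering N) :
    polytabloid A = antisym (tabloidRep N) A.colStab (MonoidAlgebra.single A.tabloid 1) := by
  classical
  rw [antisym_apply]
  unfold polytabloid
  refine Finset.sum_congr (by ext; simp [Numbering.mem_colStab]) fun σ _ => ?_
  rw [Representation.ofMulAction_single, Numbering.tabloid_smul]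

/-- A numbering none of whose rows meets a column of `A` twice has the tabloid of a column
permutation of `A`. -/
theorem Numbering.exists_tabloid_permCols (A B : Numbering N)
    (h : ∀ i, A.col (B.entry i 0) ≠ A.col (B.entry i 1)) :
    ∃ π, (A.permCols π).tabloid = B.tabloid := by
  have hd : ∀ (c : Fin 2) (i : Fin N), ∃ d, A.col (B.entry i d) = c := by
    intro c i
    by_contra hcon
    push Not at hcon
    have h0 := hcon 0
    have h1 := hcon 1
    have h2 := h i
    generalize A.col (B.entry i 0) = x at h0 h2
    generalize A.col (B.entry i 1) = y at h1 h2
    omega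
  choose d hd using hd
  have inj : ∀ c, Function.Injective fun i => A.row (B.entry i (d c i)) := by
    intro c i j hij
    have : B.entry i (d c i) = B.entry j (d c j) := by
      rw [← A.entry_row_col (B.entry i (d c i)), ← A.entry_row_col (B.entry j (d c j)), hd, hd]
      rw [show A.row (B.entry i (d c i)) = A.row (B.entry j (d c j)) from hij]
    exact (B.entry_inj.mp this).1
  refine ⟨fun c => Equiv.ofBijective _ (Finite.injective_iff_bijective.mp (inj c)), ?_⟩
  rw [Numbering.tabloid_eq_iff]
  funext a
  obtain ⟨i, c, rfl⟩ : ∃ i c, a = (A.permCols fun c => Equiv.ofBijective _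
      (Finite.injective_iff_bijective.mp (inj c))).entry i c :=
    ⟨_, _, ((A.permCols _).entry_row_col a).symm⟩
  rw [Numbering.row_entry, Numbering.entry_permCols, Equiv.ofBijective_apply]
  have : A.entry (A.row (B.entry i (d c i))) c = B.entry i (d c i) := by
    conv_rhs => rw [← A.entry_row_col (B.entry i (d c i)), hd]
  rw [this, Numbering.row_entry]

theorem swap_smul_tabloid (A : Numbering N) (i : Fin N) :
    Equiv.swap (A.entry i 0) (A.entry i 1) • A.tabloid = A.tabloid := by
  rw [← Numbering.tabloid_smul, Numbering.tabloid_eq_iff]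
  funext a
  rw [Numbering.row_smul, Equiv.swap_inv]
  rcases eq_or_ne a (A.entry i 0) with rfl | h0
  · simp
  rcases eq_or_ne a (A.entry i 1) with rfl | h1
  · simp
  rw [Equiv.swap_apply_of_ne_of_ne h0 h1]

/-- The column antisymmetrizer of `A` maps every formal combination of tabloids to a multiple of
the polytabloid of `A`. -/
theorem antisym_colStab_mem (A : Numbering N) (v : MonoidAlgebra ℂ (Tabloid N)) :
    ∃ c : ℂ, antisym (tabloidRep N) A.colStab v = c • polytabloid A := by
  induction v using MonoidAlgebra.induction_linear with
  | zero => exact ⟨0, by simp⟩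
  | add v w hv hw =>
    obtain ⟨c, hc⟩ := hv
    obtain ⟨d, hd⟩ := hw
    exact ⟨c + d, by rw [map_add, hc, hd, add_smul]⟩
  | single t r =>
    obtain ⟨B, rfl⟩ := Quotient.exists_rep t
    change ∃ c, antisym (tabloidRep N) A.colStab (MonoidAlgebra.single B.tabloid r) = _
    by_cases h : ∀ i, A.col (B.entry i 0) ≠ A.col (B.entry i 1)
    · obtain ⟨π, hπ⟩ := A.exists_tabloid_permCols B h
      refine ⟨r * csign (A.colPerm π), ?_⟩
      have h1 : (MonoidAlgebra.single B.tabloid r : MonoidAlgebra ℂ (Tabloid N)) =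
          r • tabloidRep N (A.colPerm π) (MonoidAlgebra.single A.tabloid 1) := by
        rw [Representation.ofMulAction_single, ← hπ, ← A.colPerm_smul, Numbering.tabloid_smul]
        simp
      rw [h1, map_smul, antisym_rep _ A.colStab (A.col_colPerm π), ← polytabloid_eq_antisym,
        smul_smul]
    · push Not at h
      obtain ⟨i, hi⟩ := h
      refine ⟨0, ?_⟩
      rw [zero_smul]
      have hne : B.entry i 0 ≠ B.entry i 1 := fun h => by simpa using (B.entry_inj.mp h).2
      refine antisym_eq_zero _ _ hne ?_ (by
        rw [Representation.ofMulAction_single, swap_smul_tabloid])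
      rw [Numbering.mem_colStab]
      intro a
      rcases eq_or_ne a (B.entry i 0) with rfl | h0
      · rw [Equiv.swap_apply_left, hi]
      rcases eq_or_ne a (B.entry i 1) with rfl | h1
      · rw [Equiv.swap_apply_right, hi]
      rw [Equiv.swap_apply_of_ne_of_ne h0 h1]

/-- The Specht module is orthogonal to the common kernel of the column antisymmetrizers. -/
theorem eq_zero_of_antisym_colStab {u : MonoidAlgebra ℂ (Tabloid N)}
    (hu : u ∈ (specht N).toSubmodule)
    (h : ∀ A : Numbering N, antisym (tabloidRep N) A.colStab u = 0) : u = 0 := by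
  classical
  -- the Hermitian pairing with `u` in the basis of tabloids
  set L : MonoidAlgebra ℂ (Tabloid N) →ₗ[ℂ] ℂ :=
    Finsupp.linearCombination ℂ (fun t => (starRingEnd ℂ) (u.coeff t)) ∘ₗ
      (MonoidAlgebra.coeffLinearEquiv ℂ).toLinearMap with hL
  have hLs : ∀ t c, L (MonoidAlgebra.single t c) = c * (starRingEnd ℂ) (u.coeff t) := by
    intro t c
    simp [hL]
  have hLp : ∀ A : Numbering N, L (polytabloid A) = 0 := by
    intro A
    have h1 := congrArg (fun w => (starRingEnd ℂ) (w.coeff A.tabloid)) (h A)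
    simp only [antisym_apply, MonoidAlgebra.coeff_zero, Finsupp.coe_zero, Pi.zero_apply,
      map_zero] at h1
    rw [polytabloid_eq_antisym, antisym_apply, map_sum, ← h1, MonoidAlgebra.coeff_sum,
      Finsupp.finsetSum_apply, map_sum]
    refine Finset.sum_bij (fun σ _ => σ⁻¹) ?_ ?_ ?_ ?_
    · intro σ hσ
      simpa using hσ
    · intro σ _ τ _ hστ
      exact inv_injective hστ
    · intro σ hσ
      exact ⟨σ⁻¹, by simpa using hσ, inv_inv σ⟩
    · intro σ _
      rw [map_smul, Representation.ofMulAction_single, hLs, MonoidAlgebra.coeff_smul,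
        Finsupp.smul_apply, Representation.coeff_ofMulAction, inv_inv, csign_inv, smul_eq_mul,
        smul_eq_mul, one_mul, map_mul]
      simp [csign]
  have hLu : L u = 0 := by
    have : ∀ w ∈ (specht N).toSubmodule, L w = 0 := by
      intro w hw
      induction hw using Submodule.span_induction with
      | mem w hw => obtain ⟨A, rfl⟩ := hw; exact hLp A
      | zero => exact map_zero L
      | add w w' _ _ hw hw' => rw [map_add, hw, hw', add_zero]
      | smul c w _ hw => rw [map_smul, hw, smul_zero]
    exact this u hu
  have hsum : ∑ t ∈ u.coeff.support, Complex.normSq (u.coeff t) = 0 := by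
    have : L u = ((∑ t ∈ u.coeff.support, Complex.normSq (u.coeff t) : ℝ) : ℂ) := by
      rw [hL, LinearMap.comp_apply]
      change Finsupp.linearCombination ℂ _ u.coeff = _
      rw [Finsupp.linearCombination_apply, Finsupp.sum, Complex.ofReal_sum]
      refine Finset.sum_congr rfl fun t _ => ?_
      rw [smul_eq_mul, Complex.mul_conj]
    rw [this] at hLu
    exact_mod_cast hLu
  rw [Finset.sum_eq_zero_iff_of_nonneg fun t _ => Complex.normSq_nonneg _] at hsum
  ext t
  by_contra hne
  have ht : t ∈ u.coeff.support := Finsupp.mem_support_iff.mpr hne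
  exact hne (by simpa using hsum t ht)

theorem polytabloid_mem (A : Numbering N) : polytabloid A ∈ (specht N).toSubmodule :=
  Submodule.subset_span ⟨A, rfl⟩

/-- The Specht module of the rectangle is simple. -/
theorem specht_simple {U : Submodule ℂ (MonoidAlgebra ℂ (Tabloid N))}
    (hU : U ≤ (specht N).toSubmodule) (hinv : ∀ σ, ∀ u ∈ U, tabloidRep N σ u ∈ U) (h0 : U ≠ ⊥) :
    U = (specht N).toSubmodule := by
  classical
  refine le_antisymm hU ?_
  obtain ⟨u, huU, hu0⟩ := U.ne_bot_iff.mp h0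
  obtain ⟨A, hA⟩ : ∃ A : Numbering N, antisym (tabloidRep N) A.colStab u ≠ 0 := by
    by_contra hcon
    push Not at hcon
    exact hu0 (eq_zero_of_antisym_colStab (hU huU) hcon)
  obtain ⟨c, hc⟩ := antisym_colStab_mem A u
  have hc0 : c ≠ 0 := by
    rintro rfl
    exact hA (by rw [hc, zero_smul])
  have hAU : polytabloid A ∈ U := by
    have h1 : antisym (tabloidRep N) A.colStab u ∈ U := by
      rw [antisym_apply]
      exact U.sum_mem fun σ _ => U.smul_mem _ (hinv σ u huU)
    rw [hc] at h1
    exact (U.smul_mem_iff hc0).mp h1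
  refine Submodule.span_le.mpr ?_
  rintro _ ⟨B, rfl⟩
  obtain ⟨σ, rfl⟩ := A.exists_smul_eq B
  rw [← tabloidRep_polytabloid]
  exact hinv σ _ hAU

end Specht

/-! ### Link patterns -/

namespace LinkPattern

variable {N : ℕ}

theorem partner_injective (α : LinkPattern N) : Function.Injective α.partner := fun a b h => by
  rw [← α.partner_partner a, h, α.partner_partner]

theorem partner_eq_iff (α : LinkPattern N) {a b : Fin (2 * N)} :
    α.partner a = b ↔ a = α.partner b :=
  ⟨fun h => by rw [← h, α.partner_partner], fun h => by rw [h, α.partner_partner]⟩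

theorem lt_partner_partner_iff (α : LinkPattern N) (a : Fin (2 * N)) :
    α.partner a < α.partner (α.partner a) ↔ ¬ a < α.partner a := by
  rw [α.partner_partner, not_lt, le_iff_lt_or_eq]
  exact ⟨Or.inl, fun h => h.resolve_right (α.partner_ne a)⟩

theorem partner_lt_iff (α : LinkPattern N) (a : Fin (2 * N)) :
    α.partner a < a ↔ ¬ a < α.partner a := by
  rw [← α.lt_partner_partner_iff, α.partner_partner]

/-- A link pattern is determined by its left endpoints. -/
theorem ext_of_left {α β : LinkPattern N} (h : ∀ a, a < α.partner a ↔ a < β.partner a) :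
    α = β := by
  -- the right endpoints have the same partners, by induction from left to right
  have key : ∀ (n : ℕ) (b : Fin (2 * N)), (b : ℕ) = n → ¬ b < α.partner b →
      α.partner b = β.partner b := by
    intro n
    induction n using Nat.strong_induction_on with
    | _ n ih =>
    intro b hb hbα
    have hbβ : ¬ b < β.partner b := fun hc => hbα ((h b).mpr hc)
    have main : ∀ γ δ : LinkPattern N, (∀ a, a < γ.partner a ↔ a < δ.partner a) →
        (∀ m < n, ∀ c : Fin (2 * N), (c : ℕ) = m → ¬ c < γ.partner c →
          γ.partner c = δ.partner c) →
        ¬ b < γ.partner b → ¬ b < δ.partner b → ¬ γ.partner b < δ.partner b := by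
      intro γ δ hγδ ih hγ hδ hlt
      have h1 : δ.partner b < b := (δ.partner_lt_iff b).mpr hδ
      have h2 : δ.partner b < γ.partner (δ.partner b) :=
        (hγδ _).mpr ((δ.lt_partner_partner_iff b).mpr hδ)
      have h3 : γ.partner (δ.partner b) < b := by
        have h4 := γ.noncrossing (γ.partner b) (δ.partner b)
        rw [γ.partner_partner] at h4
        have h5 : γ.partner (δ.partner b) ≠ b := fun h6 => by
          rw [γ.partner_eq_iff] at h6
          omega
        have : γ.partner (δ.partner b) ≤ b := not_lt.mp fun h6 => h4 ⟨hlt, h1, h6⟩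
        exact lt_of_le_of_ne this h5
      have h4 := ih (γ.partner (δ.partner b)) (by omega) _ rfl
        (by rw [γ.partner_partner]; exact not_lt.mpr h2.le)
      rw [γ.partner_partner, eq_comm, δ.partner_eq_iff, δ.partner_partner] at h4
      omega
    have h1 := main α β h (fun m hm c hc => ih m hm c hc) hbα hbβ
    have h2 := main β α (fun a => (h a).symm)
      (fun m hm c hc hcβ => (ih m hm c hc fun hcα => hcβ ((h c).mp hcα)).symm) hbβ hbα
    omega
  have key' : ∀ b, ¬ b < α.partner b → α.partner b = β.partner b := fun b => key b b rfl
  ext1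
  funext a
  by_cases ha : a < α.partner a
  · have h1 := key' (α.partner a) (by
      rw [α.partner_partner]; exact not_lt.mpr ha.le)
    rw [α.partner_partner] at h1
    rw [← β.partner_eq_iff.mpr h1]
  · exact key' a ha

/-! ### Heights of Dyck paths -/

/-- The steps of the Dyck path: `1` at left endpoints and `-1` at right endpoints. -/
def step (α : LinkPattern N) (a : Fin (2 * N)) : ℤ := if a < α.partner a then 1 else -1

theorem step_partner (α : LinkPattern N) (a : Fin (2 * N)) :
    α.step (α.partner a) = -α.step a := by
  have h := α.lt_partner_partner_iff a
  unfold step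
  by_cases ha : a < α.partner a
  · rw [if_pos ha, if_neg fun hc => h.mp hc ha]
  · rw [if_neg ha, if_pos (h.mpr ha), neg_neg]

theorem height_eq_sum (α : LinkPattern N) (k : ℕ) :
    α.height k = ∑ a ∈ Finset.univ.filter (fun a : Fin (2 * N) => (a : ℕ) < k), α.step a := by
  rw [Finset.sum_filter]
  rfl

/-- In sums of functions which are odd under `partner`, only the links that are open at `k`
contribute to an initial segment. -/
theorem sum_odd (α : LinkPattern N) (s : Fin (2 * N) → ℤ)
    (hs : ∀ a, s (α.partner a) = -s a) (k : ℕ) :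
    ∑ a ∈ Finset.univ.filter (fun a : Fin (2 * N) => (a : ℕ) < k), s a =
      ∑ a ∈ Finset.univ.filter (fun a : Fin (2 * N) =>
        (a : ℕ) < k ∧ k ≤ (α.partner a : ℕ)), s a := by
  rw [← Finset.sum_filter_add_sum_filter_not (Finset.univ.filter fun a : Fin (2 * N) => (a : ℕ) < k)
    (fun a => k ≤ (α.partner a : ℕ)), Finset.filter_filter, Finset.filter_filter]
  rw [add_eq_left]
  refine Finset.sum_involution (fun a _ => α.partner a) ?_ ?_ ?_ ?_
  · intro a _
    rw [hs]; ring
  · intro a _ _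
    exact α.partner_ne a
  · intro a ha
    simp only [Finset.mem_filter, Finset.mem_univ, true_and, not_le, α.partner_partner] at ha ⊢
    exact ha.symm
  · intro a _
    exact α.partner_partner a

theorem height_eq_card (α : LinkPattern N) (k : ℕ) : α.height k =
    (Finset.univ.filter fun a : Fin (2 * N) => (a : ℕ) < k ∧ k ≤ (α.partner a : ℕ)).card := by
  rw [height_eq_sum, α.sum_odd _ α.step_partner, Finset.card_eq_sum_ones, Nat.cast_sum]
  refine Finset.sum_congr rfl fun a ha => ?_
  simp only [Finset.mem_filter, Finset.mem_univ, true_and] at ha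
  rw [step, if_pos (Fin.lt_def.mpr (by omega))]
  rfl

theorem height_nonneg (α : LinkPattern N) (k : ℕ) : 0 ≤ α.height k := by
  rw [height_eq_card]
  positivity

theorem sum_le_height (α : LinkPattern N) (s : Fin (2 * N) → ℤ)
    (hs : ∀ a, s (α.partner a) = -s a) (h1 : ∀ a, s a ≤ 1) (k : ℕ) :
    ∑ a ∈ Finset.univ.filter (fun a : Fin (2 * N) => (a : ℕ) < k), s a ≤ α.height k := by
  rw [α.sum_odd s hs, height_eq_card, Finset.card_eq_sum_ones, Nat.cast_sum]
  exact Finset.sum_le_sum fun a _ => by simpa using h1 a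

theorem height_zero (α : LinkPattern N) : α.height 0 = 0 := by
  simp [height]

theorem height_succ (α : LinkPattern N) (a : Fin (2 * N)) :
    α.height (a + 1) = α.height a + α.step a := by
  rw [height_eq_sum, height_eq_sum]
  have : (Finset.univ.filter fun b : Fin (2 * N) => (b : ℕ) < a + 1) =
      insert a (Finset.univ.filter fun b : Fin (2 * N) => (b : ℕ) < a) := by
    ext b
    simp only [Finset.mem_filter, Finset.mem_univ, true_and, Finset.mem_insert, Fin.ext_iff]
    omega
  rw [this, Finset.sum_insert (by simp), add_comm]

theorem height_eq_zero_of_le (α : LinkPattern N) {k : ℕ} (hk : 2 * N ≤ k) : α.height k = 0 := by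
  rw [height_eq_card]
  simp only [Nat.cast_eq_zero, Finset.card_eq_zero]
  ext a
  simp only [Finset.mem_filter, Finset.mem_univ, true_and, Finset.notMem_empty, iff_false]
  omega

theorem below_refl (α : LinkPattern N) : α.Below α := fun _ => le_rfl

theorem Below.trans {α β γ : LinkPattern N} (h : α.Below β) (h' : β.Below γ) : α.Below γ :=
  fun k => (h k).trans (h' k)

theorem eq_of_height {α β : LinkPattern N} (h : ∀ k, α.height k = β.height k) : α = β := by
  refine ext_of_left fun a => ?_
  have h1 := α.height_succ a
  have h2 := β.height_succ a
  rw [h, h] at h1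
  have h3 : α.step a = β.step a := by omega
  unfold step at h3
  by_cases ha : a < α.partner a <;> by_cases hb : a < β.partner a
  · exact iff_of_true ha hb
  · simp [ha, hb] at h3
  · simp [ha, hb] at h3
  · exact iff_of_false ha hb

theorem Below.antisymm {α β : LinkPattern N} (h : α.Below β) (h' : β.Below α) : α = β :=
  eq_of_height fun k => le_antisymm (h k) (h' k)

/-! ### Numberings of link patterns -/

theorem card_left (α : LinkPattern N) : Fintype.card {a : Fin (2 * N) // a < α.partner a} = N := by
  have h1 : Fintype.card {a : Fin (2 * N) // a < α.partner a} =
      Fintype.card {a : Fin (2 * N) // ¬ a < α.partner a} :=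
    Fintype.card_congr
      { toFun := fun a => ⟨α.partner a, by
          rw [α.partner_partner]; exact not_lt.mpr a.2.le⟩
        invFun := fun a => ⟨α.partner a, (α.lt_partner_partner_iff _).mpr a.2⟩
        left_inv := fun a => Subtype.ext (α.partner_partner a)
        right_inv := fun a => Subtype.ext (α.partner_partner a) }
  have h2 := Fintype.card_subtype_compl fun a : Fin (2 * N) => a < α.partner a
  have h3 := Fintype.card_subtype_le fun a : Fin (2 * N) => a < α.partner a
  rw [Fintype.card_fin] at h2 h3
  omega

/-- The rows of `B` are the links of `β`, with the left endpoints in the first column. -/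
def IsNumbering (β : LinkPattern N) (B : Numbering N) : Prop :=
  ∀ i, B.entry i 0 < β.partner (B.entry i 0) ∧ B.entry i 1 = β.partner (B.entry i 0)

theorem exists_isNumbering (β : LinkPattern N) : ∃ B, β.IsNumbering B := by
  have e : Fin N ≃ {a : Fin (2 * N) // a < β.partner a} :=
    (Fintype.equivFinOfCardEq β.card_left).symm
  let f : Fin N × Fin 2 → Fin (2 * N) := fun p =>
    if p.2 = 0 then (e p.1 : Fin (2 * N)) else β.partner (e p.1)
  have hf : Function.Bijective f := by
    rw [Fintype.bijective_iff_injective_and_card]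
    refine ⟨?_, by simp [mul_comm]⟩
    rintro ⟨i, c⟩ ⟨j, d⟩ h
    have hl : ∀ i j, (e i : Fin (2 * N)) ≠ β.partner (e j) := fun i j hij => by
      have h1 := (e i).2
      rw [hij, β.lt_partner_partner_iff] at h1
      exact h1 (e j).2
    fin_cases c <;> fin_cases d
    · have h' : (e i : Fin (2 * N)) = e j := by simpa [f] using h
      simpa using e.injective (Subtype.ext h')
    · exact absurd h (by simpa [f] using hl i j)
    · exact absurd h.symm (by simpa [f] using hl j i)
    · have h' : β.partner (e i) = β.partner (e j) := by simpa [f] using h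
      simpa using e.injective (Subtype.ext (β.partner_injective h'))
  refine ⟨Equiv.ofBijective f hf, fun i => ?_⟩
  have h0 : Numbering.entry (N := N) (Equiv.ofBijective f hf) i 0 = e i := by
    change f (i, 0) = _
    simp [f]
  have h1 : Numbering.entry (N := N) (Equiv.ofBijective f hf) i 1 = β.partner (e i) := by
    change f (i, 1) = _
    simp [f]
  rw [h0, h1]
  exact ⟨(e i).2, rfl⟩

/-- A numbering whose rows are the links of `β`. -/
def numbering (β : LinkPattern N) : Numbering N := β.exists_isNumbering.choose

theorem isNumbering_numbering (β : LinkPattern N) : β.IsNumbering β.numbering :=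
  β.exists_isNumbering.choose_spec

/-- The vector of the Specht module whose image under the evaluation of a kernel is the Fomin type
determinant of `β`. -/
def polytab (β : LinkPattern N) : MonoidAlgebra ℂ (Tabloid N) := polytabloid β.numbering

theorem IsNumbering.left_iff {β : LinkPattern N} {B : Numbering N} (h : β.IsNumbering B)
    (a : Fin (2 * N)) : a < β.partner a ↔ B.col a = 0 := by
  obtain ⟨i, c, rfl⟩ : ∃ i c, a = B.entry i c := ⟨_, _, (B.entry_row_col a).symm⟩
  rw [B.col_entry]
  fin_cases c
  · simpa using (h i).1
  · simp only [Fin.mk_one, Fin.isValue, one_ne_zero, iff_false]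
    rw [(h i).2, β.lt_partner_partner_iff, not_not]
    exact (h i).1

theorem IsNumbering.col_eq {β : LinkPattern N} {B C : Numbering N} (hB : β.IsNumbering B)
    (hC : β.IsNumbering C) (a : Fin (2 * N)) : B.col a = C.col a := by
  have h := (hB.left_iff a).symm.trans (hC.left_iff a)
  generalize B.col a = x at h
  generalize C.col a = y at h
  fin_cases x <;> fin_cases y <;> simp_all

theorem IsNumbering.polytabloid_eq {β : LinkPattern N} {B : Numbering N} (hB : β.IsNumbering B) :
    polytabloid B = β.polytab := by
  have hC := β.isNumbering_numbering
  set C := β.numbering with hCdef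
  have inj : Function.Injective fun i => C.row (B.entry i 0) := by
    intro i j hij
    have : B.entry i 0 = B.entry j 0 := by
      rw [← C.entry_row_col (B.entry i 0), ← C.entry_row_col (B.entry j 0), ← hB.col_eq hC,
        ← hB.col_eq hC, B.col_entry, B.col_entry]
      rw [show C.row (B.entry i 0) = C.row (B.entry j 0) from hij]
    exact (B.entry_inj.mp this).1
  let π : Equiv.Perm (Fin N) := Equiv.ofBijective _ (Finite.injective_iff_bijective.mp inj)
  have h0 : ∀ i, C.entry (π i) 0 = B.entry i 0 := fun i => by
    have := C.entry_row_col (B.entry i 0)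
    rwa [← hB.col_eq hC, B.col_entry] at this
  have : C.permCols (fun _ => π) = B := by
    refine Numbering.ext' fun i c => ?_
    rw [Numbering.entry_permCols]
    fin_cases c
    · exact h0 i
    · change C.entry (π i) 1 = B.entry i 1
      rw [(hC _).2, (hB _).2, h0]
  rw [← this, polytabloid_permCols, csign_mul_self, one_smul, polytab]

theorem kernelEval_polytab {K : Fin (2 * N) → Fin (2 * N) → ℂ} (hK : ∀ a b, K a b = K b a)
    (β : LinkPattern N) : kernelEval K β.polytab = fominDet K β := by
  rw [polytab, kernelEval_polytabloid hK]
  have hB := β.isNumbering_numbering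
  set B := β.numbering
  have hbij : Function.Bijective fun i : Fin N =>
      (⟨B.entry i 0, (hB i).1⟩ : {a : Fin (2 * N) // a < β.partner a}) := by
    rw [Fintype.bijective_iff_injective_and_card]
    refine ⟨fun i j h => (B.entry_inj.mp (Subtype.ext_iff.mp h)).1, ?_⟩
    rw [β.card_left, Fintype.card_fin]
  let e := Equiv.ofBijective _ hbij
  unfold fominDet
  rw [← Matrix.det_submatrix_equiv_self e]
  congr 1
  ext i j
  simp [e, (hB j).2]

theorem polytab_mem (β : LinkPattern N) : β.polytab ∈ (specht N).toSubmodule :=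
  polytabloid_mem _

end LinkPattern

section Existence

variable {N : ℕ}

/-- A numbering with increasing and noncrossing rows is the one of a link pattern. -/
theorem Numbering.exists_linkPattern (B : Numbering N) (h1 : ∀ i, B.entry i 0 < B.entry i 1)
    (h2 : ∀ i j, ¬ (B.entry i 0 < B.entry j 0 ∧ B.entry j 0 < B.entry i 1 ∧
      B.entry i 1 < B.entry j 1)) : ∃ β : LinkPattern N, β.IsNumbering B := by
  let p : Fin (2 * N) → Fin (2 * N) := fun a => B.entry (B.row a) (Equiv.swap 0 1 (B.col a))
  have p0 : ∀ i, p (B.entry i 0) = B.entry i 1 := fun i => by simp [p]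
  have p1 : ∀ i, p (B.entry i 1) = B.entry i 0 := fun i => by simp [p]
  have hcase : ∀ a, ∃ i, a = B.entry i 0 ∨ a = B.entry i 1 := by
    intro a
    refine ⟨B.row a, ?_⟩
    have h := B.entry_row_col a
    generalize B.col a = c at h
    fin_cases c
    · exact Or.inl h.symm
    · exact Or.inr h.symm
  have hlt : ∀ a, a < p a → ∃ i, a = B.entry i 0 := by
    intro a ha
    obtain ⟨i, rfl | rfl⟩ := hcase a
    · exact ⟨i, rfl⟩
    · rw [p1] at ha
      exact absurd ha (h1 i).not_gt
  refine ⟨⟨p, ?_, ?_, ?_⟩, fun i => ?_⟩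
  · intro a
    obtain ⟨i, rfl | rfl⟩ := hcase a
    · rw [p0, p1]
    · rw [p1, p0]
  · intro a
    obtain ⟨i, rfl | rfl⟩ := hcase a
    · rw [p0]; exact (h1 i).ne'
    · rw [p1]; exact (h1 i).ne
  · rintro a b ⟨hab, hba, hb⟩
    obtain ⟨i, rfl⟩ := hlt a (hab.trans hba)
    obtain ⟨j, rfl⟩ := hlt b (hba.trans hb)
    rw [p0] at hba hb
    rw [p0] at hb
    exact h2 i j ⟨hab, hba, hb⟩
  · change B.entry i 0 < p (B.entry i 0) ∧ B.entry i 1 = p (B.entry i 0)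
    rw [p0]
    exact ⟨h1 i, rfl⟩

/-- A numbering with increasing rows has the columns of a link pattern: among the pairings of the
columns with increasing rows, one that maximizes the sum of the squared lengths of the rows is
noncrossing. -/
theorem Numbering.exists_linkPattern_permCols (A : Numbering N)
    (h : ∀ i, A.entry i 0 < A.entry i 1) :
    ∃ (β : LinkPattern N) (π : Fin 2 → Equiv.Perm (Fin N)), β.IsNumbering (A.permCols π) := by
  classical
  let P : Finset (Equiv.Perm (Fin N)) :=
    Finset.univ.filter fun π => ∀ i, A.entry i 0 < A.entry (π i) 1
  let f : Equiv.Perm (Fin N) → ℤ := fun π =>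
    ∑ i, ((A.entry (π i) 1 : ℤ) - (A.entry i 0 : ℤ)) ^ 2
  obtain ⟨π, hπ, hmax⟩ := P.exists_max_image f ⟨1, by simpa [P] using h⟩
  simp only [P, Finset.mem_filter, Finset.mem_univ, true_and] at hπ hmax
  obtain ⟨β, hβ⟩ := (A.permCols ![1, π]).exists_linkPattern (by simpa using hπ) (by
    rintro i j ⟨h1, h2, h3⟩
    simp only [Numbering.entry_permCols, Matrix.cons_val_zero, Matrix.cons_val_one,
      Equiv.Perm.one_apply] at h1 h2 h3
    have hij : i ≠ j := by
      rintro rfl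
      exact h1.false
    have hlt := hmax (π * Equiv.swap i j) (fun k => by
      rw [Equiv.Perm.mul_apply]
      rcases eq_or_ne k i with rfl | hi
      · rw [Equiv.swap_apply_left]; exact h1.trans (h2.trans h3)
      rcases eq_or_ne k j with rfl | hj
      · rw [Equiv.swap_apply_right]; exact h2
      rw [Equiv.swap_apply_of_ne_of_ne hi hj]
      exact hπ k)
    refine hlt.not_gt ?_
    simp only [f]
    rw [← Finset.add_sum_erase _ _ (Finset.mem_univ i),
      ← Finset.add_sum_erase _ _ (Finset.mem_univ i),
      ← Finset.add_sum_erase _ _ (Finset.mem_erase.mpr ⟨hij.symm, Finset.mem_univ j⟩),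
      ← Finset.add_sum_erase _ _ (Finset.mem_erase.mpr ⟨hij.symm, Finset.mem_univ j⟩)]
    have hrest : ∀ k ∈ (Finset.univ.erase i).erase j,
        ((A.entry ((π * Equiv.swap i j) k) 1 : ℤ) - (A.entry k 0 : ℤ)) ^ 2 =
        ((A.entry (π k) 1 : ℤ) - (A.entry k 0 : ℤ)) ^ 2 := by
      intro k hk
      simp only [Finset.mem_erase] at hk
      rw [Equiv.Perm.mul_apply, Equiv.swap_apply_of_ne_of_ne hk.2.1 hk.1]
    rw [Finset.sum_congr rfl hrest]
    simp only [Equiv.Perm.mul_apply, Equiv.swap_apply_left, Equiv.swap_apply_right]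
    have e1 : ((A.entry i 0 : ℕ) : ℤ) < (A.entry j 0 : ℕ) := by exact_mod_cast h1
    have e3 : ((A.entry (π i) 1 : ℕ) : ℤ) < (A.entry (π j) 1 : ℕ) := by exact_mod_cast h3
    nlinarith [mul_pos (sub_pos.mpr e1) (sub_pos.mpr e3)])
  exact ⟨β, _, hβ⟩

end Existence

namespace LinkPattern

variable {N : ℕ}

/-- If the Dyck path of `α` has a valley at the consecutive sites `i`, `j`, then the links `{a, i}`
and `{j, b}` are replaced by `{a, b}` and `{i, j}`, which turns the valley into a peak. -/
theorem exists_flip (α : LinkPattern N) {i j : Fin (2 * N)} (hij : (j : ℕ) = i + 1)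
    (hi : ¬ i < α.partner i) (hj : j < α.partner j) :
    ∃ β : LinkPattern N, β.partner i = j ∧
      (∀ a, a < β.partner a ↔ Equiv.swap i j a < α.partner (Equiv.swap i j a)) ∧
      tabloidRep N (Equiv.swap i j) α.polytab = -β.polytab := by
  have hB := α.isNumbering_numbering
  set B := α.numbering with hBdef
  set a := α.partner i with ha
  set b := α.partner j with hb
  have hai : a < i := (α.partner_lt_iff i).mpr hi
  have hpa : α.partner a = i := α.partner_partner i
  have hpb : α.partner b = j := α.partner_partner j
  have hne : i ≠ j := fun h => by rw [h] at hij; omega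
  have hcol0 : ∀ x, x < α.partner x → B.col x = 0 := fun x => (hB.left_iff x).mp
  obtain ⟨r, hr⟩ : ∃ r, B.entry r 0 = a := ⟨B.row a, by
    rw [← hcol0 a (by rw [hpa]; exact hai), B.entry_row_col]⟩
  obtain ⟨s, hs⟩ : ∃ s, B.entry s 0 = j := ⟨B.row j, by rw [← hcol0 j hj, B.entry_row_col]⟩
  have hr1 : B.entry r 1 = i := by rw [(hB r).2, hr, hpa]
  have hs1 : B.entry s 1 = b := by rw [(hB s).2, hs]
  have hrs : r ≠ s := by
    rintro rfl
    rw [hr] at hs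
    rw [hs] at hai
    omega
  -- exchanging the letters `i`, `j` and the right ends of their rows
  -- gives the rows of the new pattern
  set D : Numbering N := (Equiv.swap i j • B).permCols ![1, Equiv.swap r s] with hD
  have hD0 : ∀ k, D.entry k 0 = Equiv.swap i j (B.entry k 0) := fun k => by simp [hD]
  have hD1 : ∀ k, D.entry k 1 = Equiv.swap i j (B.entry (Equiv.swap r s k) 1) := fun k => by
    simp [hD]
  have hDr : D.entry r 0 = a ∧ D.entry r 1 = b := by
    rw [hD0, hD1, hr, Equiv.swap_apply_left, hs1]
    refine ⟨Equiv.swap_apply_of_ne_of_ne hai.ne (by omega), Equiv.swap_apply_of_ne_of_ne ?_ ?_⟩ <;>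
      omega
  have hDs : D.entry s 0 = i ∧ D.entry s 1 = j := by
    rw [hD0, hD1, hs, Equiv.swap_apply_right, Equiv.swap_apply_right, hr1, Equiv.swap_apply_left]
    exact ⟨rfl, rfl⟩
  have hDk : ∀ k, k ≠ r → k ≠ s → D.entry k 0 = B.entry k 0 ∧ D.entry k 1 = B.entry k 1 := by
    intro k hkr hks
    rw [hD0, hD1, Equiv.swap_apply_of_ne_of_ne hkr hks]
    refine ⟨Equiv.swap_apply_of_ne_of_ne ?_ ?_, Equiv.swap_apply_of_ne_of_ne ?_ ?_⟩
    · rw [← hr1]; exact fun h => by simpa using (B.entry_inj.mp h).2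
    · rw [← hs]; exact fun h => hks (B.entry_inj.mp h).1
    · rw [← hr1]; exact fun h => hkr (B.entry_inj.mp h).1
    · rw [← hs]; exact fun h => by simpa using (B.entry_inj.mp h).2
  -- the new rows are noncrossing since the old ones are and `i`, `j` are neighbours
  have hnc : ∀ k l, ¬ (B.entry k 0 < B.entry l 0 ∧ B.entry l 0 < B.entry k 1 ∧
      B.entry k 1 < B.entry l 1) := fun k l => by
    rw [(hB k).2, (hB l).2]; exact α.noncrossing _ _
  have hBlt : ∀ k, B.entry k 0 < B.entry k 1 := fun k => by rw [(hB k).2]; exact (hB k).1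
  obtain ⟨β, hβ⟩ := D.exists_linkPattern (by
    intro k
    rcases eq_or_ne k r with rfl | hkr
    · rw [hDr.1, hDr.2]; omega
    rcases eq_or_ne k s with rfl | hks
    · rw [hDs.1, hDs.2]; omega
    · rw [(hDk k hkr hks).1, (hDk k hkr hks).2]; exact hBlt k) (by
    intro k l
    rcases eq_or_ne k s with rfl | hks
    · rw [hDs.1, hDs.2]; omega
    rcases eq_or_ne l s with rfl | hls
    · have hk1 : D.entry k 1 ≠ j := fun h => by
        rw [← hDs.2] at h
        exact hks (D.entry_inj.mp h).1
      rw [hDs.1, hDs.2]; omega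
    rcases eq_or_ne k r with rfl | hkr
    · rcases eq_or_ne l k with rfl | hlr
      · omega
      · rw [hDr.1, hDr.2, (hDk l hlr hls).1, (hDk l hlr hls).2]
        have c1 := hnc k l
        have c2 := hnc s l
        have d1 : B.entry l 0 ≠ i := fun h => by
          rw [← hr1] at h; simpa using (B.entry_inj.mp h).2
        have d2 : B.entry l 0 ≠ j := fun h => by
          rw [← hs] at h; exact hls (B.entry_inj.mp h).1
        rw [hr, hr1] at c1
        rw [hs, hs1] at c2
        omega
    · rcases eq_or_ne l r with rfl | hlr
      · rw [hDr.1, hDr.2, (hDk k hkr hks).1, (hDk k hkr hks).2]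
        have c1 := hnc k l
        have c2 := hnc k s
        have d1 : B.entry k 1 ≠ i := fun h => by
          rw [← hr1] at h; exact hkr (B.entry_inj.mp h).1
        have d2 : B.entry k 1 ≠ j := fun h => by
          rw [← hs] at h; simpa using (B.entry_inj.mp h).2
        rw [hr, hr1] at c1
        rw [hs, hs1] at c2
        omega
      · rw [(hDk k hkr hks).1, (hDk k hkr hks).2, (hDk l hlr hls).1, (hDk l hlr hls).2]
        exact hnc k l)
  refine ⟨β, ?_, ?_, ?_⟩
  · have := hβ s
    rw [hDs.1, hDs.2] at this
    exact this.2.symm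
  · intro x
    rw [hβ.left_iff, hB.left_iff]
    have hcol : D.col x = (Equiv.swap i j • B).col x := by
      rw [← Numbering.col_colPerm (Equiv.swap i j • B) ![1, Equiv.swap r s]]
      obtain ⟨k, c, rfl⟩ : ∃ k c, x = D.entry k c := ⟨_, _, (D.entry_row_col x).symm⟩
      rw [D.col_entry, Numbering.col_colPerm]
      simp only [hD, Numbering.entry_permCols, Numbering.col_entry]
    rw [hcol, Numbering.col_smul, Equiv.swap_inv]
  · rw [← hβ.polytabloid_eq, hD, polytabloid_permCols, polytab, ← hBdef, tabloidRep_polytabloid]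
    simp [csign, Equiv.Perm.sign_swap hrs]

end LinkPattern

/-! ### Straightening by Garnir relations -/

section Straightening

variable {N : ℕ}

/-- The group of the permutations that fix all points outside `H`. -/
def fixOutside {n : ℕ} (H : Finset (Fin n)) : Subgroup (Equiv.Perm (Fin n)) where
  carrier := {σ | ∀ a, a ∉ H → σ a = a}
  mul_mem' := fun hσ hτ a ha => by rw [Equiv.Perm.mul_apply, hτ a ha, hσ a ha]
  one_mem' := fun _ _ => rfl
  inv_mem' := fun {σ} hσ a ha => by rw [Equiv.Perm.inv_eq_iff_eq, hσ a ha]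

theorem mem_fixOutside {n : ℕ} {H : Finset (Fin n)} {σ : Equiv.Perm (Fin n)} :
    σ ∈ fixOutside H ↔ ∀ a, a ∉ H → σ a = a := Iff.rfl

theorem swap_mem_fixOutside {n : ℕ} {H : Finset (Fin n)} {a b : Fin n} (ha : a ∈ H) (hb : b ∈ H) :
    Equiv.swap a b ∈ fixOutside H := fun _ hc =>
  Equiv.swap_apply_of_ne_of_ne (fun h => hc (h ▸ ha)) (fun h => hc (h ▸ hb))

/-- Garnir relations: if `H` contains more than `N` points, then some row of each tabloid occurring
in a polytabloid lies in `H`. -/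
theorem antisym_fixOutside_polytabloid (A : Numbering N) (H : Finset (Fin (2 * N)))
    (hH : N < (Finset.univ.filter fun i => A.entry i 0 ∈ H).card +
      (Finset.univ.filter fun i => A.entry i 1 ∈ H).card) :
    antisym (tabloidRep N) (fixOutside H) (polytabloid A) = 0 := by
  classical
  rw [polytabloid_eq_sum, map_sum]
  refine Finset.sum_eq_zero fun π _ => ?_
  rw [map_smul]
  set B := A.permCols π with hB
  have hcard : ∀ c, (Finset.univ.filter fun i => B.entry i c ∈ H).card =
      (Finset.univ.filter fun i => A.entry i c ∈ H).card := by
    intro c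
    refine Finset.card_bij (fun i _ => π c i) ?_ ?_ ?_
    · intro i hi
      simpa [hB] using hi
    · intro i _ j _ h
      exact (π c).injective h
    · intro i hi
      exact ⟨(π c).symm i, by simpa [hB] using hi, by simp⟩
  obtain ⟨i, hi⟩ : ((Finset.univ.filter fun i => B.entry i 0 ∈ H) ∩
      (Finset.univ.filter fun i => B.entry i 1 ∈ H)).Nonempty := by
    rw [← Finset.card_pos]
    have h1 := Finset.card_union_add_card_inter (Finset.univ.filter fun i => B.entry i 0 ∈ H)
      (Finset.univ.filter fun i => B.entry i 1 ∈ H)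
    have h2 := Finset.card_le_univ ((Finset.univ.filter fun i => B.entry i 0 ∈ H) ∪
      (Finset.univ.filter fun i => B.entry i 1 ∈ H))
    rw [Fintype.card_fin] at h2
    rw [hcard, hcard] at h1
    omega
  simp only [Finset.mem_inter, Finset.mem_filter, Finset.mem_univ, true_and] at hi
  rw [antisym_eq_zero _ _ (fun h => by simpa using (B.entry_inj.mp h).2)
    (swap_mem_fixOutside hi.1 hi.2) (by
      rw [Representation.ofMulAction_single, swap_smul_tabloid]), smul_zero]

/-- A permutation of `X ∪ Y` with all elements of `Y` below those of `X` decreases the sum over `X`,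
unless it preserves `X`. -/
theorem sum_lt_of_perm {n m : ℕ} {X Y : Finset (Fin n)} (hX : ∀ x ∈ X, m ≤ (x : ℕ))
    (hY : ∀ y ∈ Y, (y : ℕ) < m) {σ : Equiv.Perm (Fin n)} (hσ : ∀ x ∈ X, σ x ∈ X ∪ Y)
    (hne : ∃ x ∈ X, σ x ∉ X) : ∑ x ∈ X, (σ x : ℕ) < ∑ x ∈ X, (x : ℕ) := by
  classical
  set Z := X.map σ.toEmbedding with hZ
  have hsum : ∑ x ∈ X, (σ x : ℕ) = ∑ z ∈ Z, (z : ℕ) := by rw [hZ, Finset.sum_map]; rfl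
  have hcard : Z.card = X.card := Finset.card_map _
  rw [hsum, ← Finset.sum_inter_add_sum_sdiff Z X, ← Finset.sum_inter_add_sum_sdiff X Z,
    Finset.inter_comm X Z]
  have h1 : (Z \ X).card = (X \ Z).card := by
    have a := Finset.card_sdiff_add_card_inter Z X
    have b := Finset.card_sdiff_add_card_inter X Z
    rw [Finset.inter_comm] at b
    omega
  have h2 : 0 < (Z \ X).card := by
    obtain ⟨x, hx, hx'⟩ := hne
    exact Finset.card_pos.mpr ⟨σ x, by
      rw [Finset.mem_sdiff, hZ, Finset.mem_map]
      exact ⟨⟨x, hx, rfl⟩, hx'⟩⟩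
  have h3 : ∑ z ∈ Z \ X, ((z : ℕ) + 1) ≤ (Z \ X).card • m := by
    refine Finset.sum_le_card_nsmul _ _ _ fun z hz => ?_
    rw [Finset.mem_sdiff, hZ, Finset.mem_map] at hz
    obtain ⟨⟨x, hx, rfl⟩, hz⟩ := hz
    exact hY _ ((Finset.mem_union.mp (hσ x hx)).resolve_left hz)
  have h4 : (X \ Z).card • m ≤ ∑ x ∈ X \ Z, (x : ℕ) :=
    Finset.card_nsmul_le_sum _ _ _ fun x hx => hX x (Finset.mem_sdiff.mp hx).1
  rw [Finset.sum_add_distrib, Finset.sum_const, smul_eq_mul, smul_eq_mul] at h3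
  rw [smul_eq_mul] at h4
  rw [h1] at h2 h3
  rw [mul_one] at h3
  omega

/-- The vectors of the link patterns span the Specht module. -/
theorem polytabloid_mem_span_polytab (A : Numbering N) :
    polytabloid A ∈ Submodule.span ℂ (Set.range (LinkPattern.polytab (N := N))) := by
  classical
  suffices h : ∀ (n : ℕ) (A : Numbering N), ∑ i, (A.entry i 0 : ℕ) = n →
      polytabloid A ∈ Submodule.span ℂ (Set.range (LinkPattern.polytab (N := N))) from h _ A rfl
  -- induction on the sum of the entries of the first column; the columns may be assumed increasing
  intro n
  induction n using Nat.strong_induction_on with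
  | _ n ih =>
  intro A hA
  have hunit : ∀ π : Fin 2 → Equiv.Perm (Fin N), polytabloid A =
      (csign (π 0) * csign (π 1)) • polytabloid (A.permCols π) := by
    intro π
    rw [polytabloid_permCols, smul_smul, mul_mul_mul_comm, csign_mul_self, csign_mul_self, one_mul,
      one_smul]
  set s : Fin 2 → Equiv.Perm (Fin N) := fun c => Tuple.sort fun i => A.entry i c with hs
  rw [hunit s]
  refine Submodule.smul_mem _ _ ?_
  have hB0 : ∑ i, ((A.permCols s).entry i 0 : ℕ) = n := by
    rw [← hA]
    exact Equiv.sum_comp (s 0) fun i => (A.entry i 0 : ℕ)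
  have hmono : ∀ c, StrictMono fun i => (A.permCols s).entry i c := by
    intro c
    refine (Tuple.monotone_sort fun i => A.entry i c).strictMono_of_injective ?_
    intro i j hij
    exact ((A.permCols s).entry_inj.mp hij).1
  clear hunit hA
  generalize A.permCols s = B at hB0 hmono
  by_cases hrow : ∀ i, B.entry i 0 < B.entry i 1
  · obtain ⟨β, π, hβ⟩ := B.exists_linkPattern_permCols hrow
    have h1 : polytabloid B = (csign (π 0) * csign (π 1)) • β.polytab := by
      rw [← hβ.polytabloid_eq, polytabloid_permCols, smul_smul, mul_mul_mul_comm, csign_mul_self,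
        csign_mul_self, one_mul, one_smul]
    rw [h1]
    exact Submodule.smul_mem _ _ (Submodule.subset_span ⟨β, rfl⟩)
  -- at a descent in row `k`, the Garnir relation of the first column from row `k` on and of the
  -- second column up to row `k`, which together have `N + 1` entries
  push Not at hrow
  obtain ⟨k, hk⟩ := hrow
  have hk' : B.entry k 1 < B.entry k 0 :=
    lt_of_le_of_ne hk fun h => by simpa using (B.entry_inj.mp h).2
  set X : Finset (Fin (2 * N)) := (Finset.univ.filter fun i => k ≤ i).image fun i => B.entry i 0
    with hX
  set Y : Finset (Fin (2 * N)) := (Finset.univ.filter fun i => i ≤ k).image fun i => B.entry i 1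
    with hY
  have memX : ∀ i c, B.entry i c ∈ X ↔ c = 0 ∧ k ≤ i := by
    intro i c
    simp only [hX, Finset.mem_image, Finset.mem_filter, Finset.mem_univ, true_and, B.entry_inj]
    constructor
    · rintro ⟨j, hj, rfl, rfl⟩; exact ⟨rfl, hj⟩
    · rintro ⟨rfl, h⟩; exact ⟨i, h, rfl, rfl⟩
  have memY : ∀ i c, B.entry i c ∈ Y ↔ c = 1 ∧ i ≤ k := by
    intro i c
    simp only [hY, Finset.mem_image, Finset.mem_filter, Finset.mem_univ, true_and, B.entry_inj]
    constructor
    · rintro ⟨j, hj, rfl, rfl⟩; exact ⟨rfl, hj⟩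
    · rintro ⟨rfl, h⟩; exact ⟨i, h, rfl, rfl⟩
  have hge : (Finset.univ.filter fun i => k ≤ i).card = N - k := by
    rw [← Fin.card_Ici]; congr 1; ext; simp
  have hle : (Finset.univ.filter fun i => i ≤ k).card = k + 1 := by
    rw [← Fin.card_Iic]; congr 1; ext; simp
  have hzero := antisym_fixOutside_polytabloid B (X ∪ Y) (by
    simp only [Finset.mem_union, memX, memY, true_and, zero_ne_one, one_ne_zero, false_and,
      or_false, false_or, hge, hle]
    omega)
  -- the permutations that preserve the columns reproduce the polytabloid of `B`
  rw [antisym_apply, ← Finset.sum_filter_add_sum_filter_not _ (fun σ => σ ∈ B.colStab),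
    Finset.sum_congr rfl (g := fun _ => polytabloid B) (fun σ hσ => by
      rw [tabloidRep_polytabloid, polytabloid_smul_of_col B (Finset.mem_filter.mp hσ).2, smul_smul,
        csign_mul_self, one_smul]), Finset.sum_const, ← Nat.cast_smul_eq_nsmul ℂ,
    add_eq_zero_iff_eq_neg] at hzero
  have hne : ((((Finset.univ.filter fun σ => σ ∈ fixOutside (X ∪ Y)).filter
      fun σ => σ ∈ B.colStab).card : ℕ) : ℂ) ≠ 0 := by
    rw [Nat.cast_ne_zero, ← Nat.pos_iff_ne_zero, Finset.card_pos]
    exact ⟨1, by simp⟩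
  refine (Submodule.smul_mem_iff _ hne).mp ?_
  rw [hzero]
  refine Submodule.neg_mem _ (Submodule.sum_mem _ fun σ hσ => Submodule.smul_mem _ _ ?_)
  simp only [Finset.mem_filter, Finset.mem_univ, true_and] at hσ
  obtain ⟨hσ, hσ'⟩ := hσ
  rw [tabloidRep_polytabloid]
  refine ih _ ?_ (σ • B) rfl
  -- all other permutations decrease the sum of the first column
  have hstab : ∀ a ∈ X ∪ Y, σ a ∈ X ∪ Y := by
    intro a ha
    by_contra hcon
    have := mem_fixOutside.mp hσ _ hcon
    rw [σ.injective this] at hcon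
    exact hcon ha
  have hnX : ∃ x ∈ X, σ x ∉ X := by
    by_contra hcon
    push Not at hcon
    have hXX : X.map σ.toEmbedding = X := Finset.eq_of_subset_of_card_le (by
      intro z hz
      obtain ⟨x, hx, rfl⟩ := Finset.mem_map.mp hz
      exact hcon x hx) (by rw [Finset.card_map])
    refine hσ' fun a => ?_
    by_cases haX : a ∈ X
    · have h1 := hcon a haX
      rw [← B.entry_row_col a, memX] at haX
      rw [← B.entry_row_col (σ a), memX] at h1
      rw [haX.1, h1.1]
    by_cases haY : a ∈ Y
    · have h1 : σ a ∈ Y := by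
        refine (Finset.mem_union.mp (hstab a (Finset.mem_union_right _ haY))).resolve_left ?_
        intro h
        rw [← hXX, Finset.mem_map] at h
        obtain ⟨x, hx, hxa⟩ := h
        exact haX (σ.injective hxa ▸ hx)
      rw [← B.entry_row_col a, memY] at haY
      rw [← B.entry_row_col (σ a), memY] at h1
      rw [haY.1, h1.1]
    · rw [mem_fixOutside.mp hσ a (by simp [haX, haY])]
  have hlt := sum_lt_of_perm (m := (B.entry k 0 : ℕ)) (X := X) (Y := Y) (σ := σ) (by
    intro x hx
    obtain ⟨i, hi, rfl⟩ := Finset.mem_image.mp hx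
    exact (hmono 0).monotone (Finset.mem_filter.mp hi).2) (by
    intro y hy
    obtain ⟨i, hi, rfl⟩ := Finset.mem_image.mp hy
    exact lt_of_le_of_lt ((hmono 1).monotone (Finset.mem_filter.mp hi).2) hk')
    (fun x hx => hstab x (Finset.mem_union_left _ hx)) hnX
  rw [hX, Finset.sum_image fun i _ j _ h => (B.entry_inj.mp h).1,
    Finset.sum_image fun i _ j _ h => (B.entry_inj.mp h).1] at hlt
  rw [← hB0, ← Finset.sum_filter_add_sum_filter_not Finset.univ (fun i => k ≤ i),
    ← Finset.sum_filter_add_sum_filter_not Finset.univ (fun i => k ≤ i) fun i => (B.entry i 0 : ℕ)]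
  refine add_lt_add_of_lt_of_le hlt (Finset.sum_le_sum fun i hi => ?_)
  rw [Numbering.entry_smul, mem_fixOutside.mp hσ]
  rw [Finset.mem_union, memX, memY]
  simpa using hi

theorem span_polytab : Submodule.span ℂ (Set.range (LinkPattern.polytab (N := N))) =
    (specht N).toSubmodule := by
  refine le_antisymm (Submodule.span_le.mpr ?_) (Submodule.span_le.mpr ?_)
  · rintro _ ⟨β, rfl⟩
    exact β.polytab_mem
  · rintro _ ⟨A, rfl⟩
    exact polytabloid_mem_span_polytab A

end Straightening

/-! ### Cover-inclusive Dyck tilings -/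

section Tilings

variable {N : ℕ}

theorem LinkPattern.height_succ_cases (α : LinkPattern N) {k : ℕ} (hk : k < 2 * N) :
    α.height (k + 1) = α.height k + 1 ∨ α.height (k + 1) = α.height k - 1 := by
  have h := α.height_succ ⟨k, hk⟩
  unfold LinkPattern.step at h
  simp only at h
  split_ifs at h
  · exact Or.inl h
  · exact Or.inr h

theorem LinkPattern.even_height_add (α : LinkPattern N) {k : ℕ} (hk : k ≤ 2 * N) :
    Even (α.height k + k) := by
  induction k with
  | zero => simp [α.height_zero]
  | succ k ih =>
    have h1 := ih (by omega)
    push_cast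
    rcases α.height_succ_cases (show k < 2 * N by omega) with h | h <;> rw [h]
    · rw [Int.even_iff] at h1 ⊢; omega
    · rw [Int.even_iff] at h1 ⊢; omega

theorem IsDyckTile.nonempty {t : Finset (ℤ × ℤ)} (ht : IsDyckTile t) : t.Nonempty := by
  obtain ⟨x₀, y₀, m, D, -, -, -, -, rfl⟩ := ht
  exact ⟨_, Finset.mem_image.mpr ⟨0, by simp, rfl⟩⟩

theorem isDyckTile_singleton (b : ℤ × ℤ) : IsDyckTile {b} :=
  ⟨b.1, b.2, 0, fun _ => 0, rfl, rfl, fun _ _ => le_rfl, fun k hk => absurd hk (by omega), by simp⟩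

/-- A Dyck tile has at most one box in each column. -/
theorem IsDyckTile.snd_eq {t : Finset (ℤ × ℤ)} (ht : IsDyckTile t) {u v w : ℤ}
    (hv : (u, v) ∈ t) (hw : (u, w) ∈ t) : v = w := by
  obtain ⟨x₀, y₀, m, D, -, -, -, -, rfl⟩ := ht
  simp only [Finset.mem_image, Finset.mem_range, Prod.mk.injEq] at hv hw
  obtain ⟨k, -, hk, rfl⟩ := hv
  obtain ⟨l, -, hl, rfl⟩ := hw
  have : k = l := by omega
  rw [this]

/-- The boxes of a Dyck tile in consecutive columns are adjacent. -/
theorem IsDyckTile.snd_succ {t : Finset (ℤ × ℤ)} (ht : IsDyckTile t) {u v w : ℤ}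
    (hv : (u, v) ∈ t) (hw : (u + 1, w) ∈ t) : w = v + 1 ∨ w = v - 1 := by
  obtain ⟨x₀, y₀, m, D, -, -, -, hD, rfl⟩ := ht
  simp only [Finset.mem_image, Finset.mem_range, Prod.mk.injEq] at hv hw
  obtain ⟨k, -, hk, rfl⟩ := hv
  obtain ⟨l, hl2, hl, rfl⟩ := hw
  obtain rfl : l = k + 1 := by omega
  have := hD k (by omega)
  omega

/-- A Dyck tile without boxes to the upper left and to the upper right of one of its boxes is a
single box or has a peak at this box. -/
theorem IsDyckTile.peak_of_mem {t : Finset (ℤ × ℤ)} (ht : IsDyckTile t) {u v : ℤ}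
    (h : (u, v) ∈ t) (hl : (u - 1, v + 1) ∉ t) (hr : (u + 1, v + 1) ∉ t) :
    t = {(u, v)} ∨ (u - 1, v - 1) ∈ t ∧ (u + 1, v - 1) ∈ t := by
  obtain ⟨x₀, y₀, m, D, h0, h2m, hpos, hD, rfl⟩ := ht
  simp only [Finset.mem_image, Finset.mem_range, Prod.mk.injEq, not_exists, not_and] at h hl hr
  obtain ⟨k, hk, rfl, rfl⟩ := h
  have hr' : ∀ _ : k < 2 * m, D (k + 1) = D k - 1 := fun hlt =>
    (hD k hlt).resolve_left fun h => hr (k + 1) (by omega) (by push_cast; ring) (by omega)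
  have hl' : ∀ l, k = l + 1 → D l = D k - 1 := by
    rintro l rfl
    have h1 := hD l (by omega)
    have h2 : ¬ D l = D (l + 1) + 1 := fun h => hl l (by omega) (by push_cast; ring) (by omega)
    omega
  rcases Nat.eq_zero_or_pos m with rfl | hm
  · left
    obtain rfl : k = 0 := by omega
    simp
  · right
    have hk1 : k ≠ 2 * m := by
      rintro rfl
      have h1 := hl' (2 * m - 1) (by omega)
      have h2 := hpos (2 * m - 1) (by omega)
      omega
    have hk0 : k ≠ 0 := by
      rintro rfl
      have h1 := hr' (by omega)
      have h2 := hpos (0 + 1) (by omega)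
      omega
    simp only [Finset.mem_image, Finset.mem_range, Prod.mk.injEq]
    refine ⟨⟨k - 1, by omega, ?_, ?_⟩, ⟨k + 1, by omega, ?_, ?_⟩⟩
    · omega
    · have := hl' (k - 1) (by omega); omega
    · push_cast; ring
    · have := hr' (by omega); omega

theorem numTilings_self (α : LinkPattern N) : numTilings α α = 1 := by
  have hempty : ∀ b, b ∉ skewShape α α := by
    rintro b ⟨x, -, -, h1, h2, -⟩
    omega
  rw [numTilings, Set.ncard_eq_one]
  refine ⟨∅, Set.eq_singleton_iff_unique_mem.mpr ⟨⟨?_, ?_, ?_, ?_⟩, ?_⟩⟩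
  · simp
  · simp
  · intro b
    simpa using hempty b
  · simp
  · intro T hT
    refine Finset.eq_empty_of_forall_notMem fun t ht => ?_
    obtain ⟨b, hb⟩ := (hT.tile t ht).nonempty
    exact hempty b ((hT.cover b).mpr ⟨t, ht, hb⟩)

section Flip

variable {α β β' : LinkPattern N} {i : ℕ}

theorem LinkPattern.below_of_below_flip (hi : i + 1 < 2 * N)
    (hne : ∀ k, k ≠ i + 1 → β'.height k = β.height k)
    (hβ : β'.height (i + 1) = β.height (i + 1) + 2)
    (h1 : β'.height i < β'.height (i + 1)) (h2 : β'.height (i + 2) < β'.height (i + 1))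
    (hα : ¬ (α.height i < α.height (i + 1) ∧ α.height (i + 2) < α.height (i + 1)))
    (h : α.Below β') : α.Below β := by
  intro k
  rcases eq_or_ne k (i + 1) with rfl | hk
  · have p1 := α.even_height_add (show i + 1 ≤ 2 * N by omega)
    have p2 := β'.even_height_add (show i + 1 ≤ 2 * N by omega)
    rw [Int.even_iff] at p1 p2
    have a0 := h i
    have a1 := h (i + 1)
    have a2 := h (i + 2)
    omega
  · rw [← hne k hk]
    exact h k

/-- In a tiling of `α / β'`, the box at a peak of `β'` above a column in which `α` has no peak is a
tile by itself: otherwise the tile containing it has a peak there, and so do, by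
cover-inclusiveness, all the tiles below it in this column. -/
theorem singleton_mem_of_peak (hi : i + 1 < 2 * N)
    (h1 : β'.height i < β'.height (i + 1)) (h2 : β'.height (i + 2) < β'.height (i + 1))
    (hα : ¬ (α.height i < α.height (i + 1) ∧ α.height (i + 2) < α.height (i + 1)))
    {T : Finset (Finset (ℤ × ℤ))} (hT : IsCoverInclusiveDyckTiling α β' T)
    (hb : (((i + 1 : ℕ) : ℤ), β'.height (i + 1) - 1) ∈ skewShape α β') :
    {(((i + 1 : ℕ) : ℤ), β'.height (i + 1) - 1)} ∈ T := by
  set y := β'.height (i + 1) - 1 with hy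
  have hl := β'.height_succ_cases (show i < 2 * N by omega)
  have hr := β'.height_succ_cases (show i + 1 < 2 * N by omega)
  have hsub : ∀ t ∈ T, ∀ u v, (u, v) ∈ t → (u, v) ∈ skewShape α β' := fun t ht u v huv =>
    (hT.cover _).mpr ⟨t, ht, huv⟩
  have hbound : ∀ (k : ℕ) (v : ℤ), ((k : ℤ), v) ∈ skewShape α β' →
      α.height k + 1 ≤ v ∧ v + 1 ≤ β'.height k := by
    rintro k v ⟨x, hx, -, h1, h2, -⟩
    have hx' : (k : ℤ) = x := hx
    obtain rfl : k = x := by exact_mod_cast hx'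
    exact ⟨h1, h2⟩
  obtain ⟨t, ht, hbt⟩ := (hT.cover _).mp hb
  have hm1 : ((i + 1 : ℕ) : ℤ) - 1 = (i : ℕ) := by push_cast; ring
  have hp1 : ((i + 1 : ℕ) : ℤ) + 1 = ((i + 2 : ℕ) : ℤ) := by push_cast; ring
  rcases (hT.tile t ht).peak_of_mem hbt (fun h => by
      rw [hm1] at h
      have := (hbound _ _ (hsub t ht _ _ h)).2
      omega) (fun h => by
      rw [hp1] at h
      have := (hbound _ _ (hsub t ht _ _ h)).2
      omega) with hs | ⟨hbl, hbr⟩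
  · rwa [← hs]
  exfalso
  rw [hm1] at hbl
  rw [hp1] at hbr
  -- each box of the column lies in a tile with a peak there, which contradicts the finiteness of
  -- the region
  have key : ∀ n : ℕ, ∃ s ∈ T, (((i + 1 : ℕ) : ℤ), y - 2 * n) ∈ s ∧
      ((i : ℤ), y - 2 * n - 1) ∈ s ∧ (((i + 2 : ℕ) : ℤ), y - 2 * n - 1) ∈ s := by
    intro n
    induction n with
    | zero => exact ⟨t, ht, by simpa using hbt, by simpa using hbl, by simpa using hbr⟩
    | succ n ih =>
      obtain ⟨s, hs, hs0, hsl, hsr⟩ := ih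
      have a0 := hbound _ _ (hsub s hs _ _ hs0)
      have al := hbound _ _ (hsub s hs _ _ hsl)
      have ar := hbound _ _ (hsub s hs _ _ hsr)
      have hαl := α.height_succ_cases (show i < 2 * N by omega)
      have p1 := α.even_height_add (show i + 1 ≤ 2 * N by omega)
      have p2 := β'.even_height_add (show i + 1 ≤ 2 * N by omega)
      rw [Int.even_iff] at p1 p2
      have hc : (((i + 1 : ℕ) : ℤ), y - 2 * (n + 1 : ℕ)) ∈ skewShape α β' := by
        refine ⟨i + 1, rfl, by omega, ?_, ?_, ?_⟩
        · push_cast; omega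
        · push_cast; omega
        · rw [Int.odd_iff]; push_cast at p1 p2 ⊢; omega
      obtain ⟨s', hs', hc'⟩ := (hT.cover _).mp hc
      have hne : s ≠ s' := by
        rintro rfl
        have := (hT.tile s hs).snd_eq hs0 hc'
        push_cast at this
        omega
      have hdisj := Finset.disjoint_left.mp (hT.disjoint s hs s' hs' hne)
      have hext := hT.inclusive s hs s' hs' hne ⟨_, hs0, _, hc', rfl, by push_cast; omega⟩
      obtain ⟨⟨ul, vl⟩, hl', rfl⟩ := Finset.mem_image.mp (hext (Finset.mem_image.mpr ⟨_, hsl, rfl⟩))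
      obtain ⟨⟨ur, vr⟩, hr', rfl⟩ := Finset.mem_image.mp (hext (Finset.mem_image.mpr ⟨_, hsr, rfl⟩))
      have b1 := (hT.tile s' hs').snd_succ hl' (by
        rw [show ((i : ℤ), y - 2 * (n : ℤ) - 1).1 + 1 = ((i + 1 : ℕ) : ℤ) by push_cast; ring]
        exact hc')
      have b2 := (hT.tile s' hs').snd_succ hc' (by rw [hp1]; exact hr')
      have c1 : vl ≠ y - 2 * n - 1 := fun h => hdisj hsl (h ▸ hl')
      have c2 : vr ≠ y - 2 * n - 1 := fun h => hdisj hsr (h ▸ hr')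
      push_cast at b1 b2
      refine ⟨s', hs', hc', ?_, ?_⟩
      · convert hl' using 2; push_cast; omega
      · convert hr' using 2; push_cast; omega
  obtain ⟨s, hs, hs0, -, -⟩ := key (y.toNat + 1)
  have := (hbound _ _ (hsub s hs _ _ hs0)).1
  have h0 := α.height_nonneg (i + 1)
  have := Int.self_le_toNat y
  push_cast at *
  omega

/-- Filling a valley of the upper path does not change the number of tilings, if the lower path has
no peak in this column. -/
theorem numTilings_flip (hi : i + 1 < 2 * N)
    (hne : ∀ k, k ≠ i + 1 → β'.height k = β.height k)
    (hβ : β'.height (i + 1) = β.height (i + 1) + 2)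
    (h1 : β'.height i < β'.height (i + 1)) (h2 : β'.height (i + 2) < β'.height (i + 1))
    (hα : ¬ (α.height i < α.height (i + 1) ∧ α.height (i + 2) < α.height (i + 1)))
    (h : α.Below β) : numTilings α β = numTilings α β' := by
  classical
  set b : ℤ × ℤ := (((i + 1 : ℕ) : ℤ), β'.height (i + 1) - 1) with hbdef
  have hb' : b ∈ skewShape α β' := by
    have p2 := β'.even_height_add (show i + 1 ≤ 2 * N by omega)
    rw [Int.even_iff] at p2
    have := h (i + 1)
    refine ⟨i + 1, rfl, by omega, ?_, ?_, ?_⟩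
    · simp only [hbdef]; omega
    · simp only [hbdef]; omega
    · rw [Int.odd_iff]; simp only [hbdef]; push_cast at p2 ⊢; omega
  have hb : b ∉ skewShape α β := by
    rintro ⟨x, hx, -, -, h4, -⟩
    have hx' : ((i + 1 : ℕ) : ℤ) = x := hx
    obtain rfl : i + 1 = x := by exact_mod_cast hx'
    simp only [hbdef] at h4
    omega
  have hshape : ∀ c, c ∈ skewShape α β' ↔ c = b ∨ c ∈ skewShape α β := by
    intro c
    constructor
    · rintro ⟨x, hx, hx2, h3, h4, h5⟩
      rcases eq_or_ne x (i + 1) with rfl | hxi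
      · by_cases hc : c.2 = β'.height (i + 1) - 1
        · exact Or.inl (Prod.ext hx hc)
        · right
          have p2 := β'.even_height_add (show i + 1 ≤ 2 * N by omega)
          rw [Int.even_iff] at p2
          have h5' := h5
          rw [Int.odd_iff, hx] at h5'
          exact ⟨i + 1, hx, hx2, h3, by omega, h5⟩
      · exact Or.inr ⟨x, hx, hx2, h3, by rw [← hne x hxi]; exact h4, h5⟩
    · rintro (rfl | ⟨x, hx, hx2, h3, h4, h5⟩)
      · exact hb'
      · refine ⟨x, hx, hx2, h3, h4.trans ?_, h5⟩
        rcases eq_or_ne x (i + 1) with rfl | hxi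
        · omega
        · rw [hne x hxi]
  have hnot : ∀ T, IsCoverInclusiveDyckTiling α β T → ∀ t ∈ T, b ∉ t := fun T hT t ht hbt =>
    hb ((hT.cover b).mpr ⟨t, ht, hbt⟩)
  have hnot' : ∀ T, IsCoverInclusiveDyckTiling α β T → {b} ∉ T := fun T hT hbT =>
    hnot T hT _ hbT (Finset.mem_singleton_self b)
  -- the bijection of the tilings adds the new box as a tile by itself
  refine Set.ncard_congr (fun T _ => insert {b} T) ?_ ?_ ?_
  · intro T hT
    refine ⟨?_, ?_, ?_, ?_⟩
    · intro t ht
      rcases Finset.mem_insert.mp ht with rfl | ht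
      · exact isDyckTile_singleton b
      · exact hT.tile t ht
    · intro t ht s hs hts
      rcases Finset.mem_insert.mp ht with rfl | ht <;> rcases Finset.mem_insert.mp hs with rfl | hs
      · exact absurd rfl hts
      · exact Finset.disjoint_singleton_left.mpr (hnot T hT s hs)
      · exact Finset.disjoint_singleton_right.mpr (hnot T hT t ht)
      · exact hT.disjoint t ht s hs hts
    · intro c
      rw [hshape, hT.cover]
      simp
    · intro t ht s hs hts hcov
      rcases Finset.mem_insert.mp ht with rfl | ht <;> rcases Finset.mem_insert.mp hs with rfl | hs
      · exact absurd rfl hts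
      · obtain ⟨c, hc, d, hd, hcd, -⟩ := hcov
        rw [Finset.mem_singleton.mp hc] at hcd
        rw [Finset.image_singleton, Finset.singleton_subset_iff, hcd]
        exact Finset.mem_image_of_mem _ hd
      · exfalso
        obtain ⟨c, hc, d, hd, hcd, hlt⟩ := hcov
        rw [Finset.mem_singleton.mp hd] at hcd hlt
        obtain ⟨x, hx, -, -, h4, -⟩ := (hT.cover c).mpr ⟨t, ht, hc⟩
        have hcd' : (x : ℤ) = ((i + 1 : ℕ) : ℤ) := hx.symm.trans hcd
        obtain rfl : x = i + 1 := by exact_mod_cast hcd'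
        simp only [hbdef] at hlt
        omega
      · exact hT.inclusive t ht s hs hts hcov
  · intro T S hT hS hTS
    rw [← Finset.erase_insert (hnot' T hT), ← Finset.erase_insert (hnot' S hS)]
    exact congrArg (fun U => U.erase {b}) hTS
  · intro T hT
    have hbT : {b} ∈ T := singleton_mem_of_peak hi h1 h2 hα hT hb'
    refine ⟨T.erase {b}, ⟨?_, ?_, ?_, ?_⟩, Finset.insert_erase hbT⟩
    · exact fun t ht => hT.tile t (Finset.mem_of_mem_erase ht)
    · exact fun t ht s hs => hT.disjoint t (Finset.mem_of_mem_erase ht) s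
        (Finset.mem_of_mem_erase hs)
    · intro c
      have hc := hshape c
      rw [hT.cover] at hc
      constructor
      · intro hcs
        obtain ⟨t, ht, hct⟩ := hc.mpr (Or.inr hcs)
        refine ⟨t, Finset.mem_erase.mpr ⟨?_, ht⟩, hct⟩
        rintro rfl
        rw [Finset.mem_singleton.mp hct] at hcs
        exact hb hcs
      · rintro ⟨t, ht, hct⟩
        obtain ⟨htb, ht⟩ := Finset.mem_erase.mp ht
        refine (hc.mp ⟨t, ht, hct⟩).resolve_left ?_
        rintro rfl
        exact Finset.disjoint_left.mp (hT.disjoint t ht _ hbT htb) hct (Finset.mem_singleton_self _)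
    · exact fun t ht s hs => hT.inclusive t (Finset.mem_of_mem_erase ht) s
        (Finset.mem_of_mem_erase hs)

end Flip

end Tilings

/-! ### Pure vectors of the Specht module -/

namespace LinkPattern

variable {N : ℕ}

open Classical in
/-- The coefficient of `β` in the inverse Fomin type sum of `α`. -/
def tilingCoeff (α β : LinkPattern N) : ℂ := if α.Below β then (numTilings α β : ℂ) else 0

/-- The vector of the Specht module whose image under the evaluation of a kernel is the inverse
Fomin type sum of `α`. -/
def pureVec (α : LinkPattern N) : MonoidAlgebra ℂ (Tabloid N) :=
  ∑ β : LinkPattern N, α.tilingCoeff β • β.polytab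

theorem tilingCoeff_self (α : LinkPattern N) : α.tilingCoeff α = 1 := by
  rw [tilingCoeff, if_pos α.below_refl, numTilings_self, Nat.cast_one]

theorem below_of_tilingCoeff_ne {α β : LinkPattern N} (h : α.tilingCoeff β ≠ 0) : α.Below β := by
  by_contra hc
  exact h (if_neg hc)

theorem pureVec_mem (α : LinkPattern N) : α.pureVec ∈ (specht N).toSubmodule :=
  Submodule.sum_mem _ fun β _ => Submodule.smul_mem _ _ β.polytab_mem

theorem kernelEval_pureVec {K : Fin (2 * N) → Fin (2 * N) → ℂ} (hK : ∀ a b, K a b = K b a)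
    (α : LinkPattern N) : kernelEval K α.pureVec = fominSum K α := by
  rw [pureVec, map_sum, fominSum, Finset.sum_filter]
  refine Finset.sum_congr rfl fun β _ => ?_
  rw [map_smul, kernelEval_polytab hK, tilingCoeff, smul_eq_mul, ite_mul, zero_mul]

/-- The left endpoints of `γ` are obtained from those of `β` by exchanging `i` and `j`. -/
def IsSwap (i j : Fin (2 * N)) (β γ : LinkPattern N) : Prop :=
  ∀ a, a < γ.partner a ↔ Equiv.swap i j a < β.partner (Equiv.swap i j a)

theorem IsSwap.symm {i j : Fin (2 * N)} {β γ : LinkPattern N} (h : IsSwap i j β γ) :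
    IsSwap i j γ β := fun a => by
  rw [h (Equiv.swap i j a), Equiv.swap_apply_self]

theorem IsSwap.unique {i j : Fin (2 * N)} {β γ δ : LinkPattern N} (h : IsSwap i j β γ)
    (h' : IsSwap i j β δ) : γ = δ := ext_of_left fun a => (h a).trans (h' a).symm

theorem IsSwap.step_eq {i j : Fin (2 * N)} {β γ : LinkPattern N} (h : IsSwap i j β γ)
    (a : Fin (2 * N)) : γ.step a = β.step (Equiv.swap i j a) := by
  unfold step
  exact if_congr (h a) rfl rfl

theorem IsSwap.height_eq {i j : Fin (2 * N)} (hij : (j : ℕ) = i + 1) {β γ : LinkPattern N}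
    (h : IsSwap i j β γ) {k : ℕ} (hk : k ≠ i + 1) : γ.height k = β.height k := by
  rw [height_eq_sum, height_eq_sum]
  refine Finset.sum_equiv (Equiv.swap i j) (fun a => ?_) fun a _ => h.step_eq a
  simp only [Finset.mem_filter, Finset.mem_univ, true_and]
  rcases eq_or_ne a i with rfl | hi
  · rw [Equiv.swap_apply_left]; omega
  rcases eq_or_ne a j with rfl | hj
  · rw [Equiv.swap_apply_right]; omega
  rw [Equiv.swap_apply_of_ne_of_ne hi hj]

variable {α β γ : LinkPattern N} {i j : Fin (2 * N)}

theorem height_valley (hij : (j : ℕ) = i + 1) (hi : ¬ i < β.partner i) (hj : j < β.partner j) :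
    β.height (i + 1) = β.height i - 1 ∧ β.height (i + 2) = β.height i := by
  have h1 := β.height_succ i
  have h2 := β.height_succ j
  rw [hij] at h2
  rw [step, if_neg hi] at h1
  rw [step, if_pos hj] at h2
  constructor
  · omega
  · rw [show (i : ℕ) + 2 = i + 1 + 1 from rfl]; omega

theorem height_peak (hij : (j : ℕ) = i + 1) (hi : i < β.partner i) (hj : ¬ j < β.partner j) :
    β.height (i + 1) = β.height i + 1 ∧ β.height (i + 2) = β.height i := by
  have h1 := β.height_succ i
  have h2 := β.height_succ j
  rw [hij] at h2
  rw [step, if_pos hi] at h1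
  rw [step, if_neg hj] at h2
  constructor
  · omega
  · rw [show (i : ℕ) + 2 = i + 1 + 1 from rfl]; omega

theorem partner_of_peak (hij : (j : ℕ) = i + 1) (hi : i < α.partner i) (hj : ¬ j < α.partner j) :
    α.partner i = j := by
  by_contra hne
  have h1 := α.noncrossing (α.partner j) i
  rw [α.partner_partner] at h1
  have h2 := (α.partner_lt_iff j).mpr hj
  have h3 : α.partner j ≠ i := fun h => hne (by rw [α.partner_eq_iff, h])
  omega

theorem not_peak (hij : (j : ℕ) = i + 1) (hα : α.partner i ≠ j) :
    ¬ (α.height i < α.height (i + 1) ∧ α.height (i + 2) < α.height (i + 1)) := by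
  rintro ⟨h1, h2⟩
  have e1 := α.height_succ i
  have e2 := α.height_succ j
  rw [hij] at e2
  rw [show (i : ℕ) + 2 = i + 1 + 1 from rfl] at h2
  refine hα (partner_of_peak hij ?_ ?_)
  · by_contra hc
    rw [step, if_neg hc] at e1
    omega
  · intro hc
    rw [step, if_pos hc] at e2
    omega

theorem tilingCoeff_eq_of_valley (hij : (j : ℕ) = i + 1) (hα : α.partner i ≠ j)
    (hi : ¬ i < β.partner i) (hj : j < β.partner j) (h : IsSwap i j β γ) :
    α.tilingCoeff β = α.tilingCoeff γ := by
  have hb := height_valley hij hi hj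
  have hg := height_peak (β := γ) hij
    (by rw [h, Equiv.swap_apply_left]; exact hj) (by rw [h, Equiv.swap_apply_right]; exact hi)
  have hk : ∀ k, k ≠ (i : ℕ) + 1 → γ.height k = β.height k := fun k hk => h.height_eq hij hk
  have h0 := hk i (by omega)
  have hlt : (i : ℕ) + 1 < 2 * N := hij ▸ j.2
  have hflip : γ.height (i + 1) = β.height (i + 1) + 2 := by omega
  have hbelow : α.Below β ↔ α.Below γ :=
    ⟨fun hab k => (hab k).trans (by
      rcases eq_or_ne k ((i : ℕ) + 1) with rfl | hne
      · omega
      · rw [hk k hne]),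
    below_of_below_flip hlt hk hflip (by omega) (by omega) (not_peak hij hα)⟩
  unfold tilingCoeff
  by_cases hab : α.Below β
  · rw [if_pos hab, if_pos (hbelow.mp hab),
      numTilings_flip hlt hk hflip (by omega) (by omega) (not_peak hij hα) hab]
  · rw [if_neg hab, if_neg fun hc => hab (hbelow.mpr hc)]

theorem IsNumbering.exists_row {B : Numbering N} (hB : β.IsNumbering B) {a : Fin (2 * N)}
    (ha : a < β.partner a) : ∃ r, B.entry r 0 = a ∧ B.entry r 1 = β.partner a := by
  have h : B.entry (B.row a) 0 = a := by
    rw [← (hB.left_iff a).mp ha, B.entry_row_col]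
  exact ⟨B.row a, h, by rw [(hB _).2, h]⟩

theorem col_permCols (A : Numbering N) (π : Fin 2 → Equiv.Perm (Fin N)) (x : Fin (2 * N)) :
    (A.permCols π).col x = A.col x := by
  obtain ⟨k, c, rfl⟩ : ∃ k c, x = (A.permCols π).entry k c :=
    ⟨_, _, ((A.permCols π).entry_row_col x).symm⟩
  rw [Numbering.col_entry, Numbering.entry_permCols, Numbering.col_entry]

/-- A peak of the Dyck path which does not touch the ground can be turned into a valley. -/
theorem exists_isSwap_of_peak (hij : (j : ℕ) = i + 1) (hi : i < β.partner i)
    (hj : ¬ j < β.partner j) (hh : β.height i ≠ 0) : ∃ γ, IsSwap i j β γ := by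
  have hpi := partner_of_peak hij hi hj
  have hne : i ≠ j := fun h => by rw [h] at hij; omega
  rw [height_eq_card, Nat.cast_ne_zero, Finset.card_ne_zero] at hh
  obtain ⟨a, ha⟩ := hh
  simp only [Finset.mem_filter, Finset.mem_univ, true_and] at ha
  have hai : β.partner a ≠ i := fun h => by
    rw [β.partner_eq_iff, hpi] at h; omega
  have haj : β.partner a ≠ j := fun h => by
    rw [β.partner_eq_iff, ← hpi, β.partner_partner] at h; omega
  set B := β.numbering with hBdef
  have hB : β.IsNumbering B := β.isNumbering_numbering
  obtain ⟨r, hr0, hr1⟩ := hB.exists_row (a := a) (by omega)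
  obtain ⟨s, hs0, hs1⟩ := hB.exists_row hi
  rw [hpi] at hs1
  have hrs : r ≠ s := by
    rintro rfl
    rw [hr0] at hs0
    omega
  -- the rows remain increasing when the letters `i`, `j` and the right ends of the rows of `a` and
  -- `i` are exchanged
  set D : Numbering N := (Equiv.swap i j • B).permCols ![1, Equiv.swap r s] with hD
  have hD0 : ∀ k, D.entry k 0 = Equiv.swap i j (B.entry k 0) := fun k => by simp [hD]
  have hD1 : ∀ k, D.entry k 1 = Equiv.swap i j (B.entry (Equiv.swap r s k) 1) := fun k => by
    simp [hD]
  obtain ⟨γ, π, hγ⟩ := D.exists_linkPattern_permCols (by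
    intro k
    rw [hD0, hD1]
    rcases eq_or_ne k r with rfl | hkr
    · rw [Equiv.swap_apply_left, hr0, hs1, Equiv.swap_apply_right,
        Equiv.swap_apply_of_ne_of_ne (by omega) (by omega)]
      omega
    rcases eq_or_ne k s with rfl | hks
    · rw [Equiv.swap_apply_right, hs0, hr1, Equiv.swap_apply_left,
        Equiv.swap_apply_of_ne_of_ne hai haj]
      omega
    · rw [Equiv.swap_apply_of_ne_of_ne hkr hks, Equiv.swap_apply_of_ne_of_ne,
        Equiv.swap_apply_of_ne_of_ne, (hB k).2]
      · exact (hB k).1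
      · rw [← hs0]; exact fun h => by simpa using (B.entry_inj.mp h).2
      · rw [← hs1]; exact fun h => hks (B.entry_inj.mp h).1
      · rw [← hs0]; exact fun h => hks (B.entry_inj.mp h).1
      · rw [← hs1]; exact fun h => by simpa using (B.entry_inj.mp h).2)
  refine ⟨γ, fun x => ?_⟩
  rw [hγ.left_iff, hB.left_iff, col_permCols, hD, col_permCols, Numbering.col_smul, Equiv.swap_inv]

theorem tilingCoeff_eq_zero_of_peak (hij : (j : ℕ) = i + 1) (hα : α.partner i ≠ j)
    (hi : i < β.partner i) (hj : ¬ j < β.partner j) (h : ¬ ∃ γ, IsSwap i j β γ) :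
    α.tilingCoeff β = 0 := by
  by_contra hne
  have hab := below_of_tilingCoeff_ne hne
  have hh : β.height i = 0 := by
    by_contra hc
    exact h (exists_isSwap_of_peak hij hi hj hc)
  have hb := height_peak hij hi hj
  have h0 := hab i
  have h2 := hab (i + 2)
  have n0 := α.height_nonneg i
  have n1 := α.height_nonneg (i + 1)
  have n2 := α.height_nonneg (i + 2)
  have hs := α.height_succ_cases (show (i : ℕ) < 2 * N from i.2)
  exact not_peak hij hα ⟨by omega, by omega⟩

theorem swap_polytab_of_slope (hne : i ≠ j) (h : i < β.partner i ↔ j < β.partner j) :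
    tabloidRep N (Equiv.swap i j) β.polytab = -β.polytab := by
  have hB := β.isNumbering_numbering
  rw [hB.left_iff, hB.left_iff] at h
  rw [polytab, tabloidRep_polytabloid, polytabloid_smul_of_col, csign_swap hne, neg_one_smul]
  have hc : β.numbering.col i = β.numbering.col j := by
    generalize β.numbering.col i = x at h
    generalize β.numbering.col j = y at h
    fin_cases x <;> fin_cases y <;> simp_all
  intro a
  rcases eq_or_ne a i with rfl | hi
  · rw [Equiv.swap_apply_left, hc]
  rcases eq_or_ne a j with rfl | hj
  · rw [Equiv.swap_apply_right, hc]
  rw [Equiv.swap_apply_of_ne_of_ne hi hj]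

theorem swap_polytab_of_valley (hij : (j : ℕ) = i + 1) (hi : ¬ i < β.partner i)
    (hj : j < β.partner j) (h : IsSwap i j β γ) :
    tabloidRep N (Equiv.swap i j) β.polytab = -γ.polytab ∧
      tabloidRep N (Equiv.swap i j) γ.polytab = -β.polytab := by
  obtain ⟨δ, -, hδ, hs⟩ := β.exists_flip hij hi hj
  obtain rfl := h.unique (show IsSwap i j β δ from hδ)
  refine ⟨hs, ?_⟩
  rw [← neg_eq_iff_eq_neg] at hs
  rw [← hs, map_neg, ← Module.End.mul_apply, ← map_mul, Equiv.swap_mul_self, map_one,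
    Module.End.one_apply]

/-- The pure vector of `α` is antisymmetric in two consecutive points unless `α` links them: the
terms at valleys and at peaks cancel in pairs, since flipping a valley to a peak does not change
the number of tilings. -/
theorem swap_pureVec (hij : (j : ℕ) = i + 1) (hα : α.partner i ≠ j) :
    tabloidRep N (Equiv.swap i j) α.pureVec = -α.pureVec := by
  classical
  have hne : i ≠ j := fun h => by rw [h] at hij; omega
  rw [← add_eq_zero_iff_eq_neg, pureVec, map_sum, ← Finset.sum_add_distrib]
  let g : LinkPattern N → LinkPattern N := fun β =>
    if h : ∃ γ, IsSwap i j β γ then h.choose else β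
  have hg : ∀ β γ, IsSwap i j β γ → g β = γ := fun β γ h => by
    have hex : ∃ γ, IsSwap i j β γ := ⟨γ, h⟩
    simp only [g, dif_pos hex]
    exact hex.choose_spec.unique h
  have hg' : ∀ β, (¬ ∃ γ, IsSwap i j β γ) → g β = β := fun β h => by
    simp only [g, dif_neg h]
  have hslope : ∀ β : LinkPattern N, (i < β.partner i ↔ j < β.partner j) →
      tabloidRep N (Equiv.swap i j) (α.tilingCoeff β • β.polytab) +
        α.tilingCoeff β • β.polytab = 0 := fun β h => by
    rw [map_smul, swap_polytab_of_slope hne h, smul_neg, neg_add_cancel]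
  have hvalley : ∀ β γ : LinkPattern N, ¬ i < β.partner i → j < β.partner j → IsSwap i j β γ →
      tabloidRep N (Equiv.swap i j) (α.tilingCoeff β • β.polytab) +
        α.tilingCoeff β • β.polytab + (tabloidRep N (Equiv.swap i j)
        (α.tilingCoeff γ • γ.polytab) + α.tilingCoeff γ • γ.polytab) = 0 := fun β γ h1 h2 h => by
    rw [map_smul, map_smul, (swap_polytab_of_valley hij h1 h2 h).1,
      (swap_polytab_of_valley hij h1 h2 h).2, tilingCoeff_eq_of_valley hij hα h1 h2 h]
    module
  have hlr : ∀ β γ : LinkPattern N, IsSwap i j β γ →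
      ((i < γ.partner i ↔ j < β.partner j) ∧ (j < γ.partner j ↔ i < β.partner i)) :=
    fun β γ h => ⟨by rw [h i, Equiv.swap_apply_left], by rw [h j, Equiv.swap_apply_right]⟩
  refine Finset.sum_involution (fun β _ => g β) ?_ ?_ (fun _ _ => Finset.mem_univ _) ?_
  · intro β _
    by_cases hex : ∃ γ, IsSwap i j β γ
    · obtain ⟨γ, h⟩ := hex
      rw [hg β γ h]
      have hl := hlr β γ h
      by_cases h1 : i < β.partner i <;> by_cases h2 : j < β.partner j
      · rw [hslope β (iff_of_true h1 h2), hslope γ (iff_of_true (hl.1.mpr h2) (hl.2.mpr h1)),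
          add_zero]
      · rw [add_comm]
        exact hvalley γ β (fun hc => h2 (hl.1.mp hc)) (hl.2.mpr h1) h.symm
      · exact hvalley β γ h1 h2 h
      · rw [hslope β (iff_of_false h1 h2), hslope γ (iff_of_false (fun hc => h2 (hl.1.mp hc))
          fun hc => h1 (hl.2.mp hc)), add_zero]
    · rw [hg' β hex]
      by_cases h1 : i < β.partner i <;> by_cases h2 : j < β.partner j
      · rw [hslope β (iff_of_true h1 h2), add_zero]
      · rw [tilingCoeff_eq_zero_of_peak hij hα h1 h2 hex]
        simp
      · obtain ⟨γ, -, hγ, -⟩ := β.exists_flip hij h1 h2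
        exact absurd ⟨γ, hγ⟩ hex
      · rw [hslope β (iff_of_false h1 h2), add_zero]
  · intro β _ h0 hgβ
    by_cases hex : ∃ γ, IsSwap i j β γ
    · obtain ⟨γ, h⟩ := hex
      rw [hg β γ h] at hgβ
      subst hgβ
      exact h0 (hslope _ (hlr _ _ h).1)
    · by_cases h1 : i < β.partner i <;> by_cases h2 : j < β.partner j
      · exact h0 (hslope β (iff_of_true h1 h2))
      · apply h0
        rw [tilingCoeff_eq_zero_of_peak hij hα h1 h2 hex]
        simp
      · obtain ⟨γ, -, hγ, -⟩ := β.exists_flip hij h1 h2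
        exact hex ⟨γ, hγ⟩
      · exact h0 (hslope β (iff_of_false h1 h2))
  · intro β _
    by_cases hex : ∃ γ, IsSwap i j β γ
    · obtain ⟨γ, h⟩ := hex
      rw [hg β γ h, hg γ β h.symm]
    · rw [hg' β hex, hg' β hex]

end LinkPattern

/-! ### Vectors that are antisymmetric within the groups -/

section Young

variable {N : ℕ} (ς : Composition (2 * N))

theorem index_eq_iff {n : ℕ} (c : Composition n) {a : Fin n} {i : Fin c.length} :
    c.index a = i ↔ c.sizeUpTo i ≤ a ∧ (a : ℕ) < c.sizeUpTo (i + 1) := by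
  rw [eq_comm, ← c.mem_range_embedding_iff', c.mem_range_embedding_iff]

theorem index_mono {n : ℕ} (c : Composition n) : Monotone c.index := by
  intro a b hab
  by_contra! h
  have h1 := c.sizeUpTo_index_le a
  have h2 := c.lt_sizeUpTo_index_succ b
  have h3 : c.sizeUpTo (c.index b).succ ≤ c.sizeUpTo (c.index a) :=
    c.monotone_sizeUpTo (by simpa using h)
  have h4 : (a : ℕ) ≤ b := hab
  omega

/-- The Young subgroup of the permutations that preserve each group. -/
def young : Subgroup (Equiv.Perm (Fin (2 * N))) where
  carrier := {σ | ∀ a, ς.index (σ a) = ς.index a}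
  mul_mem' {σ τ} hσ hτ a := (hσ (τ a)).trans (hτ a)
  one_mem' _ := rfl
  inv_mem' {σ} hσ a := by
    have := hσ (σ⁻¹ a)
    rwa [show σ (σ⁻¹ a) = a by simp, eq_comm] at this

variable {ς}

theorem mem_young {σ : Equiv.Perm (Fin (2 * N))} :
    σ ∈ young ς ↔ ∀ a, ς.index (σ a) = ς.index a := Iff.rfl

theorem swap_mem_young {a b : Fin (2 * N)} (h : ς.index a = ς.index b) :
    Equiv.swap a b ∈ young ς := by
  intro c
  rcases eq_or_ne c a with rfl | ha
  · rw [Equiv.swap_apply_left, h]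
  rcases eq_or_ne c b with rfl | hb
  · rw [Equiv.swap_apply_right, h]
  rw [Equiv.swap_apply_of_ne_of_ne ha hb]

/-- The Young subgroup is generated by the transpositions of neighbours in a group. -/
theorem young_induction {p : Equiv.Perm (Fin (2 * N)) → Prop} (one : p 1)
    (mul : ∀ σ τ, p σ → p τ → p (σ * τ))
    (swap : ∀ i j : Fin (2 * N), (j : ℕ) = i + 1 → ς.index i = ς.index j → p (Equiv.swap i j))
    {σ : Equiv.Perm (Fin (2 * N))} (hσ : σ ∈ young ς) : p σ := by
  have hswap : ∀ (n : ℕ) (a b : Fin (2 * N)), (b : ℕ) = a + 1 + n → ς.index a = ς.index b →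
      p (Equiv.swap a b) := by
    intro n
    induction n with
    | zero => exact fun a b hab h => swap a b hab h
    | succ n ih =>
      intro a b hab h
      let c : Fin (2 * N) := ⟨a + 1 + n, by omega⟩
      have hac : ς.index a = ς.index c := le_antisymm
        (index_mono ς (Fin.le_def.mpr (by simp only [c]; omega)))
        (h ▸ index_mono ς (Fin.le_def.mpr (by simp only [c]; omega)))
      have hcb : Equiv.swap a b = Equiv.swap c b * Equiv.swap a c * Equiv.swap c b := by
        have h1 : a ≠ b := fun h => by rw [h] at hab; omega
        have h2 : a ≠ c := Fin.ne_of_val_ne (by simp only [c]; omega)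
        rw [Equiv.swap_mul_swap_mul_swap h2 h1, Equiv.swap_comm]
      rw [hcb]
      have h1 := ih a c rfl hac
      have h2 := swap c b (by simp only [c]; omega) (hac.symm.trans h)
      exact mul _ _ (mul _ _ h2 h1) h2
  have hswap' : ∀ a b : Fin (2 * N), a ≠ b → ς.index a = ς.index b → p (Equiv.swap a b) := by
    intro a b hab h
    rcases lt_or_gt_of_ne hab with hlt | hlt
    · exact hswap (b - a - 1) a b (by omega) h
    · rw [Equiv.swap_comm]
      exact hswap (a - b - 1) b a (by omega) h.symm
  induction hn : σ.support.card using Nat.strong_induction_on generalizing σ with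
  | _ n ih =>
  by_cases h1 : σ = 1
  · rw [h1]; exact one
  · obtain ⟨a, ha⟩ : ∃ a, σ a ≠ a := by
      by_contra! hc
      exact h1 (Equiv.ext hc)
    have hlt := Equiv.Perm.card_support_swap_mul ha
    have h2 := ih _ (hn ▸ hlt) ((young ς).mul_mem (swap_mem_young (hσ a).symm) hσ) rfl
    have h3 := mul _ _ (hswap' a (σ a) ha.symm (hσ a).symm) h2
    rwa [← mul_assoc, Equiv.swap_mul_self, one_mul] at h3

end Young

section Antisym

variable {N : ℕ} (ς : Composition (2 * N))

/-- The vectors of the Specht module that are antisymmetric within each group. -/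
def antiSub : Submodule ℂ (MonoidAlgebra ℂ (Tabloid N)) where
  carrier := {v | v ∈ (specht N).toSubmodule ∧ ∀ σ ∈ young ς, tabloidRep N σ v = csign σ • v}
  add_mem' {v w} hv hw := ⟨Submodule.add_mem _ hv.1 hw.1, fun σ hσ => by
    rw [map_add, hv.2 σ hσ, hw.2 σ hσ, smul_add]⟩
  zero_mem' := ⟨Submodule.zero_mem _, fun σ _ => by rw [map_zero, smul_zero]⟩
  smul_mem' c v hv := ⟨Submodule.smul_mem _ c hv.1, fun σ hσ => by
    rw [map_smul, hv.2 σ hσ, smul_comm]⟩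

variable {ς}

theorem antisym_mem_antiSub {v : MonoidAlgebra ℂ (Tabloid N)} (hv : v ∈ (specht N).toSubmodule) :
    antisym (tabloidRep N) (young ς) v ∈ antiSub ς := by
  classical
  refine ⟨?_, fun σ hσ => rep_antisym _ _ hσ v⟩
  rw [antisym_apply]
  exact Submodule.sum_mem _ fun σ _ => Submodule.smul_mem _ _
    ((specht N).apply_mem_toSubmodule σ hv)

namespace LinkPattern

theorem pureVec_mem_antiSub {α : LinkPattern N} (hα : α.IsValenced ς) :
    α.pureVec ∈ antiSub ς := by
  refine ⟨α.pureVec_mem, fun σ hσ => ?_⟩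
  refine young_induction (ς := ς)
    (p := fun σ => tabloidRep N σ α.pureVec = csign σ • α.pureVec) ?_ ?_ ?_ hσ
  · simp [csign]
  · intro σ τ h1 h2
    rw [map_mul, Module.End.mul_apply, h2, map_smul, h1, smul_smul, csign_mul, mul_comm]
  · intro i j hij h
    have hne : i ≠ j := fun h => by rw [h] at hij; omega
    rw [csign_swap hne, neg_one_smul]
    refine swap_pureVec hij fun hc => hα i ?_
    rw [hc, h]

instance : PartialOrder (LinkPattern N) where
  le := Below
  le_refl := below_refl
  le_trans _ _ _ := Below.trans
  le_antisymm _ _ := Below.antisymm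

/-- The symmetric kernel that indicates the links of `α`. -/
def indicator (α : LinkPattern N) (a b : Fin (2 * N)) : ℂ := if α.partner a = b then 1 else 0

theorem indicator_comm (α : LinkPattern N) (a b : Fin (2 * N)) :
    α.indicator a b = α.indicator b a := by
  unfold indicator
  refine if_congr ?_ rfl rfl
  rw [α.partner_eq_iff]
  exact eq_comm

theorem kernelEval_indicator_self (α : LinkPattern N) : kernelEval α.indicator α.polytab = 1 := by
  rw [kernelEval_polytab α.indicator_comm, fominDet]
  classical
  rw [← Matrix.det_one (n := {a : Fin (2 * N) // a < α.partner a})]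
  congr 1
  ext a b
  rw [Matrix.of_apply, indicator, Matrix.one_apply]
  refine if_congr ?_ rfl rfl
  rw [α.partner_injective.eq_iff, Subtype.ext_iff]

theorem le_of_kernelEval_indicator_ne {α β : LinkPattern N}
    (h : kernelEval α.indicator β.polytab ≠ 0) : β ≤ α := by
  rw [kernelEval_polytab α.indicator_comm, fominDet, Matrix.det_apply] at h
  obtain ⟨π, -, hπ⟩ := Finset.exists_ne_zero_of_sum_ne_zero h
  have hprod : ∀ b, α.partner (π b) = β.partner b := by
    intro b
    by_contra hc
    refine hπ ?_
    rw [Finset.prod_eq_zero (Finset.mem_univ b) (by rw [Matrix.of_apply, indicator, if_neg hc]),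
      smul_zero]
  -- `α` links left endpoints of `β` to right endpoints of `β`
  have key : ∀ a, a < β.partner a → ¬ α.partner a < β.partner (α.partner a) := by
    intro a ha
    have h1 := hprod (π.symm ⟨a, ha⟩)
    rw [Equiv.apply_symm_apply] at h1
    simp only at h1
    rw [h1, β.lt_partner_partner_iff, not_not]
    exact (π.symm ⟨a, ha⟩).2
  have key' : ∀ a, ¬ a < β.partner a → α.partner a < β.partner (α.partner a) := by
    intro a ha
    have hb := (β.lt_partner_partner_iff a).mpr ha
    have h1 := hprod ⟨β.partner a, hb⟩
    simp only [β.partner_partner] at h1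
    rw [← h1, α.partner_partner]
    rw [← α.partner_partner (π ⟨β.partner a, hb⟩ : Fin (2 * N)), h1]
    have h2 := (π ⟨β.partner a, hb⟩).2
    rwa [← α.partner_partner (π ⟨β.partner a, hb⟩ : Fin (2 * N)), h1] at h2
  intro k
  rw [β.height_eq_sum]
  refine α.sum_le_height β.step (fun a => ?_) (fun a => ?_) k
  · unfold step
    by_cases ha : a < β.partner a
    · rw [if_pos ha, if_neg (key a ha)]
    · rw [if_neg ha, if_pos (key' a ha), neg_neg]
  · unfold step
    split_ifs <;> norm_num

theorem kernelEval_indicator_pureVec_self (α : LinkPattern N) :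
    kernelEval α.indicator α.pureVec = 1 := by
  rw [pureVec, map_sum, Finset.sum_eq_single α]
  · rw [map_smul, tilingCoeff_self, kernelEval_indicator_self, one_smul]
  · intro β _ hβ
    rw [map_smul]
    by_contra hne
    obtain ⟨h1, h2⟩ := smul_ne_zero_iff.mp hne
    exact hβ (le_antisymm (le_of_kernelEval_indicator_ne h2) (below_of_tilingCoeff_ne h1))
  · simp

theorem le_of_kernelEval_indicator_pureVec_ne {α β : LinkPattern N}
    (h : kernelEval α.indicator β.pureVec ≠ 0) : β ≤ α := by
  rw [pureVec, map_sum] at h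
  obtain ⟨γ, -, hγ⟩ := Finset.exists_ne_zero_of_sum_ne_zero h
  rw [map_smul] at hγ
  obtain ⟨h1, h2⟩ := smul_ne_zero_iff.mp hγ
  exact le_trans (show β ≤ γ from below_of_tilingCoeff_ne h1) (le_of_kernelEval_indicator_ne h2)

theorem polytab_mem_span_pureVec (α : LinkPattern N) :
    α.polytab ∈ Submodule.span ℂ (Set.range (pureVec (N := N))) := by
  classical
  induction α using WellFoundedGT.induction with
  | _ α ih =>
  have h : α.polytab = α.pureVec -
      ∑ β ∈ Finset.univ.erase α, α.tilingCoeff β • β.polytab := by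
    rw [pureVec, ← Finset.add_sum_erase _ _ (Finset.mem_univ α), tilingCoeff_self, one_smul,
      add_sub_cancel_right]
  rw [h]
  refine Submodule.sub_mem _ (Submodule.subset_span ⟨α, rfl⟩) (Submodule.sum_mem _ fun β hβ => ?_)
  by_cases h0 : α.tilingCoeff β = 0
  · rw [h0, zero_smul]
    exact Submodule.zero_mem _
  · exact Submodule.smul_mem _ _ (ih β (lt_of_le_of_ne (below_of_tilingCoeff_ne h0)
      (Finset.ne_of_mem_erase hβ).symm))

theorem span_pureVec :
    Submodule.span ℂ (Set.range (pureVec (N := N))) = (specht N).toSubmodule := by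
  refine le_antisymm (Submodule.span_le.mpr ?_) ?_
  · rintro _ ⟨α, rfl⟩
    exact α.pureVec_mem
  · rw [← span_polytab, Submodule.span_le]
    rintro _ ⟨α, rfl⟩
    exact α.polytab_mem_span_pureVec

/-- A link inside a group makes the corresponding functional vanish on the vectors that are
antisymmetric within the groups. -/
theorem kernelEval_indicator_of_not_isValenced {α : LinkPattern N} (hα : ¬ α.IsValenced ς)
    {v : MonoidAlgebra ℂ (Tabloid N)} (hv : v ∈ antiSub ς) : kernelEval α.indicator v = 0 := by
  obtain ⟨a, ha⟩ : ∃ a, ς.index (α.partner a) = ς.index a := by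
    by_contra! hc
    exact hα hc
  have h1 := kernelEval_tabloidRep α.indicator_comm (Equiv.swap a (α.partner a)) v
  rw [hv.2 _ (swap_mem_young ha.symm), csign_swap (α.partner_ne a).symm, neg_one_smul,
    map_neg] at h1
  have h2 : (fun x y => α.indicator (Equiv.swap a (α.partner a) x)
      (Equiv.swap a (α.partner a) y)) = α.indicator := by
    funext x y
    unfold indicator
    refine if_congr ?_ rfl rfl
    have hc : α.partner (Equiv.swap a (α.partner a) x) =
        Equiv.swap a (α.partner a) (α.partner x) := by
      rcases eq_or_ne x a with rfl | hxa
      · rw [Equiv.swap_apply_left, Equiv.swap_apply_right, α.partner_partner]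
      rcases eq_or_ne x (α.partner a) with rfl | hxp
      · rw [Equiv.swap_apply_right, α.partner_partner, Equiv.swap_apply_left]
      rw [Equiv.swap_apply_of_ne_of_ne hxa hxp, Equiv.swap_apply_of_ne_of_ne]
      · rwa [Ne, α.partner_eq_iff]
      · exact fun h => hxa (α.partner_injective h)
    rw [hc, (Equiv.swap a (α.partner a)).injective.eq_iff]
  rw [h2] at h1
  linear_combination (-1 / 2 : ℂ) * h1

/-- The pure vectors of the valenced patterns span the antisymmetric vectors. -/
theorem span_pureVec_isValenced :
    Submodule.span ℂ (pureVec '' {α : LinkPattern N | α.IsValenced ς}) = antiSub ς := by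
  classical
  refine le_antisymm (Submodule.span_le.mpr ?_) fun v hv => ?_
  · rintro _ ⟨α, hα, rfl⟩
    exact pureVec_mem_antiSub hα
  have hspan : v ∈ Submodule.span ℂ (Set.range (pureVec (N := N))) := by
    rw [span_pureVec]; exact hv.1
  obtain ⟨c, rfl⟩ := (Submodule.mem_span_range_iff_exists_fun ℂ).mp hspan
  have hval : ∀ α : LinkPattern N, ¬ α.IsValenced ς → c α = 0 := by
    by_contra! hc
    obtain ⟨α, ⟨hα, hα0⟩, hmin⟩ := Set.Finite.exists_minimal
      (Set.toFinite {α : LinkPattern N | ¬ α.IsValenced ς ∧ c α ≠ 0}) hc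
    have hw : ∑ β : LinkPattern N with ¬ β.IsValenced ς, c β • β.pureVec ∈ antiSub ς := by
      have hsplit := Finset.sum_filter_add_sum_filter_not Finset.univ
        (fun β : LinkPattern N => β.IsValenced ς) fun β => c β • β.pureVec
      rw [← hsplit] at hv
      refine (Submodule.add_mem_iff_right _ (Submodule.sum_mem _ fun β hβ => ?_)).mp hv
      exact Submodule.smul_mem _ _ (pureVec_mem_antiSub (Finset.mem_filter.mp hβ).2)
    have h0 := kernelEval_indicator_of_not_isValenced hα hw
    rw [map_sum, Finset.sum_eq_single_of_mem α (by simpa using hα), map_smul,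
      kernelEval_indicator_pureVec_self, smul_eq_mul, mul_one] at h0
    · exact hα0 h0
    · intro β hβ hne
      rw [map_smul]
      by_contra hne0
      obtain ⟨h1, h2⟩ := smul_ne_zero_iff.mp hne0
      have hle := le_of_kernelEval_indicator_pureVec_ne h2
      exact hne (le_antisymm hle (hmin ⟨(Finset.mem_filter.mp hβ).2, h1⟩ hle))
  refine Submodule.sum_mem _ fun α _ => ?_
  by_cases hα : α.IsValenced ς
  · exact Submodule.smul_mem _ _ (Submodule.subset_span ⟨α, hα, rfl⟩)
  · rw [hval α hα, zero_smul]
    exact Submodule.zero_mem _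

end LinkPattern

end Antisym

/-! ### The Coxeter presentation of the symmetric group -/

section Coxeter

variable {G : Type*} [Group G] {x : ℕ → G}

/-- The descending product `x (j + l - 1) * ⋯ * x j` of `l` factors. -/
def descProd (x : ℕ → G) (j : ℕ) : ℕ → G
  | 0 => 1
  | l + 1 => x (j + l) * descProd x j l

theorem descProd_add (j a b : ℕ) :
    descProd x j (a + b) = descProd x (j + a) b * descProd x j a := by
  induction b with
  | zero => simp [descProd]
  | succ b ih => rw [← add_assoc, descProd, descProd, ih, mul_assoc, add_assoc]

theorem descProd_one (j : ℕ) : descProd x j 1 = x j := by simp [descProd]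

theorem commute_descProd {g : G} (j l : ℕ) (h : ∀ i, j ≤ i → i < j + l → Commute g (x i)) :
    Commute g (descProd x j l) := by
  induction l with
  | zero => exact Commute.one_right g
  | succ l ih =>
    exact (h (j + l) (by omega) (by omega)).mul_right (ih fun i h1 h2 => h i h1 (by omega))

/-- The Coxeter relations of type `A` for the first `m` terms of a sequence. -/
structure IsCoxeter (m : ℕ) (x : ℕ → G) : Prop where
  sq : ∀ i, i < m → x i * x i = 1
  braid : ∀ i, i + 1 < m → x i * x (i + 1) * x i = x (i + 1) * x i * x (i + 1)
  far : ∀ i j, i + 1 < j → j < m → Commute (x i) (x j)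

variable {m : ℕ}

/-- Coset representatives: every element of the subgroup generated by the first `k + 1` generators
is a product of an element of the subgroup generated by the first `k` ones and a descending
product which starts with the last generator. -/
theorem IsCoxeter.exists_normalForm (hx : IsCoxeter m x) {k : ℕ} (hk : k < m) {w : G}
    (hw : w ∈ Subgroup.closure (x '' Set.Iio (k + 1))) :
    ∃ h ∈ Subgroup.closure (x '' Set.Iio k), ∃ j l, j + l = k + 1 ∧ w = h * descProd x j l := by
  have hmem : ∀ i, i < k → x i ∈ Subgroup.closure (x '' Set.Iio k) := fun i hi =>
    Subgroup.subset_closure ⟨i, hi, rfl⟩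
  have step : ∀ i, i < k + 1 → ∀ w, (∃ h ∈ Subgroup.closure (x '' Set.Iio k), ∃ j l,
      j + l = k + 1 ∧ w = h * descProd x j l) → ∃ h ∈ Subgroup.closure (x '' Set.Iio k), ∃ j l,
      j + l = k + 1 ∧ w * x i = h * descProd x j l := by
    rintro i hi w ⟨h, hh, j, l, hjl, rfl⟩
    rcases Nat.lt_trichotomy (i + 1) j with hij | rfl | hij
    · refine ⟨h * x i, mul_mem hh (hmem i (by omega)), j, l, hjl, ?_⟩
      have hc : Commute (x i) (descProd x j l) :=
        commute_descProd j l fun p h1 h2 => hx.far _ _ (by omega) (by omega)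
      rw [mul_assoc, mul_assoc, hc.eq]
    · refine ⟨h, hh, i, 1 + l, by omega, ?_⟩
      rw [descProd_add, descProd_one, mul_assoc]
    rcases Nat.lt_succ_iff_lt_or_eq.mp hij with hij | rfl
    · refine ⟨h * x (i - 1), mul_mem hh (hmem _ (by omega)), j, l, hjl, ?_⟩
      obtain ⟨p, rfl⟩ : ∃ p, i = p + 1 := ⟨i - 1, by omega⟩
      obtain ⟨a, rfl⟩ : ∃ a, p = j + a := ⟨p - j, by omega⟩
      obtain ⟨b, rfl⟩ : ∃ b, l = a + (2 + b) := ⟨l - a - 2, by omega⟩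
      have e1 : descProd x j (a + (2 + b)) =
          descProd x (j + a + 2) b * (x (j + a + 1) * x (j + a)) * descProd x j a := by
        rw [descProd_add, descProd_add]
        simp [descProd]
      have c1 : Commute (x (j + a + 1)) (descProd x j a) :=
        commute_descProd j a fun p h1 h2 => (hx.far _ _ (by omega) (by omega)).symm
      have c2 : Commute (x (j + a)) (descProd x (j + a + 2) b) :=
        commute_descProd _ _ fun p h1 h2 => hx.far _ _ (by omega) (by omega)
      have hb := hx.braid (j + a) (by omega)
      rw [e1, Nat.add_sub_cancel]
      calc h * (descProd x (j + a + 2) b * (x (j + a + 1) * x (j + a)) * descProd x j a) *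
            x (j + a + 1)
          = h * (descProd x (j + a + 2) b * (x (j + a + 1) * x (j + a)) *
            (descProd x j a * x (j + a + 1))) := by group
        _ = h * (descProd x (j + a + 2) b * (x (j + a + 1) * x (j + a) * x (j + a + 1)) *
            descProd x j a) := by rw [← c1.eq]; group
        _ = h * ((descProd x (j + a + 2) b * x (j + a)) * (x (j + a + 1) * x (j + a)) *
            descProd x j a) := by rw [← hb]; group
        _ = _ := by rw [← c2.eq]; group
    · obtain ⟨l, rfl⟩ : ∃ b, l = 1 + b := ⟨l - 1, by omega⟩
      refine ⟨h, hh, j + 1, l, by omega, ?_⟩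
      rw [descProd_add, descProd_one, mul_assoc, mul_assoc, hx.sq j (by omega), mul_one]
  induction hw using Subgroup.closure_induction_right with
  | one => exact ⟨1, one_mem _, k + 1, 0, rfl, by simp [descProd]⟩
  | mul_right w _ y hy ih =>
    obtain ⟨i, hi, rfl⟩ := hy
    exact step i hi w ih
  | mul_inv_cancel w _ y hy ih =>
    obtain ⟨i, hi, rfl⟩ := hy
    have hi' : i < k + 1 := hi
    rw [show (x i)⁻¹ = x i from inv_eq_of_mul_eq_one_left (hx.sq i (by omega))]
    exact step i hi w ih

end Coxeter

section PermPresentation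

variable {n : ℕ}

/-- The transposition of `k` and `k + 1`, with a natural number as index. -/
def adjSwap (n k : ℕ) : Equiv.Perm (Fin n) :=
  if h : k + 1 < n then Equiv.swap ⟨k, by omega⟩ ⟨k + 1, h⟩ else 1

theorem adjSwap_of_lt {k : ℕ} (h : k + 1 < n) :
    adjSwap n k = Equiv.swap ⟨k, by omega⟩ ⟨k + 1, h⟩ := dif_pos h

theorem adjSwap_apply_of_ne {k : ℕ} {a : Fin n} (h1 : (a : ℕ) ≠ k) (h2 : (a : ℕ) ≠ k + 1) :
    adjSwap n k a = a := by
  unfold adjSwap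
  split_ifs with h
  · exact Equiv.swap_apply_of_ne_of_ne (Fin.ne_of_val_ne h1) (Fin.ne_of_val_ne h2)
  · rfl

theorem simpleTransposition_eq (i : Fin (n - 1)) :
    simpleTransposition i = adjSwap n i := (adjSwap_of_lt (by omega)).symm

theorem isCoxeter_adjSwap : IsCoxeter (n - 1) (adjSwap n) where
  sq i hi := by rw [adjSwap_of_lt (by omega), Equiv.swap_mul_self]
  braid i hi := by
    rw [adjSwap_of_lt (by omega), adjSwap_of_lt (by omega)]
    have key : ∀ a b c : Fin n, a ≠ b → b ≠ c → a ≠ c →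
        Equiv.swap a b * Equiv.swap b c * Equiv.swap a b =
          Equiv.swap b c * Equiv.swap a b * Equiv.swap b c := fun a b c hab hbc hac => by
      rw [Equiv.swap_mul_swap_mul_swap hab hac, Equiv.swap_comm a b, Equiv.swap_comm b c,
        Equiv.swap_mul_swap_mul_swap hbc.symm hac.symm, Equiv.swap_comm]
    exact key _ _ _ (by simp) (by simp) (by simp; omega)
  far i j hij hj := by
    rw [adjSwap_of_lt (by omega), adjSwap_of_lt (by omega)]
    refine (Equiv.Perm.disjoint_iff_disjoint_support.mpr ?_).commute
    rw [Equiv.Perm.support_swap (by simp), Equiv.Perm.support_swap (by simp)]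
    simp
    omega

theorem closure_adjSwap : Submonoid.closure (adjSwap n '' Set.Iio (n - 1)) = ⊤ := by
  cases n with
  | zero => exact Subsingleton.elim _ _
  | succ n =>
    rw [← Equiv.Perm.mclosure_swap_castSucc_succ]
    congr 1
    ext σ
    constructor
    · rintro ⟨i, hi, rfl⟩
      have hi' : i < n := hi
      exact ⟨⟨i, hi'⟩, by rw [adjSwap_of_lt (by omega)]; rfl⟩
    · rintro ⟨i, rfl⟩
      exact ⟨i, i.2, by rw [adjSwap_of_lt (by omega)]; rfl⟩

variable {G : Type*} [Group G] {g : ℕ → G}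

theorem IsCoxeter.prod {H : Type*} [Group H] {m : ℕ} {x : ℕ → G} {y : ℕ → H}
    (hx : IsCoxeter m x) (hy : IsCoxeter m y) : IsCoxeter m fun i => (x i, y i) where
  sq i hi := Prod.ext (hx.sq i hi) (hy.sq i hi)
  braid i hi := Prod.ext (hx.braid i hi) (hy.braid i hi)
  far i j hij hj := Prod.ext (hx.far i j hij hj) (hy.far i j hij hj)

/-- In the subgroup generated by the pairs of a simple transposition and a generator with the same
relations, the first component determines the second one. -/
theorem IsCoxeter.eq_one_of_mem_closure (hg : IsCoxeter (n - 1) g) {k : ℕ} (hk : k ≤ n - 1)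
    {w : Equiv.Perm (Fin n) × G}
    (hw : w ∈ Subgroup.closure ((fun i => (adjSwap n i, g i)) '' Set.Iio k)) (h1 : w.1 = 1) :
    w = 1 := by
  induction k generalizing w with
  | zero => simpa using hw
  | succ k ih =>
    obtain ⟨h, hh, j, l, hjl, rfl⟩ :=
      (isCoxeter_adjSwap.prod hg).exists_normalForm (show k < n - 1 by omega) hw
    -- the first factor fixes `k + 1`
    have hfix : ∀ a : Fin n, (a : ℕ) = k + 1 → h.1 a = a := by
      intro a ha
      clear hw h1
      induction hh using Subgroup.closure_induction with
      | mem y hy =>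
        obtain ⟨i, hi, rfl⟩ := hy
        have hi' : i < k := hi
        exact adjSwap_apply_of_ne (by omega) (by omega)
      | one => rfl
      | mul y z _ _ hy hz => rw [Prod.fst_mul, Equiv.Perm.mul_apply, hz, hy]
      | inv y _ hy => rw [Prod.fst_inv, Equiv.Perm.inv_eq_iff_eq, hy]
    -- the descending product takes `j` to `j + l = k + 1`
    have hdesc : ∀ (l : ℕ) (a b : Fin n), (a : ℕ) = j → (b : ℕ) = j + l →
        (descProd (fun i => (adjSwap n i, g i)) j l).1 a = b := by
      intro l
      induction l with
      | zero => exact fun a b ha hb => Fin.ext (by simp [descProd, ha, hb])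
      | succ l ihl =>
        intro a b ha hb
        rw [descProd, Prod.fst_mul, Equiv.Perm.mul_apply,
          ihl a ⟨j + l, by omega⟩ ha rfl, adjSwap_of_lt (by omega), Equiv.swap_apply_left]
        exact Fin.ext (by simp only [hb]; omega)
    have hjn : j < n := by omega
    have h2 := hdesc l ⟨j, hjn⟩ ⟨k + 1, by omega⟩ rfl hjl.symm
    have h3 := congrArg (fun σ => σ ⟨j, hjn⟩) h1
    simp only [Prod.fst_mul, Equiv.Perm.mul_apply, h2, Equiv.Perm.one_apply] at h3
    rw [hfix _ rfl, Fin.mk.injEq] at h3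
    obtain rfl : l = 0 := by omega
    simp only [descProd, mul_one] at h1 ⊢
    exact ih (by omega) hh h1

/-- Elements of a group with the Coxeter relations define a homomorphism from the symmetric
group. -/
theorem IsCoxeter.exists_hom (hg : IsCoxeter (n - 1) g) :
    ∃ f : Equiv.Perm (Fin n) →* G, ∀ i, i < n - 1 → f (adjSwap n i) = g i := by
  let C := Subgroup.closure ((fun i => (adjSwap n i, g i)) '' Set.Iio (n - 1))
  let p : C →* Equiv.Perm (Fin n) := (MonoidHom.fst _ _).comp C.subtype
  have hinj : Function.Injective p := (injective_iff_map_eq_one p).mpr fun w hw =>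
    Subtype.ext (hg.eq_one_of_mem_closure le_rfl w.2 hw)
  have hmem : ∀ i, i < n - 1 → (adjSwap n i, g i) ∈ C := fun i hi =>
    Subgroup.subset_closure ⟨i, hi, rfl⟩
  have hsurj : Function.Surjective p := by
    rw [← MonoidHom.mrange_eq_top, eq_top_iff, ← closure_adjSwap, Submonoid.closure_le]
    rintro _ ⟨i, hi, rfl⟩
    exact ⟨⟨_, hmem i hi⟩, rfl⟩
  let e := MulEquiv.ofBijective p ⟨hinj, hsurj⟩
  refine ⟨((MonoidHom.snd _ _).comp C.subtype).comp e.symm.toMonoidHom, fun i hi => ?_⟩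
  have h1 : e.symm (adjSwap n i) = ⟨_, hmem i hi⟩ := by
    rw [MulEquiv.symm_apply_eq]
    rfl
  change ((e.symm (adjSwap n i) : C) : Equiv.Perm (Fin n) × G).2 = g i
  rw [h1]

end PermPresentation

/-! ### The Temperley-Lieb algebra as a quotient of the symmetric group algebra -/

section Quotient

section Ring

theorem neg_one_add_far {R : Type*} [Ring R] {x y : R} (h : x * y = y * x) :
    -(1 + x) * -(1 + y) = -(1 + y) * -(1 + x) := by
  rw [neg_mul_neg, neg_mul_neg, add_mul, mul_add, mul_add, add_mul, mul_add, mul_add, h]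
  simp only [one_mul, mul_one]
  abel

variable {R : Type*} [Ring R] [Algebra ℂ R] {x y : R}

theorem neg_one_add_sq (h : x * x = (-2 : ℂ) • x) : -(1 + x) * -(1 + x) = 1 := by
  rw [neg_mul_neg, add_mul, mul_add, mul_add, h]
  simp only [one_mul, mul_one]
  module

theorem neg_one_add_braid (h1 : x * x = (-2 : ℂ) • x) (h2 : y * y = (-2 : ℂ) • y)
    (h3 : x * y * x = x) (h4 : y * x * y = y) :
    -(1 + x) * -(1 + y) * -(1 + x) = -(1 + y) * -(1 + x) * -(1 + y) := by
  have e1 : -(1 + x) * -(1 + y) * -(1 + x) =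
      -(1 + x + x + y + x * y + y * x + x * x + x * y * x) := by noncomm_ring
  have e2 : -(1 + y) * -(1 + x) * -(1 + y) =
      -(1 + y + y + x + x * y + y * x + y * y + y * x * y) := by noncomm_ring
  rw [e1, e2, h1, h2, h3, h4]
  module

theorem neg_one_add_mul (h : x * y = 0) : -(1 + x) * y = (-1 : ℂ) • y := by
  rw [neg_mul, add_mul, one_mul, h, add_zero, neg_one_smul]

theorem mul_eq_zero_of_mul_neg_one_add (h : y * -(1 + x) = (-1 : ℂ) • y) : y * x = 0 := by
  rw [mul_neg, mul_add, mul_one, neg_one_smul, neg_inj, add_eq_left] at h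
  exact h

end Ring

/-- The images `-(1 + e_k)` of the simple transpositions are involutions. -/
def tlUnit (n k : ℕ) : (TL n (-2))ˣ where
  val := -(1 + TL.gen n k)
  inv := -(1 + TL.gen n k)
  val_inv := neg_one_add_sq (TL.gen_sq n k)
  inv_val := neg_one_add_sq (TL.gen_sq n k)

theorem TL.gen_adj' (n k : ℕ) (h : k + 1 < n - 1) :
    TL.gen n k * TL.gen n (k + 1) * TL.gen n k = TL.gen n k := by
  have h' : k < n - 1 := by omega
  unfold TL.gen
  rw [dif_pos h, dif_pos h']
  have := RingQuot.mkAlgHom_rel ℂ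
    (TLRel.adj (ν := -2) (⟨k, h'⟩ : Fin (n - 1)) ⟨k + 1, h⟩ (Or.inl rfl))
  simpa only [map_mul, TL.e] using this

theorem isCoxeter_tlUnit (n : ℕ) : IsCoxeter (n - 1) (tlUnit n) where
  sq i _ := Units.ext (neg_one_add_sq (TL.gen_sq n i))
  braid i hi := Units.ext (neg_one_add_braid (TL.gen_sq n i) (TL.gen_sq n (i + 1))
    (TL.gen_adj' n i hi) (TL.gen_adj n i hi))
  far i j hij _ := Units.ext (neg_one_add_far (TL.gen_far n i j hij).eq)

/-- The homomorphism from the symmetric group to the Temperley-Lieb algebra. -/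
def permToTL (n : ℕ) : Equiv.Perm (Fin n) →* TL n (-2) :=
  (Units.coeHom _).comp (isCoxeter_tlUnit n).exists_hom.choose

theorem permToTL_adjSwap {n k : ℕ} (hk : k < n - 1) :
    permToTL n (adjSwap n k) = -(1 + TL.gen n k) := by
  change (((isCoxeter_tlUnit n).exists_hom.choose (adjSwap n k) : (TL n (-2))ˣ) : TL n (-2)) = _
  rw [(isCoxeter_tlUnit n).exists_hom.choose_spec k hk]
  rfl

/-- The homomorphism from the symmetric group algebra to the Temperley-Lieb algebra. -/
def groupAlgToTL (n : ℕ) : MonoidAlgebra ℂ (Equiv.Perm (Fin n)) →ₐ[ℂ] TL n (-2) :=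
  MonoidAlgebra.lift ℂ (TL n (-2)) (Equiv.Perm (Fin n)) (permToTL n)

theorem groupAlgToTL_of {n : ℕ} (σ : Equiv.Perm (Fin n)) :
    groupAlgToTL n (MonoidAlgebra.of ℂ _ σ) = permToTL n σ :=
  MonoidAlgebra.lift_of _ _

theorem TL.gen_eq_e {n : ℕ} (i : Fin (n - 1)) : TL.gen n i = TL.e i := dif_pos i.2

theorem groupAlgToTL_simpleTransposition {n : ℕ} (i : Fin (n - 1)) :
    groupAlgToTL n (MonoidAlgebra.of ℂ _ (simpleTransposition i)) = -(1 + TL.e i) := by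
  rw [groupAlgToTL_of, simpleTransposition_eq, permToTL_adjSwap i.2, TL.gen_eq_e]

/-- The Temperley-Lieb algebra is generated by the `e_i`. -/
theorem TL.eq_top_of_forall_mem {n : ℕ} {S : Subalgebra ℂ (TL n (-2))} (h : ∀ i, TL.e i ∈ S) :
    S = ⊤ := by
  rw [eq_top_iff]
  intro x _
  obtain ⟨y, rfl⟩ := RingQuot.mkAlgHom_surjective ℂ (TLRel n (-2)) x
  have : (⊤ : Subalgebra ℂ (FreeAlgebra ℂ (Fin (n - 1)))) ≤
      S.comap (RingQuot.mkAlgHom ℂ (TLRel n (-2))) := by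
    rw [← FreeAlgebra.adjoin_range_ι, Algebra.adjoin_le_iff]
    rintro _ ⟨i, rfl⟩
    exact h i
  exact this trivial

theorem groupAlgToTL_surjective (n : ℕ) : Function.Surjective (groupAlgToTL n) := by
  rw [← AlgHom.range_eq_top]
  refine TL.eq_top_of_forall_mem fun i => ?_
  refine ⟨-1 - MonoidAlgebra.of ℂ _ (simpleTransposition i), ?_⟩
  change groupAlgToTL n _ = _
  rw [map_sub, groupAlgToTL_simpleTransposition, map_neg, map_one]
  abel

end Quotient

section Idempotent

variable {N : ℕ} {ς : Composition (2 * N)}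

theorem groupEnd (i : Fin ς.length) :
    ς.sizeUpTo i + (ς.blocksFun i - 1) + 1 = ς.sizeUpTo ((i : ℕ) + 1) := by
  have h1 := ς.sizeUpTo_succ' i
  have h3 := ς.one_le_blocksFun i
  omega

/-- The generators inside the groups annihilate the idempotent. -/
theorem gen_mul_idem {a b : Fin (2 * N)} (hab : (b : ℕ) = a + 1) (h : ς.index a = ς.index b) :
    TL.gen (2 * N) a * TL.idem ς = 0 := by
  have hb := ς.lt_sizeUpTo_index_succ b
  have ha := ς.sizeUpTo_index_le a
  have he := groupEnd (ς.index a)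
  have hle := ς.sizeUpTo_le ((ς.index a : ℕ) + 1)
  rw [← h, Fin.val_succ] at hb
  obtain ⟨l, hl⟩ : ∃ l, (a : ℕ) = ς.sizeUpTo (ς.index a) + l :=
    ⟨a - ς.sizeUpTo (ς.index a), by omega⟩
  have hkill := ((TL.jw_spec (2 * N) (ς.sizeUpTo (ς.index a)) (ς.blocksFun (ς.index a) - 1)
    (Or.inl (by omega))).2.1 l (by omega)).1
  rw [← hl] at hkill
  unfold TL.idem
  -- the projector of the group commutes with the ones of the groups before
  have key : ∀ L : List (TL (2 * N) (-2)), L.Pairwise Commute →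
      TL.jw (2 * N) (ς.sizeUpTo (ς.index a)) (ς.blocksFun (ς.index a) - 1) ∈ L →
      TL.gen (2 * N) a * L.prod = 0 := by
    intro L hL hmem
    obtain ⟨L1, L2, rfl⟩ := List.append_of_mem hmem
    rw [List.pairwise_append] at hL
    have hc : Commute (TL.jw (2 * N) (ς.sizeUpTo (ς.index a)) (ς.blocksFun (ς.index a) - 1))
        L1.prod := Commute.list_prod_right _ _ fun x hx => (hL.2.2 x hx _ (by simp)).symm
    rw [List.prod_append, List.prod_cons, ← mul_assoc L1.prod, ← hc.eq, ← mul_assoc, ← mul_assoc,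
      hkill, zero_mul, zero_mul]
  refine key _ ?_ (List.mem_ofFn.mpr ⟨ς.index a, rfl⟩)
  rw [List.pairwise_ofFn]
  intro i j hij
  refine TL.commute_jw _ _ _ _ fun l _ => ?_
  refine (TL.commute_jw _ _ _ _ fun m hm => ?_).symm
  refine (TL.gen_far _ _ _ ?_).symm
  have h1 := groupEnd i
  have h2 : ς.sizeUpTo ((i : ℕ) + 1) ≤ ς.sizeUpTo j := ς.monotone_sizeUpTo hij
  omega

/-- An element annihilated by the generators inside the groups is fixed by the idempotent. -/
theorem mul_idem_eq {y : TL (2 * N) (-2)} (h : ∀ a b : Fin (2 * N), (b : ℕ) = a + 1 →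
    ς.index a = ς.index b → y * TL.gen (2 * N) a = 0) : y * TL.idem ς = y := by
  have hjw : ∀ (i : Fin ς.length) (k : ℕ), k ≤ ς.blocksFun i - 1 →
      y * TL.jw (2 * N) (ς.sizeUpTo i) k = y := by
    intro i k
    induction k with
    | zero => intro _; rw [TL.jw, mul_one]
    | succ k ih =>
      intro hk
      have he := groupEnd i
      have hle := ς.sizeUpTo_le ((i : ℕ) + 1)
      have h1 := h ⟨ς.sizeUpTo i + k, by omega⟩ ⟨ς.sizeUpTo i + k + 1, by omega⟩ rfl (by
        rw [(index_eq_iff ς (i := i)).mpr ⟨by simp, by simp only; omega⟩,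
          (index_eq_iff ς (i := i)).mpr ⟨by simp only; omega, by simp only; omega⟩])
      rw [TL.jw, mul_add, mul_smul_comm, ← mul_assoc, ← mul_assoc, ih (by omega)]
      simp only at h1
      rw [h1, zero_mul, smul_zero, add_zero]
  unfold TL.idem
  have key : ∀ L : List (TL (2 * N) (-2)), (∀ x ∈ L, y * x = y) → y * L.prod = y := by
    intro L
    induction L with
    | nil => intro _; simp
    | cons x L ih =>
      intro hL
      rw [List.prod_cons, ← mul_assoc, hL x (by simp), ih fun z hz => hL z (by simp [hz])]
  refine key _ fun x hx => ?_
  obtain ⟨i, rfl⟩ := List.mem_ofFn.mp hx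
  exact hjw i _ le_rfl

theorem permToTL_mul_idem {σ : Equiv.Perm (Fin (2 * N))} (hσ : σ ∈ young ς) :
    permToTL (2 * N) σ * TL.idem ς = csign σ • TL.idem ς := by
  refine young_induction (ς := ς)
    (p := fun σ => permToTL (2 * N) σ * TL.idem ς = csign σ • TL.idem ς) ?_ ?_ ?_ hσ
  · simp [csign]
  · intro σ τ h1 h2
    rw [map_mul, mul_assoc, h2, mul_smul_comm, h1, smul_smul, csign_mul, mul_comm (csign τ)]
  · intro i j hij h
    have hne : i ≠ j := fun h => by rw [h] at hij; omega
    have hs : Equiv.swap i j = adjSwap (2 * N) i := by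
      rw [adjSwap_of_lt (by omega)]
      congr 1
      exact Fin.ext hij
    rw [csign_swap hne, hs, permToTL_adjSwap (by omega)]
    exact neg_one_add_mul (gen_mul_idem hij h)

open Classical in
theorem card_index_eq (i : Fin ς.length) :
    Fintype.card {a : Fin (2 * N) // ς.index a = i} = ς.blocksFun i := by
  have e : Fin (ς.blocksFun i) ≃ {a : Fin (2 * N) // ς.index a = i} :=
    Equiv.ofBijective (fun j => ⟨ς.embedding i j, ς.index_embedding i j⟩)
      ⟨fun j k h => (ς.embedding i).injective (Subtype.ext_iff.mp h), by
        rintro ⟨a, rfl⟩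
        exact ⟨ς.invEmbedding a, Subtype.ext (ς.embedding_comp_inv a)⟩⟩
  rw [← Fintype.card_congr e, Fintype.card_fin]

theorem card_young :
    ((Finset.univ.filter fun σ : Equiv.Perm (Fin (2 * N)) => ∀ a, ς.index (σ a) = ς.index a).card) =
      ∏ i : Fin ς.length, (ς.blocksFun i).factorial := by
  classical
  have h := DomMulAct.stabilizer_card (f := ς.index)
  simp only [card_index_eq] at h
  rw [← h, Fintype.card_subtype]
  congr 1
  ext σ
  simp [funext_iff]

/-- The antisymmetrizer of the Young subgroup is mapped to the product of the Jones-Wenzl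
idempotents. -/
theorem groupAlgToTL_antisymmetrizer :
    groupAlgToTL (2 * N) (antisymmetrizer ς) = TL.idem ς := by
  set c := ∏ i : Fin ς.length, ((ς.blocksFun i).factorial : ℂ) with hc
  have hc0 : c ≠ 0 := Finset.prod_ne_zero_iff.mpr fun i _ => by
    exact_mod_cast (ς.blocksFun i).factorial_ne_zero
  have hq : groupAlgToTL (2 * N) (antisymmetrizer ς) = c⁻¹ •
      ∑ σ : Equiv.Perm (Fin (2 * N)) with ∀ a, ς.index (σ a) = ς.index a,
        csign σ • permToTL (2 * N) σ := by
    unfold antisymmetrizer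
    rw [map_smul, map_sum]
    congr 1
    refine Finset.sum_congr rfl fun σ _ => ?_
    rw [map_smul, ← groupAlgToTL_of]
    rfl
  -- multiplication by the idempotent from the right
  have h1 : groupAlgToTL (2 * N) (antisymmetrizer ς) * TL.idem ς = TL.idem ς := by
    rw [hq, smul_mul_assoc, Finset.sum_mul, Finset.sum_congr rfl (g := fun _ => TL.idem ς),
      Finset.sum_const, card_young, ← Nat.cast_smul_eq_nsmul ℂ, smul_smul]
    · push_cast
      rw [← hc, inv_mul_cancel₀ hc0, one_smul]
    · intro σ hσ
      rw [smul_mul_assoc, permToTL_mul_idem (mem_young.mpr (Finset.mem_filter.mp hσ).2), smul_smul,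
        csign_mul_self, one_smul]
  rw [← h1, eq_comm]
  refine mul_idem_eq fun a b hab h => ?_
  have hne : a ≠ b := fun h => by rw [h] at hab; omega
  have hs : Equiv.swap a b = adjSwap (2 * N) a := by
    rw [adjSwap_of_lt (by omega)]
    congr 1
    exact Fin.ext hab
  have h2 : groupAlgToTL (2 * N) (antisymmetrizer ς) * permToTL (2 * N) (Equiv.swap a b) =
      (-1 : ℂ) • groupAlgToTL (2 * N) (antisymmetrizer ς) := by
    rw [hq, smul_mul_assoc, smul_comm (-1 : ℂ)]
    congr 1
    rw [Finset.sum_mul, Finset.smul_sum]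
    refine Finset.sum_bij (fun σ _ => σ * Equiv.swap a b) ?_ ?_ ?_ ?_
    · intro σ hσ
      have h3 : σ ∈ young ς := (Finset.mem_filter.mp hσ).2
      exact Finset.mem_filter.mpr ⟨Finset.mem_univ _, (young ς).mul_mem h3 (swap_mem_young h)⟩
    · intro σ _ τ _ h
      exact mul_right_cancel h
    · intro σ hσ
      have h3 : σ ∈ young ς := (Finset.mem_filter.mp hσ).2
      exact ⟨σ * Equiv.swap a b, Finset.mem_filter.mpr
        ⟨Finset.mem_univ _, (young ς).mul_mem h3 (swap_mem_young h)⟩, by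
          rw [mul_assoc, Equiv.swap_mul_self, mul_one]⟩
    · intro σ _
      rw [csign_mul, csign_swap hne, map_mul, smul_mul_assoc, smul_smul]
      congr 1
      ring
  rw [hs, permToTL_adjSwap (by omega)] at h2
  exact mul_eq_zero_of_mul_neg_one_add h2

end Idempotent

section Action

variable {n : ℕ} {W : Type*} [AddCommGroup W] [Module ℂ W]

/-- A representation of the symmetric group factors through the Temperley-Lieb algebra if it is
annihilated by the symmetrizers of three consecutive points. -/
theorem exists_tl_action (r : Representation ℂ (Equiv.Perm (Fin n)) W)
    (h : ∀ a b c : Fin n, a ≠ b → b ≠ c → a ≠ c → ∀ w, w + r (Equiv.swap a b) w +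
      r (Equiv.swap b c) w + r (Equiv.swap a b * Equiv.swap b c) w +
      r (Equiv.swap b c * Equiv.swap a b) w +
      r (Equiv.swap a b * Equiv.swap b c * Equiv.swap a b) w = 0) :
    ∃ ρ : TL n (-2) →ₐ[ℂ] Module.End ℂ W, ∀ σ, ρ (permToTL n σ) = r σ := by
  let E : Fin (n - 1) → Module.End ℂ W := fun i => -(1 + r (adjSwap n i))
  have hsq : ∀ i : Fin (n - 1), r (adjSwap n i) * r (adjSwap n i) = 1 := fun i => by
    rw [← map_mul, isCoxeter_adjSwap.sq i i.2, map_one]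
  have hadj : ∀ i j : Fin (n - 1), ((i : ℕ) + 1 = j ∨ (j : ℕ) + 1 = i) →
      1 + r (adjSwap n i) + r (adjSwap n j) + r (adjSwap n i) * r (adjSwap n j) +
        r (adjSwap n j) * r (adjSwap n i) +
        r (adjSwap n i) * r (adjSwap n j) * r (adjSwap n i) = 0 := by
    intro i j hij
    ext w
    have key : ∀ a b c : Fin n, a ≠ b → b ≠ c → a ≠ c → adjSwap n i = Equiv.swap a b →
        adjSwap n j = Equiv.swap b c → _ := fun a b c h1 h2 h3 e1 e2 => by
      have := h a b c h1 h2 h3 w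
      rw [← e1, ← e2] at this
      exact this
    simp only [LinearMap.add_apply, Module.End.one_apply, ← map_mul, LinearMap.zero_apply]
    rw [adjSwap_of_lt (k := i) (by omega), adjSwap_of_lt (k := j) (by omega)] at key
    rw [adjSwap_of_lt (k := i) (by omega), adjSwap_of_lt (k := j) (by omega)]
    rcases hij with hij | hij
    · refine key ⟨i, by omega⟩ ⟨i + 1, by omega⟩ ⟨j + 1, by omega⟩ ?_ ?_ ?_ rfl ?_
      · simp
      · simp; omega
      · simp; omega
      · congr 1
        exact Fin.ext hij.symm
    · refine key ⟨i + 1, by omega⟩ ⟨i, by omega⟩ ⟨j, by omega⟩ ?_ ?_ ?_ (Equiv.swap_comm _ _) ?_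
      · simp
      · simp; omega
      · simp; omega
      · rw [Equiv.swap_comm]
        congr 1
        exact Fin.ext hij
  let ρ : TL n (-2) →ₐ[ℂ] Module.End ℂ W :=
    RingQuot.liftAlgHom ℂ ⟨FreeAlgebra.lift ℂ E, by
      intro x y hxy
      induction hxy with
      | sq i =>
        rw [map_mul, map_smul, FreeAlgebra.lift_ι_apply]
        simp only [E]
        rw [neg_mul_neg, add_mul, mul_add, mul_add, hsq]
        simp only [one_mul, mul_one]
        module
      | adj i j hij =>
        rw [map_mul, map_mul, FreeAlgebra.lift_ι_apply, FreeAlgebra.lift_ι_apply]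
        have h1 := hadj i j hij
        have h2 := hsq i
        simp only [E]
        set s := r (adjSwap n i)
        set t := r (adjSwap n j)
        have h3 : -(1 + s) * -(1 + t) * -(1 + s) =
            -(1 + s + t + s * t + t * s + s * t * s) - s - s * s := by noncomm_ring
        rw [h3, h1, h2]
        abel
      | far i j hij =>
        rw [map_mul, map_mul, FreeAlgebra.lift_ι_apply, FreeAlgebra.lift_ι_apply]
        have hc : r (adjSwap n i) * r (adjSwap n j) = r (adjSwap n j) * r (adjSwap n i) := by
          rw [← map_mul, ← map_mul]
          rcases hij with hij | hij
          · rw [(isCoxeter_adjSwap.far _ _ hij j.2).eq]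
          · rw [(isCoxeter_adjSwap.far _ _ hij i.2).eq]
        simp only [E]
        rw [neg_mul_neg, neg_mul_neg, add_mul, mul_add, mul_add, add_mul, mul_add, mul_add, hc]
        simp only [one_mul, mul_one]
        abel⟩
  have hρ : ∀ i, ρ (TL.e i) = -(1 + r (adjSwap n i)) := fun i => by
    change ρ (RingQuot.mkAlgHom ℂ _ _) = _
    rw [RingQuot.liftAlgHom_mkAlgHom_apply, FreeAlgebra.lift_ι_apply]
  refine ⟨ρ, fun σ => ?_⟩
  have heq : ((ρ : TL n (-2) →* Module.End ℂ W).comp (permToTL n)) = r := by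
    refine MonoidHom.eq_of_eqOn_denseM closure_adjSwap ?_
    rintro _ ⟨i, hi, rfl⟩
    have hi' : i < n - 1 := hi
    change ρ (permToTL n (adjSwap n i)) = _
    rw [permToTL_adjSwap hi', show TL.gen n i = TL.e ⟨i, hi'⟩ from dif_pos hi', map_neg, map_add,
      map_one, hρ]
    abel
  exact DFunLike.congr_fun heq σ

end Action

section SpechtRelation

variable {N : ℕ}

theorem swap_polytabloid {A : Numbering N} {a b : Fin (2 * N)} (hab : a ≠ b)
    (h : A.col a = A.col b) :
    tabloidRep N (Equiv.swap a b) (polytabloid A) = -polytabloid A := by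
  rw [tabloidRep_polytabloid, polytabloid_smul_of_col, csign_swap hab, neg_one_smul]
  intro c
  rcases eq_or_ne c a with rfl | hi
  · rw [Equiv.swap_apply_left, h]
  rcases eq_or_ne c b with rfl | hj
  · rw [Equiv.swap_apply_right, h]
  rw [Equiv.swap_apply_of_ne_of_ne hi hj]

/-- Symmetrizers of three points annihilate the Specht module: two of the points lie in the same
column. -/
theorem symmetrizer_eq_zero {a b c : Fin (2 * N)} (hab : a ≠ b) (hbc : b ≠ c) (hac : a ≠ c)
    {v : MonoidAlgebra ℂ (Tabloid N)} (hv : v ∈ (specht N).toSubmodule) :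
    v + tabloidRep N (Equiv.swap a b) v + tabloidRep N (Equiv.swap b c) v +
      tabloidRep N (Equiv.swap a b * Equiv.swap b c) v +
      tabloidRep N (Equiv.swap b c * Equiv.swap a b) v +
      tabloidRep N (Equiv.swap a b * Equiv.swap b c * Equiv.swap a b) v = 0 := by
  have hst : Equiv.swap a b * Equiv.swap b c * Equiv.swap a b = Equiv.swap a c := by
    rw [Equiv.swap_comm a b, Equiv.swap_comm b c, Equiv.swap_mul_swap_mul_swap hbc.symm hac.symm]
  induction hv using Submodule.span_induction with
  | mem v hv =>
    obtain ⟨A, rfl⟩ := hv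
    have hcol : A.col a = A.col b ∨ A.col b = A.col c ∨ A.col a = A.col c := by
      generalize A.col a = x
      generalize A.col b = y
      generalize A.col c = z
      revert x y z
      decide
    have hp : ∀ x y, x ≠ y → A.col x = A.col y → _ := fun x y =>
      swap_polytabloid (a := x) (b := y) (A := A)
    generalize polytabloid A = v at hp
    rcases hcol with h | h | h
    · have e := hp _ _ hab h
      simp only [map_mul, Module.End.mul_apply, e, map_neg]
      abel
    · have e := hp _ _ hbc h
      have h2 : Equiv.swap a b * Equiv.swap b c * Equiv.swap a b =
          Equiv.swap b c * Equiv.swap a b * Equiv.swap b c := by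
        rw [hst, Equiv.swap_mul_swap_mul_swap hab hac, Equiv.swap_comm]
      rw [h2]
      simp only [map_mul, Module.End.mul_apply, e, map_neg]
      abel
    · have e := hp _ _ hac h
      have e1 : Equiv.swap a b * Equiv.swap b c = Equiv.swap b c * Equiv.swap a c := by
        rw [Equiv.swap_comm a c, ← Equiv.swap_mul_swap_mul_swap hab hac, ← mul_assoc, ← mul_assoc,
          Equiv.swap_mul_self, one_mul]
      have e2 : Equiv.swap b c * Equiv.swap a b = Equiv.swap a b * Equiv.swap a c := by
        rw [← hst, ← mul_assoc, ← mul_assoc, Equiv.swap_mul_self, one_mul]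
      rw [hst, e1, e2]
      simp only [map_mul, Module.End.mul_apply, e, map_neg]
      abel
  | zero => simp
  | add v w _ _ hv hw =>
    simp only [map_add]
    have := congrArg₂ (· + ·) hv hw
    simp only [add_zero] at this
    rw [← this]
    abel
  | smul c v _ hv =>
    simp only [map_smul, ← smul_add, hv, smul_zero]

end SpechtRelation

/-! ### Derivatives of the excursion kernel -/

section Kernel

theorem prod_range_neg_sub (p q : ℕ) :
    ((q + 1).factorial : ℂ) * ∏ i ∈ Finset.range p, (((-(2 + q) : ℤ) : ℂ) - i) =
      (-1) ^ p * ((p + q + 1).factorial : ℂ) := by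
  induction p with
  | zero => simp
  | succ p ih =>
    rw [Finset.prod_range_succ, ← mul_assoc, ih, show p + 1 + q + 1 = (p + q + 1) + 1 by omega,
      Nat.factorial_succ (p + q + 1)]
    push_cast
    ring

theorem iteratedDeriv_zpow_neg (p q : ℕ) (x : ℂ) :
    ((q + 1).factorial : ℂ) * iteratedDeriv p (fun z : ℂ => z ^ (-(2 + q) : ℤ)) x =
      (-1) ^ p * ((p + q + 1).factorial : ℂ) * x ^ (-(2 + (p + q : ℕ)) : ℤ) := by
  rw [iteratedDeriv_eq_iterate, iter_deriv_zpow, ← mul_assoc, prod_range_neg_sub]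
  congr 2
  push_cast
  ring

theorem excKernelDeriv_eq (p q : ℕ) (x y : ℂ) : excKernelDeriv p q x y =
    1 / (Real.pi : ℂ) * ((-1) ^ p * ((p + q + 1).factorial : ℂ) / (x - y) ^ (p + q + 2)) := by
  have h1 : ∀ u, iteratedDeriv q (fun v => excKernel u v) y =
      1 / (Real.pi : ℂ) * (((q + 1).factorial : ℂ) * (u - y) ^ (-(2 + q) : ℤ)) := by
    intro u
    have e : (fun v => excKernel u v) =
        fun v => 1 / (Real.pi : ℂ) *
          (fun z : ℂ => (fun w : ℂ => w ^ (-(2 + (0 : ℕ)) : ℤ)) (u - z)) v := by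
      funext v
      simp only [excKernel, Nat.cast_zero, add_zero, zpow_neg, one_div]
      rfl
    rw [e, iteratedDeriv_const_mul_field,
      iteratedDeriv_comp_const_sub q (fun w : ℂ => w ^ (-(2 + (0 : ℕ)) : ℤ)) u]
    have h := iteratedDeriv_zpow_neg q 0 (u - y)
    simp only [zero_add, Nat.factorial_one, Nat.cast_one, one_mul, add_zero] at h
    simp only [smul_eq_mul]
    have h2 : ((-1 : ℂ) ^ q) * (-1) ^ q = 1 := by rw [← mul_pow]; norm_num
    rw [h]
    linear_combination (1 / (Real.pi : ℂ) * (((q + 1).factorial : ℂ) *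
      (u - y) ^ (-(2 + q) : ℤ))) * h2
  unfold excKernelDeriv
  have e : (fun u => iteratedDeriv q (fun v => excKernel u v) y) =
      fun u => (1 / (Real.pi : ℂ) * ((q + 1).factorial : ℂ)) *
        (fun z : ℂ => (fun w : ℂ => w ^ (-(2 + q) : ℤ)) (z - y)) u := by
    funext u
    rw [h1, mul_assoc]
  rw [e, iteratedDeriv_const_mul_field,
    iteratedDeriv_comp_sub_const p (fun w : ℂ => w ^ (-(2 + q) : ℤ)) y, mul_assoc]
  simp only
  rw [iteratedDeriv_zpow_neg, zpow_neg, div_eq_mul_inv]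
  congr 3
  rw [add_comm]
  norm_cast

theorem excKernelDeriv_comm (p q : ℕ) (x y : ℂ) :
    excKernelDeriv p q x y = excKernelDeriv q p y x := by
  rw [excKernelDeriv_eq, excKernelDeriv_eq, show q + p = p + q from add_comm _ _,
    show x - y = -(y - x) by ring]
  congr 1
  rw [show p + q + 2 = p + (q + 2) by ring, neg_eq_neg_one_mul (y - x), mul_pow, pow_add (-1 : ℂ),
    pow_add (-1 : ℂ) q 2]
  rcases Nat.even_or_odd p with hp | hp <;> rcases Nat.even_or_odd q with hq | hq <;>
    simp [hp.neg_one_pow, hq.neg_one_pow, neg_div, div_neg]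

end Kernel

/-! ### Newton interpolation of the kernel -/

section Newton

variable (x y : ℕ → ℂ)

/-- The solution of `(x_k - y_l) G_{k,l} = R_{k,l} - G_{k-1,l} + G_{k,l-1}`. If `R` is the table of
divided differences of a function `r` of two variables, then `G` is the one of `r / (x - y)`. -/
def divTable (R : ℕ → ℕ → ℂ) : ℕ → ℕ → ℂ
  | 0, 0 => R 0 0 / (x 0 - y 0)
  | k + 1, 0 => (R (k + 1) 0 - divTable R k 0) / (x (k + 1) - y 0)
  | 0, l + 1 => (R 0 (l + 1) + divTable R 0 l) / (x 0 - y (l + 1))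
  | k + 1, l + 1 =>
    (R (k + 1) (l + 1) - divTable R k (l + 1) + divTable R (k + 1) l) / (x (k + 1) - y (l + 1))
  termination_by k l => k + l

/-- The divided differences of the constant function `1`. -/
def deltaTable (k l : ℕ) : ℂ := if k = 0 ∧ l = 0 then 1 else 0

/-- The divided differences of the function `(x - y)⁻²`. -/
def squareTable : ℕ → ℕ → ℂ := divTable x y (divTable x y deltaTable)

variable {x y}

/-- Newton's interpolation formula for the table `R` implies the one for the table divided by
`x - y`. -/
theorem newton_divTable {R : ℕ → ℕ → ℂ} {a b m n : ℕ} (ha : a < m) (hb : b < n)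
    (hxy : ∀ k l, k < m → l < n → x k ≠ y l) :
    (x a - y b) * ∑ k ∈ Finset.range m, ∑ l ∈ Finset.range n,
      (∏ i ∈ Finset.range k, (x a - x i)) * (∏ j ∈ Finset.range l, (y b - y j)) *
        divTable x y R k l =
    ∑ k ∈ Finset.range m, ∑ l ∈ Finset.range n,
      (∏ i ∈ Finset.range k, (x a - x i)) * (∏ j ∈ Finset.range l, (y b - y j)) * R k l := by
  set P : ℕ → ℂ := fun k => ∏ i ∈ Finset.range k, (x a - x i) with hP
  set Q : ℕ → ℂ := fun l => ∏ j ∈ Finset.range l, (y b - y j) with hQ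
  set G := divTable x y R with hG
  have hPs : ∀ k, P (k + 1) = P k * (x a - x k) := fun k => Finset.prod_range_succ _ _
  have hQs : ∀ l, Q (l + 1) = Q l * (y b - y l) := fun l => Finset.prod_range_succ _ _
  have hPm : P m = 0 := Finset.prod_eq_zero (Finset.mem_range.mpr ha) (sub_self _)
  have hQn : Q n = 0 := Finset.prod_eq_zero (Finset.mem_range.mpr hb) (sub_self _)
  -- the shifted tables
  let G1 : ℕ → ℕ → ℂ := fun k l => match k with | 0 => 0 | k + 1 => G k l
  let G2 : ℕ → ℕ → ℂ := fun k l => match l with | 0 => 0 | l + 1 => G k l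
  have hrec : ∀ k l, k < m → l < n → (x k - y l) * G k l = R k l - G1 k l + G2 k l := by
    intro k l hk hl
    have h0 := sub_ne_zero.mpr (hxy k l hk hl)
    rcases k with _ | k <;> rcases l with _ | l <;> simp only [hG, G1, G2] <;> rw [divTable] <;>
      field_simp <;> ring
  have h1 : ∀ l, ∑ k ∈ Finset.range m, P (k + 1) * G k l = ∑ k ∈ Finset.range m, P k * G1 k l := by
    intro l
    have e1 := Finset.sum_range_succ (fun k => P k * G1 k l) m
    rw [Finset.sum_range_succ'] at e1
    simpa [G1, hPm] using e1
  have h2 : ∀ k, ∑ l ∈ Finset.range n, Q (l + 1) * G k l = ∑ l ∈ Finset.range n, Q l * G2 k l := by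
    intro k
    have e1 := Finset.sum_range_succ (fun l => Q l * G2 k l) n
    rw [Finset.sum_range_succ'] at e1
    simpa [G2, hQn] using e1
  have e1 : ∑ k ∈ Finset.range m, ∑ l ∈ Finset.range n, P (k + 1) * Q l * G k l =
      ∑ k ∈ Finset.range m, ∑ l ∈ Finset.range n, P k * Q l * G1 k l := by
    rw [Finset.sum_comm, Finset.sum_comm (s := Finset.range m)]
    refine Finset.sum_congr rfl fun l _ => ?_
    have := congrArg (Q l * ·) (h1 l)
    simp only [Finset.mul_sum] at this
    convert this using 2 <;> ring
  have e2 : ∑ k ∈ Finset.range m, ∑ l ∈ Finset.range n, P k * Q (l + 1) * G k l =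
      ∑ k ∈ Finset.range m, ∑ l ∈ Finset.range n, P k * Q l * G2 k l := by
    refine Finset.sum_congr rfl fun k _ => ?_
    have := congrArg (P k * ·) (h2 k)
    simp only [Finset.mul_sum] at this
    convert this using 2 <;> ring
  have e3 : (x a - y b) * ∑ k ∈ Finset.range m, ∑ l ∈ Finset.range n, P k * Q l * G k l =
      ∑ k ∈ Finset.range m, ∑ l ∈ Finset.range n, (P (k + 1) * Q l * G k l -
        P k * Q (l + 1) * G k l + P k * Q l * (R k l - G1 k l + G2 k l)) := by
    rw [Finset.mul_sum]
    refine Finset.sum_congr rfl fun k hk => ?_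
    rw [Finset.mul_sum]
    refine Finset.sum_congr rfl fun l hl => ?_
    rw [hPs, hQs, ← hrec k l (Finset.mem_range.mp hk) (Finset.mem_range.mp hl)]
    ring
  rw [e3]
  simp only [mul_add, mul_sub, Finset.sum_add_distrib, Finset.sum_sub_distrib]
  rw [e1, e2]
  ring

theorem newton_squareTable {a b m n : ℕ} (ha : a < m) (hb : b < n)
    (hxy : ∀ k l, k < m → l < n → x k ≠ y l) :
    ∑ k ∈ Finset.range m, ∑ l ∈ Finset.range n,
      (∏ i ∈ Finset.range k, (x a - x i)) * (∏ j ∈ Finset.range l, (y b - y j)) *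
        squareTable x y k l = 1 / (x a - y b) ^ 2 := by
  have h1 := newton_divTable (R := divTable x y deltaTable) ha hb hxy
  have h2 := newton_divTable (R := deltaTable) ha hb hxy
  rw [← h1] at h2
  have h3 : ∑ k ∈ Finset.range m, ∑ l ∈ Finset.range n,
      (∏ i ∈ Finset.range k, (x a - x i)) * (∏ j ∈ Finset.range l, (y b - y j)) *
        deltaTable k l = 1 := by
    rw [Finset.sum_eq_single_of_mem 0 (Finset.mem_range.mpr (by omega)),
      Finset.sum_eq_single_of_mem 0 (Finset.mem_range.mpr (by omega))]
    · simp [deltaTable]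
    · intro l _ hl
      simp [deltaTable, hl]
    · intro k _ hk
      simp [deltaTable, hk]
  rw [h3] at h2
  have h0 := sub_ne_zero.mpr (hxy a b ha hb)
  rw [eq_div_iff (pow_ne_zero 2 h0), ← h2, squareTable]
  ring

theorem divTable_comm {R R' : ℕ → ℕ → ℂ} {s : ℂ} (h : ∀ k l, R' l k = s * R k l) (k l : ℕ) :
    divTable y x R' l k = -s * divTable x y R k l := by
  have key : ∀ a b c : ℂ, s * c / (a - b) = -s * (c / (b - a)) := fun a b c => by
    rw [← neg_sub b a, div_neg, mul_div_assoc, neg_mul]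
  induction hn : k + l using Nat.strong_induction_on generalizing k l with
  | _ n ih =>
  rcases k with _ | k <;> rcases l with _ | l
  · rw [divTable, divTable, h, key]
  · rw [divTable, divTable, h, ih _ (by omega) 0 l rfl, ← key]
    ring
  · rw [divTable, divTable, h, ih _ (by omega) k 0 rfl, ← key]
    ring
  · rw [divTable, divTable, h, ih _ (by omega) (k + 1) l rfl, ih _ (by omega) k (l + 1) rfl, ← key]
    ring

theorem squareTable_comm (k l : ℕ) : squareTable y x l k = squareTable x y k l := by
  have h1 : ∀ k l, divTable y x deltaTable l k = -1 * divTable x y deltaTable k l :=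
    divTable_comm fun k l => by simp only [deltaTable, one_mul, and_comm]
  unfold squareTable
  rw [divTable_comm h1 k l, neg_neg, one_mul]

/-- At coinciding nodes the divided differences are derivatives, up to factorials. -/
theorem divTable_delta_const {ξ η : ℂ} (h : ξ ≠ η) (k l : ℕ) :
    divTable (fun _ => ξ) (fun _ => η) deltaTable k l =
      (-1) ^ k * ((k + l).choose k : ℂ) / (ξ - η) ^ (k + l + 1) := by
  have h0 := sub_ne_zero.mpr h
  induction hn : k + l using Nat.strong_induction_on generalizing k l with
  | _ n ih =>
  subst hn
  rcases k with _ | k <;> rcases l with _ | l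
  · rw [divTable]; simp [deltaTable]
  · rw [divTable, ih _ (by omega) 0 l rfl]
    simp only [deltaTable]
    field_simp
    simp
    ring
  · rw [divTable, ih _ (by omega) k 0 rfl]
    simp only [deltaTable]
    field_simp
    simp
    ring
  · rw [divTable, ih _ (by omega) (k + 1) l rfl, ih _ (by omega) k (l + 1) rfl]
    simp only [deltaTable]
    rw [show k + 1 + (l + 1) = (k + l + 1) + 1 by ring, Nat.choose_succ_succ,
      show k + 1 + l = k + l + 1 by ring, show k + (l + 1) = k + l + 1 by ring]
    push_cast
    field_simp
    simp
    ring

theorem squareTable_const {ξ η : ℂ} (h : ξ ≠ η) (k l : ℕ) :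
    squareTable (fun _ => ξ) (fun _ => η) k l =
      (-1) ^ k * ((k + l + 1 : ℕ) : ℂ) * ((k + l).choose k : ℂ) / (ξ - η) ^ (k + l + 2) := by
  have h0 := sub_ne_zero.mpr h
  unfold squareTable
  induction hn : k + l using Nat.strong_induction_on generalizing k l with
  | _ n ih =>
  subst hn
  rcases k with _ | k <;> rcases l with _ | l
  · rw [divTable, divTable_delta_const h]; simp; field_simp
  · rw [divTable, ih _ (by omega) 0 l rfl, divTable_delta_const h]
    field_simp
    simp
    ring
  · rw [divTable, ih _ (by omega) k 0 rfl, divTable_delta_const h]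
    field_simp
    simp
    ring
  · rw [divTable, ih _ (by omega) (k + 1) l rfl, ih _ (by omega) k (l + 1) rfl,
      divTable_delta_const h]
    rw [show k + 1 + (l + 1) = (k + l + 1) + 1 by ring, Nat.choose_succ_succ,
      show k + 1 + l = k + l + 1 by ring, show k + (l + 1) = k + l + 1 by ring]
    push_cast
    field_simp
    ring

theorem excKernelDeriv_eq_squareTable {ξ η : ℂ} (h : ξ ≠ η) (k l : ℕ) : excKernelDeriv k l ξ η =
    (k.factorial : ℂ) * (1 / (Real.pi : ℂ) * squareTable (fun _ => ξ) (fun _ => η) k l) *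
      (l.factorial : ℂ) := by
  rw [excKernelDeriv_eq, squareTable_const h, Nat.factorial_succ,
    ← Nat.choose_mul_factorial_mul_factorial (Nat.le_add_right k l), Nat.add_sub_cancel_left]
  push_cast
  ring

/-- The tables depend continuously on the nodes. -/
theorem tendsto_divTable {ι : Type*} {f : Filter ι} {X Y : ι → ℕ → ℂ} {S : ι → ℕ → ℕ → ℂ}
    {R : ℕ → ℕ → ℂ} {m n : ℕ} (hX : ∀ k < m, Tendsto (fun i => X i k) f (𝓝 (x k)))
    (hY : ∀ l < n, Tendsto (fun i => Y i l) f (𝓝 (y l)))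
    (hS : ∀ k < m, ∀ l < n, Tendsto (fun i => S i k l) f (𝓝 (R k l)))
    (hxy : ∀ k < m, ∀ l < n, x k ≠ y l) (k l : ℕ) (hk : k < m) (hl : l < n) :
    Tendsto (fun i => divTable (X i) (Y i) (S i) k l) f (𝓝 (divTable x y R k l)) := by
  have key : ∀ k < m, ∀ l < n, ∀ {u : ι → ℂ} {v : ℂ}, Tendsto u f (𝓝 v) →
      Tendsto (fun i => u i / (X i k - Y i l)) f (𝓝 (v / (x k - y l))) := fun k hk l hl u v hu =>
    hu.div ((hX k hk).sub (hY l hl)) (sub_ne_zero.mpr (hxy k hk l hl))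
  induction hn : k + l using Nat.strong_induction_on generalizing k l with
  | _ d ih =>
  rcases k with _ | k <;> rcases l with _ | l <;> simp only [divTable]
  · exact key _ hk _ hl (hS _ hk _ hl)
  · exact key _ hk _ hl ((hS _ hk _ hl).add (ih _ (by omega) 0 l (by omega) (by omega) rfl))
  · exact key _ hk _ hl ((hS _ hk _ hl).sub (ih _ (by omega) k 0 (by omega) (by omega) rfl))
  · exact key _ hk _ hl (((hS _ hk _ hl).sub (ih _ (by omega) k (l + 1) (by omega) hl rfl)).add
      (ih _ (by omega) (k + 1) l hk (by omega) rfl))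

theorem tendsto_squareTable {ι : Type*} {f : Filter ι} {X Y : ι → ℕ → ℂ} {m n : ℕ}
    (hX : ∀ k < m, Tendsto (fun i => X i k) f (𝓝 (x k)))
    (hY : ∀ l < n, Tendsto (fun i => Y i l) f (𝓝 (y l)))
    (hxy : ∀ k < m, ∀ l < n, x k ≠ y l) (k l : ℕ) (hk : k < m) (hl : l < n) :
    Tendsto (fun i => squareTable (X i) (Y i) k l) f (𝓝 (squareTable x y k l)) :=
  tendsto_divTable hX hY (fun k hk l hl => tendsto_divTable (S := fun _ => deltaTable) hX hY
    (fun _ _ _ _ => tendsto_const_nhds) hxy k l hk hl) hxy k l hk hl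

end Newton

/-! ### Kernel evaluations of antisymmetric vectors -/

section KernelEvalAntisym

variable {N : ℕ} {ς : Composition (2 * N)}

theorem kernelEval_apply (K : Fin (2 * N) → Fin (2 * N) → ℂ) (v : MonoidAlgebra ℂ (Tabloid N)) :
    kernelEval K v = (N.factorial : ℂ)⁻¹ * ∑ t ∈ v.coeff.support, v.coeff t * rowProd K t := rfl

theorem tendsto_kernelEval {ι : Type*} {f : Filter ι} {K : ι → Fin (2 * N) → Fin (2 * N) → ℂ}
    {K₀ : Fin (2 * N) → Fin (2 * N) → ℂ} (h : ∀ a b, Tendsto (fun i => K i a b) f (𝓝 (K₀ a b)))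
    (v : MonoidAlgebra ℂ (Tabloid N)) :
    Tendsto (fun i => kernelEval (K i) v) f (𝓝 (kernelEval K₀ v)) := by
  simp only [kernelEval_apply]
  exact (tendsto_finsetSum _ fun t _ => (tendsto_finsetProd _ fun i _ =>
    h _ _).const_mul _).const_mul _

/-- A product over the sites is a product over the rows of a numbering. -/
theorem prod_entry (B : Numbering N) (f : Fin (2 * N) → ℂ) :
    ∏ i : Fin N, (f (B.entry i 0) * f (B.entry i 1)) = ∏ a, f a := by
  rw [← Equiv.prod_comp (show Fin N × Fin 2 ≃ Fin (2 * N) from B) f, Fintype.prod_prod_type]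
  refine Finset.prod_congr rfl fun i _ => ?_
  rw [Fin.prod_univ_two]
  rfl

theorem kernelEval_diagonal (d : Fin (2 * N) → ℂ) (K : Fin (2 * N) → Fin (2 * N) → ℂ)
    (v : MonoidAlgebra ℂ (Tabloid N)) :
    kernelEval (fun a b => d a * K a b * d b) v = (∏ a, d a) * kernelEval K v := by
  have h : ∀ t, rowProd (fun a b => d a * K a b * d b) t = (∏ a, d a) * rowProd K t := by
    intro t
    unfold rowProd
    rw [← prod_entry (Quotient.out (s := rowSetoid N) t) d, ← Finset.prod_mul_distrib]
    exact Finset.prod_congr rfl fun i _ => by ring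
  simp only [kernelEval_apply, h, Finset.mul_sum]
  exact Finset.sum_congr rfl fun t _ => by ring

/-- Antisymmetric vectors only involve tabloids without a row inside a group. -/
theorem kernelEval_congr {K K' : Fin (2 * N) → Fin (2 * N) → ℂ}
    (h : ∀ a b, ς.index a ≠ ς.index b → K a b = K' a b) {v : MonoidAlgebra ℂ (Tabloid N)}
    (hv : v ∈ antiSub ς) : kernelEval K v = kernelEval K' v := by
  rw [kernelEval_apply, kernelEval_apply]
  congr 1
  refine Finset.sum_congr rfl fun t ht => ?_
  congr 1
  unfold rowProd
  refine Finset.prod_congr rfl fun i _ => h _ _ fun hi => ?_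
  have ht0 := Finsupp.mem_support_iff.mp ht
  set B : Numbering N := Quotient.out (s := rowSetoid N) t with hB
  have hBt : B.tabloid = t := Quotient.out_eq (s := rowSetoid N) t
  have h1 := congrArg (fun w => w.coeff t) (hv.2 _ (swap_mem_young hi))
  have hne : B.entry i 0 ≠ B.entry i 1 := fun h => by simpa using (B.entry_inj.mp h).2
  simp only [Representation.coeff_ofMulAction, MonoidAlgebra.coeff_smul, Finsupp.smul_apply,
    csign_swap hne, Equiv.swap_inv] at h1
  rw [← hBt, swap_smul_tabloid, smul_eq_mul] at h1
  rw [← hBt] at ht0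
  exact ht0 (by linear_combination (1 / 2 : ℂ) * h1)

/-- The product over the rows of a numbering is expanded by choosing a label of each site. -/
theorem Numbering.prod_expand {Λ : Type*} [Fintype Λ] (B : Numbering N) (L : Fin (2 * N) → Λ → ℂ)
    (C : Fin (2 * N) → Fin (2 * N) → Λ → Λ → ℂ) :
    ∏ i, (∑ μ, ∑ ν, L (B.entry i 0) μ * C (B.entry i 0) (B.entry i 1) μ ν * L (B.entry i 1) ν) =
      ∑ g : Fin (2 * N) → Λ, (∏ a, L a (g a)) *
        ∏ i, C (B.entry i 0) (B.entry i 1) (g (B.entry i 0)) (g (B.entry i 1)) := by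
  classical
  simp only [← Fintype.sum_prod_type']
  rw [Finset.prod_univ_sum, Fintype.piFinset_univ]
  symm
  refine Finset.sum_bij (fun g _ i => (g (B.entry i 0), g (B.entry i 1)))
    (fun _ _ => Finset.mem_univ _) ?_ ?_ ?_
  · intro g _ g' _ h
    funext a
    have h1 := congrFun h (B.row a)
    simp only [Prod.mk.injEq] at h1
    have h2 := B.entry_row_col a
    generalize B.col a = c at h2
    fin_cases c
    · rw [← h2]; exact h1.1
    · rw [← h2]; exact h1.2
  · intro G _
    refine ⟨fun a => if B.col a = 0 then (G (B.row a)).1 else (G (B.row a)).2,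
      Finset.mem_univ _, ?_⟩
    funext i
    simp
  · intro g _
    rw [← prod_entry B fun a => L a (g a), ← Finset.prod_mul_distrib]
    exact Finset.prod_congr rfl fun i _ => by ring

theorem rowProd_congruence (L K : Fin (2 * N) → Fin (2 * N) → ℂ) (t : Tabloid N) :
    rowProd (fun a b => ∑ c, ∑ d, L a c * K c d * L b d) t =
      ∑ g : Fin (2 * N) → Fin (2 * N), (∏ a, L a (g a)) * rowProd (fun a b => K (g a) (g b)) t :=
  Numbering.prod_expand _ L fun _ _ => K

/-- A congruence transformation of the kernel which acts within the groups multiplies the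
evaluation of antisymmetric vectors by the determinant of the transformation. -/
theorem kernelEval_congruence {L K : Fin (2 * N) → Fin (2 * N) → ℂ}
    (hL : ∀ a c, ς.index c ≠ ς.index a → L a c = 0) (hK : ∀ a b, K a b = K b a)
    {v : MonoidAlgebra ℂ (Tabloid N)} (hv : v ∈ antiSub ς) :
    kernelEval (fun a b => ∑ c, ∑ d, L a c * K c d * L b d) v =
      Matrix.det (Matrix.of L) * kernelEval K v := by
  classical
  have h1 : kernelEval (fun a b => ∑ c, ∑ d, L a c * K c d * L b d) v =
      ∑ g : Fin (2 * N) → Fin (2 * N),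
        (∏ a, L a (g a)) * kernelEval (fun a b => K (g a) (g b)) v := by
    simp only [kernelEval_apply, rowProd_congruence, Finset.mul_sum]
    rw [Finset.sum_comm]
    refine Finset.sum_congr rfl fun g _ => Finset.sum_congr rfl fun t _ => by ring
  have h0 : ∀ g : Fin (2 * N) → Fin (2 * N), ¬ Function.Injective g →
      (∏ a, L a (g a)) * kernelEval (fun a b => K (g a) (g b)) v = 0 := by
    intro g hg
    by_cases hyoung : ∀ a, ς.index (g a) = ς.index a
    · obtain ⟨a, b, hab, hne⟩ : ∃ a b, g a = g b ∧ a ≠ b := by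
        by_contra! hc
        exact hg fun a b h => hc a b h
      have hidx : ς.index a = ς.index b := by rw [← hyoung a, hab, hyoung b]
      have h2 := kernelEval_tabloidRep (K := fun a b => K (g a) (g b)) (fun a b => hK _ _)
        (Equiv.swap a b) v
      have h3 : ∀ c, g (Equiv.swap a b c) = g c := by
        intro c
        rcases eq_or_ne c a with rfl | hi
        · rw [Equiv.swap_apply_left, hab]
        rcases eq_or_ne c b with rfl | hj
        · rw [Equiv.swap_apply_right, hab]
        rw [Equiv.swap_apply_of_ne_of_ne hi hj]
      rw [hv.2 _ (swap_mem_young hidx), csign_swap hne, neg_one_smul, map_neg] at h2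
      simp only [h3] at h2
      rw [show kernelEval (fun a b => K (g a) (g b)) v = 0 by linear_combination (-1 / 2 : ℂ) * h2,
        mul_zero]
    · obtain ⟨a, ha⟩ := not_forall.mp hyoung
      rw [Finset.prod_eq_zero (Finset.mem_univ a) (hL a (g a) ha), zero_mul]
  rw [h1, ← Matrix.det_transpose, Matrix.det_apply', Finset.sum_mul]
  symm
  refine Finset.sum_of_injOn (fun σ : Equiv.Perm (Fin (2 * N)) => (σ : Fin (2 * N) → Fin (2 * N)))
    (fun σ _ τ _ h => DFunLike.coe_injective h) (fun _ _ => Finset.mem_coe.mpr (Finset.mem_univ _))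
    ?_ ?_
  · intro g _ hg
    refine h0 g fun hinj => hg ?_
    exact ⟨Equiv.ofBijective g (Finite.injective_iff_bijective.mp hinj), by simp, rfl⟩
  · intro σ _
    simp only [Matrix.transpose_apply, Matrix.of_apply]
    by_cases hσ : ∀ a, ς.index (σ a) = ς.index a
    · rw [← kernelEval_tabloidRep hK σ v, hv.2 σ hσ, map_smul, smul_eq_mul, csign]
      ring
    · obtain ⟨a, ha⟩ := not_forall.mp hσ
      rw [Finset.prod_eq_zero (f := fun a => L a (σ a)) (Finset.mem_univ a) (hL a (σ a) ha)]
      ring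

end KernelEvalAntisym

/-! ### Evaluation on the diagonal -/

section DiagEval

variable {N : ℕ} (ς : Composition (2 * N))

/-- The position of a site in its group, counted from zero. -/
def pos (a : Fin (2 * N)) : ℕ := ς.invEmbedding a

theorem sizeUpTo_add_pos (a : Fin (2 * N)) : ς.sizeUpTo (ς.index a) + pos ς a = a := by
  rw [pos, ς.coe_invEmbedding]
  have := ς.sizeUpTo_index_le a
  omega

theorem pos_lt (a : Fin (2 * N)) : pos ς a < ς.blocksFun (ς.index a) := (ς.invEmbedding a).2

theorem pos_embedding (i : Fin ς.length) (m : Fin (ς.blocksFun i)) :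
    pos ς (ς.embedding i m) = m := ς.invEmbedding_comp i m

theorem eq_of_index_pos {a b : Fin (2 * N)} (h : ς.index a = ς.index b) (h' : pos ς a = pos ς b) :
    a = b := by
  have h1 := sizeUpTo_add_pos ς a
  have h2 := sizeUpTo_add_pos ς b
  rw [h, h', h2] at h1
  exact Fin.ext h1.symm

/-- The variables of the `i`-th group as a sequence, which is constant beyond the group. -/
def groupSeq (x : Fin (2 * N) → ℂ) (i : Fin ς.length) (m : ℕ) : ℂ :=
  if h : m < ς.blocksFun i then x (ς.embedding i ⟨m, h⟩) else 0

theorem groupSeq_of_lt (x : Fin (2 * N) → ℂ) (i : Fin ς.length) {m : ℕ} (h : m < ς.blocksFun i) :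
    groupSeq ς x i m = x (ς.embedding i ⟨m, h⟩) := dif_pos h

theorem groupSeq_pos (x : Fin (2 * N) → ℂ) (a : Fin (2 * N)) :
    groupSeq ς x (ς.index a) (pos ς a) = x a := by
  rw [groupSeq_of_lt ς x _ (pos_lt ς a)]
  congr 1
  exact ς.embedding_comp_inv a

/-- The kernel of divided differences, zero within each group. -/
def newtonKernel (x : Fin (2 * N) → ℂ) (a b : Fin (2 * N)) : ℂ :=
  if ς.index a = ς.index b then 0 else 1 / (Real.pi : ℂ) *
    squareTable (groupSeq ς x (ς.index a)) (groupSeq ς x (ς.index b)) (pos ς a) (pos ς b)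

/-- The matrix of the Newton basis polynomials of each group. -/
def newtonMatrix (x : Fin (2 * N) → ℂ) (a c : Fin (2 * N)) : ℂ :=
  if ς.index a = ς.index c then
    ∏ m ∈ Finset.range (pos ς c), (x a - groupSeq ς x (ς.index c) m) else 0

theorem newtonKernel_comm (x : Fin (2 * N) → ℂ) (a b : Fin (2 * N)) :
    newtonKernel ς x a b = newtonKernel ς x b a := by
  unfold newtonKernel
  rw [squareTable_comm]
  exact if_congr eq_comm rfl rfl

theorem sum_index_eq (i : Fin ς.length) (f : ℕ → ℂ) :
    ∑ c : Fin (2 * N), (if ς.index c = i then f (pos ς c) else 0) =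
      ∑ m ∈ Finset.range (ς.blocksFun i), f m := by
  rw [← Finset.sum_filter, ← Fin.sum_univ_eq_sum_range]
  symm
  refine Finset.sum_bij (fun m _ => ς.embedding i m) ?_ ?_ ?_ ?_
  · intro m _
    simp
  · intro m _ m' _ h
    exact (ς.embedding i).injective h
  · intro c hc
    obtain rfl := (Finset.mem_filter.mp hc).2
    exact ⟨ς.invEmbedding c, Finset.mem_univ _, ς.embedding_comp_inv c⟩
  · intro m _
    rw [pos_embedding]

/-- Newton interpolation in the variables of two different groups. -/
theorem excKernel_eq_newton {x : Fin (2 * N) → ℂ} (hx : Function.Injective x) {a b : Fin (2 * N)}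
    (hab : ς.index a ≠ ς.index b) : excKernel (x a) (x b) =
      ∑ c, ∑ d, newtonMatrix ς x a c * newtonKernel ς x c d * newtonMatrix ς x b d := by
  have hne : ∀ k l, k < ς.blocksFun (ς.index a) → l < ς.blocksFun (ς.index b) →
      groupSeq ς x (ς.index a) k ≠ groupSeq ς x (ς.index b) l := by
    intro k l hk hl h
    rw [groupSeq_of_lt ς x _ hk, groupSeq_of_lt ς x _ hl] at h
    have h2 := congrArg ς.index (hx h)
    rw [ς.index_embedding, ς.index_embedding] at h2
    exact hab h2
  have h := newton_squareTable (pos_lt ς a) (pos_lt ς b) hne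
  rw [groupSeq_pos, groupSeq_pos] at h
  rw [excKernel, ← h, Finset.mul_sum, ← sum_index_eq]
  refine Finset.sum_congr rfl fun c _ => ?_
  split_ifs with hc
  · rw [Finset.mul_sum, ← sum_index_eq]
    refine Finset.sum_congr rfl fun d _ => ?_
    split_ifs with hd
    · rw [newtonMatrix, newtonMatrix, newtonKernel, if_pos hc.symm, if_pos hd.symm,
        if_neg (by rwa [hc, hd]), hc, hd]
      ring
    · rw [newtonMatrix.eq_def ς x b d, if_neg fun h => hd h.symm, mul_zero]
  · refine (Finset.sum_eq_zero fun d _ => ?_).symm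
    rw [newtonMatrix, if_neg fun h => hc h.symm, zero_mul, zero_mul]

theorem pos_lt_pos {a b : Fin (2 * N)} (h : ς.index a = ς.index b) :
    pos ς a < pos ς b ↔ a < b := by
  have h1 := sizeUpTo_add_pos ς a
  have h2 := sizeUpTo_add_pos ς b
  rw [h] at h1
  rw [Fin.lt_def]
  omega

theorem det_newtonMatrix (x : Fin (2 * N) → ℂ) :
    Matrix.det (Matrix.of (newtonMatrix ς x)) =
      ∏ p : Fin (2 * N) × Fin (2 * N) with p.1 < p.2 ∧ ς.index p.1 = ς.index p.2,
        (x p.2 - x p.1) := by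
  rw [Matrix.det_of_isLowerTriangular]
  · rw [Finset.prod_filter, Fintype.prod_prod_type_right]
    refine Finset.prod_congr rfl fun b _ => ?_
    rw [Matrix.of_apply, newtonMatrix, if_pos rfl, ← Finset.prod_filter]
    symm
    refine Finset.prod_bij (fun a _ => pos ς a) ?_ ?_ ?_ ?_
    · intro a ha
      have ha' := (Finset.mem_filter.mp ha).2
      exact Finset.mem_range.mpr ((pos_lt_pos ς ha'.2).mpr ha'.1)
    · intro a ha a' ha' h
      exact eq_of_index_pos ς ((Finset.mem_filter.mp ha).2.2.trans
        (Finset.mem_filter.mp ha').2.2.symm) h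
    · intro m hm
      have hm' := Finset.mem_range.mp hm
      have hlt := pos_lt ς b
      have h1 : ς.index (ς.embedding (ς.index b) ⟨m, hm'.trans hlt⟩) = ς.index b :=
        ς.index_embedding _ _
      refine ⟨ς.embedding (ς.index b) ⟨m, hm'.trans hlt⟩, Finset.mem_filter.mpr
        ⟨Finset.mem_univ _, (pos_lt_pos ς h1).mp ?_, h1⟩, pos_embedding ς _ _⟩
      rw [pos_embedding]
      exact hm'
    · intro a ha
      have ha' := (Finset.mem_filter.mp ha).2
      rw [← ha'.2, groupSeq_pos]
  · intro a c hac
    rw [Matrix.of_apply, newtonMatrix]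
    split_ifs with h
    · have hlt : a < c := hac
      refine Finset.prod_eq_zero (Finset.mem_range.mpr ((pos_lt_pos ς h).mpr hlt)) ?_
      rw [← h, groupSeq_pos, sub_self]
    · rfl

theorem groupVandermonde_ne_zero (x : Conf (2 * N)) : groupVandermonde ς x ≠ 0 :=
  Finset.prod_ne_zero_iff.mpr fun _ hp => sub_ne_zero.mpr fun h =>
    (Finset.mem_filter.mp hp).2.1.ne (x.2 h).symm

variable {ς}

/-- The unfused evaluation of an antisymmetric vector is a Vandermonde product times a function
which extends continuously to the diagonal. -/
theorem kernelEval_unfused {v : MonoidAlgebra ℂ (Tabloid N)} (hv : v ∈ antiSub ς)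
    (x : Conf (2 * N)) : kernelEval (unfusedKernel x) v =
      groupVandermonde ς x * kernelEval (newtonKernel ς x.1) v := by
  rw [groupVandermonde, ← det_newtonMatrix,
    ← kernelEval_congruence (ς := ς) (K := newtonKernel ς x.1) ?_
    (newtonKernel_comm ς x.1) hv]
  · refine kernelEval_congr (ς := ς) (fun a b hab => ?_) hv
    rw [← excKernel_eq_newton ς x.2 hab, unfusedKernel, if_neg]
    rintro rfl
    exact hab rfl
  · intro a c h
    exact if_neg fun h' => h h'.symm

variable (ς)

/-- The product of the factorials by which derivatives and divided differences differ. -/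
def factorialFactor : ℂ := ∏ a : Fin (2 * N), ((pos ς a).factorial : ℂ)

theorem factorialFactor_ne_zero : factorialFactor ς ≠ 0 :=
  Finset.prod_ne_zero_iff.mpr fun a _ => by exact_mod_cast (pos ς a).factorial_ne_zero

theorem fusedKernel_comm (ξ : Conf ς.length) (a b : Fin (2 * N)) :
    fusedKernel ς ξ a b = fusedKernel ς ξ b a := by
  unfold fusedKernel
  rw [excKernelDeriv_comm]
  exact if_congr eq_comm rfl rfl

theorem squareTable_congr {x x' y y' : ℕ → ℂ} {k l : ℕ} (hx : ∀ i ≤ k, x i = x' i)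
    (hy : ∀ j ≤ l, y j = y' j) : squareTable x y k l = squareTable x' y' k l := by
  have key : ∀ {R R' : ℕ → ℕ → ℂ} (k l : ℕ), (∀ i ≤ k, x i = x' i) → (∀ j ≤ l, y j = y' j) →
      (∀ i ≤ k, ∀ j ≤ l, R i j = R' i j) → divTable x y R k l = divTable x' y' R' k l := by
    intro R R' k l
    induction hn : k + l using Nat.strong_induction_on generalizing k l with
    | _ n ih =>
    intro hx hy hR
    rcases k with _ | k <;> rcases l with _ | l <;> simp only [divTable]
    · rw [hx 0 le_rfl, hy 0 le_rfl, hR 0 le_rfl 0 le_rfl]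
    · rw [hx 0 le_rfl, hy _ le_rfl, hR 0 le_rfl _ le_rfl, ih _ (by omega) 0 l rfl hx
        (fun j hj => hy j (by omega)) fun i hi j hj => hR i hi j (by omega)]
    · rw [hx _ le_rfl, hy _ le_rfl, hR _ le_rfl _ le_rfl, ih _ (by omega) k 0 rfl
        (fun j hj => hx j (by omega)) hy fun i hi j hj => hR i (by omega) j hj]
    · rw [hx _ le_rfl, hy _ le_rfl, hR _ le_rfl _ le_rfl, ih _ (by omega) k (l + 1) rfl
        (fun j hj => hx j (by omega)) hy fun i hi j hj => hR i (by omega) j hj,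
        ih _ (by omega) (k + 1) l rfl hx
        (fun j hj => hy j (by omega)) fun i hi j hj => hR i hi j (by omega)]
  exact key k l hx hy fun i hi j hj => key i j (fun p hp => hx p (by omega))
    (fun p hp => hy p (by omega)) fun _ _ _ _ => rfl

theorem fusedKernel_eq (ξ : Conf ς.length) (a b : Fin (2 * N)) : fusedKernel ς ξ a b =
    ((pos ς a).factorial : ℂ) * newtonKernel ς (diagPoint ς ξ) a b *
      ((pos ς b).factorial : ℂ) := by
  unfold fusedKernel newtonKernel
  split_ifs with h
  · simp
  · rw [show (ς.invEmbedding a : ℕ) = pos ς a from rfl,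
      show (ς.invEmbedding b : ℕ) = pos ς b from rfl,
      excKernelDeriv_eq_squareTable fun h' => h (ξ.2 h')]
    congr 3
    have ha := pos_lt ς a
    have hb := pos_lt ς b
    refine squareTable_congr (fun i hi => ?_) fun j hj => ?_
    · rw [groupSeq_of_lt ς _ _ (by omega), diagPoint, ς.index_embedding]
    · rw [groupSeq_of_lt ς _ _ (by omega), diagPoint, ς.index_embedding]

theorem kernelEval_fused (ξ : Conf ς.length) (v : MonoidAlgebra ℂ (Tabloid N)) :
    kernelEval (fusedKernel ς ξ) v =
      factorialFactor ς * kernelEval (newtonKernel ς (diagPoint ς ξ)) v := by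
  rw [factorialFactor, ← kernelEval_diagonal]
  congr 2
  funext a b
  exact fusedKernel_eq ς ξ a b

variable {ς}

/-- The evaluation on the diagonal turns the unfused evaluation of an antisymmetric vector into the
fused one. -/
theorem isDiagEval_kernelEval {v : MonoidAlgebra ℂ (Tabloid N)} (hv : v ∈ antiSub ς) :
    IsDiagEval ς (fun x => kernelEval (unfusedKernel x) v / groupVandermonde ς x)
      (fun ξ => (factorialFactor ς)⁻¹ * kernelEval (fusedKernel ς ξ) v) := by
  intro ξ
  have h1 : ∀ x : Conf (2 * N), kernelEval (unfusedKernel x) v / groupVandermonde ς x =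
      kernelEval (newtonKernel ς x.1) v := fun x => by
    rw [kernelEval_unfused hv, mul_div_cancel_left₀ _ (groupVandermonde_ne_zero ς x)]
  simp only [h1]
  rw [kernelEval_fused, ← mul_assoc, inv_mul_cancel₀ (factorialFactor_ne_zero ς), one_mul]
  suffices h : Tendsto (fun x : Fin (2 * N) → ℂ => kernelEval (newtonKernel ς x) v)
      (𝓝 (diagPoint ς ξ)) (𝓝 (kernelEval (newtonKernel ς (diagPoint ς ξ)) v)) from
    h.comp tendsto_comap
  refine tendsto_kernelEval (fun a b => ?_) v
  unfold newtonKernel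
  split_ifs with h
  · exact tendsto_const_nhds
  have hseq : ∀ i, ∀ k < ς.blocksFun i, Tendsto (fun x => groupSeq ς x i k)
      (𝓝 (diagPoint ς ξ)) (𝓝 (groupSeq ς (diagPoint ς ξ) i k)) := by
    intro i k hk
    simp only [groupSeq_of_lt ς _ i hk]
    exact (continuous_apply _).continuousAt
  refine (tendsto_squareTable (hseq _) (hseq _) ?_ _ _ (pos_lt ς a) (pos_lt ς b)).const_mul _
  intro k hk l hl h'
  rw [groupSeq_of_lt ς _ _ hk, groupSeq_of_lt ς _ _ hl, diagPoint, diagPoint,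
    ς.index_embedding, ς.index_embedding] at h'
  exact h (ξ.2 h')

end DiagEval

/-! ### Signs of extremal configurations -/

section Pairs

/-- A product of a symmetric function over pairs can be ordered by any key. -/
theorem prod_pairs_by_key {ι M : Type*} [Fintype ι] [LinearOrder ι] [CommMonoid M] (G : ι → ι → M)
    (hG : ∀ u v, G u v = G v u) (K : ι → ℕ) :
    ∏ p : ι × ι with p.1 < p.2, G p.1 p.2 = (∏ p : ι × ι with K p.1 < K p.2, G p.1 p.2) *
      ∏ p : ι × ι with p.1 < p.2 ∧ K p.1 = K p.2, G p.1 p.2 := by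
  rw [← Finset.prod_filter_mul_prod_filter_not (Finset.univ.filter fun p : ι × ι => p.1 < p.2)
    (fun p => K p.1 = K p.2), Finset.filter_filter, Finset.filter_filter, mul_comm]
  congr 1
  rw [← Finset.prod_filter_mul_prod_filter_not
      (Finset.univ.filter fun p : ι × ι => K p.1 < K p.2) (fun p => p.1 < p.2),
    ← Finset.prod_filter_mul_prod_filter_not
      (Finset.univ.filter fun p : ι × ι => p.1 < p.2 ∧ ¬ K p.1 = K p.2) (fun p => K p.1 < K p.2)]
  simp only [Finset.filter_filter]
  congr 1
  · refine Finset.prod_congr (Finset.filter_congr fun p _ => ?_) fun _ _ => rfl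
    constructor
    · rintro ⟨⟨h1, _⟩, h2⟩; exact ⟨h2, h1⟩
    · rintro ⟨h1, h2⟩; exact ⟨⟨h2, h1.ne⟩, h1⟩
  · refine Finset.prod_bij (fun p _ => p.swap) ?_ ?_ ?_ ?_
    · rintro ⟨u, v⟩ h
      simp only [Finset.mem_filter, Finset.mem_univ, true_and, Prod.swap] at h ⊢
      exact ⟨lt_of_le_of_ne (not_lt.mp h.2) fun h' => h.1.2 h'.symm, h.1.1.not_gt⟩
    · intro p _ q _ h
      exact Prod.swap_injective h
    · rintro ⟨u, v⟩ h
      simp only [Finset.mem_filter, Finset.mem_univ, true_and] at h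
      refine ⟨(v, u), ?_, rfl⟩
      simp only [Finset.mem_filter, Finset.mem_univ, true_and]
      refine ⟨⟨lt_of_le_of_ne (not_lt.mp h.2) fun h' => h.1.ne (by rw [h']), h.1.ne'⟩, h.1.not_gt⟩
    · rintro ⟨u, v⟩ _
      exact hG u v

end Pairs

section Arcs

/-- `-1` if `x` lies strictly between `l` and `r`, and `1` otherwise. -/
def betweenSign (l r x : ℕ) : ℤ := if l < x ∧ x < r then -1 else 1

/-- For arcs `(a i, b i)` with levels `H i`, such that the arcs above each point carry distinct
levels, without gaps from `1` on: an arc strictly below the level of the arc `j` ends under `j` as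
often as it starts under `j`. -/
theorem prod_betweenSign {ι : Type*} [Fintype ι] {a b : ι → ℕ} {H : ι → ℤ}
    (hab : ∀ i, a i < b i) (hpos : ∀ i, 0 < H i)
    (hinj : ∀ k i j, a i < k → k ≤ b i → a j < k → k ≤ b j → H i = H j → i = j)
    (hdown : ∀ k i, a i < k → k ≤ b i → ∀ h, 0 < h → h < H i → ∃ j, a j < k ∧ k ≤ b j ∧ H j = h)
    (j : ι) : ∏ i with H i < H j,
      (betweenSign (a j) (b j) (a i) * betweenSign (a j) (b j) (b i)) = 1 := by
  classical
  -- the levels below that of `j` each occur exactly once above every point under the arc `j`, so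
  -- that the number of open arcs on these levels is constant there
  have hcard : ∀ k, a j < k → k ≤ b j →
      ((Finset.univ.filter fun i => H i < H j ∧ a i < k).card : ℤ) =
        (Finset.univ.filter fun i => H i < H j ∧ b i < k).card + (H j - 1) := by
    intro k h1 h2
    have h3 : (Finset.univ.filter fun i => H i < H j ∧ a i < k ∧ k ≤ b i).card =
        (Finset.Ico 1 (H j)).card := by
      refine Finset.card_bij (fun i _ => H i) ?_ ?_ ?_
      · intro i hi
        have := (Finset.mem_filter.mp hi).2
        exact Finset.mem_Ico.mpr ⟨hpos i, this.1⟩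
      · intro i hi i' hi' h
        have h4 := (Finset.mem_filter.mp hi).2
        have h5 := (Finset.mem_filter.mp hi').2
        exact hinj k i i' h4.2.1 h4.2.2 h5.2.1 h5.2.2 h
      · intro h hh
        rw [Finset.mem_Ico] at hh
        obtain ⟨i, hi1, hi2, rfl⟩ := hdown k j h1 h2 h (by omega) hh.2
        exact ⟨i, Finset.mem_filter.mpr ⟨Finset.mem_univ _, hh.2, hi1, hi2⟩, rfl⟩
    have h4 := Finset.card_filter_add_card_filter_not
      (s := Finset.univ.filter fun i => H i < H j ∧ a i < k) (p := fun i => k ≤ b i)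
    rw [Finset.filter_filter, Finset.filter_filter] at h4
    have h5 : (Finset.univ.filter fun i => (H i < H j ∧ a i < k) ∧ ¬ k ≤ b i) =
        Finset.univ.filter fun i => H i < H j ∧ b i < k := by
      refine Finset.filter_congr fun i _ => ?_
      have := hab i
      constructor
      · rintro ⟨⟨h, _⟩, h'⟩; exact ⟨h, by omega⟩
      · rintro ⟨h, h'⟩; exact ⟨⟨h, by omega⟩, by omega⟩
    have h6 : (Finset.univ.filter fun i => (H i < H j ∧ a i < k) ∧ k ≤ b i) =
        Finset.univ.filter fun i => H i < H j ∧ a i < k ∧ k ≤ b i :=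
      Finset.filter_congr fun i _ => by rw [and_assoc]
    rw [h5, h6, h3, Int.card_Ico] at h4
    have := hpos j
    omega
  have hsplit : ∀ f : ι → ℕ, (Finset.univ.filter fun i => H i < H j ∧ f i < b j).card =
      (Finset.univ.filter fun i => H i < H j ∧ f i < a j + 1).card +
        (Finset.univ.filter fun i => H i < H j ∧ (a j < f i ∧ f i < b j)).card := by
    intro f
    rw [← Finset.card_filter_add_card_filter_not
      (s := Finset.univ.filter fun i => H i < H j ∧ f i < b j) (p := fun i => f i < a j + 1),
      Finset.filter_filter, Finset.filter_filter]
    have := hab j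
    congr 2
    · refine Finset.filter_congr fun i _ => ?_
      constructor
      · rintro ⟨⟨h, _⟩, h'⟩; exact ⟨h, h'⟩
      · rintro ⟨h, h'⟩; exact ⟨⟨h, by omega⟩, h'⟩
    · refine Finset.filter_congr fun i _ => ?_
      constructor
      · rintro ⟨⟨h, _⟩, h'⟩; exact ⟨h, by omega, by omega⟩
      · rintro ⟨h, h'⟩; exact ⟨⟨h, by omega⟩, by omega⟩
  have key : (Finset.univ.filter fun i => H i < H j ∧ (a j < a i ∧ a i < b j)).card =
      (Finset.univ.filter fun i => H i < H j ∧ (a j < b i ∧ b i < b j)).card := by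
    have h1 := hcard (a j + 1) (by omega) (hab j)
    have h2 := hcard (b j) (hab j) le_rfl
    have h3 := hsplit a
    have h4 := hsplit b
    omega
  have hprod : ∀ f : ι → ℕ, ∏ i with H i < H j, betweenSign (a j) (b j) (f i) =
      (-1) ^ (Finset.univ.filter fun i => H i < H j ∧ (a j < f i ∧ f i < b j)).card := by
    intro f
    simp only [betweenSign]
    rw [Finset.prod_ite, Finset.prod_const, Finset.prod_const_one, mul_one, Finset.filter_filter]
  rw [Finset.prod_mul_distrib, hprod, hprod, key, ← mul_pow]
  norm_num

end Arcs

section Extremal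

variable {N : ℕ}

/-- The sites `a` are divided into groups by a map `c`; a configuration of chords from the first
column of `A` to the second one, with labels `g`, is extremal if all chords point forward and if,
above each cut between groups, the labels of the chords are distinct and without gaps from `1` on.
-/
structure IsExtremal (c : Fin (2 * N) → ℕ) (A : Numbering N) (m : Equiv.Perm (Fin N))
    (g : Fin (2 * N) → ℤ) : Prop where
  lt : ∀ i, c (A.entry i 0) < c (A.entry (m i) 1)
  pos : ∀ i, 0 < g (A.entry i 0)
  neg : ∀ i, g (A.entry (m i) 1) = - g (A.entry i 0)
  inj : ∀ k i j, c (A.entry i 0) < k → k ≤ c (A.entry (m i) 1) → c (A.entry j 0) < k →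
    k ≤ c (A.entry (m j) 1) → g (A.entry i 0) = g (A.entry j 0) → i = j
  down : ∀ k i, c (A.entry i 0) < k → k ≤ c (A.entry (m i) 1) → ∀ h, 0 < h → h < g (A.entry i 0) →
    ∃ j, c (A.entry j 0) < k ∧ k ≤ c (A.entry (m j) 1) ∧ g (A.entry j 0) = h

/-- The Vandermonde product of the labels within each group. -/
def labelVandermonde (c : Fin (2 * N) → ℕ) (g : Fin (2 * N) → ℤ) : ℤ :=
  ∏ p : Fin (2 * N) × Fin (2 * N) with p.1 < p.2 ∧ c p.1 = c p.2, (g p.2 - g p.1)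

/-- The order of two sites: by groups, and by labels within a group. -/
def orderSign (c : Fin (2 * N) → ℕ) (g : Fin (2 * N) → ℤ) (u v : Fin (2 * N)) : ℤ :=
  if c u = c v then (g v - g u).sign else ((c v : ℤ) - c u).sign

theorem orderSign_antisymm (c : Fin (2 * N) → ℕ) (g : Fin (2 * N) → ℤ) (u v : Fin (2 * N)) :
    orderSign c g u v = - orderSign c g v u := by
  unfold orderSign
  simp only [eq_comm (a := c v)]
  split_ifs
  · rw [← Int.sign_neg, neg_sub]
  · rw [← Int.sign_neg, neg_sub]

theorem orderSign_pos {c : Fin (2 * N) → ℕ} {g : Fin (2 * N) → ℤ} {u v : Fin (2 * N)}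
    (h : c u ≤ c v) (h' : c u = c v → g u < g v) : orderSign c g u v = 1 := by
  unfold orderSign
  split_ifs with h1
  · exact Int.sign_eq_one_of_pos (by have := h' h1; omega)
  · exact Int.sign_eq_one_of_pos (by omega)

theorem orderSign_neg {c : Fin (2 * N) → ℕ} {g : Fin (2 * N) → ℤ} {u v : Fin (2 * N)}
    (h : c v ≤ c u) (h' : c u = c v → g v < g u) : orderSign c g u v = -1 := by
  rw [orderSign_antisymm, orderSign_pos h fun h1 => h' h1.symm]

theorem prod_orderSign {c : Fin (2 * N) → ℕ} (hc : Monotone c) (g : Fin (2 * N) → ℤ) :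
    ∏ p : Fin (2 * N) × Fin (2 * N) with p.1 < p.2, orderSign c g p.1 p.2 =
      (labelVandermonde c g).sign := by
  have hsign : ∀ s : Finset (Fin (2 * N) × Fin (2 * N)), ∀ f : Fin (2 * N) × Fin (2 * N) → ℤ,
      (∏ p ∈ s, f p).sign = ∏ p ∈ s, (f p).sign := by
    intro s f
    classical
    induction s using Finset.induction_on with
    | empty => simp
    | insert p s hp ih => rw [Finset.prod_insert hp, Finset.prod_insert hp, Int.sign_mul, ih]
  unfold labelVandermonde
  rw [hsign, ← Finset.prod_filter_mul_prod_filter_not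
    (Finset.univ.filter fun p : Fin (2 * N) × Fin (2 * N) => p.1 < p.2) (fun p => c p.1 = c p.2),
    Finset.filter_filter, Finset.filter_filter]
  rw [Finset.prod_eq_one (s := Finset.univ.filter fun p : Fin (2 * N) × Fin (2 * N) =>
    p.1 < p.2 ∧ ¬ c p.1 = c p.2), mul_one]
  · refine Finset.prod_congr rfl fun p hp => ?_
    rw [orderSign, if_pos (Finset.mem_filter.mp hp).2.2]
  · intro p hp
    have h := (Finset.mem_filter.mp hp).2
    exact orderSign_pos (hc h.1.le) fun h' => absurd h' h.2

theorem prod_orderSign_perm (σ : Equiv.Perm (Fin (2 * N))) (c : Fin (2 * N) → ℕ)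
    (g : Fin (2 * N) → ℤ) :
    ∏ p : Fin (2 * N) × Fin (2 * N) with p.1 < p.2, orderSign c g (σ p.1) (σ p.2) =
      (Equiv.Perm.sign σ : ℤ) *
        ∏ p : Fin (2 * N) × Fin (2 * N) with p.1 < p.2, orderSign c g p.1 p.2 := by
  have h := σ.prod_Iio_comp_eq_sign_mul_prod (orderSign_antisymm c g)
  have h1 : ∀ f : Fin (2 * N) → Fin (2 * N) → ℤ,
      ∏ p : Fin (2 * N) × Fin (2 * N) with p.1 < p.2, f p.1 p.2 =
        ∏ j, ∏ i ∈ Finset.Iio j, f i j := by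
    intro f
    rw [Finset.prod_filter, Fintype.prod_prod_type_right]
    refine Finset.prod_congr rfl fun j _ => ?_
    rw [← Finset.prod_filter]
    refine Finset.prod_congr (by ext; simp) fun _ _ => rfl
  rw [h1 fun u v => orderSign c g (σ u) (σ v), h1 (orderSign c g), h]
  simp

/-- The ends of two different links of a planar pair partition form an even number of
inversions. -/
theorem LinkPattern.IsNumbering.prod_sign {α : LinkPattern N} {A : Numbering N}
    (hA : α.IsNumbering A) {i j : Fin N} (hij : i ≠ j) :
    ∏ s : Fin 2, ∏ t : Fin 2, (((A.entry j t : ℕ) : ℤ) - (A.entry i s : ℕ)).sign = 1 := by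
  have h : ∀ i j : Fin N, A.entry i 0 < A.entry j 0 →
      ∏ s : Fin 2, ∏ t : Fin 2, (((A.entry j t : ℕ) : ℤ) - (A.entry i s : ℕ)).sign = 1 ∧
      ∏ s : Fin 2, ∏ t : Fin 2, (((A.entry i t : ℕ) : ℤ) - (A.entry j s : ℕ)).sign = 1 := by
    intro i j hlt
    have hi := (hA i).1
    have hj := (hA j).1
    have hnc := α.noncrossing (A.entry i 0) (A.entry j 0)
    rw [← (hA i).2] at hi hnc
    rw [← (hA j).2] at hj hnc
    have hne : A.entry i 1 ≠ A.entry j 1 := fun h => by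
      have := (A.entry_inj.mp h).1
      rw [this] at hlt
      exact lt_irrefl _ hlt
    have hne' : A.entry i 1 ≠ A.entry j 0 := fun h => by
      simpa using (A.entry_inj.mp h).2
    simp only [Fin.prod_univ_two]
    simp only [Fin.lt_def, ne_eq, Fin.ext_iff] at hlt hi hj hnc hne hne'
    have e1 : (((A.entry j 0 : ℕ) : ℤ) - (A.entry i 0 : ℕ)).sign = 1 :=
      Int.sign_eq_one_of_pos (by omega)
    have e2 : (((A.entry j 1 : ℕ) : ℤ) - (A.entry i 0 : ℕ)).sign = 1 :=
      Int.sign_eq_one_of_pos (by omega)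
    have e3 : (((A.entry j 0 : ℕ) : ℤ) - (A.entry i 1 : ℕ)).sign =
        (((A.entry j 1 : ℕ) : ℤ) - (A.entry i 1 : ℕ)).sign := by
      rcases lt_or_ge (A.entry i 1 : ℕ) (A.entry j 0 : ℕ) with h | h
      · rw [Int.sign_eq_one_of_pos (by omega), Int.sign_eq_one_of_pos (by omega)]
      · rw [Int.sign_eq_neg_one_of_neg (by omega), Int.sign_eq_neg_one_of_neg (by omega)]
    have e4 : (((A.entry j 1 : ℕ) : ℤ) - (A.entry i 1 : ℕ)).sign *
        (((A.entry j 1 : ℕ) : ℤ) - (A.entry i 1 : ℕ)).sign = 1 := by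
      rcases lt_or_ge (A.entry i 1 : ℕ) (A.entry j 1 : ℕ) with h | h
      · rw [Int.sign_eq_one_of_pos (by omega)]; rfl
      · rw [Int.sign_eq_neg_one_of_neg (by omega)]; rfl
    have ef : ∀ x y : ℤ, (x - y).sign = - (y - x).sign := fun x y => by
      rw [← Int.sign_neg, neg_sub]
    constructor
    · rw [e1, e2, e3, e4]; rfl
    · rw [ef (A.entry i 0 : ℕ) (A.entry j 0 : ℕ), ef (A.entry i 1 : ℕ) (A.entry j 0 : ℕ),
        ef (A.entry i 0 : ℕ) (A.entry j 1 : ℕ), ef (A.entry i 1 : ℕ) (A.entry j 1 : ℕ),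
        e1, e2, e3]
      linear_combination e4
  rcases lt_or_gt_of_ne fun h => hij (A.entry_inj.mp h).1 with h1 | h1
  · exact (h i j h1).1
  · exact (h j i h1).2

/-- The orders of the ends of two chords on different levels. -/
theorem IsExtremal.prod_orderSign_of_lt {c : Fin (2 * N) → ℕ} {A : Numbering N}
    {m : Equiv.Perm (Fin N)} {g : Fin (2 * N) → ℤ} (h : IsExtremal c A m g) {i j : Fin N}
    (hij : g (A.entry i 0) < g (A.entry j 0)) :
    ∏ s : Fin 2, ∏ t : Fin 2,
      orderSign c g (A.entry (![1, m] s i) s) (A.entry (![1, m] t j) t) =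
      betweenSign (c (A.entry j 0)) (c (A.entry (m j) 1)) (c (A.entry i 0)) *
        betweenSign (c (A.entry j 0)) (c (A.entry (m j) 1)) (c (A.entry (m i) 1)) := by
  have hi := h.lt i
  have hj := h.lt j
  have pi := h.pos i
  have pj := h.pos j
  have ni := h.neg i
  have nj := h.neg j
  simp only [Fin.prod_univ_two, Matrix.cons_val_zero, Matrix.cons_val_one, Equiv.Perm.coe_one,
    id_eq]
  congr 1
  · unfold betweenSign
    split_ifs with hb
    · rw [orderSign_neg hb.1.le (by omega), orderSign_pos hb.2.le (by omega)]; rfl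
    · rcases le_or_gt (c (A.entry i 0)) (c (A.entry j 0)) with h1 | h1
      · rw [orderSign_pos h1 (by omega), orderSign_pos (by omega) (by omega)]; rfl
      · rw [orderSign_neg h1.le (by omega), orderSign_neg (by omega) (by omega)]; rfl
  · unfold betweenSign
    split_ifs with hb
    · rw [orderSign_neg hb.1.le (by omega), orderSign_pos hb.2.le (by omega)]; rfl
    · rcases le_or_gt (c (A.entry (m i) 1)) (c (A.entry j 0)) with h1 | h1
      · rw [orderSign_pos h1 (by omega), orderSign_pos (by omega) (by omega)]; rfl
      · rw [orderSign_neg h1.le (by omega), orderSign_neg (by omega) (by omega)]; rfl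

/-- Two chords on the same level are disjoint. -/
theorem IsExtremal.prod_orderSign_of_eq {c : Fin (2 * N) → ℕ} {A : Numbering N}
    {m : Equiv.Perm (Fin N)} {g : Fin (2 * N) → ℤ} (h : IsExtremal c A m g) {i j : Fin N}
    (hne : i ≠ j) (hij : g (A.entry i 0) = g (A.entry j 0)) :
    ∏ s : Fin 2, ∏ t : Fin 2,
      orderSign c g (A.entry (![1, m] s i) s) (A.entry (![1, m] t j) t) = 1 := by
  have hi := h.lt i
  have hj := h.lt j
  have pi := h.pos i
  have pj := h.pos j
  have ni := h.neg i
  have nj := h.neg j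
  simp only [Fin.prod_univ_two, Matrix.cons_val_zero, Matrix.cons_val_one, Equiv.Perm.coe_one,
    id_eq]
  have hdis : c (A.entry (m i) 1) ≤ c (A.entry j 0) ∨ c (A.entry (m j) 1) ≤ c (A.entry i 0) := by
    by_contra! hcon
    refine hne (h.inj (max (c (A.entry i 0)) (c (A.entry j 0)) + 1) i j ?_ ?_ ?_ ?_ hij) <;> omega
  rcases hdis with hd | hd
  · rw [orderSign_pos (by omega) (by omega), orderSign_pos (by omega) (by omega),
      orderSign_pos (by omega) (by omega), orderSign_pos (by omega) (by omega)]; rfl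
  · rw [orderSign_neg (by omega) (by omega), orderSign_neg (by omega) (by omega),
      orderSign_neg (by omega) (by omega), orderSign_neg (by omega) (by omega)]; rfl

theorem Numbering.prod_sites {M : Type*} [CommMonoid M] (A : Numbering N)
    (f : Fin (2 * N) → M) : ∏ u, f u = ∏ i, ∏ s : Fin 2, f (A.entry i s) := by
  rw [← Equiv.prod_comp (show Fin N × Fin 2 ≃ Fin (2 * N) from A), Fintype.prod_prod_type]
  rfl

theorem Numbering.prod_pairs_row {M : Type*} [CommMonoid M] (A : Numbering N)
    (G : Fin (2 * N) → Fin (2 * N) → M) (r : Fin N → Fin N → Prop) [DecidableRel r] :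
    ∏ p : Fin (2 * N) × Fin (2 * N) with r (A.row p.1) (A.row p.2), G p.1 p.2 =
      ∏ j, ∏ i, if r i j then ∏ s : Fin 2, ∏ t : Fin 2, G (A.entry i s) (A.entry j t) else 1 := by
  rw [Finset.prod_filter, Fintype.prod_prod_type_right, A.prod_sites]
  refine Finset.prod_congr rfl fun j _ => ?_
  have : ∀ t : Fin 2, (∏ u, if r (A.row u) (A.row (A.entry j t)) then G u (A.entry j t) else 1) =
      ∏ i, ∏ s : Fin 2, if r i j then G (A.entry i s) (A.entry j t) else 1 := by
    intro t
    rw [A.prod_sites]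
    refine Finset.prod_congr rfl fun i _ => Finset.prod_congr rfl fun s _ => ?_
    rw [A.row_entry, A.row_entry]
  rw [Finset.prod_congr rfl fun t _ => this t, Finset.prod_comm]
  refine Finset.prod_congr rfl fun i _ => ?_
  rw [Finset.prod_comm]
  split_ifs
  · rfl
  · exact Finset.prod_eq_one fun _ _ => Finset.prod_eq_one fun _ _ => rfl

/-- The sign of an extremal configuration does not depend on the configuration. -/
theorem IsExtremal.sign_eq {c : Fin (2 * N) → ℕ} (hc : Monotone c) {α : LinkPattern N}
    {A : Numbering N} (hA : α.IsNumbering A) {m : Equiv.Perm (Fin N)} {g : Fin (2 * N) → ℤ}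
    (h : IsExtremal c A m g) : (Equiv.Perm.sign m : ℤ) * (labelVandermonde c g).sign = 1 := by
  set σ := A.colPerm ![1, m] with hσ
  have hsgn : (Equiv.Perm.sign σ : ℤ) = Equiv.Perm.sign m := by
    have := A.csign_colPerm ![1, m]
    simp only [Matrix.cons_val_zero, Matrix.cons_val_one, csign, Equiv.Perm.sign_one, Units.val_one,
      Int.cast_one, one_mul] at this
    exact_mod_cast this
  rw [← hsgn, ← prod_orderSign hc, ← prod_orderSign_perm]
  -- the product of the orders becomes symmetric when it is compared with the order of the sites
  set G : Fin (2 * N) → Fin (2 * N) → ℤ := fun u v =>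
    orderSign c g (σ u) (σ v) * (((v : ℕ) : ℤ) - (u : ℕ)).sign with hG
  have hGsymm : ∀ u v, G u v = G v u := by
    intro u v
    simp only [hG]
    rw [orderSign_antisymm, ← neg_sub ((u : ℕ) : ℤ), Int.sign_neg, neg_mul_neg]
  have h1 : ∏ p : Fin (2 * N) × Fin (2 * N) with p.1 < p.2, orderSign c g (σ p.1) (σ p.2) =
      ∏ p : Fin (2 * N) × Fin (2 * N) with p.1 < p.2, G p.1 p.2 := by
    refine Finset.prod_congr rfl fun p hp => ?_
    have hlt := Fin.lt_def.mp (Finset.mem_filter.mp hp).2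
    simp only [hG]
    rw [Int.sign_eq_one_of_pos (a := ((p.2 : ℕ) : ℤ) - (p.1 : ℕ)) (by omega), mul_one]
  -- order the links by level, then by row
  set L : Fin N → ℕ := fun i => (g (A.entry i 0)).toNat * N + i with hL
  have hLinj : ∀ i j, L i = L j → i = j := by
    intro i j hij
    have h2 := congrArg (· % N) hij
    simp only [hL, Nat.mul_add_mod_self_right, Nat.mod_eq_of_lt i.2, Nat.mod_eq_of_lt j.2] at h2
    exact Fin.ext h2
  have hLle : ∀ i j, L i < L j → g (A.entry i 0) ≤ g (A.entry j 0) := by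
    intro i j hij
    by_contra! hcon
    have h2 := h.pos j
    have h3 : (g (A.entry j 0)).toNat + 1 ≤ (g (A.entry i 0)).toNat := by omega
    have h4 := Nat.mul_le_mul_right N h3
    have := j.2
    simp only [hL] at hij
    rw [Nat.add_mul] at h4
    omega
  have hLlt : ∀ i j, g (A.entry i 0) < g (A.entry j 0) → L i < L j := by
    intro i j hij
    by_contra! hcon
    rcases hcon.lt_or_eq with h2 | h2
    · exact absurd (hLle j i h2) (not_le.mpr hij)
    · rw [hLinj j i h2] at hij
      exact lt_irrefl _ hij
  -- pairs of sites in the same row contribute `1`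
  rw [h1, prod_pairs_by_key G hGsymm fun u => L (A.row u)]
  have h2 : ∏ p : Fin (2 * N) × Fin (2 * N) with p.1 < p.2 ∧ L (A.row p.1) = L (A.row p.2),
      G p.1 p.2 = 1 := by
    refine Finset.prod_eq_one fun p hp => ?_
    obtain ⟨hlt, hrow⟩ := (Finset.mem_filter.mp hp).2
    have hrow' := hLinj _ _ hrow
    obtain ⟨u, v⟩ := p
    obtain ⟨i, s, rfl⟩ : ∃ i s, u = A.entry i s := ⟨_, _, (A.entry_row_col u).symm⟩
    obtain ⟨j, t, rfl⟩ : ∃ i s, v = A.entry i s := ⟨_, _, (A.entry_row_col v).symm⟩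
    simp only [Numbering.row_entry] at hrow' hlt
    subst hrow'
    have hi := (hA i).1
    rw [← (hA i).2] at hi
    have hst : s = 0 ∧ t = 1 := by
      have h01 := hi.not_gt
      clear * - h01 hlt
      fin_cases s <;> fin_cases t
      · exact absurd hlt (lt_irrefl _)
      · exact ⟨rfl, rfl⟩
      · exact absurd hlt h01
      · exact absurd hlt (lt_irrefl _)
    rw [hst.1, hst.2]
    simp only [hG, hσ, A.colPerm_entry, Matrix.cons_val_zero, Matrix.cons_val_one,
      Equiv.Perm.coe_one, id_eq]
    rw [orderSign_pos (h.lt i).le fun hh => absurd hh (h.lt i).ne,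
      Int.sign_eq_one_of_pos (by have := Fin.lt_def.mp hi; omega), mul_one]
  rw [h2, mul_one]
  rw [A.prod_pairs_row G fun i j => L i < L j]
  -- for two different rows the comparison with the order of the sites does not matter
  have h4 : ∀ i j, i ≠ j → ∏ s : Fin 2, ∏ t : Fin 2, G (A.entry i s) (A.entry j t) =
      ∏ s : Fin 2, ∏ t : Fin 2,
        orderSign c g (A.entry (![1, m] s i) s) (A.entry (![1, m] t j) t) := by
    intro i j hij
    refine Eq.trans ?_ (mul_one _)
    rw [← hA.prod_sign hij, ← Finset.prod_mul_distrib]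
    refine Finset.prod_congr rfl fun s _ => ?_
    rw [← Finset.prod_mul_distrib]
    refine Finset.prod_congr rfl fun t _ => ?_
    rw [← A.colPerm_entry, ← A.colPerm_entry]
  refine Finset.prod_eq_one fun j _ => ?_
  refine Eq.trans ?_ (prod_betweenSign h.lt h.pos h.inj h.down j)
  rw [Finset.prod_filter]
  refine Finset.prod_congr rfl fun i _ => ?_
  split_ifs with h5 h6 h6
  · rw [h4 i j fun hij => by rw [hij] at h5; exact lt_irrefl _ h5, h.prod_orderSign_of_lt h6]
  · have hij : i ≠ j := fun hij => by rw [hij] at h5; exact lt_irrefl _ h5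
    rw [h4 i j hij, h.prod_orderSign_of_eq hij (le_antisymm (hLle i j h5) (not_lt.mp h6))]
  · exact absurd (hLlt i j h6) h5
  · rfl

end Extremal

/-! ### Expansion of fused determinants over labels -/

section Expansion

variable {N : ℕ} {ς : Composition (2 * N)}

open Classical in
/-- The evaluation of a kernel of the form `L C Lᵀ` on an antisymmetrized polytabloid is a sum over
labels of the sites. -/
theorem kernelEval_antisym_polytabloid {Λ : Type*} [Fintype Λ] {K : Fin (2 * N) → Fin (2 * N) → ℂ}
    {L : Fin (2 * N) → Λ → ℂ} {C : Fin (2 * N) → Fin (2 * N) → Λ → Λ → ℂ}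
    (hK : ∀ a b, K a b = K b a) (hKL : ∀ a b, K a b = ∑ μ, ∑ ν, L a μ * C a b μ ν * L b ν)
    (hC : ∀ σ ∈ young ς, ∀ a b, C (σ a) (σ b) = C a b) (A : Numbering N) :
    kernelEval K (antisym (tabloidRep N) (young ς) (polytabloid A)) =
      ∑ g : Fin (2 * N) → Λ,
        (∑ σ : Equiv.Perm (Fin (2 * N)) with σ ∈ young ς, csign σ * ∏ a, L (σ a) (g a)) *
        ∑ m : Equiv.Perm (Fin N), csign m *
          ∏ i, C (A.entry i 0) (A.entry (m i) 1) (g (A.entry i 0)) (g (A.entry (m i) 1)) := by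
  have h1 : ∀ σ ∈ young ς, kernelEval K (tabloidRep N σ (polytabloid A)) =
      ∑ m : Equiv.Perm (Fin N), csign m * ∑ g : Fin (2 * N) → Λ, (∏ a, L (σ a) (g a)) *
          ∏ i, C (A.entry i 0) (A.entry (m i) 1) (g (A.entry i 0)) (g (A.entry (m i) 1)) := by
    intro σ hσ
    rw [kernelEval_tabloidRep hK, kernelEval_polytabloid fun a b => hK _ _,
      ← Matrix.det_transpose, Matrix.det_apply']
    refine Finset.sum_congr rfl fun m _ => ?_
    rw [csign]
    congr 1
    have h2 := (A.permCols ![1, m]).prod_expand (fun a => L (σ a)) fun a b => C a b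
    simp only [Numbering.entry_permCols, Matrix.cons_val_zero, Matrix.cons_val_one,
      Equiv.Perm.coe_one, id_eq] at h2
    rw [← h2]
    refine Finset.prod_congr rfl fun i _ => ?_
    rw [Matrix.transpose_apply, Matrix.of_apply, hKL, hC σ hσ]
  rw [antisym_apply, map_sum]
  simp only [Finset.sum_mul]
  rw [Finset.sum_comm]
  refine Finset.sum_congr rfl fun σ hσ => ?_
  rw [map_smul, smul_eq_mul, h1 σ (Finset.mem_filter.mp hσ).2, Finset.mul_sum]
  simp only [Finset.mul_sum]
  rw [Finset.sum_comm]
  refine Finset.sum_congr rfl fun g _ => Finset.sum_congr rfl fun m _ => by ring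

open Polynomial in
/-- A block diagonal Vandermonde determinant for monic polynomials. -/
theorem det_block_eval (P : Fin (2 * N) → ℂ[X]) (hP : ∀ a, (P a).Monic)
    (hdeg : ∀ a, (P a).natDegree = pos ς a) (z : Fin (2 * N) → ℂ) :
    Matrix.det (Matrix.of fun a b => if ς.index a = ς.index b then (P b).eval (z a) else 0) =
      ∏ p : Fin (2 * N) × Fin (2 * N) with p.1 < p.2 ∧ ς.index p.1 = ς.index p.2,
        (z p.2 - z p.1) := by
  -- the determinant does not depend on the monic polynomials
  have key : ∀ P : Fin (2 * N) → ℂ[X], (∀ a, (P a).Monic) → (∀ a, (P a).natDegree = pos ς a) →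
      Matrix.det (Matrix.of fun a b => if ς.index a = ς.index b then (P b).eval (z a) else 0) =
      Matrix.det (Matrix.of fun a b : Fin (2 * N) =>
        if ς.index a = ς.index b then z a ^ pos ς b else 0) := by
    intro P hP hdeg
    have hU : Matrix.det (Matrix.of fun d b : Fin (2 * N) =>
        if ς.index d = ς.index b then (P b).coeff (pos ς d) else 0) = 1 := by
      rw [Matrix.det_of_isUpperTriangular]
      · refine Finset.prod_eq_one fun a _ => ?_
        rw [Matrix.of_apply, if_pos rfl, ← hdeg]
        exact hP a
      · intro d b hdb
        rw [Matrix.of_apply]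
        split_ifs with h
        · refine Polynomial.coeff_eq_zero_of_natDegree_lt ?_
          rw [hdeg]
          exact (pos_lt_pos ς h.symm).mpr hdb
        · rfl
    rw [← mul_one (Matrix.det (Matrix.of fun a b : Fin (2 * N) =>
        if ς.index a = ς.index b then z a ^ pos ς b else 0)), ← hU, ← Matrix.det_mul]
    congr 1
    ext a b
    rw [Matrix.mul_apply]
    simp only [Matrix.of_apply]
    split_ifs with h
    · have hlt : (P b).natDegree < ς.blocksFun (ς.index b) := by
        rw [hdeg]; exact pos_lt ς b
      rw [Polynomial.eval_eq_sum_range' hlt, ← sum_index_eq]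
      refine Finset.sum_congr rfl fun d _ => ?_
      by_cases hd : ς.index d = ς.index b
      · rw [if_pos hd, if_pos hd, if_pos (h.trans hd.symm), mul_comm]
      · rw [if_neg hd, if_neg hd, mul_zero]
    · symm
      refine Finset.sum_eq_zero fun d _ => ?_
      by_cases hd : ς.index d = ς.index b
      · rw [if_neg fun h' => h (h'.trans hd), zero_mul]
      · rw [if_neg hd, mul_zero]
  rw [key P hP hdeg, ← det_newtonMatrix, ← key fun b =>
    ∏ m ∈ Finset.range (pos ς b), (X - C (groupSeq ς z (ς.index b) m))]
  · congr 1
    ext a b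
    simp only [Matrix.of_apply, newtonMatrix, Polynomial.eval_prod, Polynomial.eval_sub,
      Polynomial.eval_X, Polynomial.eval_C]
  · exact fun a => Polynomial.monic_prod_of_monic _ _ fun m _ => Polynomial.monic_X_sub_C _
  · intro a
    rw [Polynomial.natDegree_finsetProd_X_sub_C_eq_card, Finset.card_range]

/-- The monic polynomial with roots `1, …, p`. -/
def fallingPoly (p : ℕ) : Polynomial ℂ :=
  ∏ r ∈ Finset.range p, (Polynomial.X - Polynomial.C ((r : ℂ) + 1))

theorem fallingPoly_eval (p : ℕ) (z : ℂ) :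
    (fallingPoly p).eval z = ∏ r ∈ Finset.range p, (z - (r + 1)) := by
  simp [fallingPoly, Polynomial.eval_prod]

open Classical in
theorem sum_young_fallingPoly (g : Fin (2 * N) → ℤ) :
    ∑ σ : Equiv.Perm (Fin (2 * N)) with σ ∈ young ς,
      csign σ * ∏ a, (fallingPoly (pos ς (σ a))).eval (g a : ℂ) =
      (labelVandermonde (fun a => (ς.index a : ℕ)) g : ℤ) := by
  have h := det_block_eval (ς := ς) (fun a => fallingPoly (pos ς a))
    (fun a => Polynomial.monic_prod_of_monic _ _ fun m _ => Polynomial.monic_X_sub_C _)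
    (fun a => by
      rw [fallingPoly, Polynomial.natDegree_finsetProd_X_sub_C_eq_card, Finset.card_range])
    (fun a => (g a : ℂ))
  unfold labelVandermonde
  push_cast
  simp only [Fin.val_inj]
  rw [← h, ← Matrix.det_transpose, Matrix.det_apply', Finset.sum_filter]
  refine Finset.sum_congr rfl fun σ _ => ?_
  split_ifs with hσ
  · rw [csign]
    congr 1
    refine Finset.prod_congr rfl fun a _ => ?_
    rw [Matrix.transpose_apply, Matrix.of_apply, if_pos (hσ a).symm]
  · obtain ⟨a, ha⟩ := not_forall.mp hσ
    rw [Finset.prod_eq_zero (Finset.mem_univ a), mul_zero]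
    rw [Matrix.transpose_apply, Matrix.of_apply, if_neg fun h => ha h.symm]

end Expansion

/-! ### Chords and labels -/

section DistinctSum

theorem card_mul_le_two_mul_sum {s : Finset ℤ} (hs : ∀ x ∈ s, 0 < x) :
    (s.card : ℤ) * (s.card + 1) ≤ 2 * ∑ x ∈ s, x ∧
      ((s.card : ℤ) * (s.card + 1) = 2 * ∑ x ∈ s, x → s = Finset.Icc 1 (s.card : ℤ)) := by
  induction hn : s.card generalizing s with
  | zero =>
    rw [Finset.card_eq_zero] at hn
    subst hn
    simp
  | succ n ih =>
    have hne : s.Nonempty := by rw [← Finset.card_pos]; omega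
    set M := s.max' hne with hM
    have hMs : M ∈ s := s.max'_mem hne
    have hsub : s ⊆ Finset.Icc 1 M := fun x hx => Finset.mem_Icc.mpr ⟨hs x hx, s.le_max' x hx⟩
    have hcard := Finset.card_le_card hsub
    rw [hn, Int.card_Icc] at hcard
    obtain ⟨h1, h2⟩ := ih (s := s.erase M) (fun x hx => hs x (Finset.mem_of_mem_erase hx))
      (by rw [Finset.card_erase_of_mem hMs, hn]; rfl)
    have h3 := Finset.add_sum_erase s (fun x => x) hMs
    push_cast
    constructor
    · have : (n : ℤ) + 1 ≤ M := by omega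
      nlinarith
    · intro h4
      have h5 : (n : ℤ) + 1 = M := by
        have : (n : ℤ) + 1 ≤ M := by omega
        nlinarith
      refine Finset.eq_of_subset_of_card_le (h5 ▸ hsub) ?_
      rw [Int.card_Icc, hn]
      omega

end DistinctSum

section Chords

variable {N : ℕ}

/-- The labels `g` are compatible with the chords from the first column of `A` to the second one:
the ends of each chord have opposite labels, and the positive one comes first. -/
def IsCompatible (c : Fin (2 * N) → ℕ) (A : Numbering N) (g : Fin (2 * N) → ℤ)
    (m : Equiv.Perm (Fin N)) : Prop :=
  ∀ i, g (A.entry i 0) + g (A.entry (m i) 1) = 0 ∧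
    ((c (A.entry i 0) < c (A.entry (m i) 1) ∧ 0 < g (A.entry i 0)) ∨
      (c (A.entry (m i) 1) < c (A.entry i 0) ∧ 0 < g (A.entry (m i) 1)))

theorem Numbering.sum_chords {M : Type*} [AddCommMonoid M] (A : Numbering N)
    (m : Equiv.Perm (Fin N)) (f : Fin (2 * N) → M) :
    ∑ a, f a = ∑ i, (f (A.entry i 0) + f (A.entry (m i) 1)) := by
  rw [← Equiv.sum_comp (show Fin N × Fin 2 ≃ Fin (2 * N) from A), Fintype.sum_prod_type,
    Finset.sum_congr rfl fun i _ => Fin.sum_univ_two _, Finset.sum_add_distrib,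
    Finset.sum_add_distrib, Equiv.sum_comp m fun i => f (A.entry i 1)]
  rfl

variable {c : Fin (2 * N) → ℕ} {A : Numbering N} {g : Fin (2 * N) → ℤ} {m : Equiv.Perm (Fin N)}

/-- The rows whose chords pass forward over the cut `k` with label `J`. -/
def forwardRows (c : Fin (2 * N) → ℕ) (A : Numbering N) (g : Fin (2 * N) → ℤ)
    (m : Equiv.Perm (Fin N)) (k : ℕ) (J : ℤ) : Finset (Fin N) :=
  Finset.univ.filter fun i =>
    g (A.entry i 0) = J ∧ c (A.entry i 0) < k ∧ k ≤ c (A.entry (m i) 1)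

/-- The number of chords that pass forward over a cut with a given label is determined by the
labels. -/
theorem IsCompatible.card_forwardRows (h : IsCompatible c A g m) (k : ℕ) {J : ℤ} (hJ : 0 < J) :
    ((forwardRows c A g m k J).card : ℤ) =
      (Finset.univ.filter fun i => g (A.entry i 0) = J ∧ c (A.entry i 0) < k).card -
        (Finset.univ.filter fun i => g (A.entry i 1) = -J ∧ c (A.entry i 1) < k).card := by
  have h1 : (Finset.univ.filter fun i => g (A.entry i 1) = -J ∧ c (A.entry i 1) < k).card =
      (Finset.univ.filter fun i => (g (A.entry i 0) = J ∧ c (A.entry i 0) < k) ∧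
        ¬ k ≤ c (A.entry (m i) 1)).card := by
    symm
    refine Finset.card_bij (fun i _ => m i) ?_ (fun i _ j _ h => m.injective h) ?_
    · intro i hi
      have h2 := (Finset.mem_filter.mp hi).2
      have h3 := h i
      exact Finset.mem_filter.mpr ⟨Finset.mem_univ _, by omega, by omega⟩
    · intro j hj
      have h2 := (Finset.mem_filter.mp hj).2
      have h3 := h (m.symm j)
      rw [m.apply_symm_apply] at h3
      refine ⟨m.symm j, Finset.mem_filter.mpr ⟨Finset.mem_univ _, ?_⟩, m.apply_symm_apply j⟩
      rw [m.apply_symm_apply]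
      omega
  have h2 := Finset.card_filter_add_card_filter_not
    (s := Finset.univ.filter fun i => g (A.entry i 0) = J ∧ c (A.entry i 0) < k)
    (p := fun i => k ≤ c (A.entry (m i) 1))
  rw [Finset.filter_filter, Finset.filter_filter] at h2
  have h3 : (Finset.univ.filter fun i => (g (A.entry i 0) = J ∧ c (A.entry i 0) < k) ∧
      k ≤ c (A.entry (m i) 1)) = forwardRows c A g m k J :=
    Finset.filter_congr fun i _ => by rw [and_assoc]
  rw [h3, ← h1] at h2
  omega

open Classical in
/-- If two chords with the same label pass forward over a cut then the signed number of compatible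
configurations of chords is zero: exchange the ends of two such chords. -/
theorem IsCompatible.sum_sign_eq_zero (h : IsCompatible c A g m) {k : ℕ} {i j : Fin N}
    (hij : i ≠ j) (hi : c (A.entry i 0) < k) (hi' : k ≤ c (A.entry (m i) 1))
    (hj : c (A.entry j 0) < k) (hj' : k ≤ c (A.entry (m j) 1))
    (hg : g (A.entry i 0) = g (A.entry j 0)) :
    ∑ m : Equiv.Perm (Fin N) with IsCompatible c A g m, (Equiv.Perm.sign m : ℤ) = 0 := by
  have hJ : 0 < g (A.entry i 0) := by have := h i; omega
  set J := g (A.entry i 0) with hJdef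
  -- every compatible configuration has two chords with the label `J` over the cut
  have htwo : ∀ m', IsCompatible c A g m' → 1 < (forwardRows c A g m' k J).card := by
    intro m' hm'
    have h1 := h.card_forwardRows k hJ
    rw [← hm'.card_forwardRows k hJ] at h1
    have h2 : 1 < (forwardRows c A g m k J).card := Finset.one_lt_card.mpr
      ⟨i, by simp [forwardRows, hi, hi', ← hJdef], j, by simp [forwardRows, hj, hj', ← hg], hij⟩
    omega
  -- a choice of two rows that only depends on the set of rows makes the exchange an involution
  have hchoose : ∀ S : Finset (Fin N), ∃ p : Fin N × Fin N, 1 < S.card →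
      p.1 ∈ S ∧ p.2 ∈ S ∧ p.1 ≠ p.2 := by
    intro S
    by_cases hS : 1 < S.card
    · obtain ⟨a, ha, b, hb, hab⟩ := Finset.one_lt_card.mp hS
      exact ⟨(a, b), fun _ => ⟨ha, hb, hab⟩⟩
    · exact ⟨(i, i), fun h => absurd h hS⟩
  choose p hp using hchoose
  -- the exchanged configuration has the same rows over the cut
  have hrows : ∀ m', IsCompatible c A g m' → ∀ a ∈ forwardRows c A g m' k J,
      ∀ b ∈ forwardRows c A g m' k J,
      IsCompatible c A g (m' * Equiv.swap a b) ∧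
        forwardRows c A g (m' * Equiv.swap a b) k J = forwardRows c A g m' k J := by
    intro m' hm' a ha b hb
    have ha' := (Finset.mem_filter.mp ha).2
    have hb' := (Finset.mem_filter.mp hb).2
    have hca := hm' a
    have hcb := hm' b
    refine ⟨fun l => ?_, Finset.filter_congr fun l _ => ?_⟩
    · rw [Equiv.Perm.mul_apply]
      rcases eq_or_ne l a with rfl | hla
      · rw [Equiv.swap_apply_left]; omega
      rcases eq_or_ne l b with rfl | hlb
      · rw [Equiv.swap_apply_right]; omega
      rw [Equiv.swap_apply_of_ne_of_ne hla hlb]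
      exact hm' l
    · rw [Equiv.Perm.mul_apply]
      rcases eq_or_ne l a with rfl | hla
      · rw [Equiv.swap_apply_left]; omega
      rcases eq_or_ne l b with rfl | hlb
      · rw [Equiv.swap_apply_right]; omega
      rw [Equiv.swap_apply_of_ne_of_ne hla hlb]
  have hq : ∀ m', IsCompatible c A g m' →
      (p (forwardRows c A g m' k J)).1 ∈ forwardRows c A g m' k J ∧
      (p (forwardRows c A g m' k J)).2 ∈ forwardRows c A g m' k J ∧
      (p (forwardRows c A g m' k J)).1 ≠ (p (forwardRows c A g m' k J)).2 :=
    fun m' hm' => hp _ (htwo m' hm')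
  refine Finset.sum_involution (fun m' _ => m' *
    Equiv.swap (p (forwardRows c A g m' k J)).1 (p (forwardRows c A g m' k J)).2) ?_ ?_ ?_ ?_
  · intro m' hm'
    have h1 := hq m' (Finset.mem_filter.mp hm').2
    simp [Equiv.Perm.sign_swap h1.2.2]
  · intro m' hm' _ heq
    have h1 := hq m' (Finset.mem_filter.mp hm').2
    rw [mul_eq_left, Equiv.swap_eq_one_iff] at heq
    exact h1.2.2 heq
  · intro m' hm'
    have h0 := (Finset.mem_filter.mp hm').2
    have h1 := hq m' h0
    exact Finset.mem_filter.mpr ⟨Finset.mem_univ _, (hrows m' h0 _ h1.1 _ h1.2.1).1⟩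
  · intro m' hm'
    have h0 := (Finset.mem_filter.mp hm').2
    have h1 := hq m' h0
    simp only [(hrows m' h0 _ h1.1 _ h1.2.1).2]
    rw [mul_assoc, Equiv.swap_mul_self, mul_one]

/-- If the forward chords over the cut `k` have distinct labels, then the labels before the cut sum
up to at least `1 + ⋯ + r`, where `r` is the number of forward chords minus the number of backward
ones; equality forces the absence of backward chords and the labels `1, …, r`. -/
theorem IsCompatible.le_sum (h : IsCompatible c A g m) {k : ℕ}
    (hinj : ∀ i j, c (A.entry i 0) < k → k ≤ c (A.entry (m i) 1) → c (A.entry j 0) < k →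
      k ≤ c (A.entry (m j) 1) → g (A.entry i 0) = g (A.entry j 0) → i = j) {r : ℤ} (hr : 0 ≤ r)
    (hrk : r = ∑ i, ((if c (A.entry i 0) < k then 1 else 0) -
      (if c (A.entry (m i) 1) < k then 1 else 0))) :
    r * (r + 1) ≤ 2 * ∑ a with c a < k, g a ∧ (r * (r + 1) = 2 * ∑ a with c a < k, g a →
      (∀ i, ¬ (c (A.entry (m i) 1) < k ∧ k ≤ c (A.entry i 0))) ∧
      ∀ i, c (A.entry i 0) < k → k ≤ c (A.entry (m i) 1) → ∀ l, 0 < l → l < g (A.entry i 0) →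
        ∃ j, c (A.entry j 0) < k ∧ k ≤ c (A.entry (m j) 1) ∧ g (A.entry j 0) = l) := by
  -- the chords that pass over the cut forward and backward
  set F := Finset.univ.filter fun i => c (A.entry i 0) < k ∧ k ≤ c (A.entry (m i) 1) with hF
  set B := Finset.univ.filter fun i => c (A.entry (m i) 1) < k ∧ k ≤ c (A.entry i 0) with hB
  have hr' : r = F.card - B.card := by
    rw [hrk, hF, hB, Finset.card_filter, Finset.card_filter]
    push_cast
    rw [← Finset.sum_sub_distrib]
    refine Finset.sum_congr rfl fun i _ => ?_
    split_ifs <;> omega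
  -- the labels of the two ends of a chord on one side of the cut cancel
  have hD : ∑ a with c a < k, g a = ∑ i ∈ F, g (A.entry i 0) + ∑ i ∈ B, g (A.entry (m i) 1) := by
    rw [Finset.sum_filter, A.sum_chords m, hF, hB, Finset.sum_filter, Finset.sum_filter,
      ← Finset.sum_add_distrib]
    refine Finset.sum_congr rfl fun i _ => ?_
    have := h i
    split_ifs <;> omega
  have hBpos : ∀ i ∈ B, 1 ≤ g (A.entry (m i) 1) := by
    intro i hi
    have h1 := (Finset.mem_filter.mp hi).2
    have h2 := h i
    omega
  have hBsum : (B.card : ℤ) ≤ ∑ i ∈ B, g (A.entry (m i) 1) := by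
    rw [Finset.card_eq_sum_ones, Nat.cast_sum]
    exact Finset.sum_le_sum fun i hi => by simpa using hBpos i hi
  have hinjF : Set.InjOn (fun i => g (A.entry i 0)) F := by
    intro i hi j hj hij
    have h1 := (Finset.mem_filter.mp hi).2
    have h2 := (Finset.mem_filter.mp hj).2
    exact hinj i j h1.1 h1.2 h2.1 h2.2 hij
  have hcard := Finset.card_image_of_injOn hinjF
  have hsum := Finset.sum_image (f := fun x : ℤ => x) hinjF
  obtain ⟨h1, h2⟩ := card_mul_le_two_mul_sum (s := F.image fun i => g (A.entry i 0)) (by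
    intro x hx
    obtain ⟨i, hi, rfl⟩ := Finset.mem_image.mp hx
    have h1 := (Finset.mem_filter.mp hi).2
    have h2 := h i
    omega)
  rw [hcard, hsum] at h1 h2
  have hle : r ≤ F.card := by omega
  constructor
  · rw [hD]
    nlinarith
  · intro heq
    rw [hD] at heq
    have hB0 : B.card = 0 := by
      by_contra hne
      have : 0 < (B.card : ℤ) := by omega
      nlinarith
    have hrF : r = F.card := by omega
    have hBe := Finset.card_eq_zero.mp hB0
    rw [hBe, Finset.sum_empty, add_zero, hrF] at heq
    have h3 := h2 heq
    refine ⟨fun i hi => ?_, fun i hi1 hi2 l hl1 hl2 => ?_⟩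
    · have : i ∈ B := Finset.mem_filter.mpr ⟨Finset.mem_univ _, hi⟩
      rw [hBe] at this
      simp at this
    · have hiF : g (A.entry i 0) ∈ F.image fun i => g (A.entry i 0) :=
        Finset.mem_image_of_mem _ (Finset.mem_filter.mpr ⟨Finset.mem_univ _, hi1, hi2⟩)
      rw [h3, Finset.mem_Icc] at hiF
      have hl : l ∈ F.image fun i => g (A.entry i 0) := by
        rw [h3, Finset.mem_Icc]; omega
      obtain ⟨j, hj, hjl⟩ := Finset.mem_image.mp hl
      have h4 := (Finset.mem_filter.mp hj).2
      exact ⟨j, h4.1, h4.2, hjl⟩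

end Chords

section Cuts

variable {N : ℕ} {ς : Composition (2 * N)}

theorem lt_sizeUpTo_iff (a : Fin (2 * N)) (k : ℕ) :
    (a : ℕ) < ς.sizeUpTo k ↔ (ς.index a : ℕ) < k := by
  constructor
  · intro h
    by_contra! hc
    have h1 := ς.sizeUpTo_index_le a
    have h2 := ς.monotone_sizeUpTo hc
    omega
  · intro h
    have h1 := ς.lt_sizeUpTo_index_succ a
    have h2 : ς.sizeUpTo (ς.index a).succ ≤ ς.sizeUpTo k := ς.monotone_sizeUpTo (by simpa using h)
    omega

theorem LinkPattern.IsNumbering.height_cut {α : LinkPattern N} {A : Numbering N}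
    (hA : α.IsNumbering A) (m : Equiv.Perm (Fin N)) (k : ℕ) : α.height (ς.sizeUpTo k) =
      ∑ i, ((if (ς.index (A.entry i 0) : ℕ) < k then 1 else 0) -
        (if (ς.index (A.entry (m i) 1) : ℕ) < k then 1 else 0)) := by
  rw [LinkPattern.height, A.sum_chords m]
  refine Finset.sum_congr rfl fun i _ => ?_
  have h0 : A.entry i 0 < α.partner (A.entry i 0) := (hA i).1
  have h1 : ¬ A.entry (m i) 1 < α.partner (A.entry (m i) 1) := fun h => by
    rw [(hA (m i)).2, α.lt_partner_partner_iff] at h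
    exact h (hA (m i)).1
  rw [if_pos h0, if_neg h1]
  simp only [lt_sizeUpTo_iff]
  split_ifs <;> ring

/-- Twice the sum of the labels before each cut is at least the value `r (r + 1)` for the height `r`
of the path at the cut, unless the signed number of compatible configurations is zero; in the case
of equality all compatible configurations are extremal. -/
theorem LinkPattern.IsNumbering.le_sum_labels {α : LinkPattern N} {A : Numbering N}
    (hA : α.IsNumbering A) {g : Fin (2 * N) → ℤ} {m : Equiv.Perm (Fin N)}
    (hm : IsCompatible (fun a => (ς.index a : ℕ)) A g m)
    (hinj : ∀ k i j, (ς.index (A.entry i 0) : ℕ) < k → k ≤ (ς.index (A.entry (m i) 1) : ℕ) →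
      (ς.index (A.entry j 0) : ℕ) < k → k ≤ (ς.index (A.entry (m j) 1) : ℕ) →
      g (A.entry i 0) = g (A.entry j 0) → i = j) :
    (∀ k, α.height (ς.sizeUpTo k) * (α.height (ς.sizeUpTo k) + 1) ≤
      2 * ∑ a with (ς.index a : ℕ) < k, g a) ∧
    ((∀ k < ς.length, α.height (ς.sizeUpTo k) * (α.height (ς.sizeUpTo k) + 1) =
      2 * ∑ a with (ς.index a : ℕ) < k, g a) →
      IsExtremal (fun a => (ς.index a : ℕ)) A m g) := by
  have key := fun k => hm.le_sum (hinj k) (α.height_nonneg (ς.sizeUpTo k)) (hA.height_cut m k)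
  refine ⟨fun k => (key k).1, fun heq => ?_⟩
  have hlt : ∀ i, (ς.index (A.entry i 0) : ℕ) < (ς.index (A.entry (m i) 1) : ℕ) := by
    intro i
    have h1 := ((key _).2 (heq (ς.index (A.entry i 0)) (ς.index (A.entry i 0)).2)).1 i
    have h2 := hm i
    simp only at h2
    omega
  refine ⟨hlt, fun i => ?_, fun i => ?_, hinj, fun k i h1 h2 => ?_⟩
  · have h1 := hm i
    have h2 := hlt i
    simp only at h1
    omega
  · have h1 := hm i
    omega
  · have := (ς.index (A.entry (m i) 1)).2
    exact ((key k).2 (heq k (by omega))).2 i h1 h2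

end Cuts

/-! ### The extremal configuration of a valenced link pattern -/

namespace LinkPattern

variable {N : ℕ}

/-- The left endpoints of the links that are open at `p`. -/
def openLinks (α : LinkPattern N) (p : ℕ) : Finset (Fin (2 * N)) :=
  Finset.univ.filter fun a => (a : ℕ) < p ∧ p ≤ (α.partner a : ℕ)

theorem mem_openLinks {α : LinkPattern N} {p : ℕ} {a : Fin (2 * N)} :
    a ∈ α.openLinks p ↔ (a : ℕ) < p ∧ p ≤ (α.partner a : ℕ) := by
  simp [openLinks]

theorem height_eq_card_openLinks (α : LinkPattern N) (p : ℕ) :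
    α.height p = (α.openLinks p).card := α.height_eq_card p

theorem openLinks_subset {α : LinkPattern N} {a : Fin (2 * N)} {p : ℕ} (ha : a ∈ α.openLinks p) :
    α.openLinks (a + 1) ⊆ α.openLinks p := by
  rw [mem_openLinks] at ha
  intro b hb
  rw [mem_openLinks] at hb ⊢
  have h := α.noncrossing b a
  have h1 : b = a ∨ α.partner b ≠ α.partner a := by
    by_cases hba : b = a
    · exact Or.inl hba
    · exact Or.inr fun h => hba (α.partner_injective h)
  rcases h1 with rfl | h1
  · exact ha
  · by_cases hba : b = a
    · exact hba ▸ ha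
    · simp only [Fin.lt_def, ne_eq, Fin.ext_iff] at h h1 hba
      omega

/-- The heights at which open links start are distinct. -/
theorem height_strictMonoOn (α : LinkPattern N) (p : ℕ) :
    StrictMonoOn (fun a : Fin (2 * N) => α.height (a + 1)) (α.openLinks p) := by
  intro a ha b hb hab
  have ha' := mem_openLinks.mp ha
  have hb' := mem_openLinks.mp hb
  have hlt := Fin.lt_def.mp hab
  simp only [height_eq_card_openLinks, Nat.cast_lt]
  refine Finset.card_lt_card ((Finset.ssubset_iff_of_subset ?_).mpr ⟨b, ?_, ?_⟩)
  · exact openLinks_subset (mem_openLinks.mpr (by omega))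
  · exact mem_openLinks.mpr (by omega)
  · intro h
    have := mem_openLinks.mp h
    omega

theorem image_height_openLinks (α : LinkPattern N) (p : ℕ) :
    (α.openLinks p).image (fun a : Fin (2 * N) => α.height (a + 1)) =
      Finset.Icc 1 (α.height p) := by
  refine Finset.eq_of_subset_of_card_le ?_ ?_
  · intro x hx
    obtain ⟨a, ha, rfl⟩ := Finset.mem_image.mp hx
    have ha' := mem_openLinks.mp ha
    rw [Finset.mem_Icc, height_eq_card_openLinks, height_eq_card_openLinks]
    constructor
    · have : 0 < (α.openLinks (a + 1)).card :=
        Finset.card_pos.mpr ⟨a, mem_openLinks.mpr (by omega)⟩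
      omega
    · exact_mod_cast Finset.card_le_card (openLinks_subset ha)
  · rw [Finset.card_image_of_injOn (α.height_strictMonoOn p).injOn, Int.card_Icc,
      height_eq_card_openLinks]
    omega

theorem height_le (α : LinkPattern N) (p : ℕ) : α.height p ≤ N := by
  rw [height_eq_card_openLinks]
  have h := α.card_left
  rw [Fintype.card_subtype] at h
  refine Int.ofNat_le.mpr (le_trans (Finset.card_le_card fun a ha => ?_) h.le)
  have := mem_openLinks.mp ha
  exact Finset.mem_filter.mpr ⟨Finset.mem_univ _, Fin.lt_def.mpr (by omega)⟩

/-- The labels of the extremal configuration whose chords are the links: the height of the link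
at its left endpoint, and minus the height at the right endpoint. -/
def linkLabel (α : LinkPattern N) (a : Fin (2 * N)) : ℤ :=
  if a < α.partner a then α.height (a + 1) else - α.height (α.partner a + 1)

theorem linkLabel_of_lt {α : LinkPattern N} {a : Fin (2 * N)} (h : a < α.partner a) :
    α.linkLabel a = α.height (a + 1) := if_pos h

theorem linkLabel_partner (α : LinkPattern N) (a : Fin (2 * N)) :
    α.linkLabel (α.partner a) = - α.linkLabel a := by
  have h := α.lt_partner_partner_iff a
  unfold linkLabel
  rw [α.partner_partner] at h ⊢
  by_cases ha : a < α.partner a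
  · rw [if_pos ha, if_neg fun hc => h.mp hc ha]
  · rw [if_neg ha, if_pos (h.mpr ha), neg_neg]

theorem abs_linkLabel_le (α : LinkPattern N) (a : Fin (2 * N)) : |α.linkLabel a| ≤ N := by
  unfold linkLabel
  split_ifs
  · rw [abs_of_nonneg (α.height_nonneg _)]
    exact α.height_le _
  · rw [abs_neg, abs_of_nonneg (α.height_nonneg _)]
    exact α.height_le _

theorem sum_linkLabel (α : LinkPattern N) (p : ℕ) :
    2 * ∑ a ∈ Finset.univ.filter (fun a : Fin (2 * N) => (a : ℕ) < p), α.linkLabel a =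
      α.height p * (α.height p + 1) := by
  rw [α.sum_odd _ α.linkLabel_partner]
  change 2 * ∑ a ∈ α.openLinks p, α.linkLabel a = _
  have h1 : ∑ a ∈ α.openLinks p, α.linkLabel a = ∑ x ∈ Finset.Icc 1 (α.height p), x := by
    rw [← α.image_height_openLinks p, Finset.sum_image (α.height_strictMonoOn p).injOn]
    refine Finset.sum_congr rfl fun a ha => linkLabel_of_lt (Fin.lt_def.mpr ?_)
    have := mem_openLinks.mp ha
    omega
  have h2 : ∀ n : ℕ, 2 * ∑ x ∈ Finset.Icc (1 : ℤ) n, x = (n : ℤ) * (n + 1) := by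
    intro n
    induction n with
    | zero => simp
    | succ n ih =>
      have : Finset.Icc (1 : ℤ) ((n + 1 : ℕ) : ℤ) =
          insert ((n : ℤ) + 1) (Finset.Icc (1 : ℤ) n) := by
        ext x
        simp only [Finset.mem_Icc, Finset.mem_insert]
        omega
      rw [this, Finset.sum_insert (by simp), mul_add, ih]
      push_cast
      ring
  rw [h1]
  obtain ⟨n, hn⟩ := Int.eq_ofNat_of_zero_le (α.height_nonneg p)
  rw [hn]
  exact h2 n

variable {ς : Composition (2 * N)}

/-- The links of a valenced pattern, labelled by their heights, form an extremal configuration. -/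
theorem IsValenced.isExtremal {α : LinkPattern N} (hα : α.IsValenced ς) {A : Numbering N}
    (hA : α.IsNumbering A) : IsExtremal (fun a => (ς.index a : ℕ)) A 1 α.linkLabel := by
  have hlabel : ∀ i, α.linkLabel (A.entry i 0) = α.height (A.entry i 0 + 1) := fun i =>
    linkLabel_of_lt (hA i).1
  have hopen : ∀ k i, (ς.index (A.entry i 0) : ℕ) < k → k ≤ (ς.index (A.entry i 1) : ℕ) →
      A.entry i 0 ∈ α.openLinks (ς.sizeUpTo k) := by
    intro k i h1 h2
    rw [mem_openLinks, lt_sizeUpTo_iff, ← (hA i).2]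
    have := (lt_sizeUpTo_iff (ς := ς) (A.entry i 1) k).not.mpr (by omega)
    exact ⟨h1, by omega⟩
  refine ⟨fun i => ?_, fun i => ?_, fun i => ?_, fun k i j h1 h2 h3 h4 h5 => ?_,
    fun k i h1 h2 l hl1 hl2 => ?_⟩
  · have h1 : ς.index (A.entry i 0) ≤ ς.index (A.entry i 1) := by
      rw [(hA i).2]
      exact index_mono ς (hA i).1.le
    have h2 := hα (A.entry i 0)
    rw [← (hA i).2] at h2
    exact lt_of_le_of_ne h1 fun h => h2 (Fin.ext h.symm)
  · rw [hlabel, height_eq_card_openLinks]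
    have := Fin.lt_def.mp (hA i).1
    have : 0 < (α.openLinks (A.entry i 0 + 1)).card :=
      Finset.card_pos.mpr ⟨A.entry i 0, mem_openLinks.mpr (by omega)⟩
    omega
  · rw [Equiv.Perm.one_apply, (hA i).2, linkLabel_partner]
  · rw [hlabel, hlabel] at h5
    exact (A.entry_inj.mp ((α.height_strictMonoOn (ς.sizeUpTo k)).injOn (hopen k i h1 h2)
      (hopen k j h3 h4) h5)).1
  · rw [hlabel] at hl2
    have hi := mem_openLinks.mp (hopen k i h1 h2)
    have hmem : l ∈ (α.openLinks (A.entry i 0 + 1)).image fun a : Fin (2 * N) =>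
        α.height (a + 1) := by
      rw [image_height_openLinks, Finset.mem_Icc]
      omega
    obtain ⟨a, ha, hal⟩ := Finset.mem_image.mp hmem
    have ha' := mem_openLinks.mp (openLinks_subset (hopen k i h1 h2) ha)
    have hlt : a < α.partner a := Fin.lt_def.mpr (by omega)
    have hrow : A.entry (A.row a) 0 = a := by
      rw [← (hA.left_iff a).mp hlt, A.entry_row_col]
    refine ⟨A.row a, ?_, ?_, ?_⟩
    · rw [hrow, ← lt_sizeUpTo_iff]
      exact ha'.1
    · rw [Equiv.Perm.one_apply, (hA _).2, hrow]
      have := (lt_sizeUpTo_iff (ς := ς) (α.partner a) k).not.mp (by omega)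
      omega
    · rw [hlabel, hrow]
      exact hal

/-- In a group of a valenced pattern, the right endpoints precede the left endpoints. -/
theorem IsValenced.left_of_le {α : LinkPattern N} (hα : α.IsValenced ς) {a b : Fin (2 * N)}
    (hab : a ≤ b) (h : ς.index a = ς.index b) (ha : a < α.partner a) : b < α.partner b := by
  obtain ⟨n, hn⟩ := Nat.exists_eq_add_of_le (Fin.le_def.mp hab)
  induction n generalizing b with
  | zero =>
    obtain rfl : a = b := Fin.ext (by omega)
    exact ha
  | succ n ih =>
    let d : Fin (2 * N) := ⟨a + n, by omega⟩
    have had : a ≤ d := Fin.le_def.mpr (by simp [d])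
    have hdb : d ≤ b := Fin.le_def.mpr (by simp only [d]; omega)
    have hd : ς.index a = ς.index d :=
      le_antisymm (index_mono ς had) (h ▸ index_mono ς hdb)
    have h1 := ih had hd rfl
    by_contra hb
    have h2 := partner_of_peak (i := d) (j := b) (by simp only [d]; omega) h1 hb
    exact hα d (by rw [h2, ← h, hd])

theorem abs_height_sub_le (α : LinkPattern N) (p n : ℕ) (h : p + n ≤ 2 * N) :
    |α.height (p + n) - α.height p| ≤ n := by
  induction n with
  | zero => simp
  | succ n ih =>
    have h1 := ih (by omega)
    have h2 := α.height_succ_cases (k := p + n) (by omega)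
    rw [abs_le] at h1 ⊢
    rw [← add_assoc]
    push_cast
    omega

theorem height_of_left (α : LinkPattern N) (p n : ℕ) (h : p + n ≤ 2 * N)
    (hl : ∀ a : Fin (2 * N), p ≤ (a : ℕ) → (a : ℕ) < p + n → a < α.partner a) :
    α.height (p + n) = α.height p + n := by
  induction n with
  | zero => simp
  | succ n ih =>
    have h1 := ih (by omega) fun a ha ha' => hl a ha (by omega)
    have h2 := α.height_succ ⟨p + n, by omega⟩
    rw [step, if_pos (hl _ (by simp) (by simp))] at h2
    simp only at h2
    rw [← add_assoc, h2, h1]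
    push_cast
    ring

theorem height_of_right (α : LinkPattern N) (p n : ℕ) (h : p + n ≤ 2 * N)
    (hl : ∀ a : Fin (2 * N), p ≤ (a : ℕ) → (a : ℕ) < p + n → ¬ a < α.partner a) :
    α.height (p + n) = α.height p - n := by
  induction n with
  | zero => simp
  | succ n ih =>
    have h1 := ih (by omega) fun a ha ha' => hl a ha (by omega)
    have h2 := α.height_succ ⟨p + n, by omega⟩
    rw [step, if_neg (hl _ (by simp) (by simp))] at h2
    simp only at h2
    rw [← add_assoc, h2, h1]
    push_cast
    ring

/-- A valenced pattern is determined by the heights of its path between the groups. -/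
theorem IsValenced.eq_of_height {α β : LinkPattern N} (hα : α.IsValenced ς) (hβ : β.IsValenced ς)
    (h : ∀ k < ς.length, α.height (ς.sizeUpTo k) = β.height (ς.sizeUpTo k)) : α = β := by
  have h' : ∀ k, α.height (ς.sizeUpTo k) = β.height (ς.sizeUpTo k) := by
    intro k
    by_cases hk : k < ς.length
    · exact h k hk
    · rw [ς.sizeUpTo_ofLength_le k (not_lt.mp hk), α.height_eq_zero_of_le le_rfl,
        β.height_eq_zero_of_le le_rfl]
  have key : ∀ {α β : LinkPattern N}, α.IsValenced ς → β.IsValenced ς →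
      (∀ k, α.height (ς.sizeUpTo k) = β.height (ς.sizeUpTo k)) →
      ∀ a, a < α.partner a → a < β.partner a := by
    intro α β hα hβ h a ha
    by_contra hb
    have hidx := (index_eq_iff ς (a := a) (i := ς.index a)).mp rfl
    have hle := ς.sizeUpTo_le ((ς.index a : ℕ) + 1)
    obtain ⟨u, hu⟩ := Nat.exists_eq_add_of_le hidx.1
    obtain ⟨v, hv⟩ := Nat.exists_eq_add_of_lt hidx.2
    have hrange : ∀ b : Fin (2 * N), ς.sizeUpTo (ς.index a) ≤ (b : ℕ) →
        (b : ℕ) < ς.sizeUpTo ((ς.index a : ℕ) + 1) → ς.index b = ς.index a :=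
      fun b h1 h2 => (index_eq_iff ς).mpr ⟨h1, h2⟩
    -- from `a` on, the path of `α` rises until the end of the group, and up to `a` the path of `β`
    -- falls from the beginning of the group: the two paths have different increments over the group
    have e1 := α.height_of_left a (v + 1) (by omega) fun b h1 h2 =>
      hα.left_of_le (Fin.le_def.mpr h1) (hrange b (by omega) (by omega)).symm ha
    have e2 := β.height_of_right (ς.sizeUpTo (ς.index a)) (u + 1) (by omega) fun b h1 h2 hl =>
      hb (hβ.left_of_le (Fin.le_def.mpr (by omega)) (hrange b (by omega) (by omega)) hl)
    have e3 := α.abs_height_sub_le (ς.sizeUpTo (ς.index a)) u (by omega)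
    have e4 := β.abs_height_sub_le (a + 1) v (by omega)
    have e5 := h (ς.index a)
    have e6 := h ((ς.index a : ℕ) + 1)
    rw [hv] at e6
    rw [abs_le] at e3 e4
    rw [show (a : ℕ) + v + 1 = a + (v + 1) by ring] at e6
    rw [show (a : ℕ) + 1 + v = a + (v + 1) by ring] at e4
    rw [show ς.sizeUpTo (ς.index a) + (u + 1) = a + 1 by omega] at e2
    rw [← hu] at e3
    push_cast at e1 e2
    omega
  exact ext_of_left fun a => ⟨key hα hβ h' a, key hβ hα (fun k => (h' k).symm) a⟩

end LinkPattern

/-! ### Expansion of the fused kernel at well separated points -/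

section KernelSeries

open Asymptotics

/-- The coefficients of the expansion of the fused kernel in powers of the quotient of its two
arguments; they are products of a function of `p` and `J` and of a function of `q` and `J`. -/
def seriesCoeff (p q : ℕ) (J : ℤ) : ℂ :=
  (J : ℂ) * (fallingPoly p).eval (J : ℂ) * (fallingPoly q).eval ((-J : ℤ) : ℂ)

theorem seriesCoeff_eq_zero (p q : ℕ) {n : ℕ} (h : n < p + 1) : seriesCoeff p q n = 0 := by
  unfold seriesCoeff
  rcases n with _ | n
  · simp
  · rw [fallingPoly_eval, Finset.prod_eq_zero (Finset.mem_range.mpr (Nat.lt_of_succ_lt_succ h))]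
    · simp
    · push_cast
      ring

theorem seriesCoeff_add (p q n : ℕ) : seriesCoeff p q ((n + (p + 1) : ℕ) : ℤ) =
    (-1) ^ q * (p + q + 1).factorial * ((n + (p + q + 1)).choose (p + q + 1) : ℕ) := by
  have h1 : (((n + 1).ascFactorial (p + q + 1) : ℕ) : ℂ) =
      (p + q + 1).factorial * ((n + (p + q + 1)).choose (p + q + 1) : ℕ) := by
    rw [Nat.ascFactorial_eq_factorial_mul_choose]
    push_cast
    rfl
  have h2 : (((n + 1).ascFactorial (p + q + 1) : ℕ) : ℂ) =
      (∏ r ∈ Finset.range p, ((n : ℂ) + 1 + r)) * ((n : ℂ) + p + 1) *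
        ∏ r ∈ Finset.range q, ((n : ℂ) + p + 2 + r) := by
    rw [Nat.ascFactorial_eq_prod_range, show p + q + 1 = (p + 1) + q by ring,
      Finset.prod_range_add, Finset.prod_range_succ]
    push_cast
    congr 1
    · ring
    · exact Finset.prod_congr rfl fun r _ => by ring
  have h3 : (fallingPoly p).eval (((n + (p + 1) : ℕ) : ℤ) : ℂ) =
      ∏ r ∈ Finset.range p, ((n : ℂ) + 1 + r) := by
    rw [fallingPoly_eval, ← Finset.prod_range_reflect]
    refine Finset.prod_congr rfl fun r hr => ?_
    have hr' := Finset.mem_range.mp hr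
    rw [Nat.sub_sub, Nat.cast_sub (by omega)]
    push_cast
    ring
  have h4 : (fallingPoly q).eval (((-((n + (p + 1) : ℕ) : ℤ)) : ℤ) : ℂ) =
      (-1) ^ q * ∏ r ∈ Finset.range q, ((n : ℂ) + p + 2 + r) := by
    rw [fallingPoly_eval]
    conv_rhs => rw [← Finset.card_range q]
    rw [← Finset.prod_const, Finset.card_range, ← Finset.prod_mul_distrib]
    refine Finset.prod_congr rfl fun r hr => ?_
    push_cast
    ring
  rw [seriesCoeff, h3, h4, mul_assoc ((-1 : ℂ) ^ q), ← h1, h2]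
  push_cast
  ring

/-- The binomial series. -/
theorem hasSum_seriesCoeff (p q : ℕ) {u : ℂ} (hu : ‖u‖ < 1) :
    HasSum (fun n : ℕ => seriesCoeff p q n * u ^ n)
      ((-1) ^ q * (p + q + 1).factorial * u ^ (p + 1) / (1 - u) ^ (p + q + 2)) := by
  rw [← hasSum_nat_add_iff' (p + 1)]
  rw [Finset.sum_eq_zero fun n hn => by
    rw [seriesCoeff_eq_zero p q (Finset.mem_range.mp hn), zero_mul], sub_zero]
  have h := (hasSum_choose_mul_geometric_of_norm_lt_one (p + q + 1) hu).mul_left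
    ((-1) ^ q * ((p + q + 1).factorial : ℂ) * u ^ (p + 1))
  have hf : (fun n : ℕ => seriesCoeff p q ((n + (p + 1) : ℕ) : ℤ) * u ^ (n + (p + 1))) =
      fun n => (-1) ^ q * ((p + q + 1).factorial : ℂ) * u ^ (p + 1) *
        (((n + (p + q + 1)).choose (p + q + 1) : ℕ) * u ^ n) := by
    funext n
    rw [seriesCoeff_add]
    ring
  rw [hf, div_eq_mul_one_div]
  exact h

/-- The error of the truncated expansion. -/
theorem exists_norm_sub_le (p q M : ℕ) : ∃ D : ℝ, ∀ u : ℂ, ‖u‖ ≤ 1 / 2 →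
    ‖(-1) ^ q * (p + q + 1).factorial * u ^ (p + 1) / (1 - u) ^ (p + q + 2) -
      ∑ n ∈ Finset.range (M + 1), seriesCoeff p q n * u ^ n‖ ≤ D * ‖u‖ ^ (M + 1) := by
  have hsum : Summable fun n : ℕ => ‖seriesCoeff p q ((n + (M + 1) : ℕ) : ℤ)‖ * (1 / 2) ^ n := by
    have h1 := (hasSum_seriesCoeff p q (u := 1 / 2) (by norm_num)).summable.norm
    have h2 := ((summable_nat_add_iff (M + 1)).mpr h1).mul_left (2 ^ (M + 1))
    refine h2.congr fun n => ?_
    rw [norm_mul, norm_pow, pow_add]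
    have h3 : ‖(1 / 2 : ℂ)‖ = 1 / 2 := by norm_num
    have h4 : (2 : ℝ) ^ (M + 1) * (1 / 2) ^ (M + 1) = 1 := by rw [← mul_pow]; norm_num
    rw [h3]
    linear_combination (‖seriesCoeff p q ((n + (M + 1) : ℕ) : ℤ)‖ * (1 / 2) ^ n) * h4
  refine ⟨∑' n : ℕ, ‖seriesCoeff p q ((n + (M + 1) : ℕ) : ℤ)‖ * (1 / 2) ^ n, fun u hu => ?_⟩
  have h1 := (hasSum_nat_add_iff' (M + 1)).mpr (hasSum_seriesCoeff p q (u := u) (by linarith))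
  have h2 : HasSum (fun n : ℕ =>
      (‖seriesCoeff p q ((n + (M + 1) : ℕ) : ℤ)‖ * (1 / 2) ^ n) * ‖u‖ ^ (M + 1)) _ :=
    hsum.hasSum.mul_right _
  refine HasSum.norm_le_of_bounded h1 h2 fun n => ?_
  rw [norm_mul, norm_pow, pow_add, mul_assoc]
  have h3 : ‖u‖ ^ n ≤ (1 / 2) ^ n := pow_le_pow_left₀ (norm_nonneg u) hu n
  gcongr

/-- The fused kernel at `x = u y`, scaled to be a function of `u`. -/
theorem scaled_excKernelDeriv (p q : ℕ) {u y : ℂ} (hy : y ≠ 0) :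
    (u * y) ^ (1 + p) * excKernelDeriv p q (u * y) y * y ^ (1 + q) =
      1 / (Real.pi : ℂ) *
        ((-1) ^ q * (p + q + 1).factorial * u ^ (p + 1) / (1 - u) ^ (p + q + 2)) := by
  rw [excKernelDeriv_eq, show u * y - y = - ((1 - u) * y) by ring, neg_pow ((1 - u) * y),
    mul_pow (1 - u)]
  have h1 : ((-1 : ℂ) ^ (p + q + 2)) = (-1) ^ p * (-1) ^ q := by
    rw [pow_add, pow_add]; norm_num
  have h2 : ((-1 : ℂ) ^ p) ≠ 0 := pow_ne_zero _ (by norm_num)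
  have h3 : ((-1 : ℂ) ^ q) * (-1) ^ q = 1 := by rw [← mul_pow]; norm_num
  have h4 : ((-1 : ℂ) ^ q) ≠ 0 := pow_ne_zero _ (by norm_num)
  have h5 : (y : ℂ) ^ (p + q + 2) ≠ 0 := pow_ne_zero _ hy
  rw [h1]
  by_cases h6 : (1 - u) ^ (p + q + 2) = 0
  · rw [h6]; simp
  have hpi : (Real.pi : ℂ) ≠ 0 := by exact_mod_cast Real.pi_ne_zero
  field_simp
  rw [show ((-1 : ℂ) ^ q) ^ 2 = 1 by rw [sq, h3], mul_pow]
  ring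

variable {N : ℕ}

theorem isBigO_prod_sub_prod {ι : Type*} {f : Filter ℝ} {F G : ι → ℝ → ℂ} {r : ℝ → ℝ}
    (s : Finset ι) (hF : ∀ i, F i =O[f] (fun _ => (1 : ℝ))) (hG : ∀ i, G i =O[f] (fun _ => (1 : ℝ)))
    (h : ∀ i, (fun t => F i t - G i t) =O[f] r) :
    (fun t => ∏ i ∈ s, F i t - ∏ i ∈ s, G i t) =O[f] r := by
  classical
  have hprod : ∀ s : Finset ι, (fun t => ∏ i ∈ s, F i t) =O[f] (fun _ => (1 : ℝ)) := by
    intro s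
    induction s using Finset.induction_on with
    | empty => simpa using isBigO_refl (fun _ : ℝ => (1 : ℝ)) f
    | insert i s hi ih =>
      simp only [Finset.prod_insert hi]
      simpa using (hF i).mul ih
  induction s using Finset.induction_on with
  | empty => simpa using isBigO_zero _ _
  | insert i s hi ih =>
    simp only [Finset.prod_insert hi]
    have h1 : (fun t => F i t * ∏ j ∈ s, F j t - G i t * ∏ j ∈ s, G j t) =
        fun t => (F i t - G i t) * ∏ j ∈ s, F j t + G i t * (∏ j ∈ s, F j t - ∏ j ∈ s, G j t) := by
      funext t; ring
    rw [h1]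
    have h2 := (h i).mul (hprod s)
    have h3 := (hG i).mul ih
    simp only [mul_one, one_mul] at h2 h3
    exact h2.add h3

/-- An approximation of a bounded kernel yields one of its evaluations. -/
theorem isBigO_kernelEval_sub {f : Filter ℝ} {K K' : ℝ → Fin (2 * N) → Fin (2 * N) → ℂ}
    {r : ℝ → ℝ} (hK : ∀ a b, (fun t => K t a b) =O[f] (fun _ => (1 : ℝ)))
    (hK' : ∀ a b, (fun t => K' t a b) =O[f] (fun _ => (1 : ℝ)))
    (h : ∀ a b, (fun t => K t a b - K' t a b) =O[f] r) (v : MonoidAlgebra ℂ (Tabloid N)) :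
    (fun t => kernelEval (K t) v - kernelEval (K' t) v) =O[f] r := by
  simp only [kernelEval_apply, ← mul_sub, ← Finset.sum_sub_distrib]
  refine IsBigO.const_mul_left (IsBigO.fun_sum fun t _ => IsBigO.const_mul_left ?_ _) _
  exact isBigO_prod_sub_prod _ (fun i => hK _ _) (fun i => hK' _ _) fun i => h _ _

end KernelSeries

/-! ### Leading terms of fused determinants -/

section Weights

variable {N : ℕ} (ς : Composition (2 * N)) (B : ℕ)

/-- The weight of the `i`-th group: the `i`-th point is placed at `t ^ weight ς B i`. The
differences of consecutive weights are the powers of `B`, so that an exponent records in base `B`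
the sums of the labels before the cuts between the groups. -/
def weight (i : ℕ) : ℕ := ∑ k ∈ Finset.range ς.length with i < k, B ^ k

variable {B} in
theorem weight_lt_weight (hB : 0 < B) {i j : ℕ} (hij : i < j) (hj : j < ς.length) :
    weight ς B j < weight ς B i := by
  refine Finset.sum_lt_sum_of_subset (i := j) ?_ ?_ ?_ (by positivity) fun _ _ _ => Nat.zero_le _
  · intro k hk
    rw [Finset.mem_filter] at hk ⊢
    exact ⟨hk.1, hij.trans hk.2⟩
  · exact Finset.mem_filter.mpr ⟨Finset.mem_range.mpr hj, hij⟩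
  · simp

/-- The exponent of `t` that belongs to the labels `g`. -/
def labelExponent (g : Fin (2 * N) → ℤ) : ℤ := ∑ a, (weight ς B (ς.index a) : ℤ) * g a

theorem labelExponent_eq (g : Fin (2 * N) → ℤ) : labelExponent ς B g =
    ∑ k ∈ Finset.range ς.length, (B : ℤ) ^ k * ∑ a with (ς.index a : ℕ) < k, g a := by
  simp only [labelExponent, weight, Finset.mul_sum, Finset.sum_filter, Nat.cast_sum, Finset.sum_mul]
  rw [Finset.sum_comm]
  refine Finset.sum_congr rfl fun k _ => Finset.sum_congr rfl fun a _ => ?_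
  split_ifs <;> simp

/-- The leading exponent of a link pattern. -/
def leadExponent (α : LinkPattern N) : ℤ := labelExponent ς B α.linkLabel

theorem two_mul_sum_linkLabel_cut (α : LinkPattern N) (k : ℕ) :
    2 * ∑ a with (ς.index a : ℕ) < k, α.linkLabel a =
      α.height (ς.sizeUpTo k) * (α.height (ς.sizeUpTo k) + 1) := by
  rw [← α.sum_linkLabel]
  congr 1
  exact Finset.sum_congr (Finset.filter_congr fun a _ => (lt_sizeUpTo_iff a k).symm) fun _ _ => rfl

/-- Uniqueness of the digits in base `B`. -/
theorem eq_of_sum_pow_mul {B : ℤ} (n : ℕ) {x y : ℕ → ℤ} (hx : ∀ k, 0 ≤ x k ∧ x k < B)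
    (hy : ∀ k, 0 ≤ y k ∧ y k < B)
    (h : ∑ k ∈ Finset.range n, B ^ k * x k = ∑ k ∈ Finset.range n, B ^ k * y k) :
    ∀ k < n, x k = y k := by
  induction n generalizing x y with
  | zero => intro k hk; omega
  | succ n ih =>
    rw [Finset.sum_range_succ', Finset.sum_range_succ'] at h
    simp only [pow_zero, one_mul, pow_succ'] at h
    simp only [mul_assoc, ← Finset.mul_sum] at h
    have h0 : x 0 = y 0 := by
      have h1 := congrArg (· % B) h
      simp only [Int.mul_add_emod_self_left] at h1
      rwa [Int.emod_eq_of_lt (hx 0).1 (hx 0).2, Int.emod_eq_of_lt (hy 0).1 (hy 0).2] at h1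
    have hB : B ≠ 0 := by have := hx 0; omega
    have h2 := ih (x := fun k => x (k + 1)) (y := fun k => y (k + 1)) (fun k => hx _)
      (fun k => hy _)
      (by
        rw [h0, add_left_inj] at h
        exact mul_left_cancel₀ hB h)
    rintro (_ | k) hk
    · exact h0
    · exact h2 k (by omega)

/-- Valenced patterns have distinct leading exponents if the base is large. -/
theorem leadExponent_injOn (hB : N * (N + 1) < B) :
    Set.InjOn (leadExponent ς B) {α | α.IsValenced ς} := by
  intro α hα β hβ h
  refine LinkPattern.IsValenced.eq_of_height hα hβ fun k hk => ?_
  have hbound : ∀ (γ : LinkPattern N) (k : ℕ), 0 ≤ ∑ a with (ς.index a : ℕ) < k, γ.linkLabel a ∧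
      ∑ a with (ς.index a : ℕ) < k, γ.linkLabel a < (B : ℤ) := by
    intro γ k
    have h1 := two_mul_sum_linkLabel_cut ς γ k
    have h2 := γ.height_nonneg (ς.sizeUpTo k)
    have h3 := γ.height_le (ς.sizeUpTo k)
    have h4 : ((N * (N + 1) : ℕ) : ℤ) < B := by exact_mod_cast hB
    push_cast at h4
    constructor <;> nlinarith
  unfold leadExponent at h
  rw [labelExponent_eq, labelExponent_eq] at h
  have h1 := eq_of_sum_pow_mul ς.length (hbound α) (hbound β) h k hk
  have h2 := two_mul_sum_linkLabel_cut ς α k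
  rw [h1, two_mul_sum_linkLabel_cut] at h2
  have h3 := α.height_nonneg (ς.sizeUpTo k)
  have h4 := β.height_nonneg (ς.sizeUpTo k)
  nlinarith

open Classical in
/-- The coefficient of the labels `g` in the expansion, up to a positive factor. -/
def labelSign (A : Numbering N) (g : Fin (2 * N) → ℤ) : ℤ :=
  labelVandermonde (fun a => (ς.index a : ℕ)) g *
    ∑ m : Equiv.Perm (Fin N) with IsCompatible (fun a => (ς.index a : ℕ)) A g m,
      (Equiv.Perm.sign m : ℤ)

variable {ς} {α : LinkPattern N} {A : Numbering N}

/-- If in all compatible configurations the chords over each cut have distinct labels, then the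
exponent is at least the leading one, with equality only for extremal configurations, which all
contribute a positive sign. -/
theorem labelSign_spec (hA : α.IsNumbering A) (hB : 0 < B) {g : Fin (2 * N) → ℤ}
    (hg : ∀ m, IsCompatible (fun a => (ς.index a : ℕ)) A g m →
      ∀ k i j, (ς.index (A.entry i 0) : ℕ) < k → k ≤ (ς.index (A.entry (m i) 1) : ℕ) →
      (ς.index (A.entry j 0) : ℕ) < k → k ≤ (ς.index (A.entry (m j) 1) : ℕ) →
      g (A.entry i 0) = g (A.entry j 0) → i = j) :
    (labelSign ς A g ≠ 0 → leadExponent ς B α ≤ labelExponent ς B g) ∧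
    (labelExponent ς B g = leadExponent ς B α → 0 ≤ labelSign ς A g ∧
      ((∃ m, IsCompatible (fun a => (ς.index a : ℕ)) A g m) → 0 < labelSign ς A g)) := by
  classical
  have hle : ∀ m, IsCompatible (fun a => (ς.index a : ℕ)) A g m → ∀ k,
      (B : ℤ) ^ k * ∑ a with (ς.index a : ℕ) < k, α.linkLabel a ≤
        (B : ℤ) ^ k * ∑ a with (ς.index a : ℕ) < k, g a := by
    intro m hm k
    have h1 := (hA.le_sum_labels hm (hg m hm)).1 k
    rw [← two_mul_sum_linkLabel_cut] at h1
    exact mul_le_mul_of_nonneg_left (by omega) (by positivity)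
  constructor
  · intro h0
    obtain ⟨m, hm⟩ : ∃ m, IsCompatible (fun a => (ς.index a : ℕ)) A g m := by
      by_contra! hc
      refine h0 ?_
      rw [labelSign, Finset.sum_filter, Finset.sum_eq_zero fun m _ => if_neg (hc m), mul_zero]
    rw [leadExponent, labelExponent_eq, labelExponent_eq]
    exact Finset.sum_le_sum fun k _ => hle m hm k
  · intro he
    have hext : ∀ m, IsCompatible (fun a => (ς.index a : ℕ)) A g m →
        0 < labelVandermonde (fun a => (ς.index a : ℕ)) g * (Equiv.Perm.sign m : ℤ) := by
      intro m hm
      rw [leadExponent, labelExponent_eq, labelExponent_eq, eq_comm] at he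
      have h1 := (Finset.sum_eq_sum_iff_of_le fun k _ => hle m hm k).mp he
      have h2 : IsExtremal (fun a => (ς.index a : ℕ)) A m g := by
        refine (hA.le_sum_labels hm (hg m hm)).2 fun k hk => ?_
        rw [← two_mul_sum_linkLabel_cut]
        congr 1
        exact mul_left_cancel₀ (by positivity) (h1 k (Finset.mem_range.mpr hk))
      have h3 := h2.sign_eq (fun a b hab => index_mono ς hab) hA
      rcases Int.units_eq_one_or (Equiv.Perm.sign m) with h4 | h4
      · rw [h4] at h3 ⊢
        simp only [Units.val_one, one_mul, mul_one] at h3 ⊢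
        exact Int.sign_eq_one_iff_pos.mp h3
      · rw [h4] at h3 ⊢
        simp only [Units.val_neg, Units.val_one, neg_mul, one_mul, mul_neg, mul_one] at h3 ⊢
        rw [← Int.sign_neg] at h3
        exact Int.sign_eq_one_iff_pos.mp h3
    rw [labelSign, Finset.mul_sum]
    constructor
    · exact Finset.sum_nonneg fun m hm => (hext m (Finset.mem_filter.mp hm).2).le
    · rintro ⟨m, hm⟩
      exact Finset.sum_pos (fun m hm => hext m (Finset.mem_filter.mp hm).2)
        ⟨m, Finset.mem_filter.mpr ⟨Finset.mem_univ _, hm⟩⟩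

/-- Either the compatible configurations cancel or, in all of them, the chords over each cut have
distinct labels. -/
theorem labelSign_dichotomy (g : Fin (2 * N) → ℤ) : labelSign ς A g = 0 ∨
    ∀ m, IsCompatible (fun a => (ς.index a : ℕ)) A g m →
      ∀ k i j, (ς.index (A.entry i 0) : ℕ) < k → k ≤ (ς.index (A.entry (m i) 1) : ℕ) →
      (ς.index (A.entry j 0) : ℕ) < k → k ≤ (ς.index (A.entry (m j) 1) : ℕ) →
      g (A.entry i 0) = g (A.entry j 0) → i = j := by
  refine or_iff_not_imp_right.mpr fun h => ?_
  push Not at h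
  obtain ⟨m, hm, k, i, j, h1, h2, h3, h4, h5, h6⟩ := h
  rw [labelSign, hm.sum_sign_eq_zero h6 h1 h2 h3 h4 h5, mul_zero]

theorem le_labelExponent (hA : α.IsNumbering A) (hB : 0 < B) {g : Fin (2 * N) → ℤ}
    (h : labelSign ς A g ≠ 0) : leadExponent ς B α ≤ labelExponent ς B g := by
  rcases labelSign_dichotomy (ς := ς) (A := A) g with h0 | h0
  · exact absurd h0 h
  · exact (labelSign_spec B hA hB h0).1 h

theorem labelSign_nonneg (hA : α.IsNumbering A) (hB : 0 < B) {g : Fin (2 * N) → ℤ}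
    (h : labelExponent ς B g = leadExponent ς B α) : 0 ≤ labelSign ς A g := by
  rcases labelSign_dichotomy (ς := ς) (A := A) g with h0 | h0
  · exact h0.ge
  · exact ((labelSign_spec B hA hB h0).2 h).1

theorem labelSign_linkLabel_pos (hα : α.IsValenced ς) (hA : α.IsNumbering A) :
    0 < labelSign ς A α.linkLabel := by
  have hext := hα.isExtremal hA
  have hcomp : IsCompatible (fun a => (ς.index a : ℕ)) A α.linkLabel 1 := by
    intro i
    have h1 := hext.neg i
    exact ⟨by omega, Or.inl ⟨hext.lt i, hext.pos i⟩⟩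
  -- the number of chords over a cut with a given label is the same for all compatible
  -- configurations
  refine ((labelSign_spec 1 hA one_pos fun m hm k i j h1 h2 h3 h4 h5 => ?_).2 rfl).2 ⟨1, hcomp⟩
  by_contra hij
  have hpos := hext.pos i
  have h6 := hm.card_forwardRows k hpos
  rw [← hcomp.card_forwardRows k hpos] at h6
  have h7 : 1 < (forwardRows (fun a => (ς.index a : ℕ)) A α.linkLabel m k
      (α.linkLabel (A.entry i 0))).card := Finset.one_lt_card.mpr
    ⟨i, by simp [forwardRows, h1, h2], j, by simp [forwardRows, h3, h4, h5], hij⟩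
  have h8 : 1 < (forwardRows (fun a => (ς.index a : ℕ)) A α.linkLabel 1 k
      (α.linkLabel (A.entry i 0))).card := by omega
  obtain ⟨a, ha, b, hb, hab⟩ := Finset.one_lt_card.mp h8
  have ha' := (Finset.mem_filter.mp ha).2
  have hb' := (Finset.mem_filter.mp hb).2
  exact hab (hext.inj k a b ha'.2.1 ha'.2.2 hb'.2.1 hb'.2.2 (ha'.1.trans hb'.1.symm))

end Weights

/-! ### Injectivity of the fused evaluation -/

section LeadingTerm

open Asymptotics

variable {N : ℕ} (ς : Composition (2 * N)) (B : ℕ)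

/-- The fused kernel at the points `t ^ weight ς B i`, scaled by powers of these points. -/
def scaledKernel (t : ℝ) (a b : Fin (2 * N)) : ℂ :=
  if ς.index a = ς.index b then 0 else
    ((t : ℂ) ^ weight ς B (ς.index a)) ^ (1 + pos ς a) *
      excKernelDeriv (pos ς a) (pos ς b) ((t : ℂ) ^ weight ς B (ς.index a))
        ((t : ℂ) ^ weight ς B (ς.index b)) *
      ((t : ℂ) ^ weight ς B (ς.index b)) ^ (1 + pos ς b)

theorem scaledKernel_comm (t : ℝ) (a b : Fin (2 * N)) :
    scaledKernel ς B t a b = scaledKernel ς B t b a := by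
  unfold scaledKernel
  rw [excKernelDeriv_comm]
  refine if_congr eq_comm rfl ?_
  ring

variable {B}

/-- The points `t ^ weight ς B i`. -/
def scalePoint (hB : 0 < B) {t : ℝ} (ht0 : 0 < t) (ht1 : t < 1) : Conf ς.length :=
  ⟨fun i => (t : ℂ) ^ weight ς B i, by
    have hanti : ∀ i j : Fin ς.length, i < j → (t : ℂ) ^ weight ς B i ≠ (t : ℂ) ^ weight ς B j := by
      intro i j hij h
      have h1 : t ^ weight ς B i < t ^ weight ς B j :=
        pow_lt_pow_right_of_lt_one₀ ht0 ht1 (weight_lt_weight ς hB hij j.2)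
      rw [← Complex.ofReal_pow, ← Complex.ofReal_pow, Complex.ofReal_inj] at h
      exact h1.ne h
    intro i j h
    rcases lt_trichotomy i j with h1 | h1 | h1
    · exact absurd h (hanti i j h1)
    · exact h1
    · exact absurd h.symm (hanti j i h1)⟩

theorem kernelEval_scaledKernel (hB : 0 < B) {t : ℝ} (ht0 : 0 < t) (ht1 : t < 1)
    (v : MonoidAlgebra ℂ (Tabloid N)) : kernelEval (scaledKernel ς B t) v =
      (∏ a, ((t : ℂ) ^ weight ς B (ς.index a)) ^ (1 + pos ς a)) *
        kernelEval (fusedKernel ς (scalePoint ς hB ht0 ht1)) v := by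
  rw [← kernelEval_diagonal]
  congr 2
  funext a b
  unfold scaledKernel fusedKernel
  split_ifs
  · ring
  · rfl

variable (B)

/-- The part of the label `μ` at the site `a` in the expansion of the scaled kernel. -/
def labelMatrix (t : ℝ) (a : Fin (2 * N)) (μ : ℤ) : ℂ :=
  (fallingPoly (pos ς a)).eval (μ : ℂ) * (t : ℂ) ^ ((weight ς B (ς.index a) : ℤ) * μ)

/-- The pairing of the labels in the expansion of the scaled kernel: opposite labels, the positive
one in the earlier group. -/
def labelPairing (a b : Fin (2 * N)) (μ ν : ℤ) : ℂ :=
  if μ + ν = 0 ∧ ((ς.index a < ς.index b ∧ 0 < μ) ∨ (ς.index b < ς.index a ∧ 0 < ν)) then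
    ((|μ| / Real.pi : ℝ) : ℂ) else 0

/-- The truncation of the expansion of the scaled kernel. -/
def truncKernel (M : ℕ) (t : ℝ) (a b : Fin (2 * N)) : ℂ :=
  ∑ μ : Finset.Icc (-M : ℤ) M, ∑ ν : Finset.Icc (-M : ℤ) M,
    labelMatrix ς B t a μ * labelPairing ς a b μ ν * labelMatrix ς B t b ν

theorem truncKernel_comm (M : ℕ) (t : ℝ) (a b : Fin (2 * N)) :
    truncKernel ς B M t a b = truncKernel ς B M t b a := by
  unfold truncKernel
  rw [Finset.sum_comm]
  refine Finset.sum_congr rfl fun μ _ => Finset.sum_congr rfl fun ν _ => ?_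
  have h : labelPairing ς a b ν μ = labelPairing ς b a μ ν := by
    unfold labelPairing
    by_cases h0 : (ν : ℤ) + μ = 0
    · rw [show (μ : ℤ) = -ν by omega, abs_neg]
      refine if_congr ?_ rfl rfl
      rw [add_comm (ν : ℤ), or_comm]
    · rw [if_neg fun h => h0 h.1, if_neg fun h => h0 (by rw [add_comm]; exact h.1)]
  rw [h]
  ring

theorem truncKernel_of_eq (M : ℕ) (t : ℝ) {a b : Fin (2 * N)} (h : ς.index a = ς.index b) :
    truncKernel ς B M t a b = 0 := by
  refine Finset.sum_eq_zero fun μ _ => Finset.sum_eq_zero fun ν _ => ?_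
  rw [labelPairing, if_neg, mul_zero, zero_mul]
  rw [h]
  simp

variable {B}

theorem truncKernel_of_lt (hB : 0 < B) (M : ℕ) {t : ℝ} (ht : t ≠ 0) {a b : Fin (2 * N)}
    (h : ς.index a < ς.index b) : truncKernel ς B M t a b =
      1 / (Real.pi : ℂ) * ∑ n ∈ Finset.range (M + 1), seriesCoeff (pos ς a) (pos ς b) n *
        ((t : ℂ) ^ (weight ς B (ς.index a) - weight ς B (ς.index b))) ^ n := by
  have hw := (weight_lt_weight ς hB (Fin.lt_def.mp h) (ς.index b).2).le
  have ht' : (t : ℂ) ≠ 0 := by exact_mod_cast ht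
  unfold truncKernel
  have h1 : ∀ μ : ℤ, ∑ ν : Finset.Icc (-M : ℤ) M,
      labelMatrix ς B t a μ * labelPairing ς a b μ ν * labelMatrix ς B t b ν =
      ∑ ν ∈ Finset.Icc (-M : ℤ) M,
        labelMatrix ς B t a μ * labelPairing ς a b μ ν * labelMatrix ς B t b ν := fun μ =>
    Finset.sum_coe_sort (Finset.Icc (-M : ℤ) M) fun ν =>
      labelMatrix ς B t a μ * labelPairing ς a b μ ν * labelMatrix ς B t b ν
  simp only [h1]
  rw [Finset.sum_coe_sort (Finset.Icc (-M : ℤ) M) fun μ => ∑ ν ∈ Finset.Icc (-M : ℤ) M,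
        labelMatrix ς B t a μ * labelPairing ς a b μ ν * labelMatrix ς B t b ν,
    ← Finset.sum_product', Finset.mul_sum]
  symm
  refine Finset.sum_of_injOn (fun n : ℕ => ((n : ℤ), -(n : ℤ))) ?_ ?_ ?_ ?_
  · intro n _ n' _ hn
    exact Int.ofNat_inj.mp (Prod.ext_iff.mp hn).1
  · intro n hn
    have := Finset.mem_range.mp (Finset.mem_coe.mp hn)
    rw [Finset.mem_coe, Finset.mem_product, Finset.mem_Icc, Finset.mem_Icc]
    simp only
    omega
  · rintro ⟨μ, ν⟩ hμ hn
    rw [Finset.mem_product, Finset.mem_Icc, Finset.mem_Icc] at hμ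
    simp only at hμ ⊢
    rw [labelPairing, if_neg, mul_zero, zero_mul]
    rintro ⟨h0, h2 | h2⟩
    · refine hn ⟨μ.toNat, ?_, ?_⟩
      · rw [Finset.mem_coe, Finset.mem_range]; omega
      · simp only [Prod.mk.injEq]
        omega
    · exact absurd h2.1 h.not_gt
  · intro n hn
    rcases n.eq_zero_or_pos with rfl | hpos
    · rw [seriesCoeff_eq_zero _ _ (Nat.succ_pos _), labelPairing, if_neg]
      · ring
      · simp
    · simp only [labelPairing, labelMatrix]
      rw [if_pos ⟨by ring, Or.inl ⟨h, by omega⟩⟩, seriesCoeff]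
      have h2 : ((t : ℂ) ^ (weight ς B (ς.index a) - weight ς B (ς.index b))) ^ n =
          (t : ℂ) ^ ((weight ς B (ς.index a) : ℤ) * n) *
            (t : ℂ) ^ ((weight ς B (ς.index b) : ℤ) * -n) := by
        rw [← zpow_add₀ ht', ← pow_mul, ← zpow_natCast]
        congr 1
        push_cast [hw]
        ring
      rw [h2]
      have h3 : ((|(n : ℤ)| / Real.pi : ℝ) : ℂ) = ((n : ℤ) : ℂ) / Real.pi := by
        rw [Nat.abs_cast]
        push_cast
        rfl
      push_cast at h3 ⊢
      rw [h3]
      ring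

theorem isBigO_scaledKernel_sub (hB : 0 < B) (M : ℕ) (a b : Fin (2 * N)) :
    (fun t => scaledKernel ς B t a b - truncKernel ς B M t a b) =O[𝓝[>] 0]
      fun t : ℝ => t ^ (M + 1) := by
  have key : ∀ {a b : Fin (2 * N)}, ς.index a < ς.index b →
      (fun t => scaledKernel ς B t a b - truncKernel ς B M t a b) =O[𝓝[>] 0]
        fun t : ℝ => t ^ (M + 1) := by
    intro a b h
    have hw := weight_lt_weight ς hB (Fin.lt_def.mp h) (ς.index b).2
    obtain ⟨D, hD⟩ := exists_norm_sub_le (pos ς a) (pos ς b) M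
    refine IsBigO.of_bound (‖1 / (Real.pi : ℂ)‖ * |D|) ?_
    filter_upwards [Ioo_mem_nhdsGT (show (0 : ℝ) < 1 / 2 by norm_num)] with t ht
    have ht' : (t : ℂ) ≠ 0 := by exact_mod_cast ht.1.ne'
    set n := weight ς B (ς.index a) - weight ς B (ς.index b) with hn
    set u := (t : ℂ) ^ n with hu
    have hx : (t : ℂ) ^ weight ς B (ς.index a) = u * (t : ℂ) ^ weight ς B (ς.index b) := by
      rw [hu, ← pow_add, hn, Nat.sub_add_cancel hw.le]
    have hnorm : ‖u‖ ≤ t := by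
      rw [hu, norm_pow, Complex.norm_real, Real.norm_of_nonneg ht.1.le]
      exact pow_le_of_le_one ht.1.le (by linarith [ht.2]) (by omega)
    rw [truncKernel_of_lt ς hB M ht.1.ne' h, scaledKernel, if_neg h.ne, hx,
      scaled_excKernelDeriv _ _ (pow_ne_zero _ ht'), ← mul_sub, norm_mul,
      mul_assoc ‖1 / (Real.pi : ℂ)‖]
    refine mul_le_mul_of_nonneg_left ?_ (norm_nonneg (1 / (Real.pi : ℂ)))
    refine (hD u (by linarith [ht.2])).trans ?_
    rw [Real.norm_of_nonneg (pow_nonneg ht.1.le _)]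
    exact mul_le_mul (le_abs_self D) (pow_le_pow_left₀ (norm_nonneg u) hnorm _) (by positivity)
      (abs_nonneg D)
  rcases lt_trichotomy (ς.index a) (ς.index b) with h | h | h
  · exact key h
  · simp only [truncKernel_of_eq ς B M _ h, scaledKernel, if_pos h, sub_self]
    exact isBigO_zero _ _
  · simp only [scaledKernel_comm ς B _ a b, truncKernel_comm ς B M _ a b]
    exact key h

theorem isBigO_truncKernel (hB : 0 < B) (M : ℕ) (a b : Fin (2 * N)) :
    (fun t => truncKernel ς B M t a b) =O[𝓝[>] 0] fun _ : ℝ => (1 : ℝ) := by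
  have key : ∀ {a b : Fin (2 * N)}, ς.index a < ς.index b →
      (fun t => truncKernel ς B M t a b) =O[𝓝[>] 0] fun _ : ℝ => (1 : ℝ) := by
    intro a b h
    have hcont : Continuous fun t : ℝ => 1 / (Real.pi : ℂ) *
        ∑ n ∈ Finset.range (M + 1), seriesCoeff (pos ς a) (pos ς b) n *
        ((t : ℂ) ^ (weight ς B (ς.index a) - weight ς B (ς.index b))) ^ n := by fun_prop
    refine ((hcont.tendsto 0).mono_left nhdsWithin_le_nhds).isBigO_one ℝ
      |>.congr' ?_ EventuallyEq.rfl
    filter_upwards [self_mem_nhdsWithin] with t ht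
    exact (truncKernel_of_lt ς hB M (ne_of_gt ht) h).symm
  rcases lt_trichotomy (ς.index a) (ς.index b) with h | h | h
  · exact key h
  · simp only [truncKernel_of_eq ς B M _ h]
    exact isBigO_zero _ _
  · simp only [truncKernel_comm ς B M _ a b]
    exact key h

/-- The positive factor of the coefficient of the labels `g`. -/
def labelWeight (A : Numbering N) (g : Fin (2 * N) → ℤ) : ℝ :=
  ∏ i, (|g (A.entry i 0)| / Real.pi : ℝ)

open Classical in
theorem sum_sign_labelPairing (A : Numbering N) (g : Fin (2 * N) → ℤ) :
    ∑ m : Equiv.Perm (Fin N), csign m * ∏ i, labelPairing ς (A.entry i 0) (A.entry (m i) 1)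
      (g (A.entry i 0)) (g (A.entry (m i) 1)) =
    ((∑ m : Equiv.Perm (Fin N) with IsCompatible (fun a => (ς.index a : ℕ)) A g m,
      (Equiv.Perm.sign m : ℤ) : ℤ) : ℂ) * (labelWeight A g : ℂ) := by
  rw [Int.cast_sum, Finset.sum_mul, Finset.sum_filter]
  refine Finset.sum_congr rfl fun m _ => ?_
  split_ifs with hm
  · rw [labelWeight, Complex.ofReal_prod]
    congr 1
    refine Finset.prod_congr rfl fun i _ => ?_
    exact if_pos (hm i)
  · obtain ⟨i, hi⟩ := not_forall.mp hm
    rw [Finset.prod_eq_zero (Finset.mem_univ i), mul_zero]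
    exact if_neg hi

theorem kernelEval_truncKernel (M : ℕ) {t : ℝ} (ht : t ≠ 0) (A : Numbering N) :
    kernelEval (truncKernel ς B M t) (antisym (tabloidRep N) (young ς) (polytabloid A)) =
      ∑ g : Fin (2 * N) → Finset.Icc (-M : ℤ) M,
        (t : ℂ) ^ labelExponent ς B (fun a => g a) *
          ((labelSign ς A (fun a => g a) : ℂ) * (labelWeight A (fun a => g a) : ℂ)) := by
  classical
  have ht' : (t : ℂ) ≠ 0 := by exact_mod_cast ht
  rw [kernelEval_antisym_polytabloid (Λ := Finset.Icc (-M : ℤ) M)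
    (L := fun a μ => labelMatrix ς B t a μ) (C := fun a b μ ν => labelPairing ς a b μ ν)
    (truncKernel_comm ς B M t) (fun a b => rfl)]
  · refine Finset.sum_congr rfl fun g _ => ?_
    rw [sum_sign_labelPairing ς A fun a => g a]
    have h1 : ∑ σ : Equiv.Perm (Fin (2 * N)) with σ ∈ young ς,
        csign σ * ∏ a, labelMatrix ς B t (σ a) (g a) =
        (t : ℂ) ^ labelExponent ς B (fun a => g a) *
          (labelVandermonde (fun a => (ς.index a : ℕ)) (fun a => g a) : ℤ) := by
      rw [← sum_young_fallingPoly, Finset.mul_sum]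
      refine Finset.sum_congr rfl fun σ hσ => ?_
      have hσ' : ∀ a, ς.index (σ a) = ς.index a := (Finset.mem_filter.mp hσ).2
      have hpow : ∀ s : Finset (Fin (2 * N)), ∏ a ∈ s,
          (t : ℂ) ^ ((weight ς B (ς.index a) : ℤ) * (g a : ℤ)) =
          (t : ℂ) ^ ∑ a ∈ s, (weight ς B (ς.index a) : ℤ) * (g a : ℤ) := by
        intro s
        induction s using Finset.induction_on with
        | empty => simp
        | insert a s ha ih =>
          rw [Finset.prod_insert ha, Finset.sum_insert ha, zpow_add₀ ht', ih]
      simp only [labelMatrix, hσ', Finset.prod_mul_distrib]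
      rw [hpow, labelExponent]
      ring
    rw [h1, labelSign]
    push_cast
    ring
  · intro σ hσ a b
    funext μ ν
    rw [labelPairing, labelPairing, hσ a, hσ b]

/-- The leading term of an antisymmetrized polytabloid of a link pattern as `t` tends to zero: the
coefficients of all labels with the leading exponent are nonnegative, and the one of `linkLabel` is
positive. -/
theorem exists_tendsto_scaledKernel (hB : 0 < B) (α : LinkPattern N) {e : ℤ}
    (he : e ≤ leadExponent ς B α) : ∃ L : ℂ,
    Tendsto (fun t : ℝ => (t : ℂ) ^ (-e) * kernelEval (scaledKernel ς B t)
      (antisym (tabloidRep N) (young ς) α.polytab)) (𝓝[>] 0) (𝓝 L) ∧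
    (e < leadExponent ς B α → L = 0) ∧
    (α.IsValenced ς → e = leadExponent ς B α → L ≠ 0) := by
  classical
  set A := α.numbering with hAdef
  have hA : α.IsNumbering A := α.isNumbering_numbering
  -- the truncation includes the labels `linkLabel`, and its error has a higher order than `e`
  set M : ℕ := max N e.toNat with hM
  set P : (Fin (2 * N) → Finset.Icc (-M : ℤ) M) → ℂ := fun g =>
    (labelSign ς A (fun a => g a) : ℂ) * (labelWeight A (fun a => g a) : ℂ) with hP
  set E : (Fin (2 * N) → Finset.Icc (-M : ℤ) M) → ℤ := fun g => labelExponent ς B fun a => g a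
  have hP0 : ∀ g, P g ≠ 0 → leadExponent ς B α ≤ E g := by
    intro g hg
    refine le_labelExponent B hA hB fun h => hg ?_
    simp [hP, h]
  refine ⟨∑ g, if E g = e then P g else 0, ?_, ?_, ?_⟩
  · have htrunc : Tendsto (fun t : ℝ => (t : ℂ) ^ (-e) * kernelEval (truncKernel ς B M t)
        (antisym (tabloidRep N) (young ς) α.polytab)) (𝓝[>] 0)
        (𝓝 (∑ g, if E g = e then P g else 0)) := by
      have h1 : ∀ᶠ t : ℝ in 𝓝[>] 0, ∑ g, (t : ℂ) ^ (E g - e) * P g =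
          (t : ℂ) ^ (-e) * kernelEval (truncKernel ς B M t)
            (antisym (tabloidRep N) (young ς) α.polytab) := by
        filter_upwards [self_mem_nhdsWithin] with t ht
        have ht' : (t : ℂ) ≠ 0 := by exact_mod_cast (ne_of_gt ht)
        rw [LinkPattern.polytab, kernelEval_truncKernel ς M (ne_of_gt ht), Finset.mul_sum]
        refine Finset.sum_congr rfl fun g _ => ?_
        rw [sub_eq_add_neg, zpow_add₀ ht']
        ring
      refine Tendsto.congr' h1 (tendsto_finsetSum _ fun g _ => ?_)
      by_cases hg : P g = 0
      · simp [hg]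
      have hle := hP0 g hg
      by_cases heq : E g = e
      · simp [heq]
      rw [if_neg heq]
      obtain ⟨n, hn⟩ := Int.eq_ofNat_of_zero_le (show 0 ≤ E g - e by omega)
      rw [hn]
      have hn0 : n ≠ 0 := by omega
      have hcont : Continuous fun t : ℝ => (t : ℂ) ^ n * P g := by fun_prop
      have h2 := (hcont.tendsto 0).mono_left (nhdsWithin_le_nhds (s := Set.Ioi 0))
      simpa [hn0] using h2
    have hdiff : Tendsto (fun t : ℝ => (t : ℂ) ^ (-e) * (kernelEval (scaledKernel ς B t)
        (antisym (tabloidRep N) (young ς) α.polytab) - kernelEval (truncKernel ς B M t)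
        (antisym (tabloidRep N) (young ς) α.polytab))) (𝓝[>] 0) (𝓝 0) := by
      have hpow : (fun t : ℝ => t ^ (M + 1)) =O[𝓝[>] 0] fun _ : ℝ => (1 : ℝ) := by
        have hcont : Continuous fun t : ℝ => t ^ (M + 1) := by fun_prop
        exact ((hcont.tendsto 0).mono_left nhdsWithin_le_nhds).isBigO_one ℝ
      have hbig := isBigO_kernelEval_sub
        (K := fun t => scaledKernel ς B t) (K' := fun t => truncKernel ς B M t)
        (fun a b => by
          simpa using ((isBigO_scaledKernel_sub ς hB M a b).trans hpow).add
            (isBigO_truncKernel ς hB M a b))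
        (isBigO_truncKernel ς hB M) (isBigO_scaledKernel_sub ς hB M)
        (antisym (tabloidRep N) (young ς) α.polytab)
      have hbig' := hbig.trans (IsBigO.of_bound 1 (Eventually.of_forall fun t : ℝ => by
        rw [Complex.norm_real, one_mul]) :
          (fun t : ℝ => t ^ (M + 1)) =O[𝓝[>] 0] fun t : ℝ => ((t ^ (M + 1) : ℝ) : ℂ))
      have h2 := (isBigO_refl (fun t : ℝ => (t : ℂ) ^ (-e)) (𝓝[>] 0)).mul hbig'
      refine h2.trans_tendsto ?_
      obtain ⟨n, hn⟩ := Int.eq_ofNat_of_zero_le (show 0 ≤ (M : ℤ) - e by omega)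
      have hcont : Continuous fun t : ℝ => (t : ℂ) ^ (n + 1) := by fun_prop
      have h3 := (hcont.tendsto 0).mono_left (nhdsWithin_le_nhds (s := Set.Ioi 0))
      simp only [Complex.ofReal_zero, ne_eq, Nat.add_eq_zero_iff, one_ne_zero, and_false,
        not_false_eq_true, zero_pow] at h3
      refine h3.congr' ?_
      filter_upwards [self_mem_nhdsWithin] with t ht
      have ht' : (t : ℂ) ≠ 0 := by exact_mod_cast (ne_of_gt ht)
      rw [Complex.ofReal_pow, ← zpow_natCast, ← zpow_natCast, ← zpow_add₀ ht']
      congr 1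
      push_cast
      omega
    have := hdiff.add htrunc
    rw [zero_add] at this
    refine this.congr fun t => ?_
    ring
  · intro hlt
    refine Finset.sum_eq_zero fun g _ => ?_
    split_ifs with hg
    · by_contra h
      have := hP0 g h
      omega
    · rfl
  · intro hα he'
    have hreal : (∑ g, if E g = e then P g else 0) = ((∑ g, if E g = e then
        (labelSign ς A (fun a => g a) : ℝ) * labelWeight A (fun a => g a) else 0 : ℝ) : ℂ) := by
      rw [Complex.ofReal_sum]
      refine Finset.sum_congr rfl fun g _ => ?_
      split_ifs
      · simp [hP]
      · simp
    rw [hreal, Complex.ofReal_ne_zero]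
    have hw0 : ∀ g : Fin (2 * N) → ℤ, 0 ≤ labelWeight A g := fun g =>
      Finset.prod_nonneg fun i _ => div_nonneg (by positivity) Real.pi_pos.le
    have hlabel : ∀ a, α.linkLabel a ∈ Finset.Icc (-M : ℤ) M := by
      intro a
      have h1 := abs_le.mp (α.abs_linkLabel_le a)
      rw [Finset.mem_Icc]
      omega
    refine ne_of_gt (Finset.sum_pos' (fun g _ => ?_)
      ⟨fun a => ⟨α.linkLabel a, hlabel a⟩, Finset.mem_univ _, ?_⟩)
    · split_ifs with hg
      · refine mul_nonneg ?_ (hw0 _)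
        exact_mod_cast labelSign_nonneg B hA hB (hg.trans he')
      · rfl
    · rw [if_pos (show labelExponent ς B α.linkLabel = e from he'.symm)]
      refine mul_pos ?_ (Finset.prod_pos fun i _ => div_pos ?_ Real.pi_pos)
      · exact_mod_cast labelSign_linkLabel_pos hα hA
      · exact_mod_cast abs_pos.mpr ((hα.isExtremal hA).pos i).ne'

open Classical in
/-- The fused evaluations of the antisymmetrized polytabloids of the valenced link patterns are
linearly independent. -/
theorem linearIndependent_fused {c : {α : LinkPattern N // α.IsValenced ς} → ℂ}
    (h : ∀ ξ : Conf ς.length, kernelEval (fusedKernel ς ξ)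
      (∑ α, c α • antisym (tabloidRep N) (young ς) α.1.polytab) = 0) : c = 0 := by
  classical
  set B := N * (N + 1) + 1 with hBdef
  have hB : 0 < B := Nat.succ_pos _
  by_contra hc
  obtain ⟨α₁, hα₁⟩ : ∃ α, c α ≠ 0 := by
    by_contra! h'
    exact hc (funext h')
  -- the pattern with the smallest leading exponent dominates
  obtain ⟨α₀, hα₀, hmin⟩ := Finset.exists_min_image
    (Finset.univ.filter fun α => c α ≠ 0) (fun α => leadExponent ς B α.1)
    ⟨α₁, Finset.mem_filter.mpr ⟨Finset.mem_univ _, hα₁⟩⟩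
  have hc0 := (Finset.mem_filter.mp hα₀).2
  set e := leadExponent ς B α₀.1 with he
  have hlim : ∀ α : {α : LinkPattern N // α.IsValenced ς}, ∃ L : ℂ,
      Tendsto (fun t : ℝ => c α * ((t : ℂ) ^ (-e) * kernelEval (scaledKernel ς B t)
        (antisym (tabloidRep N) (young ς) α.1.polytab))) (𝓝[>] 0) (𝓝 L) ∧
      (α ≠ α₀ → L = 0) ∧ (α = α₀ → L ≠ 0) := by
    intro α
    by_cases hcα : c α = 0
    · exact ⟨0, by simp [hcα], fun _ => rfl, fun h => absurd (h ▸ hcα) hc0⟩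
    · have hle := hmin α (Finset.mem_filter.mpr ⟨Finset.mem_univ _, hcα⟩)
      obtain ⟨L, h1, h2, h3⟩ := exists_tendsto_scaledKernel ς hB α.1 hle
      refine ⟨c α * L, h1.const_mul _, fun hne => ?_, fun heq => ?_⟩
      · rw [h2, mul_zero]
        refine lt_of_le_of_ne hle fun h => hne ?_
        exact Subtype.ext (leadExponent_injOn ς B (Nat.lt_succ_self _) α.2 α₀.2 h.symm)
      · refine mul_ne_zero hcα (h3 α.2 ?_)
        rw [heq]
  choose L hL1 hL2 hL3 using hlim
  have hsum := tendsto_finsetSum (Finset.univ) fun α _ => hL1 α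
  rw [Finset.sum_eq_single α₀ (fun α _ hne => hL2 α hne)
    (fun h => absurd (Finset.mem_univ _) h)] at hsum
  refine hL3 α₀ rfl (tendsto_nhds_unique hsum ?_)
  refine Tendsto.congr' ?_ tendsto_const_nhds
  filter_upwards [Ioo_mem_nhdsGT (show (0 : ℝ) < 1 by norm_num)] with t ht
  have h1 := kernelEval_scaledKernel ς hB ht.1 ht.2
    (∑ α, c α • antisym (tabloidRep N) (young ς) α.1.polytab)
  rw [h, mul_zero, map_sum] at h1
  have h2 := congrArg ((t : ℂ) ^ (-e) * ·) h1
  simp only [mul_zero, Finset.mul_sum, map_smul, smul_eq_mul] at h2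
  rw [← h2]
  exact Finset.sum_congr rfl fun α _ => by ring

/-- An antisymmetric vector is determined by its fused evaluation. -/
theorem eq_zero_of_kernelEval_fused {v : MonoidAlgebra ℂ (Tabloid N)} (hv : v ∈ antiSub ς)
    (h : ∀ ξ : Conf ς.length, kernelEval (fusedKernel ς ξ) v = 0) : v = 0 := by
  classical
  set f : {α : LinkPattern N // α.IsValenced ς} → MonoidAlgebra ℂ (Tabloid N) :=
    fun α => antisym (tabloidRep N) (young ς) α.1.polytab with hf
  have hli : LinearIndependent ℂ f := by
    rw [Fintype.linearIndependent_iff]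
    intro c hc α
    have := linearIndependent_fused ς (c := c) fun ξ => by
      rw [show ∑ α, c α • antisym (tabloidRep N) (young ς) α.1.polytab = 0 from hc, map_zero]
    rw [this]; rfl
  have hle : Submodule.span ℂ (Set.range f) ≤ antiSub ς := by
    rw [Submodule.span_le]
    rintro _ ⟨α, rfl⟩
    exact antisym_mem_antiSub α.1.polytab_mem
  have hspan : antiSub ς = Submodule.span ℂ
      (Set.range fun α : {α : LinkPattern N // α.IsValenced ς} => α.1.pureVec) := by
    rw [← LinkPattern.span_pureVec_isValenced, Set.image_eq_range]
    rfl
  -- the pure vectors bound the dimension by the number of valenced patterns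
  have hfin : FiniteDimensional ℂ (antiSub ς) := by
    rw [hspan]
    exact FiniteDimensional.span_of_finite ℂ (Set.finite_range _)
  have heq : Submodule.span ℂ (Set.range f) = antiSub ς := by
    refine Submodule.eq_of_le_of_finrank_le hle ?_
    rw [finrank_span_eq_card hli]
    conv_lhs => rw [hspan]
    exact finrank_range_le_card _
  rw [← heq] at hv
  obtain ⟨c, rfl⟩ := (Submodule.mem_span_range_iff_exists_fun ℂ).mp hv
  rw [linearIndependent_fused ς h]
  simp

end LeadingTerm

/-! ### Spaces of partition functions -/

section Existence

variable {N : ℕ}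

/-- If no group has more than half of the sites then there is a valenced link pattern. The group in
the middle is joined to the sites before it and to the sites after it, and the remaining sites
before and after it are joined to each other. -/
theorem exists_isValenced {ς : Composition (2 * N)} (hς : ∀ i, ς.blocksFun i ≤ N) :
    ∃ α : LinkPattern N, α.IsValenced ς := by
  rcases N.eq_zero_or_pos with rfl | hN
  · exact ⟨⟨fun a => a, fun a => a.elim0, fun a => a.elim0, fun a => a.elim0⟩, fun a => a.elim0⟩
  set i := ς.index ⟨N, by omega⟩ with hi
  obtain ⟨h1, h2⟩ := (index_eq_iff ς (a := ⟨N, by omega⟩) (i := i)).mp rfl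
  have h3 := ς.sizeUpTo_succ' i
  have h4 := hς i
  have h5 := ς.sizeUpTo_le ((i : ℕ) + 1)
  have hcut : ∀ (a b : Fin (2 * N)) (k : ℕ), (a : ℕ) < ς.sizeUpTo k → ς.sizeUpTo k ≤ b →
      ς.index a ≠ ς.index b := by
    intro a b k ha hb hab
    rw [lt_sizeUpTo_iff] at ha
    have := (lt_sizeUpTo_iff (ς := ς) b k).not.mp (by omega)
    rw [hab] at ha
    exact this ha
  have hcutl := fun a b => hcut a b i
  have hcutr := fun a b => hcut a b (i + 1)
  simp only at h1 h2
  generalize ς.sizeUpTo i = c₁ at h1 h3 hcutl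
  generalize ς.sizeUpTo ((i : ℕ) + 1) = c₂ at h2 h3 h5 hcutr
  generalize ς.blocksFun i = s at h3 h4
  -- the group that contains the site `N` is `[c₁, c₂)`; the sites in `[N - s, c₁ + c₂ - N)` are
  -- reflected at `c₁`, the ones in `[c₁ + c₂ - N, N + s)` at `c₂`, and all others at `N`
  let p : Fin (2 * N) → Fin (2 * N) := fun a =>
    if h : N - s ≤ (a : ℕ) ∧ (a : ℕ) < c₁ + c₂ - N then ⟨2 * c₁ - 1 - a, by omega⟩
    else if h' : c₁ + c₂ - N ≤ (a : ℕ) ∧ (a : ℕ) < N + s then ⟨2 * c₂ - 1 - a, by omega⟩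
    else ⟨2 * N - 1 - a, by omega⟩
  have hp : ∀ a : Fin (2 * N), (p a : ℕ) = if N - s ≤ (a : ℕ) ∧ (a : ℕ) < c₁ + c₂ - N then
      2 * c₁ - 1 - a else if c₁ + c₂ - N ≤ (a : ℕ) ∧ (a : ℕ) < N + s then 2 * c₂ - 1 - a
      else 2 * N - 1 - a := by
    intro a
    simp only [p]
    split_ifs <;> rfl
  refine ⟨⟨p, fun a => ?_, fun a h => ?_, fun a b h => ?_⟩, fun a h => ?_⟩
  · refine Fin.ext ?_
    have ha := hp a
    rw [hp (p a)]
    have := a.2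
    split_ifs at ha ⊢ <;> omega
  · have ha := hp a
    rw [h] at ha
    have := a.2
    split_ifs at ha <;> omega
  · simp only [Fin.lt_def] at h
    have ha := hp a
    have hb := hp b
    have := a.2
    have := b.2
    split_ifs at ha hb <;> omega
  · change ς.index (p a) = ς.index a at h
    have ha := hp a
    have := a.2
    rcases lt_or_ge (a : ℕ) (p a : ℕ) with hlt | hle
    · have e1 := hcutl a (p a)
      have e2 := hcutr a (p a)
      rw [h] at e1 e2
      split_ifs at ha <;> omega
    · have e1 := hcutl (p a) a
      have e2 := hcutr (p a) a
      rw [h] at e1 e2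
      split_ifs at ha <;> omega

end Existence

section RationalFunctions

variable (d : ℕ)

/-- The quotients of polynomials whose denominators do not vanish at distinct points. -/
def rationalFunctions : Subalgebra ℂ (Conf d → ℂ) where
  carrier := {f | ∃ P Q : MvPolynomial (Fin d) ℂ, (∀ x : Conf d, MvPolynomial.eval x.1 Q ≠ 0) ∧
    ∀ x : Conf d, f x * MvPolynomial.eval x.1 Q = MvPolynomial.eval x.1 P}
  mul_mem' := by
    rintro f g ⟨P, Q, hQ, h⟩ ⟨P', Q', hQ', h'⟩
    refine ⟨P * P', Q * Q', fun x => ?_, fun x => ?_⟩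
    · rw [map_mul]
      exact mul_ne_zero (hQ x) (hQ' x)
    · rw [map_mul, map_mul, ← h, ← h', Pi.mul_apply]
      ring
  add_mem' := by
    rintro f g ⟨P, Q, hQ, h⟩ ⟨P', Q', hQ', h'⟩
    refine ⟨P * Q' + P' * Q, Q * Q', fun x => ?_, fun x => ?_⟩
    · rw [map_mul]
      exact mul_ne_zero (hQ x) (hQ' x)
    · rw [map_add, map_mul, map_mul, map_mul, ← h, ← h', Pi.add_apply]
      ring
  algebraMap_mem' c := ⟨MvPolynomial.C c, 1, fun x => by simp, fun x => by simp⟩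

variable {d}

/-- A rational function is determined by its values at real points in increasing order. -/
theorem eq_zero_of_mem_rationalFunctions {f : Conf d → ℂ} (hf : f ∈ rationalFunctions d)
    (h : ∀ (x : Fin d → ℝ) (hx : StrictMono x), f (Conf.ofReal x hx) = 0) : f = 0 := by
  obtain ⟨P, Q, hQ, hPQ⟩ := hf
  -- the numerator vanishes on a product of infinite sets
  have hP : P = 0 := by
    refine MvPolynomial.funext_set
      (fun i : Fin d => (fun x : ℝ => (x : ℂ)) '' Set.Ioo (i : ℝ) ((i : ℝ) + 1)) (fun i => ?_) ?_
    · exact (Set.Ioo_infinite (by linarith)).image Complex.ofReal_injective.injOn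
    · intro z hz
      choose x hx using fun i => hz i (Set.mem_univ i)
      have hmono : StrictMono x := by
        intro i j hij
        have h1 := (hx i).1.2
        have h2 := (hx j).1.1
        have h3 : (i : ℝ) + 1 ≤ j := by exact_mod_cast hij
        linarith
      have h4 := hPQ (Conf.ofReal x hmono)
      rw [h, zero_mul] at h4
      rw [map_zero, h4]
      congr 2
      funext i
      exact (hx i).2.symm
  funext x
  have h1 := hPQ x
  rw [hP, map_zero] at h1
  exact (mul_eq_zero.mp h1).resolve_right (hQ x)

theorem fusedKernel_mem_rationalFunctions {N : ℕ} (ς : Composition (2 * N)) (a b : Fin (2 * N)) :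
    (fun ξ : Conf ς.length => fusedKernel ς ξ a b) ∈ rationalFunctions ς.length := by
  by_cases hab : ς.index a = ς.index b
  · simp only [fusedKernel, if_pos hab]
    exact zero_mem _
  · simp only [fusedKernel, if_neg hab, excKernelDeriv_eq]
    have hne : ∀ ξ : Conf ς.length, ξ.1 (ς.index a) - ξ.1 (ς.index b) ≠ 0 := fun ξ =>
      sub_ne_zero.mpr fun h => hab (ξ.2 h)
    refine ⟨MvPolynomial.C (1 / (Real.pi : ℂ) * ((-1) ^ (ς.invEmbedding a : ℕ) *
        ((ς.invEmbedding a : ℕ) + (ς.invEmbedding b : ℕ) + 1).factorial)),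
      (MvPolynomial.X (ς.index a) - MvPolynomial.X (ς.index b)) ^
        ((ς.invEmbedding a : ℕ) + (ς.invEmbedding b : ℕ) + 2), fun ξ => ?_, fun ξ => ?_⟩
    · simpa using fun h => absurd h (hne ξ)
    · simp only [map_pow, map_sub, MvPolynomial.eval_X, MvPolynomial.eval_C]
      rw [mul_assoc, div_mul_cancel₀ _ (pow_ne_zero _ (hne ξ))]

end RationalFunctions

section Evaluations

variable {N : ℕ} (ς : Composition (2 * N))

variable (N) in
/-- The evaluation of formal combinations of tabloids as functions of distinct points. -/
def unfusedEval : MonoidAlgebra ℂ (Tabloid N) →ₗ[ℂ] Conf (2 * N) → ℂ :=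
  LinearMap.pi fun x => kernelEval (unfusedKernel x)

/-- The evaluation of formal combinations of tabloids with the fused kernel. -/
def fusedEval : MonoidAlgebra ℂ (Tabloid N) →ₗ[ℂ] Conf ς.length → ℂ :=
  LinearMap.pi fun ξ => kernelEval (fusedKernel ς ξ)

theorem unfusedEval_apply (v : MonoidAlgebra ℂ (Tabloid N)) (x : Conf (2 * N)) :
    unfusedEval N v x = kernelEval (unfusedKernel x) v := rfl

theorem fusedEval_apply (v : MonoidAlgebra ℂ (Tabloid N)) (ξ : Conf ς.length) :
    fusedEval ς v ξ = kernelEval (fusedKernel ς ξ) v := rfl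

theorem unfusedKernel_comm {n : ℕ} (x : Conf n) (a b : Fin n) :
    unfusedKernel x a b = unfusedKernel x b a := by
  unfold unfusedKernel excKernel
  refine if_congr eq_comm rfl ?_
  rw [← neg_sub (x.1 b), neg_sq]

theorem map_unfusedEval : (specht N).toSubmodule.map (unfusedEval N) = unfusedSpace N := by
  rw [← LinkPattern.span_pureVec, Submodule.map_span, ← Set.range_comp, unfusedSpace]
  congr 2
  funext α x
  exact LinkPattern.kernelEval_pureVec (unfusedKernel_comm x) α

theorem map_fusedEval : (antiSub ς).map (fusedEval ς) = solSpace ς := by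
  rw [← LinkPattern.span_pureVec_isValenced, Submodule.map_span, solSpace, ← Set.image_comp]
  congr 2
  funext α ξ
  exact LinkPattern.kernelEval_pureVec (fusedKernel_comm ς ξ) α

theorem fusedEval_injOn {v : MonoidAlgebra ℂ (Tabloid N)} (hv : v ∈ antiSub ς)
    (h : fusedEval ς v = 0) : v = 0 :=
  eq_zero_of_kernelEval_fused ς hv fun ξ => congrFun h ξ

/-- The unfused evaluation is injective on the Specht module: this is the case of groups of one
site. -/
theorem unfusedEval_injOn {v : MonoidAlgebra ℂ (Tabloid N)} (hv : v ∈ (specht N).toSubmodule)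
    (h : unfusedEval N v = 0) : v = 0 := by
  set ς := Composition.ones (2 * N) with hς
  have hinj : Function.Injective ς.index := by
    have hpos : ∀ a, pos ς a = 0 := by
      intro a
      have := pos_lt ς a
      rw [hς, Composition.ones_blocksFun] at this
      rw [hς]
      omega
    intro a b hab
    exact eq_of_index_pos ς hab ((hpos a).trans (hpos b).symm)
  have hanti : v ∈ antiSub ς := by
    refine ⟨hv, fun σ hσ => ?_⟩
    obtain rfl : σ = 1 := Equiv.ext fun a => hinj (hσ a)
    simp [csign]
  refine eq_zero_of_kernelEval_fused ς hanti fun ξ => ?_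
  have h1 := isDiagEval_kernelEval hanti ξ
  have h2 : (fun x : Conf (2 * N) =>
      kernelEval (unfusedKernel x) v / groupVandermonde ς x) = fun _ => 0 := by
    funext x
    rw [← unfusedEval_apply, h, Pi.zero_apply, zero_div]
  rw [h2] at h1
  have hne : (comap (Subtype.val : Conf (2 * N) → Fin (2 * N) → ℂ) (𝓝 (diagPoint ς ξ))).NeBot := by
    rw [comap_neBot_iff]
    intro s hs
    exact ⟨⟨diagPoint ς ξ, ξ.2.comp hinj⟩, mem_of_mem_nhds hs⟩
  have h3 := tendsto_nhds_unique' hne h1 tendsto_const_nhds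
  exact (mul_eq_zero.mp h3).resolve_left (inv_ne_zero (factorialFactor_ne_zero ς))

theorem solSpace_le_rationalFunctions :
    solSpace ς ≤ Subalgebra.toSubmodule (rationalFunctions ς.length) := by
  rw [← map_fusedEval, Submodule.map_le_iff_le_comap]
  intro v _
  rw [Submodule.mem_comap, Subalgebra.mem_toSubmodule]
  have h : fusedEval ς v = (N.factorial : ℂ)⁻¹ • ∑ t ∈ v.coeff.support, v.coeff t •
      ∏ i : Fin N, fun ξ : Conf ς.length => fusedKernel ς ξ
        ((Quotient.out (s := rowSetoid N) t).entry i 0)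
        ((Quotient.out (s := rowSetoid N) t).entry i 1) := by
    funext ξ
    rw [fusedEval_apply, kernelEval_apply]
    simp [rowProd, Finset.sum_apply, Finset.prod_apply]
  rw [h]
  exact Subalgebra.smul_mem _ (Subalgebra.sum_mem _ fun t _ => Subalgebra.smul_mem _
    (Subalgebra.prod_mem _ fun i _ => fusedKernel_mem_rationalFunctions ς _ _) _) _

theorem unfusedEval_tabloidRep (σ : Equiv.Perm (Fin (2 * N))) (v : MonoidAlgebra ℂ (Tabloid N)) :
    unfusedEval N (tabloidRep N σ v) = permRep (2 * N) σ (unfusedEval N v) := by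
  funext x
  rw [unfusedEval_apply, kernelEval_tabloidRep (unfusedKernel_comm x)]
  change _ = kernelEval (unfusedKernel (x.perm σ)) v
  congr 2
  funext a b
  unfold unfusedKernel
  exact if_congr σ.injective.eq_iff rfl rfl

theorem unfusedEval_polytabloid (A : Numbering N) :
    unfusedEval N (polytabloid A) = kernelMinor A := by
  funext x
  exact kernelEval_polytabloid (unfusedKernel_comm x) A

end Evaluations

/-! ### Actions on the spaces of partition functions -/

section Corner

variable {R W M : Type*} [Semiring R] [Algebra ℂ R] [AddCommGroup W] [Module ℂ W] [AddCommGroup M]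
  [Module ℂ M] (ρ : R →ₐ[ℂ] Module.End ℂ W) {e : R} (he : IsIdempotentElem e)

include he in
theorem apply_of_mem_range {w : W} (hw : w ∈ LinearMap.range (ρ e)) : ρ e w = w := by
  obtain ⟨u, rfl⟩ := hw
  rw [← Module.End.mul_apply, ← map_mul, he.eq]

theorem apply_mem_range_of_corner (x : he.Corner) (w : W) : ρ x.1 w ∈ LinearMap.range (ρ e) := by
  obtain ⟨_, a, rfl⟩ := x
  simp only [map_mul, Module.End.mul_apply]
  exact ⟨_, rfl⟩

/-- The action of the corner ring `e R e` on the image of `e`. -/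
def cornerAction : he.Corner →+* Module.End ℂ (LinearMap.range (ρ e)) where
  toFun x := (ρ x.1).restrict fun w _ => apply_mem_range_of_corner ρ he x w
  map_one' := LinearMap.ext fun w => Subtype.ext (apply_of_mem_range ρ he w.2)
  map_mul' x y := LinearMap.ext fun w => Subtype.ext (by
    change ρ (x.1 * y.1) w = ρ x.1 (ρ y.1 w)
    rw [map_mul, Module.End.mul_apply])
  map_zero' := LinearMap.ext fun w => Subtype.ext (by
    change ρ 0 (w : W) = 0
    rw [map_zero, LinearMap.zero_apply])
  map_add' x y := LinearMap.ext fun w => Subtype.ext (by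
    change ρ (x.1 + y.1) (w : W) = ρ x.1 w + ρ y.1 w
    rw [map_add, LinearMap.add_apply])

theorem coe_cornerAction (x : he.Corner) (w : LinearMap.range (ρ e)) :
    (cornerAction ρ he x w : W) = ρ x.1 w := rfl

/-- The action of the corner ring transported to an isomorphic space. -/
abbrev cornerModule (ψ : LinearMap.range (ρ e) ≃ₗ[ℂ] M) : Module he.Corner M :=
  Module.compHom M ((ψ.conjRingEquiv : Module.End ℂ (LinearMap.range (ρ e)) →+* Module.End ℂ M).comp
    (cornerAction ρ he))

theorem cornerModule_smul (ψ : LinearMap.range (ρ e) ≃ₗ[ℂ] M) (x : he.Corner)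
    (w : LinearMap.range (ρ e)) :
    letI := cornerModule ρ he ψ
    x • ψ w = ψ (cornerAction ρ he x w) := by
  change ψ (cornerAction ρ he x (ψ.symm (ψ w))) = _
  rw [ψ.symm_apply_apply]

end Corner

section Actions

variable (N : ℕ)

/-- The unfused evaluation as an isomorphism of the Specht module with the unfused space. -/
def spechtEquiv : (specht N).toSubmodule ≃ₗ[ℂ] unfusedSpace N :=
  LinearEquiv.ofBijective
    ((unfusedEval N).restrict (p := (specht N).toSubmodule) (q := unfusedSpace N) fun v hv => by
      rw [← map_unfusedEval]
      exact Submodule.mem_map_of_mem hv)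
    ⟨by
      rw [injective_iff_map_eq_zero]
      intro v hv
      exact Subtype.ext (unfusedEval_injOn v.2 (congrArg Subtype.val hv)), by
      rintro ⟨F, hF⟩
      have hF' := hF
      rw [← map_unfusedEval] at hF'
      obtain ⟨v, hv, rfl⟩ := hF'
      exact ⟨⟨v, hv⟩, rfl⟩⟩

variable {N}

theorem coe_spechtEquiv (v : (specht N).toSubmodule) :
    (spechtEquiv N v : Conf (2 * N) → ℂ) = unfusedEval N v := rfl

theorem unfusedEval_spechtEquiv_symm (F : unfusedSpace N) :
    unfusedEval N ((spechtEquiv N).symm F) = F := by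
  rw [← coe_spechtEquiv, LinearEquiv.apply_symm_apply]

theorem permRep_mem_unfusedSpace (σ : Equiv.Perm (Fin (2 * N))) {F : Conf (2 * N) → ℂ}
    (hF : F ∈ unfusedSpace N) : permRep (2 * N) σ F ∈ unfusedSpace N := by
  rw [← map_unfusedEval] at hF ⊢
  obtain ⟨v, hv, rfl⟩ := hF
  exact ⟨tabloidRep N σ v, (specht N).apply_mem_toSubmodule σ hv, unfusedEval_tabloidRep σ v⟩

variable (N) in
/-- The symmetric group acting on the unfused space. -/
def unfusedRep : Representation ℂ (Equiv.Perm (Fin (2 * N))) (unfusedSpace N) where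
  toFun σ := (permRep (2 * N) σ).restrict fun _ hF => permRep_mem_unfusedSpace σ hF
  map_one' := rfl
  map_mul' _ _ := rfl

theorem spechtEquiv_rep (σ : Equiv.Perm (Fin (2 * N))) (v : (specht N).toSubmodule) :
    spechtEquiv N ((specht N).toRepresentation σ v) = unfusedRep N σ (spechtEquiv N v) :=
  Subtype.ext (unfusedEval_tabloidRep σ v)

theorem exists_tlAction : ∃ ρ : TL (2 * N) (-2) →ₐ[ℂ] Module.End ℂ (unfusedSpace N),
    ∀ σ, ρ (permToTL (2 * N) σ) = unfusedRep N σ := by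
  refine exists_tl_action (unfusedRep N) fun a b c hab hbc hac F => ?_
  obtain ⟨v, rfl⟩ := (spechtEquiv N).surjective F
  simp only [← spechtEquiv_rep, ← map_add]
  rw [LinearEquiv.map_eq_zero_iff]
  exact Subtype.ext (symmetrizer_eq_zero hab hbc hac v.2)

variable (N) in
/-- The action of the Temperley-Lieb algebra on the unfused space. -/
def tlAction : TL (2 * N) (-2) →ₐ[ℂ] Module.End ℂ (unfusedSpace N) := exists_tlAction.choose

theorem tlAction_permToTL (σ : Equiv.Perm (Fin (2 * N))) :
    tlAction N (permToTL (2 * N) σ) = unfusedRep N σ := exists_tlAction.choose_spec σ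

/-- The unfused space is a simple module. -/
theorem exists_tlAction_eq {F : unfusedSpace N} (hF : F ≠ 0) (G : unfusedSpace N) :
    ∃ a, tlAction N a F = G := by
  -- the orbit of `F`, as a subspace of the Specht module
  set ev : TL (2 * N) (-2) →ₗ[ℂ] unfusedSpace N :=
    (LinearMap.applyₗ F).comp (tlAction N).toLinearMap with hev
  set U : Submodule ℂ (MonoidAlgebra ℂ (Tabloid N)) :=
    (LinearMap.range ev).map ((specht N).toSubmodule.subtype ∘ₗ
      ((spechtEquiv N).symm : unfusedSpace N →ₗ[ℂ] (specht N).toSubmodule)) with hU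
  have hmem : ∀ G : unfusedSpace N, ((spechtEquiv N).symm G : MonoidAlgebra ℂ (Tabloid N)) ∈ U ↔
      ∃ a, tlAction N a F = G := by
    intro G
    constructor
    · rintro ⟨_, ⟨a, rfl⟩, h⟩
      exact ⟨a, (spechtEquiv N).symm.injective (Subtype.ext h)⟩
    · rintro ⟨a, rfl⟩
      exact ⟨_, ⟨a, rfl⟩, rfl⟩
  rw [← hmem]
  have hspecht : U = (specht N).toSubmodule := by
    refine specht_simple ?_ ?_ ?_
    · rintro _ ⟨H, _, rfl⟩
      exact ((spechtEquiv N).symm H).2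
    · rintro σ _ ⟨_, ⟨a, rfl⟩, rfl⟩
      have h : tabloidRep N σ ((spechtEquiv N).symm (ev a)) =
          (spechtEquiv N).symm (unfusedRep N σ (ev a)) := by
        obtain ⟨v, hv⟩ := (spechtEquiv N).surjective (ev a)
        rw [← hv, ← spechtEquiv_rep, LinearEquiv.symm_apply_apply, LinearEquiv.symm_apply_apply]
        rfl
      change tabloidRep N σ ((spechtEquiv N).symm (ev a)) ∈ U
      rw [h, hmem]
      refine ⟨permToTL (2 * N) σ * a, ?_⟩
      rw [map_mul, tlAction_permToTL]
      rfl
    · rw [Submodule.ne_bot_iff]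
      refine ⟨(spechtEquiv N).symm F, (hmem F).mpr ⟨1, by rw [map_one]; rfl⟩, fun h => hF ?_⟩
      have h1 : (spechtEquiv N).symm F = 0 := Subtype.ext h
      rwa [LinearEquiv.map_eq_zero_iff] at h1
  rw [hspecht]
  exact ((spechtEquiv N).symm G).2

variable (ς : Composition (2 * N))

/-- The image of the idempotent consists of the functions of antisymmetric vectors. -/
theorem mem_range_idem (F : unfusedSpace N) : F ∈ LinearMap.range (tlAction N (TL.idem ς)) ↔
    ((spechtEquiv N).symm F : MonoidAlgebra ℂ (Tabloid N)) ∈ antiSub ς := by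
  have hrep : ∀ σ (F : unfusedSpace N), ((spechtEquiv N).symm (unfusedRep N σ F) :
      MonoidAlgebra ℂ (Tabloid N)) = tabloidRep N σ ((spechtEquiv N).symm F) := by
    intro σ F
    obtain ⟨v, rfl⟩ := (spechtEquiv N).surjective F
    rw [← spechtEquiv_rep, LinearEquiv.symm_apply_apply, LinearEquiv.symm_apply_apply]
    rfl
  constructor
  · rintro ⟨G, rfl⟩
    refine ⟨((spechtEquiv N).symm _).2, fun σ hσ => ?_⟩
    rw [← hrep, ← tlAction_permToTL, ← Module.End.mul_apply, ← map_mul, permToTL_mul_idem hσ,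
      map_smul,
      LinearMap.smul_apply, map_smul]
    rfl
  · intro h
    refine ⟨F, ?_⟩
    have h1 : ∀ σ ∈ young ς, unfusedRep N σ F = csign σ • F := by
      intro σ hσ
      refine (spechtEquiv N).symm.injective (Subtype.ext ?_)
      rw [hrep, h.2 σ hσ, map_smul]
      rfl
    have hc0 : (∏ i : Fin ς.length, ((ς.blocksFun i).factorial : ℂ)) ≠ 0 :=
      Finset.prod_ne_zero_iff.mpr fun i _ => by exact_mod_cast (ς.blocksFun i).factorial_ne_zero
    rw [← groupAlgToTL_antisymmetrizer, antisymmetrizer]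
    simp only [map_smul, map_sum, LinearMap.smul_apply, LinearMap.sum_apply]
    rw [Finset.sum_congr rfl (g := fun _ => F) fun σ hσ => ?_]
    · rw [Finset.sum_const, card_young, ← Nat.cast_smul_eq_nsmul ℂ, smul_smul, Nat.cast_prod,
        inv_mul_cancel₀ hc0, one_smul]
    · rw [← MonoidAlgebra.of_apply, groupAlgToTL_of, tlAction_permToTL,
        h1 σ (Finset.mem_filter.mp hσ).2, smul_smul, csign_mul_self, one_smul]

/-- The fusion map on the image of the idempotent. By `isDiagEval_kernelEval`, the evaluation on the
diagonal of the quotient by the Vandermonde product is the fused evaluation, up to a constant. -/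
def fusionMap : LinearMap.range (tlAction N (TL.idem ς)) →ₗ[ℂ] solSpace ς :=
  (((factorialFactor ς)⁻¹ • fusedEval ς) ∘ₗ (specht N).toSubmodule.subtype ∘ₗ
    ((spechtEquiv N).symm : unfusedSpace N →ₗ[ℂ] (specht N).toSubmodule) ∘ₗ
    (LinearMap.range (tlAction N (TL.idem ς))).subtype).codRestrict (solSpace ς) fun F => by
      rw [← map_fusedEval]
      exact Submodule.smul_mem _ _ (Submodule.mem_map_of_mem ((mem_range_idem ς F.1).mp F.2))

theorem fusionMap_bijective : Function.Bijective (fusionMap ς) := by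
  have hc := factorialFactor_ne_zero ς
  constructor
  · rw [injective_iff_map_eq_zero]
    intro F hF
    have h1 : (factorialFactor ς)⁻¹ • fusedEval ς ((spechtEquiv N).symm F.1) = 0 :=
      congrArg Subtype.val hF
    have h2 := fusedEval_injOn ς ((mem_range_idem ς F.1).mp F.2)
      ((smul_eq_zero.mp h1).resolve_left (inv_ne_zero hc))
    have h3 : (spechtEquiv N).symm F.1 = 0 := Subtype.ext h2
    rw [LinearEquiv.map_eq_zero_iff] at h3
    exact Subtype.ext h3
  · rintro ⟨Z, hZ⟩
    have hZ' := hZ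
    rw [← map_fusedEval] at hZ'
    obtain ⟨v, hv, rfl⟩ := hZ'
    have hv' := Submodule.smul_mem _ (factorialFactor ς) hv
    refine ⟨⟨spechtEquiv N ⟨factorialFactor ς • v, hv'.1⟩, ?_⟩, Subtype.ext ?_⟩
    · rw [mem_range_idem, LinearEquiv.symm_apply_apply]
      exact hv'
    · change (factorialFactor ς)⁻¹ • fusedEval ς ((spechtEquiv N).symm (spechtEquiv N _)) = _
      rw [LinearEquiv.symm_apply_apply, map_smul, smul_smul, inv_mul_cancel₀ hc, one_smul]

/-- The fusion isomorphism. -/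
def fusionEquiv : LinearMap.range (tlAction N (TL.idem ς)) ≃ₗ[ℂ] solSpace ς :=
  LinearEquiv.ofBijective (fusionMap ς) (fusionMap_bijective ς)

theorem isDiagEval_fusionEquiv (F : LinearMap.range (tlAction N (TL.idem ς))) :
    IsDiagEval ς (fun x => ((F : unfusedSpace N) : Conf (2 * N) → ℂ) x / groupVandermonde ς x)
      (fusionEquiv ς F : Conf ς.length → ℂ) := by
  have h := isDiagEval_kernelEval ((mem_range_idem ς F.1).mp F.2)
  have h1 : ∀ x, kernelEval (unfusedKernel x) ((spechtEquiv N).symm F.1) =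
      ((F : unfusedSpace N) : Conf (2 * N) → ℂ) x := fun x =>
    congrFun (unfusedEval_spechtEquiv_symm F.1) x
  simp only [h1] at h
  exact h

theorem nontrivial_solSpace (hς : ∀ i, ς.blocksFun i ≤ N) : Nontrivial (solSpace ς) := by
  obtain ⟨α, hα⟩ := exists_isValenced hς
  have hmem := LinkPattern.pureVec_mem_antiSub hα
  refine ⟨⟨⟨fusedEval ς α.pureVec, ?_⟩, 0, fun h => ?_⟩⟩
  · rw [← map_fusedEval]
    exact Submodule.mem_map_of_mem hmem
  · have h1 := fusedEval_injOn ς hmem (congrArg Subtype.val h)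
    have h2 := α.kernelEval_indicator_pureVec_self
    rw [h1, map_zero] at h2
    exact zero_ne_one h2

end Actions

/-! ### The valenced action and its simplicity -/

section ValencedAction

variable {N : ℕ} (ς : Composition (2 * N))

theorem isScalarTower_valencedTL :
    letI := cornerModule (tlAction N) (TL.idem_isIdempotentElem ς) (fusionEquiv ς)
    IsScalarTower ℂ (ValencedTL ς) (solSpace ς) := by
  let := cornerModule (tlAction N) (TL.idem_isIdempotentElem ς) (fusionEquiv ς)
  refine ⟨fun c x s => ?_⟩
  obtain ⟨G, rfl⟩ := (fusionEquiv ς).surjective s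
  rw [cornerModule_smul, cornerModule_smul, ← map_smul]
  refine congrArg _ (Subtype.ext ?_)
  rw [coe_cornerAction, Submodule.coe_smul, coe_cornerAction]
  change tlAction N (c • x.1) _ = _
  rw [map_smul, LinearMap.smul_apply]

theorem valencedTL_mk_smul (a : TL (2 * N) (-2)) (F : unfusedSpace N) :
    letI := cornerModule (tlAction N) (TL.idem_isIdempotentElem ς) (fusionEquiv ς)
    ValencedTL.mk ς a • fusionEquiv ς ((tlAction N (TL.idem ς)).rangeRestrict F) =
      fusionEquiv ς ((tlAction N (TL.idem ς)).rangeRestrict (tlAction N (a * TL.idem ς) F)) := by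
  let := cornerModule (tlAction N) (TL.idem_isIdempotentElem ς) (fusionEquiv ς)
  rw [cornerModule_smul]
  refine congrArg _ (Subtype.ext ?_)
  rw [coe_cornerAction]
  change tlAction N (TL.idem ς * a * TL.idem ς) (tlAction N (TL.idem ς) F) =
    tlAction N (TL.idem ς) (tlAction N (a * TL.idem ς) F)
  rw [← Module.End.mul_apply, ← Module.End.mul_apply, ← map_mul, ← map_mul]
  rw [mul_assoc, (TL.idem_isIdempotentElem ς).eq, mul_assoc]

/-- A corner of a simple module is simple: if `F ≠ 0` and `G` lie in the image of the idempotent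
`p` and `a F = G`, then `(p a p) F = G`. -/
theorem isSimpleModule_valencedTL (hς : ∀ i, ς.blocksFun i ≤ N) :
    letI := cornerModule (tlAction N) (TL.idem_isIdempotentElem ς) (fusionEquiv ς)
    IsSimpleModule (ValencedTL ς) (solSpace ς) := by
  let := cornerModule (tlAction N) (TL.idem_isIdempotentElem ς) (fusionEquiv ς)
  have he := TL.idem_isIdempotentElem ς
  have := nontrivial_solSpace ς hς
  refine isSimpleModule_iff_toSpanSingleton_surjective.mpr ⟨this, fun s hs t => ?_⟩
  obtain ⟨F, rfl⟩ := (fusionEquiv ς).surjective s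
  obtain ⟨G, rfl⟩ := (fusionEquiv ς).surjective t
  have hF : (F : unfusedSpace N) ≠ 0 := fun h => hs (by
    rw [show F = 0 from Subtype.ext h, map_zero])
  obtain ⟨a, ha⟩ := exists_tlAction_eq hF (G : unfusedSpace N)
  refine ⟨ValencedTL.mk ς a, ?_⟩
  rw [LinearMap.toSpanSingleton_apply, cornerModule_smul]
  refine congrArg _ (Subtype.ext ?_)
  rw [coe_cornerAction]
  change tlAction N (TL.idem ς * a * TL.idem ς) F = _
  rw [map_mul, map_mul, Module.End.mul_apply, Module.End.mul_apply,
    apply_of_mem_range (tlAction N) he F.2, ha, apply_of_mem_range (tlAction N) he G.2]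

end ValencedAction

end USTAlg

end

open Filter Topology USTAlg in
theorem theorem1p3 (N : ℕ) (ς : Composition (2 * N))
    (hς : ∀ i : Fin ς.length, ς.blocksFun i ≤ N) :
    -- functions in `S_ς` are determined by their values on the real chamber
    (∀ F ∈ solSpace ς, (∀ (x : Fin ς.length → ℝ) (hx : StrictMono x), F (Conf.ofReal x hx) = 0) →
      F = 0) ∧
    -- `S_N` is stable under permutations of the variables
    ∃ rep : Representation ℂ (Equiv.Perm (Fin (2 * N))) (unfusedSpace N),
      (∀ σ F, (rep σ F : Conf (2 * N) → ℂ) = permRep (2 * N) σ F) ∧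
      -- `S_N` is isomorphic to the Specht module
      (∃ φ : Representation.Equiv (specht N).toRepresentation rep,
        ∀ A : Numbering N, (φ (spechtVec A) : Conf (2 * N) → ℂ) = kernelMinor A) ∧
      -- the Temperley-Lieb algebra is a quotient of the symmetric group algebra
      ∃ q : MonoidAlgebra ℂ (Equiv.Perm (Fin (2 * N))) →ₐ[ℂ] TL (2 * N) (-2),
        Function.Surjective q ∧
        (∀ i : Fin (2 * N - 1),
          q (MonoidAlgebra.of ℂ _ (simpleTransposition i)) = -(1 + TL.e i)) ∧
        q (antisymmetrizer ς) = TL.idem ς ∧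
        -- the action of the symmetric group on `S_N` factors through this quotient
        ∃ ρ : TL (2 * N) (-2) →ₐ[ℂ] Module.End ℂ (unfusedSpace N),
          (∀ σ, ρ (q (MonoidAlgebra.of ℂ _ σ)) = rep σ) ∧
          -- the fusion isomorphism `ψ : p_ς(S_N) → S_ς`
          ∃ ψ : LinearMap.range (ρ (TL.idem ς)) ≃ₗ[ℂ] solSpace ς,
            (∀ G : LinearMap.range (ρ (TL.idem ς)),
              IsDiagEval ς
                (fun x => ((G : unfusedSpace N) : Conf (2 * N) → ℂ) x / groupVandermonde ς x)
                (ψ G : Conf ς.length → ℂ)) ∧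
            -- the transported action, for which `S_ς` is simple
            ∃ inst : Module (ValencedTL ς) (solSpace ς),
              IsScalarTower ℂ (ValencedTL ς) (solSpace ς) ∧
              (∀ (a : TL (2 * N) (-2)) (F : unfusedSpace N),
                ValencedTL.mk ς a • ψ ((ρ (TL.idem ς)).rangeRestrict F) =
                  ψ ((ρ (TL.idem ς)).rangeRestrict (ρ (a * TL.idem ς) F))) ∧
              IsSimpleModule (ValencedTL ς) (solSpace ς) := by
  refine ⟨fun F hF h => eq_zero_of_mem_rationalFunctions (solSpace_le_rationalFunctions ς hF) h,
    unfusedRep N, fun σ F => rfl,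
    ⟨.mk (spechtEquiv N) fun σ => LinearMap.ext (spechtEquiv_rep σ),
      fun A => unfusedEval_polytabloid A⟩,
    groupAlgToTL (2 * N), groupAlgToTL_surjective _, groupAlgToTL_simpleTransposition,
    groupAlgToTL_antisymmetrizer, tlAction N,
    fun σ => by rw [groupAlgToTL_of, tlAction_permToTL],
    fusionEquiv ς, isDiagEval_fusionEquiv ς,
    cornerModule (tlAction N) (TL.idem_isIdempotentElem ς) (fusionEquiv ς),
    isScalarTower_valencedTL ς, fun a F => valencedTL_mk_smul ς a F,
    isSimpleModule_valencedTL ς hς⟩
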